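/- Let $k$ be a field and let $(H,\sigma)$ be a coquasitriangular Hopf algebra over $k$: $\sigma:H\otimes H\to k$ is a convolution invertible bilinear form with $\sigma(hh',g)=\sigma(h,g_1)\sigma(h',g_2)$, $\sigma(g,hh')=\sigma(g_2,h)\sigma(g_1,h')$, $\sigma(1,h)=\sigma(h,1)=\varepsilon(h)$ and $\sigma(h_1,g_1)h_2g_2=g_1h_1\sigma(h_2,g_2)$. Let $X,A\subseteq H$ be sub-Hopf algebras, and for $x\in X$, $a\in A$ put $l_x=\sigma(-,x)$, $r_a=\sigma(a,-)$, $H_{l_X}=\{l_x\mid x\in X\}$, $H_{r_A}=\{r_a\mid a\in A\}$. Then $X$ has a bijective antipode, all $l_x$, $r_a$ lie in the finite dual Hopf algebra $H^0$, and $H_{X,A}:=H_{l_X}H_{r_A}=H_{r_A}H_{l_X}$ is a sub-Hopf algebra of $H^0$ with bijective antipode. Write $K=H_{X,A}^{\rm cop}$, and let $D=D(K,X)$ be the generalized quantum double for the evaluation pairing $\langle\kappa,x\rangle=\kappa(x)$: the coalgebra $K\otimes X$ with unit $1\otimes1$ and product $$(\kappa\otimes y)(\kappa'\otimes y')=\langle\kappa'_1,y_1\rangle\,\langle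 S_K(\kappa'_3),y_3\rangle\;\kappa\kappa'_2\otimes y_2y'$$ (coproducts and antipode $S_K$ taken in $K$), which is a Hopf algebra. Let $i:K\to D$, $i(\kappa)=\kappa\otimes1$. Then the following hold. 1. There is a Hopf algebra morphism $\pi:D\to K$ with $\pi(l_xr_a\otimes y)=l_xr_al_{S^{-1}(y)}$ for all $x,y\in X$, $a\in A$, and $\pi\circ i=\mathrm{id}_K$. 2. The vector space $X$ carries a structure $\underline X$ of Hopf algebra in the braided category ${}^K_K\mathcal{YD}$ of left Yetter–Drinfeld modules over $K$ (compatibility $\kappa_1m_{-1}\otimes\kappa_2\cdot m_0=(\kappa_1\cdot m)_{-1}\kappa_2\otimes(\kappa_1\cdot m)_0$, braiding $m\otimes n\mapsto m_{-1}\cdot n\otimes m_0$), with the unit and the counit of $X$ and, for $\kappa\in K$, $x,y\in X$, $$\kappa\triangleright y=\langle\kappa,S^{-1}(y_1)S^{-2}(y_3)\rangle\,y_2,\qquad \lambda(y)=l_{S^{-1}(y_1)S^{-2}(y_3)}\otimes y_2,$$ $$x\circ y=\sigma(S(x_3)S^2(x_1),y_2)\,x_2y_1,\qquad \underline\Delta(x)=\sigma(S(x_1)x_3,S(x_4)x_6)\,x_2\otimes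 x_5,$$ $$\underline S(x)=\sigma(S^2(x_3)S(x_1),x_4)\,S(x_2).$$ 3. $\underline X$ is induced from the projection $\pi$: the map $\theta(x)=l_{S^{-2}(x_2)}\otimes x_1$ is a linear bijection of $X$ onto the space of coinvariants $B=\{d\in D\mid d_1\otimes\pi(d_2)=d\otimes1\}$, and it carries the structure of $\underline X$ to the braided Hopf algebra structure of $B$, that is, to the action $\kappa\triangleright b=i(\kappa_1)\,b\,i(S_K(\kappa_2))$, the coaction $b\mapsto\pi(b_1)\otimes b_2$, the product, unit and counit of $D$, the coproduct $\Pi(d)\mapsto\Pi(d_1)\otimes\Pi(d_2)$ with $\Pi(d)=d_1\,i(S_K(\pi(d_2)))$, and the antipode $b\mapsto i(\pi(b_1))S_D(b_2)$. Moreover $x\times\kappa\mapsto\theta(x)\,i(\kappa)$ is an isomorphism of Hopf algebras from the biproduct $\underline X\times K$, with $(x\times\kappa)(y\times\kappa')=x\circ(\kappa_1\triangleright y)\times\kappa_2\kappa'$ and $\Delta(x\times\kappa)=(x_{\underline1}\times(x_{\underline2})_{-1}\kappa_1)\otimes((x_{\underline2})_0\times\kappa_2)$, where $\underline\Delta(x)=x_{\underline1}\otimes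 x_{\underline2}$, onto $D$. -/

import Mathlib

open TensorProduct Coalgebra HopfAlgebra

noncomputable section

-- Cheaper forms of `map_zero`, `map_add` and `map_smul` for `simp`.
attribute [-simp] map_zero map_add map_smul
attribute [local simp] LinearMap.map_zero LinearEquiv.map_zero LinearMap.map_add
  LinearEquiv.map_add LinearMap.map_smul LinearEquiv.map_smul
set_option linter.unusedSimpArgs false

namespace BraidedCQT

section SubHopf

variable (k H : Type*) [Field k] [Ring H] [HopfAlgebra k H]

/-- A sub-Hopf algebra: a unital subalgebra `X` with `Δ(X) ⊆ X ⊗ X` and `S(X) ⊆ X`. -/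
structure SubHopfAlgebra extends Subalgebra k H where
  comul_mem' : ∀ x ∈ carrier, comul (R := k) x ∈
    LinearMap.range (TensorProduct.map toSubalgebra.val.toLinearMap toSubalgebra.val.toLinearMap)
  antipode_mem' : ∀ x ∈ carrier, antipode k x ∈ carrier

end SubHopf

namespace SubHopfAlgebra

variable {k H : Type*} [Field k] [Ring H] [HopfAlgebra k H]

instance : CoeSort (SubHopfAlgebra k H) (Type _) := ⟨fun X => X.toSubalgebra⟩

variable (X : SubHopfAlgebra k H)

/-- The inclusion `X → H`. -/
def incl : X →ₗ[k] H := X.toSubalgebra.val.toLinearMap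

theorem incl_injective : Function.Injective X.incl := Subtype.val_injective

theorem map_incl_injective : Function.Injective (TensorProduct.map X.incl X.incl) :=
  TensorProduct.map_injective_of_flat_flat _ _ X.incl_injective X.incl_injective

/-- The coproduct of `H` restricted to `X`, with values in `X ⊗ X`. -/
def comulAux : X →ₗ[k] X ⊗[k] X :=
  (LinearEquiv.ofInjective _ X.map_incl_injective).symm.toLinearMap ∘ₗ
    (comul ∘ₗ X.incl).codRestrict (LinearMap.range (TensorProduct.map X.incl X.incl))
      (fun x => X.comul_mem' _ x.2)

theorem map_incl_comulAux (x : X) :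
    TensorProduct.map X.incl X.incl (X.comulAux x) = comul (R := k) (x : H) := by
  have := LinearEquiv.apply_symm_apply (LinearEquiv.ofInjective _ X.map_incl_injective)
    ((comul ∘ₗ X.incl).codRestrict (LinearMap.range (TensorProduct.map X.incl X.incl))
      (fun x => X.comul_mem' _ x.2) x)
  exact congrArg Subtype.val this

theorem map_incl_comp_comulAux :
    TensorProduct.map X.incl X.incl ∘ₗ X.comulAux = comul (R := k) ∘ₗ X.incl :=
  LinearMap.ext X.map_incl_comulAux

instance : Coalgebra k X where
  comul := X.comulAux
  counit := counit ∘ₗ X.incl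
  coassoc := by
    have hinj : Function.Injective (TensorProduct.map X.incl (TensorProduct.map X.incl X.incl)) :=
      TensorProduct.map_injective_of_flat_flat _ _ X.incl_injective X.map_incl_injective
    refine LinearMap.cancel_left hinj |>.1 ?_
    have h := X.map_incl_comp_comulAux
    calc _ = (TensorProduct.assoc k H H H).toLinearMap ∘ₗ
          TensorProduct.map (TensorProduct.map X.incl X.incl ∘ₗ X.comulAux) X.incl ∘ₗ X.comulAux := by
          simp only [coassoc_simps]
      _ = TensorProduct.map X.incl (TensorProduct.map X.incl X.incl ∘ₗ X.comulAux) ∘ₗ X.comulAux := by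
          have e1 : TensorProduct.map (comul (R := k) ∘ₗ X.incl) X.incl ∘ₗ X.comulAux =
              (comul (R := k)).rTensor H ∘ₗ comul ∘ₗ X.incl := by
            rw [LinearMap.rTensor, ← h, ← LinearMap.comp_assoc, ← TensorProduct.map_comp, h,
              LinearMap.id_comp]
          have e2 : TensorProduct.map X.incl (comul (R := k) ∘ₗ X.incl) ∘ₗ X.comulAux =
              (comul (R := k)).lTensor H ∘ₗ comul ∘ₗ X.incl := by
            rw [LinearMap.lTensor, ← h, ← LinearMap.comp_assoc, ← TensorProduct.map_comp, h,
              LinearMap.id_comp]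
          rw [h, e1, e2]
          exact congrArg (· ∘ₗ X.incl) (Coalgebra.coassoc (R := k) (A := H))
      _ = _ := by simp only [coassoc_simps]
  rTensor_counit_comp_comul := by
    have hinj : Function.Injective (X.incl.lTensor k) :=
      Module.Flat.lTensor_preserves_injective_linearMap _ X.incl_injective
    refine LinearMap.cancel_left hinj |>.1 ?_
    have h := X.map_incl_comp_comulAux
    refine Eq.trans (b := (counit (R := k) (A := H)).rTensor H ∘ₗ
      TensorProduct.map X.incl X.incl ∘ₗ X.comulAux) ?_ ?_
    · simp only [coassoc_simps]
    · rw [h, ← LinearMap.comp_assoc, Coalgebra.rTensor_counit_comp_comul]; rfl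
  lTensor_counit_comp_comul := by
    have hinj : Function.Injective (X.incl.rTensor k) :=
      Module.Flat.rTensor_preserves_injective_linearMap _ X.incl_injective
    refine LinearMap.cancel_left hinj |>.1 ?_
    have h := X.map_incl_comp_comulAux
    refine Eq.trans (b := (counit (R := k) (A := H)).lTensor H ∘ₗ
      TensorProduct.map X.incl X.incl ∘ₗ X.comulAux) ?_ ?_
    · simp only [coassoc_simps]
    · rw [h, ← LinearMap.comp_assoc, Coalgebra.lTensor_counit_comp_comul]; rfl

theorem map_incl_comul (x : X) :
    TensorProduct.map X.incl X.incl (comul (R := k) x) = comul (R := k) (x : H) :=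
  X.map_incl_comulAux x

instance : Bialgebra k X :=
  Bialgebra.mk' k X (Bialgebra.counit_one (R := k) (A := H))
    (fun {a b} => Bialgebra.counit_mul (R := k) (a : H) b)
    (X.map_incl_injective <| by
      rw [map_incl_comul]
      exact (Bialgebra.comul_one (R := k) (A := H)))
    (fun {a b} => X.map_incl_injective <| by
      rw [map_incl_comul]
      have := map_mul (Algebra.TensorProduct.map X.toSubalgebra.val X.toSubalgebra.val)
        (comul (R := k) a) (comul b)
      exact (Bialgebra.comul_mul (R := k) (a : H) b).trans
        ((congrArg₂ _ (X.map_incl_comul a).symm (X.map_incl_comul b).symm).trans this.symm))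

instance : HopfAlgebra k X where
  antipode := (antipode k ∘ₗ X.incl).codRestrict (Subalgebra.toSubmodule X.toSubalgebra)
    (fun x => X.antipode_mem' _ x.2)
  mul_antipode_rTensor_comul := by
    refine LinearMap.cancel_left X.incl_injective |>.1 (LinearMap.ext fun x => ?_)
    have h := HopfAlgebra.mul_antipode_rTensor_comul_apply (R := k) (x : H)
    rw [← map_incl_comul] at h
    refine Eq.trans ?_ h
    simp only [LinearMap.comp_apply]
    induction comul (R := k) x using TensorProduct.induction_on with
    | zero => rfl
    | tmul a b => rfl
    | add a b ha hb => simp only [LinearMap.map_add, LinearEquiv.map_add, ha, hb]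
  mul_antipode_lTensor_comul := by
    refine LinearMap.cancel_left X.incl_injective |>.1 (LinearMap.ext fun x => ?_)
    have h := HopfAlgebra.mul_antipode_lTensor_comul_apply (R := k) (x : H)
    rw [← map_incl_comul] at h
    refine Eq.trans ?_ h
    simp only [LinearMap.comp_apply]
    induction comul (R := k) x using TensorProduct.induction_on with
    | zero => rfl
    | tmul a b => rfl
    | add a b ha hb => simp only [LinearMap.map_add, LinearEquiv.map_add, ha, hb]

end SubHopfAlgebra

section FinDual

variable (k H : Type*) [Field k] [Ring H] [HopfAlgebra k H]

/-- `f` lies in the finite dual: it vanishes on a two-sided ideal of finite codimension. -/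
def IsFiniteDual {k H : Type*} [Field k] [Ring H] [HopfAlgebra k H]
    (f : WithConv (H →ₗ[k] k)) : Prop :=
  ∃ I : Ideal H, I.IsTwoSided ∧ Module.Finite k (H ⧸ I.restrictScalars k) ∧ ∀ x ∈ I, f x = 0

variable {k H} in
theorem IsFiniteDual.of_factor {B : Type*} [Ring B] [Algebra k B] [Module.Finite k B]
    (ρ : H →ₐ[k] B) (φ : B →ₗ[k] k) :
    IsFiniteDual (WithConv.toConv (φ ∘ₗ ρ.toLinearMap) : WithConv (H →ₗ[k] k)) := by
  refine ⟨RingHom.ker ρ, inferInstance, ?_, ?_⟩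
  · have e : (RingHom.ker ρ).restrictScalars k = LinearMap.ker ρ.toLinearMap := by
      ext x; simp [RingHom.mem_ker]
    rw [e]
    exact Module.Finite.equiv (LinearMap.quotKerEquivRange ρ.toLinearMap).symm
  · intro x hx
    have hx : ρ x = 0 := hx
    show φ (ρ x) = 0
    rw [hx, map_zero]

variable {k H} in
theorem IsFiniteDual.exists_factor {f : WithConv (H →ₗ[k] k)} (hf : IsFiniteDual f) :
    ∃ I : Ideal H, ∃ _ : I.IsTwoSided, Module.Finite k (H ⧸ I) ∧
      ∃ φ : (H ⧸ I) →ₗ[k] k, f.ofConv = φ ∘ₗ (Ideal.Quotient.mkₐ k I).toLinearMap := by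
  obtain ⟨I, hI, hfin, h0⟩ := hf
  refine ⟨I, hI, ?_, ?_⟩
  · exact hfin
  · have hle : I.restrictScalars k ≤ LinearMap.ker f.ofConv := h0
    exact ⟨Submodule.liftQ (I.restrictScalars k) f.ofConv hle, rfl⟩



/-- The finite dual of `H` as a subalgebra of the convolution algebra `H^*`. -/
def finiteDualSubalgebra : Subalgebra k (WithConv (H →ₗ[k] k)) where
  carrier := {f | IsFiniteDual f}
  mul_mem' := by
    rintro f g hf hg
    obtain ⟨I, hI, hfI, φ, hφ⟩ := hf.exists_factor
    obtain ⟨J, hJ, hfJ, ψ, hψ⟩ := hg.exists_factor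
    have e : f * g = WithConv.toConv ((LinearMap.mul' k k ∘ₗ TensorProduct.map φ ψ) ∘ₗ
        ((Algebra.TensorProduct.map (Ideal.Quotient.mkₐ k I) (Ideal.Quotient.mkₐ k J)).comp
          (Bialgebra.comulAlgHom k H)).toLinearMap) := by
      rw [LinearMap.convMul_def, hφ, hψ, TensorProduct.map_comp]
      rfl
    rw [e]
    exact IsFiniteDual.of_factor _ _
  add_mem' := by
    rintro f g hf hg
    obtain ⟨I, hI, hfI, φ, hφ⟩ := hf.exists_factor
    obtain ⟨J, hJ, hfJ, ψ, hψ⟩ := hg.exists_factor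
    have e : f + g = WithConv.toConv ((φ.coprod ψ) ∘ₗ
        ((Ideal.Quotient.mkₐ k I).prod (Ideal.Quotient.mkₐ k J)).toLinearMap) := by
      apply WithConv.ext
      rw [WithConv.ofConv_add, hφ, hψ]
      rfl
    rw [e]
    exact IsFiniteDual.of_factor _ _
  algebraMap_mem' r := by
    have e : algebraMap k (WithConv (H →ₗ[k] k)) r = WithConv.toConv ((r • LinearMap.id) ∘ₗ
        (Bialgebra.counitAlgHom k H).toLinearMap) := by
      rfl
    rw [e]
    exact IsFiniteDual.of_factor _ _

/-- The finite dual `H⁰` of `H`; its product is the convolution product of `H^*`. -/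
def FiniteDual : Type _ := finiteDualSubalgebra k H

instance : Ring (FiniteDual k H) := inferInstanceAs (Ring (finiteDualSubalgebra k H))

instance : Algebra k (FiniteDual k H) :=
  inferInstanceAs (Algebra k (finiteDualSubalgebra k H))

namespace FiniteDual

/-- The evaluation `H⁰ → H^*`. -/
def ev : FiniteDual k H →ₗ[k] Module.Dual k H :=
  (WithConv.linearEquiv k (H →ₗ[k] k)).toLinearMap ∘ₗ (finiteDualSubalgebra k H).val.toLinearMap

theorem ev_injective : Function.Injective (ev k H) :=
  (WithConv.linearEquiv k (H →ₗ[k] k)).injective.comp Subtype.val_injective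

end FiniteDual

theorem dualDistrib_injective (M N : Type*) [AddCommGroup M] [Module k M]
    [AddCommGroup N] [Module k N] : Function.Injective (TensorProduct.dualDistrib k M N) := by
  classical
  rw [injective_iff_map_eq_zero]
  intro t ht
  let c := Module.Basis.ofVectorSpace k (Module.Dual k N)
  apply (TensorProduct.equivFinsuppOfBasisRight c).injective
  rw [map_zero]
  set u := TensorProduct.equivFinsuppOfBasisRight c t with hu
  have ht' : t = u.sum fun i m => m ⊗ₜ[k] c i := by
    rw [← TensorProduct.equivFinsuppOfBasisRight_symm_apply, hu, LinearEquiv.symm_apply_apply]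
  have key : ∀ m : M, (u.sum fun i f => f m • c i) = 0 := by
    intro m
    ext n
    have := LinearMap.congr_fun ht (m ⊗ₜ n)
    rw [ht'] at this
    simpa [Finsupp.sum, TensorProduct.dualDistrib_apply] using this
  ext i m
  have h1 := congrArg (fun z => c.repr z i) (key m)
  have h2 : ¬u i = 0 → u i m = 0 := by
    simpa [Finsupp.sum, Finsupp.single_apply, map_sum] using h1
  by_cases hi : u i = 0
  · simp [hi]
  · simpa using h2 hi

namespace FiniteDual

/-- The evaluation `H⁰ ⊗ H⁰ → (H ⊗ H)^*`. -/
def ev2 : FiniteDual k H ⊗[k] FiniteDual k H →ₗ[k] Module.Dual k (H ⊗[k] H) :=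
  TensorProduct.dualDistrib k H H ∘ₗ TensorProduct.map (ev k H) (ev k H)

theorem ev2_injective : Function.Injective (ev2 k H) :=
  (dualDistrib_injective k H H).comp
    (TensorProduct.map_injective_of_flat_flat _ _ (ev_injective k H) (ev_injective k H))

/-- The evaluation `H⁰ ⊗ (H⁰ ⊗ H⁰) → (H ⊗ (H ⊗ H))^*`. -/
def ev3 : FiniteDual k H ⊗[k] (FiniteDual k H ⊗[k] FiniteDual k H) →ₗ[k]
    Module.Dual k (H ⊗[k] (H ⊗[k] H)) :=
  TensorProduct.dualDistrib k H (H ⊗[k] H) ∘ₗ TensorProduct.map (ev k H) (ev2 k H)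

theorem ev3_injective : Function.Injective (ev3 k H) :=
  (dualDistrib_injective k H _).comp
    (TensorProduct.map_injective_of_flat_flat _ _ (ev_injective k H) (ev2_injective k H))

theorem comp_mul_mem_range (f : FiniteDual k H) :
    ev k H f ∘ₗ LinearMap.mul' k H ∈ LinearMap.range (ev2 k H) := by
  obtain ⟨f, hf⟩ := f
  obtain ⟨I, hI, hfI, φ, hφ⟩ := IsFiniteDual.exists_factor hf
  have h1 : ∀ z : Module.Dual k ((H ⧸ I) ⊗[k] (H ⧸ I)),
      z ∘ₗ TensorProduct.map (Ideal.Quotient.mkₐ k I).toLinearMap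
        (Ideal.Quotient.mkₐ k I).toLinearMap ∈ LinearMap.range (ev2 k H) := by
    intro z
    obtain ⟨w, rfl⟩ := (TensorProduct.dualDistribEquiv k (H ⧸ I) (H ⧸ I)).surjective z
    induction w using TensorProduct.induction_on with
    | zero => rw [map_zero, LinearMap.zero_comp]; exact zero_mem _
    | tmul a b =>
      refine ⟨(⟨_, IsFiniteDual.of_factor (Ideal.Quotient.mkₐ k I) a⟩ : FiniteDual k H) ⊗ₜ
        (⟨_, IsFiniteDual.of_factor (Ideal.Quotient.mkₐ k I) b⟩ : FiniteDual k H), ?_⟩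
      ext x y
      rfl
    | add a b ha hb => rw [map_add, LinearMap.add_comp]; exact add_mem ha hb
  have h2 : ev k H ⟨f, hf⟩ ∘ₗ LinearMap.mul' k H = (φ ∘ₗ LinearMap.mul' k (H ⧸ I)) ∘ₗ
      TensorProduct.map (Ideal.Quotient.mkₐ k I).toLinearMap
        (Ideal.Quotient.mkₐ k I).toLinearMap := by
    have : ev k H ⟨f, hf⟩ = φ ∘ₗ (Ideal.Quotient.mkₐ k I).toLinearMap := hφ
    rw [this]
    ext x y
    simp
  rw [h2]
  exact h1 _

/-- The coproduct of `H⁰`: the unique element of `H⁰ ⊗ H⁰` with `f(xy) = f₁(x) f₂(y)`. -/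
def comulAux : FiniteDual k H →ₗ[k] FiniteDual k H ⊗[k] FiniteDual k H :=
  (LinearEquiv.ofInjective _ (ev2_injective k H)).symm.toLinearMap ∘ₗ
    ((LinearMap.lcomp k k (LinearMap.mul' k H)) ∘ₗ ev k H).codRestrict
      (LinearMap.range (ev2 k H)) (comp_mul_mem_range k H)

theorem ev2_comulAux (f : FiniteDual k H) :
    ev2 k H (comulAux k H f) = ev k H f ∘ₗ LinearMap.mul' k H :=
  congrArg Subtype.val (LinearEquiv.apply_symm_apply
    (LinearEquiv.ofInjective _ (ev2_injective k H))
    (((LinearMap.lcomp k k (LinearMap.mul' k H)) ∘ₗ ev k H).codRestrict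
      (LinearMap.range (ev2 k H)) (comp_mul_mem_range k H) f))

theorem ev2_tmul (f g : FiniteDual k H) (x y : H) :
    ev2 k H (f ⊗ₜ g) (x ⊗ₜ y) = ev k H f x * ev k H g y := rfl

theorem ev3_tmul (f : FiniteDual k H) (t : FiniteDual k H ⊗[k] FiniteDual k H) (x : H)
    (y : H ⊗[k] H) : ev3 k H (f ⊗ₜ t) (x ⊗ₜ y) = ev k H f x * ev2 k H t y := rfl

theorem ev3_assoc (t : FiniteDual k H ⊗[k] FiniteDual k H) (g : FiniteDual k H) (x y z : H) :
    ev3 k H (TensorProduct.assoc k _ _ _ (t ⊗ₜ g)) (x ⊗ₜ (y ⊗ₜ z)) =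
      ev2 k H t (x ⊗ₜ y) * ev k H g z := by
  induction t using TensorProduct.induction_on with
  | zero => simp
  | tmul a b =>
    rw [TensorProduct.assoc_tmul, ev3_tmul, ev2_tmul, ev2_tmul, mul_assoc]
  | add a b ha hb =>
    rw [TensorProduct.add_tmul, map_add, map_add, map_add, LinearMap.add_apply, ha, hb,
      LinearMap.add_apply, add_mul]

instance : Coalgebra k (FiniteDual k H) where
  comul := comulAux k H
  counit := LinearMap.applyₗ 1 ∘ₗ ev k H
  coassoc := by
    refine LinearMap.ext fun f => ev3_injective k H ?_
    ext x y z
    have hl : ∀ t : FiniteDual k H ⊗[k] FiniteDual k H,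
        ev3 k H (TensorProduct.assoc k _ _ _ ((comulAux k H).rTensor _ t)) (x ⊗ₜ (y ⊗ₜ z)) =
          ev2 k H t ((x * y) ⊗ₜ z) := by
      intro t
      induction t using TensorProduct.induction_on with
      | zero => simp
      | tmul a b =>
        rw [LinearMap.rTensor_tmul, ev3_assoc, ev2_comulAux, ev2_tmul]; rfl
      | add a b ha hb => simp only [LinearMap.map_add, LinearEquiv.map_add, LinearMap.add_apply, ha, hb]
    have hr : ∀ t : FiniteDual k H ⊗[k] FiniteDual k H,
        ev3 k H ((comulAux k H).lTensor _ t) (x ⊗ₜ (y ⊗ₜ z)) =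
          ev2 k H t (x ⊗ₜ (y * z)) := by
      intro t
      induction t using TensorProduct.induction_on with
      | zero => simp
      | tmul a b =>
        rw [LinearMap.lTensor_tmul, ev3_tmul, ev2_comulAux, ev2_tmul]; rfl
      | add a b ha hb => simp only [LinearMap.map_add, LinearEquiv.map_add, LinearMap.add_apply, ha, hb]
    refine (hl _).trans (Eq.trans ?_ (hr _).symm)
    rw [ev2_comulAux]
    simp [mul_assoc]
  rTensor_counit_comp_comul := by
    refine LinearMap.ext fun f => (TensorProduct.lid k _).injective (ev_injective k H ?_)
    ext x
    have hl : ∀ t : FiniteDual k H ⊗[k] FiniteDual k H,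
        ev k H (TensorProduct.lid k _ ((LinearMap.applyₗ 1 ∘ₗ ev k H).rTensor _ t)) x =
          ev2 k H t (1 ⊗ₜ x) := by
      intro t
      induction t using TensorProduct.induction_on with
      | zero => simp
      | tmul a b => simp [ev2_tmul]
      | add a b ha hb => simp only [LinearMap.map_add, LinearEquiv.map_add, LinearMap.add_apply, ha, hb]
    refine (hl _).trans ?_
    rw [ev2_comulAux]
    simp
  lTensor_counit_comp_comul := by
    refine LinearMap.ext fun f => (TensorProduct.rid k _).injective (ev_injective k H ?_)
    ext x
    have hl : ∀ t : FiniteDual k H ⊗[k] FiniteDual k H,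
        ev k H (TensorProduct.rid k _ ((LinearMap.applyₗ 1 ∘ₗ ev k H).lTensor _ t)) x =
          ev2 k H t (x ⊗ₜ 1) := by
      intro t
      induction t using TensorProduct.induction_on with
      | zero => simp
      | tmul a b => simp [ev2_tmul, mul_comm]
      | add a b ha hb => simp only [LinearMap.map_add, LinearEquiv.map_add, LinearMap.add_apply, ha, hb]
    refine (hl _).trans ?_
    rw [ev2_comulAux]
    simp

theorem ev2_comul (f : FiniteDual k H) (x y : H) :
    ev2 k H (comul (R := k) f) (x ⊗ₜ y) = ev k H f (x * y) :=
  LinearMap.congr_fun (ev2_comulAux k H f) (x ⊗ₜ y)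

theorem counit_apply (f : FiniteDual k H) : counit (R := k) f = ev k H f 1 := rfl

theorem ev_mul (f g : FiniteDual k H) (x : H) :
    ev k H (f * g) x = ev2 k H (f ⊗ₜ g) (comul (R := k) x) := by
  show LinearMap.mul' k k (TensorProduct.map (ev k H f) (ev k H g) (comul (R := k) x)) = _
  rfl

theorem ev_one (x : H) : ev k H 1 x = counit (R := k) x := rfl

theorem ev2_mul (s t : FiniteDual k H ⊗[k] FiniteDual k H) (z : H ⊗[k] H) :
    ev2 k H (s * t) z = LinearMap.mul' k k
      (TensorProduct.map (ev2 k H s) (ev2 k H t) (comul (R := k) z)) := by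
  induction s using TensorProduct.induction_on with
  | zero => simp
  | add a b ha hb =>
    rw [add_mul, map_add, LinearMap.add_apply, ha, hb, map_add, TensorProduct.map_add_left,
      LinearMap.add_apply, map_add]
  | tmul a b =>
    induction t using TensorProduct.induction_on with
    | zero => simp
    | add c d hc hd =>
      rw [mul_add, map_add, LinearMap.add_apply, hc, hd, map_add, TensorProduct.map_add_right,
        LinearMap.add_apply, map_add]
    | tmul c d =>
      induction z using TensorProduct.induction_on with
      | zero => simp
      | add u v hu hv => simp only [LinearMap.map_add, LinearEquiv.map_add, hu, hv]
      | tmul x y =>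
        rw [Algebra.TensorProduct.tmul_mul_tmul, ev2_tmul, ev_mul, ev_mul,
          TensorProduct.comul_tmul]
        generalize comul (R := k) x = p
        generalize comul (R := k) y = r
        induction p using TensorProduct.induction_on with
        | zero => simp
        | add u v hu hv => simp only [LinearMap.map_add, LinearEquiv.map_add, add_mul, TensorProduct.add_tmul, hu, hv]
        | tmul x1 x2 =>
          induction r using TensorProduct.induction_on with
          | zero => simp
          | add u v hu hv => simp only [LinearMap.map_add, LinearEquiv.map_add, mul_add, TensorProduct.tmul_add, hu, hv]
          | tmul y1 y2 =>
            simp only [ev2_tmul, TensorProduct.AlgebraTensorModule.tensorTensorTensorComm_tmul,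
              TensorProduct.map_tmul, LinearMap.mul'_apply]
            ring

instance : Bialgebra k (FiniteDual k H) :=
  Bialgebra.mk' k (FiniteDual k H)
    (by rw [counit_apply, ev_one, Bialgebra.counit_one])
    (fun {f g} => by
      rw [counit_apply, ev_mul, Bialgebra.comul_one, Algebra.TensorProduct.one_def, ev2_tmul]; rfl)
    (ev2_injective k H <| by
      ext x y
      simp only [TensorProduct.AlgebraTensorModule.curry_apply, LinearMap.restrictScalars_self,
        TensorProduct.curry_apply]
      rw [ev2_comul, ev_one, Algebra.TensorProduct.one_def, ev2_tmul, ev_one, ev_one,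
        Bialgebra.counit_mul])
    (fun {f g} => ev2_injective k H <| by
      ext x y
      simp only [TensorProduct.AlgebraTensorModule.curry_apply, LinearMap.restrictScalars_self,
        TensorProduct.curry_apply]
      rw [ev2_comul, ev_mul, ev2_mul, Bialgebra.comul_mul, TensorProduct.comul_tmul]
      generalize comul (R := k) x = p
      generalize comul (R := k) y = r
      induction p using TensorProduct.induction_on with
      | zero => simp
      | add u v hu hv => simp only [LinearMap.map_add, LinearEquiv.map_add, add_mul, TensorProduct.add_tmul, hu, hv]
      | tmul x1 x2 =>
        induction r using TensorProduct.induction_on with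
        | zero => simp
        | add u v hu hv => simp only [LinearMap.map_add, LinearEquiv.map_add, mul_add, TensorProduct.tmul_add, hu, hv]
        | tmul y1 y2 =>
          rw [Algebra.TensorProduct.tmul_mul_tmul, ev2_tmul,
            TensorProduct.AlgebraTensorModule.tensorTensorTensorComm_tmul, TensorProduct.map_tmul,
            ev2_comul, ev2_comul]; rfl)

theorem isFiniteDual_antipode {f : WithConv (H →ₗ[k] k)} (hf : IsFiniteDual f) :
    IsFiniteDual (WithConv.toConv (f.ofConv ∘ₗ antipode k) : WithConv (H →ₗ[k] k)) := by
  obtain ⟨I, hI, hfI, φ, hφ⟩ := hf.exists_factor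
  rw [hφ]
  exact IsFiniteDual.of_factor
    ((AlgHom.op (Ideal.Quotient.mkₐ k I)).comp (antipodeAlgHomOp k H))
    (φ ∘ₗ (MulOpposite.opLinearEquiv k).symm.toLinearMap)

/-- The antipode `f ↦ f ∘ S` of `H⁰`. -/
def antipodeAux : FiniteDual k H →ₗ[k] FiniteDual k H where
  toFun f := ⟨WithConv.toConv (ev k H f ∘ₗ antipode k), isFiniteDual_antipode k H f.2⟩
  map_add' _ _ := rfl
  map_smul' _ _ := rfl

theorem ev_antipodeAux (f : FiniteDual k H) (x : H) :
    ev k H (antipodeAux k H f) x = ev k H f (antipode k x) := rfl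

instance : HopfAlgebra k (FiniteDual k H) where
  antipode := antipodeAux k H
  mul_antipode_rTensor_comul := by
    refine LinearMap.ext fun f => ev_injective k H (LinearMap.ext fun x => ?_)
    have hl : ∀ t : FiniteDual k H ⊗[k] FiniteDual k H,
        ev k H (LinearMap.mul' k _ ((antipodeAux k H).rTensor _ t)) x =
          ev2 k H t ((antipode k).rTensor H (comul x)) := by
      intro t
      induction t using TensorProduct.induction_on with
      | zero => simp
      | add a b ha hb => simp only [LinearMap.map_add, LinearEquiv.map_add, LinearMap.add_apply, ha, hb]
      | tmul a b =>
        rw [LinearMap.rTensor_tmul, LinearMap.mul'_apply, ev_mul]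
        induction comul (R := k) x using TensorProduct.induction_on with
        | zero => simp
        | add u v hu hv => simp only [LinearMap.map_add, LinearEquiv.map_add, hu, hv]
        | tmul u v => rfl
    have h2 : ∀ z : H ⊗[k] H, ev2 k H (comul (R := k) f) z = ev k H f (LinearMap.mul' k H z) :=
      fun z => LinearMap.congr_fun (ev2_comulAux k H f) z
    refine (hl _).trans ?_
    rw [h2, HopfAlgebra.mul_antipode_rTensor_comul_apply]
    simp only [LinearMap.comp_apply, Algebra.linearMap_apply, Algebra.algebraMap_eq_smul_one,
      map_smul, LinearMap.smul_apply, ev_one, counit_apply, smul_eq_mul]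
    exact mul_comm _ _
  mul_antipode_lTensor_comul := by
    refine LinearMap.ext fun f => ev_injective k H (LinearMap.ext fun x => ?_)
    have hl : ∀ t : FiniteDual k H ⊗[k] FiniteDual k H,
        ev k H (LinearMap.mul' k _ ((antipodeAux k H).lTensor _ t)) x =
          ev2 k H t ((antipode k).lTensor H (comul x)) := by
      intro t
      induction t using TensorProduct.induction_on with
      | zero => simp
      | add a b ha hb => simp only [LinearMap.map_add, LinearEquiv.map_add, LinearMap.add_apply, ha, hb]
      | tmul a b =>
        rw [LinearMap.lTensor_tmul, LinearMap.mul'_apply, ev_mul]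
        induction comul (R := k) x using TensorProduct.induction_on with
        | zero => simp
        | add u v hu hv => simp only [LinearMap.map_add, LinearEquiv.map_add, hu, hv]
        | tmul u v => rfl
    have h2 : ∀ z : H ⊗[k] H, ev2 k H (comul (R := k) f) z = ev k H f (LinearMap.mul' k H z) :=
      fun z => LinearMap.congr_fun (ev2_comulAux k H f) z
    refine (hl _).trans ?_
    rw [h2, HopfAlgebra.mul_antipode_lTensor_comul_apply]
    simp only [LinearMap.comp_apply, Algebra.linearMap_apply, Algebra.algebraMap_eq_smul_one,
      map_smul, LinearMap.smul_apply, ev_one, counit_apply, smul_eq_mul]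
    exact mul_comm _ _

end FiniteDual

end FinDual

section Cop

variable (k H : Type*) [Field k] [Ring H] [HopfAlgebra k H]

/-- The antipode of `H` is bijective. -/
class BijectiveAntipode : Prop where
  bijective : Function.Bijective (antipode k : H →ₗ[k] H)

/-- The composition inverse `S⁻¹` of a bijective antipode. -/
def antipodeInv [BijectiveAntipode k H] : H →ₗ[k] H :=
  (LinearEquiv.ofBijective (antipode k : H →ₗ[k] H) BijectiveAntipode.bijective).symm.toLinearMap

theorem antipode_antipodeInv [BijectiveAntipode k H] (x : H) :
    antipode k (antipodeInv k H x) = x :=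
  LinearEquiv.apply_symm_apply
    (LinearEquiv.ofBijective (antipode k : H →ₗ[k] H) BijectiveAntipode.bijective) x

/-- The co-opposite `H^cop`: same algebra, coproduct `x ↦ x₂ ⊗ x₁`, antipode `S⁻¹`. -/
def Cop (_k : Type*) (H : Type*) : Type _ := H

namespace Cop

instance : Ring (Cop k H) := inferInstanceAs (Ring H)

instance : Algebra k (Cop k H) := inferInstanceAs (Algebra k H)

/-- The identity map `H → H^cop`, which is an isomorphism of algebras. -/
def of : H ≃ₐ[k] Cop k H := AlgEquiv.refl

/-- The flipped coproduct. -/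
def comulAux : H →ₗ[k] H ⊗[k] H :=
  (TensorProduct.comm k H H).toLinearMap ∘ₗ (comul : H →ₗ[k] H ⊗[k] H)

theorem coassocAux : (TensorProduct.assoc k H H H).toLinearMap ∘ₗ
    (comulAux k H).rTensor H ∘ₗ comulAux k H = (comulAux k H).lTensor H ∘ₗ comulAux k H := by
  let rev : H ⊗[k] (H ⊗[k] H) →ₗ[k] H ⊗[k] (H ⊗[k] H) :=
    (TensorProduct.assoc k H H H).toLinearMap ∘ₗ (TensorProduct.comm k H (H ⊗[k] H)).toLinearMap ∘ₗ
      (TensorProduct.comm k H H).toLinearMap.lTensor H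
  ext x
  have h1 : ∀ t : H ⊗[k] H, TensorProduct.assoc k H H H ((comulAux k H).rTensor H
      (TensorProduct.comm k H H t)) = rev ((comul (R := k)).lTensor H t) := by
    intro t
    induction t using TensorProduct.induction_on with
    | zero => simp
    | add a b ha hb => simp only [LinearMap.map_add, LinearEquiv.map_add, ha, hb]
    | tmul a b => simp [rev, comulAux]
  have h2 : ∀ t : H ⊗[k] H, (comulAux k H).lTensor H (TensorProduct.comm k H H t) =
      rev (TensorProduct.assoc k H H H ((comul (R := k)).rTensor H t)) := by
    intro t
    induction t using TensorProduct.induction_on with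
    | zero => simp
    | add a b ha hb => simp only [LinearMap.map_add, LinearEquiv.map_add, ha, hb]
    | tmul a b =>
      simp only [comulAux, TensorProduct.comm_tmul, LinearMap.lTensor_tmul, LinearMap.comp_apply,
        LinearEquiv.coe_coe, LinearMap.rTensor_tmul]
      induction comul (R := k) a using TensorProduct.induction_on with
      | zero => simp
      | add p q hp hq =>
        simp only [LinearMap.map_add, LinearEquiv.map_add, TensorProduct.tmul_add, TensorProduct.add_tmul, hp, hq]
      | tmul p q => simp [rev]
  refine (h1 _).trans (Eq.trans ?_ (h2 _).symm)
  rw [Coalgebra.coassoc_apply]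

instance : Coalgebra k (Cop k H) where
  comul := comulAux k H
  counit := (counit : H →ₗ[k] k)
  coassoc := coassocAux k H
  rTensor_counit_comp_comul := by
    refine LinearMap.ext fun x => ?_
    have h : ∀ t : H ⊗[k] H, (counit (R := k) (A := H)).rTensor H (TensorProduct.comm k H H t) =
        TensorProduct.comm k H k ((counit (R := k) (A := H)).lTensor H t) := by
      intro t
      induction t using TensorProduct.induction_on with
      | zero => simp
      | add a b ha hb => simp only [LinearMap.map_add, LinearEquiv.map_add, ha, hb]
      | tmul a b => simp
    exact (h _).trans (congrArg (TensorProduct.comm k H k)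
      (Coalgebra.lTensor_counit_comul (R := k) (A := H) x))
  lTensor_counit_comp_comul := by
    refine LinearMap.ext fun x => ?_
    have h : ∀ t : H ⊗[k] H, (counit (R := k) (A := H)).lTensor H (TensorProduct.comm k H H t) =
        TensorProduct.comm k k H ((counit (R := k) (A := H)).rTensor H t) := by
      intro t
      induction t using TensorProduct.induction_on with
      | zero => simp
      | add a b ha hb => simp only [LinearMap.map_add, LinearEquiv.map_add, ha, hb]
      | tmul a b => simp
    exact (h _).trans (congrArg (TensorProduct.comm k k H)
      (Coalgebra.rTensor_counit_comul (R := k) (A := H) x))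

theorem comul_of (x : H) : comul (R := k) (of k H x) =
    TensorProduct.map (of k H).toLinearMap (of k H).toLinearMap
      (TensorProduct.comm k H H (comul (R := k) x)) :=
  (LinearMap.congr_fun (TensorProduct.map_id (R := k) (M := H) (N := H))
    (TensorProduct.comm k H H (comul (R := k) x))).symm

instance : Bialgebra k (Cop k H) :=
  Bialgebra.mk' k (Cop k H) (Bialgebra.counit_one (R := k) (A := H))
    (fun {a b} => Bialgebra.counit_mul (R := k) (A := H) a b)
    (by
      show TensorProduct.comm k H H (comul (R := k) (1 : H)) = _
      rw [Bialgebra.comul_one]; rfl)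
    (fun {a b} => by
      have h := Bialgebra.comul_mul (R := k) (A := H) a b
      exact (congrArg (Algebra.TensorProduct.comm k H H) h).trans (map_mul _ _ _))

instance [BijectiveAntipode k H] : HopfAlgebra k (Cop k H) where
  antipode := antipodeInv k H
  mul_antipode_rTensor_comul := by
    refine LinearMap.ext fun x => (BijectiveAntipode.bijective (k := k) (H := H)).1 ?_
    have h : ∀ t : H ⊗[k] H, antipode k (LinearMap.mul' k H ((antipodeInv k H).rTensor H
        (TensorProduct.comm k H H t))) = LinearMap.mul' k H ((antipode k).rTensor H t) := by
      intro t
      induction t using TensorProduct.induction_on with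
      | zero => simp
      | add a b ha hb => simp only [LinearMap.map_add, LinearEquiv.map_add, ha, hb]
      | tmul a b => simp [antipode_mul_antidistrib, antipode_antipodeInv]
    refine (h _).trans ((HopfAlgebra.mul_antipode_rTensor_comul_apply (R := k) (A := H) x).trans ?_)
    show _ = antipode k (algebraMap k H (counit (R := k) (A := H) x))
    rw [Algebra.algebraMap_eq_smul_one, map_smul, antipode_one]
  mul_antipode_lTensor_comul := by
    refine LinearMap.ext fun x => (BijectiveAntipode.bijective (k := k) (H := H)).1 ?_
    have h : ∀ t : H ⊗[k] H, antipode k (LinearMap.mul' k H ((antipodeInv k H).lTensor H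
        (TensorProduct.comm k H H t))) = LinearMap.mul' k H ((antipode k).lTensor H t) := by
      intro t
      induction t using TensorProduct.induction_on with
      | zero => simp
      | add a b ha hb => simp only [LinearMap.map_add, LinearEquiv.map_add, ha, hb]
      | tmul a b => simp [antipode_mul_antidistrib, antipode_antipodeInv]
    refine (h _).trans ((HopfAlgebra.mul_antipode_lTensor_comul_apply (R := k) (A := H) x).trans ?_)
    show _ = antipode k (algebraMap k H (counit (R := k) (A := H) x))
    rw [Algebra.algebraMap_eq_smul_one, map_smul, antipode_one]

end Cop
end Cop

section SkewPairing

variable {k B V : Type*} [Field k] [Ring B] [HopfAlgebra k B] [Ring V] [HopfAlgebra k V]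

/-- `p : B ⊗ V → k` is a skew pairing: `p(bb', h) = p(b, h₁) p(b', h₂)`,
`p(b, hh') = p(b₂, h) p(b₁, h')`, `p(1, h) = ε(h)` and `p(b, 1) = ε(b)`. -/
structure IsSkewPairing (p : B →ₗ[k] V →ₗ[k] k) : Prop where
  mul_left : ∀ b b' h, p (b * b') h =
    LinearMap.mul' k k (TensorProduct.map (p b) (p b') (comul (R := k) h))
  mul_right : ∀ b h h', p b (h * h') =
    LinearMap.mul' k k (TensorProduct.map (p.flip h') (p.flip h) (comul (R := k) b))
  one_left : ∀ h, p 1 h = counit (R := k) h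
  one_right : ∀ b, p b 1 = counit (R := k) b

end SkewPairing

section Hit

variable {k B : Type*} [Field k] [Ring B] [HopfAlgebra k B]

theorem comul_antipode (x : B) : comul (R := k) (antipode k x) =
    TensorProduct.map (antipode k) (antipode k) (TensorProduct.comm k B B (comul (R := k) x)) := by
  let G : B →ₗ[k] B ⊗[k] B := TensorProduct.map (antipode k) (antipode k) ∘ₗ
    (TensorProduct.comm k B B).toLinearMap ∘ₗ comul
  suffices h : (WithConv.toConv G : WithConv (B →ₗ[k] B ⊗[k] B)) =
      WithConv.toConv (comul ∘ₗ antipode k) from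
    (LinearMap.congr_fun (WithConv.toConv_injective h) x).symm
  refine left_inv_eq_right_inv (a := WithConv.toConv (comul (R := k) (A := B))) ?_
    LinearMap.comul_right_inv
  apply WithConv.ext
  -- contraction `a ⊗ ((b ⊗ c) ⊗ d) ↦ (S b * c) ⊗ (S a * d)`
  let F : B ⊗[k] ((B ⊗[k] B) ⊗[k] B) →ₗ[k] B ⊗[k] B :=
    TensorProduct.map (LinearMap.mul' k B ∘ₗ (antipode k).rTensor B)
      (LinearMap.mul' k B ∘ₗ (antipode k).rTensor B) ∘ₗ
        (TensorProduct.leftComm k B (B ⊗[k] B) B).toLinearMap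
  have e1 : ((WithConv.toConv G : WithConv (B →ₗ[k] B ⊗[k] B)) *
      WithConv.toConv (comul (R := k) (A := B))).ofConv =
      F ∘ₗ ((comul (R := k)).rTensor B).lTensor B ∘ₗ (comul (R := k)).lTensor B ∘ₗ comul := by
    have e2 : ((comul (R := k) (A := B)).rTensor B).lTensor B ∘ₗ (comul (R := k)).lTensor B ∘ₗ comul =
        ((TensorProduct.assoc k B B B).symm.toLinearMap.lTensor B ∘ₗ
          (TensorProduct.assoc k B B (B ⊗[k] B)).toLinearMap) ∘ₗ
          TensorProduct.map (comul (R := k)) (comul (R := k)) ∘ₗ comul := by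
      simp only [coassoc_simps]
    rw [e2, LinearMap.convMul_def]
    ext x
    simp only [LinearMap.comp_apply]
    induction comul (R := k) x using TensorProduct.induction_on with
    | zero => simp
    | add a b ha hb => simp only [LinearMap.map_add, LinearEquiv.map_add, ha, hb]
    | tmul a b =>
      simp only [TensorProduct.map_tmul, G, LinearMap.comp_apply]
      induction comul (R := k) a using TensorProduct.induction_on with
      | zero => simp
      | add u v hu hv => simp only [LinearMap.map_add, LinearEquiv.map_add, TensorProduct.add_tmul, hu, hv]
      | tmul a1 a2 =>
        induction comul (R := k) b using TensorProduct.induction_on with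
        | zero => simp
        | add u v hu hv => simp only [LinearMap.map_add, LinearEquiv.map_add, TensorProduct.tmul_add, hu, hv]
        | tmul b1 b2 => simp [F]
  rw [e1]
  have e3 : F ∘ₗ ((comul (R := k)).rTensor B).lTensor B =
      TensorProduct.mk k B B 1 ∘ₗ LinearMap.mul' k B ∘ₗ (antipode k).rTensor B ∘ₗ
        (TensorProduct.lid k B).toLinearMap.lTensor B ∘ₗ ((counit (R := k)).rTensor B).lTensor B := by
    ext a b c
    simp [F, Algebra.algebraMap_eq_smul_one, TensorProduct.smul_tmul]
  rw [← LinearMap.comp_assoc, e3]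
  ext x
  have h1 : (counit (R := k) (A := B)).rTensor B ∘ₗ comul = TensorProduct.mk k _ _ 1 :=
    Coalgebra.rTensor_counit_comp_comul
  have h2 : (TensorProduct.lid k B).toLinearMap.lTensor B (((counit (R := k)).rTensor B).lTensor B
      ((comul (R := k)).lTensor B (comul (R := k) x))) = comul (R := k) x := by
    rw [← LinearMap.comp_apply, ← LinearMap.comp_apply, ← LinearMap.lTensor_comp,
      ← LinearMap.lTensor_comp, LinearMap.comp_assoc, h1]
    have : (TensorProduct.lid k B).toLinearMap ∘ₗ TensorProduct.mk k k B 1 = LinearMap.id := by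
      ext; simp
    rw [this]; simp
  simp only [LinearMap.comp_apply, h2, HopfAlgebra.mul_antipode_rTensor_comul_apply]
  simp [Algebra.algebraMap_eq_smul_one, Algebra.TensorProduct.one_def, LinearMap.convOne_def]

/-- `hitL f b = f(b₁) b₂`. -/
def hitL : (B →ₗ[k] k) →ₗ[k] (B →ₗ[k] B) :=
  LinearMap.lcomp k B comul ∘ₗ LinearMap.llcomp k (B ⊗[k] B) (k ⊗[k] B) B
    (TensorProduct.lid k B).toLinearMap ∘ₗ LinearMap.rTensorHom B

/-- `hitR f b = b₁ f(b₂)`. -/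
def hitR : (B →ₗ[k] k) →ₗ[k] (B →ₗ[k] B) :=
  LinearMap.lcomp k B comul ∘ₗ LinearMap.llcomp k (B ⊗[k] B) (B ⊗[k] k) B
    (TensorProduct.rid k B).toLinearMap ∘ₗ LinearMap.lTensorHom B

theorem hitL_apply (f : B →ₗ[k] k) (b : B) :
    hitL f b = TensorProduct.lid k B (f.rTensor B (comul b)) := rfl

theorem hitR_apply (f : B →ₗ[k] k) (b : B) :
    hitR f b = TensorProduct.rid k B (f.lTensor B (comul b)) := rfl

theorem hitL_counit : hitL (counit (R := k) (A := B)) = LinearMap.id := by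
  ext b; simp [hitL_apply]

theorem hitR_counit : hitR (counit (R := k) (A := B)) = LinearMap.id := by
  ext b; simp [hitR_apply]

/-- The convolution product of two functionals. -/
def conv (f g : B →ₗ[k] k) : B →ₗ[k] k := LinearMap.mul' k k ∘ₗ TensorProduct.map f g ∘ₗ comul

theorem comul_hitL (f : B →ₗ[k] k) (b : B) :
    comul (R := k) (hitL f b) = (hitL f).rTensor B (comul (R := k) b) := by
  have h : comul (R := k) ∘ₗ hitL f = (hitL f).rTensor B ∘ₗ comul := by
    have e : hitL f = (TensorProduct.lid k B).toLinearMap ∘ₗ f.rTensor B ∘ₗ comul := rfl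
    rw [e]
    have e2 : comul (R := k) ∘ₗ (TensorProduct.lid k B).toLinearMap ∘ₗ f.rTensor B ∘ₗ comul =
        (TensorProduct.lid k (B ⊗[k] B)).toLinearMap ∘ₗ f.rTensor (B ⊗[k] B) ∘ₗ
          (TensorProduct.assoc k B B B).toLinearMap ∘ₗ (comul (R := k)).rTensor B ∘ₗ comul := by
      rw [Coalgebra.coassoc]
      ext b
      simp only [LinearMap.comp_apply]
      induction comul (R := k) b using TensorProduct.induction_on with
      | zero => simp
      | add u v hu hv => simp only [LinearMap.map_add, LinearEquiv.map_add, hu, hv]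
      | tmul u v => simp
    rw [e2]
    ext b
    simp only [LinearMap.comp_apply]
    induction comul (R := k) b using TensorProduct.induction_on with
    | zero => simp
    | add u v hu hv => simp only [LinearMap.map_add, LinearEquiv.map_add, hu, hv]
    | tmul u v =>
      simp only [LinearMap.rTensor_tmul, LinearMap.comp_apply]
      induction comul (R := k) u using TensorProduct.induction_on with
      | zero => simp
      | add p q hp hq => simp only [LinearMap.map_add, LinearEquiv.map_add, TensorProduct.add_tmul, hp, hq]
      | tmul p q => simp [TensorProduct.smul_tmul']
  exact LinearMap.congr_fun h b

theorem comul_hitR (f : B →ₗ[k] k) (b : B) :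
    comul (R := k) (hitR f b) = (hitR f).lTensor B (comul (R := k) b) := by
  have h : comul (R := k) ∘ₗ hitR f = (hitR f).lTensor B ∘ₗ comul := by
    have e : hitR f = (TensorProduct.rid k B).toLinearMap ∘ₗ f.lTensor B ∘ₗ comul := rfl
    rw [e]
    have e2 : comul (R := k) ∘ₗ (TensorProduct.rid k B).toLinearMap ∘ₗ f.lTensor B ∘ₗ comul =
        (TensorProduct.rid k (B ⊗[k] B)).toLinearMap ∘ₗ f.lTensor (B ⊗[k] B) ∘ₗ
          (TensorProduct.assoc k B B B).symm.toLinearMap ∘ₗ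
            (comul (R := k)).lTensor B ∘ₗ comul := by
      rw [Coalgebra.coassoc_symm]
      ext b
      simp only [LinearMap.comp_apply]
      induction comul (R := k) b using TensorProduct.induction_on with
      | zero => simp
      | add u v hu hv => simp only [LinearMap.map_add, LinearEquiv.map_add, hu, hv]
      | tmul u v => simp
    rw [e2]
    ext b
    simp only [LinearMap.comp_apply]
    induction comul (R := k) b using TensorProduct.induction_on with
    | zero => simp
    | add u v hu hv => simp only [LinearMap.map_add, LinearEquiv.map_add, hu, hv]
    | tmul u v =>
      simp only [LinearMap.lTensor_tmul, LinearMap.comp_apply]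
      induction comul (R := k) v using TensorProduct.induction_on with
      | zero => simp
      | add p q hp hq => simp only [LinearMap.map_add, LinearEquiv.map_add, TensorProduct.tmul_add, hp, hq]
      | tmul p q => simp
  exact LinearMap.congr_fun h b

theorem conv_eq_hitL (f g : B →ₗ[k] k) (b : B) : conv f g b = g (hitL f b) := by
  rw [hitL_apply, conv, LinearMap.comp_apply, LinearMap.comp_apply]
  induction comul (R := k) b using TensorProduct.induction_on with
  | zero => simp
  | add u v hu hv => simp only [LinearMap.map_add, LinearEquiv.map_add, hu, hv]
  | tmul u v => simp

theorem conv_eq_hitR (f g : B →ₗ[k] k) (b : B) : conv f g b = f (hitR g b) := by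
  rw [hitR_apply, conv, LinearMap.comp_apply, LinearMap.comp_apply]
  induction comul (R := k) b using TensorProduct.induction_on with
  | zero => simp
  | add u v hu hv => simp only [LinearMap.map_add, LinearEquiv.map_add, hu, hv]
  | tmul u v => simp [mul_comm]

theorem hitL_conv (f g : B →ₗ[k] k) : hitL (conv f g) = hitL g ∘ₗ hitL f := by
  ext b
  rw [LinearMap.comp_apply, hitL_apply g, comul_hitL, hitL_apply]
  induction comul (R := k) b using TensorProduct.induction_on with
  | zero => simp
  | add u v hu hv => simp only [LinearMap.map_add, LinearEquiv.map_add, hu, hv]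
  | tmul u v => simp [conv_eq_hitL]

theorem hitR_conv (f g : B →ₗ[k] k) : hitR (conv f g) = hitR f ∘ₗ hitR g := by
  ext b
  rw [LinearMap.comp_apply, hitR_apply f, comul_hitR, hitR_apply]
  induction comul (R := k) b using TensorProduct.induction_on with
  | zero => simp
  | add u v hu hv => simp only [LinearMap.map_add, LinearEquiv.map_add, hu, hv]
  | tmul u v => simp [conv_eq_hitR]

theorem hitL_hitR (f g : B →ₗ[k] k) : hitL f ∘ₗ hitR g = hitR g ∘ₗ hitL f := by
  ext b
  rw [LinearMap.comp_apply, LinearMap.comp_apply, hitL_apply f, comul_hitR, hitL_apply f]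
  induction comul (R := k) b using TensorProduct.induction_on with
  | zero => simp
  | add u v hu hv => simp only [LinearMap.map_add, LinearEquiv.map_add, hu, hv]
  | tmul u v => simp

theorem conv_antipode (f g : B →ₗ[k] k) :
    conv f g ∘ₗ antipode k = conv (g ∘ₗ antipode k) (f ∘ₗ antipode k) := by
  ext b
  simp only [LinearMap.comp_apply, conv, comul_antipode]
  induction comul (R := k) b using TensorProduct.induction_on with
  | zero => simp
  | add u v hu hv => simp only [LinearMap.map_add, LinearEquiv.map_add, hu, hv]
  | tmul u v => simp [mul_comm]

theorem counit_hitL (f : B →ₗ[k] k) (b : B) : counit (R := k) (hitL f b) = f b := by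
  have h := Coalgebra.lTensor_counit_comul (R := k) b
  have h2 : ∀ t : B ⊗[k] B, counit (R := k) (TensorProduct.lid k B (f.rTensor B t)) =
      f (TensorProduct.rid k B ((counit (R := k)).lTensor B t)) := by
    intro t
    induction t using TensorProduct.induction_on with
    | zero => simp
    | add u v hu hv => simp only [LinearMap.map_add, LinearEquiv.map_add, hu, hv]
    | tmul u v => simp [mul_comm]
  rw [hitL_apply, h2, h]; simp

theorem counit_hitR (f : B →ₗ[k] k) (b : B) : counit (R := k) (hitR f b) = f b := by
  have h := Coalgebra.rTensor_counit_comul (R := k) b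
  have h2 : ∀ t : B ⊗[k] B, counit (R := k) (TensorProduct.rid k B (f.lTensor B t)) =
      f (TensorProduct.lid k B ((counit (R := k)).rTensor B t)) := by
    intro t
    induction t using TensorProduct.induction_on with
    | zero => simp
    | add u v hu hv => simp only [LinearMap.map_add, LinearEquiv.map_add, hu, hv]
    | tmul u v => simp [mul_comm]
  rw [hitR_apply, h2, h]; simp

end Hit

section Double

variable {k B V : Type*} [Field k] [Ring B] [HopfAlgebra k B] [Ring V] [HopfAlgebra k V]

/-- `actL p x b = p(b₁, x) b₂`. -/
def actL (p : B →ₗ[k] V →ₗ[k] k) : V →ₗ[k] Module.End k B := hitL ∘ₗ p.flip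

/-- `actR p x b = b₁ p(S(b₂), x)`. -/
def actR (p : B →ₗ[k] V →ₗ[k] k) : V →ₗ[k] Module.End k B :=
  hitR ∘ₗ LinearMap.lcomp k k (antipode k) ∘ₗ p.flip

/-- `x ⊗ (y ⊗ z) ↦ (b ⊗ v ↦ p(b₁, x) b₂ p(S(b₃), z) ⊗ y v)`. -/
def act3 (p : B →ₗ[k] V →ₗ[k] k) : V ⊗[k] (V ⊗[k] V) →ₗ[k] Module.End k (B ⊗[k] V) :=
  TensorProduct.lift (TensorProduct.mapBilinear (RingHom.id k) B V B V).flip ∘ₗ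
    TensorProduct.map (LinearMap.mul k V)
      (LinearMap.mul' k (Module.End k B) ∘ₗ TensorProduct.map (actL p) (actR p)) ∘ₗ
    (TensorProduct.leftComm k V V V).toLinearMap

theorem act3_tmul (p : B →ₗ[k] V →ₗ[k] k) (x y z v : V) (b : B) :
    act3 p (x ⊗ₜ (y ⊗ₜ z)) (b ⊗ₜ v) = actL p x (actR p z b) ⊗ₜ (y * v) := rfl

/-- The threefold coproduct `h ↦ h₁ ⊗ (h₂ ⊗ h₃)`. -/
def comul3 (k A : Type*) [Field k] [Ring A] [HopfAlgebra k A] : A →ₗ[k] A ⊗[k] (A ⊗[k] A) :=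
  comul.lTensor A ∘ₗ comul

/-- The product `(b ⊗ h)(b' ⊗ h') = p(b'₁, h₁) p(S(b'₃), h₃) b b'₂ ⊗ h₂ h'` on `B ⊗ V`. -/
def doubleMul (p : B →ₗ[k] V →ₗ[k] k) : B ⊗[k] V →ₗ[k] B ⊗[k] V →ₗ[k] B ⊗[k] V :=
  TensorProduct.lift (LinearMap.compl₁₂ (LinearMap.mul k (Module.End k (B ⊗[k] V)))
    (LinearMap.rTensorHom V ∘ₗ LinearMap.mul k B) (act3 p ∘ₗ comul3 k V))

theorem doubleMul_tmul (p : B →ₗ[k] V →ₗ[k] k) (b : B) (h : V) (w : B ⊗[k] V) :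
    doubleMul p (b ⊗ₜ h) w =
      (LinearMap.mulLeft k b).rTensor V (act3 p (comul3 k V h) w) := rfl

namespace IsSkewPairing

variable {p : B →ₗ[k] V →ₗ[k] k}

theorem flip_one (hp : IsSkewPairing p) : p.flip 1 = counit (R := k) := LinearMap.ext hp.one_right

theorem flip_mul (hp : IsSkewPairing p) (x y : V) : p.flip (x * y) = conv (p.flip y) (p.flip x) :=
  LinearMap.ext fun b => hp.mul_right b x y

theorem actL_one (hp : IsSkewPairing p) : actL p 1 = 1 := by
  show hitL (p.flip 1) = 1
  rw [hp.flip_one, hitL_counit]; rfl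

theorem actR_one (hp : IsSkewPairing p) : actR p 1 = 1 := by
  show hitR (p.flip 1 ∘ₗ antipode k) = 1
  rw [hp.flip_one, HopfAlgebra.counit_comp_antipode, hitR_counit]; rfl

theorem actL_mul (hp : IsSkewPairing p) (x y : V) : actL p (x * y) = actL p x * actL p y := by
  show hitL (p.flip (x * y)) = _
  rw [hp.flip_mul, hitL_conv]; rfl

theorem actR_mul (hp : IsSkewPairing p) (x y : V) : actR p (x * y) = actR p x * actR p y := by
  show hitR (p.flip (x * y) ∘ₗ antipode k) = _
  rw [hp.flip_mul, conv_antipode, hitR_conv]; rfl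

theorem actL_actR (x y : V) : actL p x * actR p y = actR p y * actL p x := hitL_hitR _ _

theorem act3_one (hp : IsSkewPairing p) : act3 p 1 = 1 := by
  ext b v
  show act3 p (1 ⊗ₜ (1 ⊗ₜ 1)) (b ⊗ₜ v) = b ⊗ₜ v
  rw [act3_tmul, hp.actL_one, hp.actR_one, one_mul]; rfl

theorem act3_mul (hp : IsSkewPairing p) (s t : V ⊗[k] (V ⊗[k] V)) : act3 p (s * t) = act3 p s * act3 p t := by
  induction s using TensorProduct.induction_on with
  | zero => simp
  | add a b ha hb => simp only [add_mul, LinearMap.map_add, LinearEquiv.map_add, ha, hb]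
  | tmul x s =>
  induction s using TensorProduct.induction_on with
  | zero => simp
  | add a b ha hb => simp only [TensorProduct.tmul_add, add_mul, LinearMap.map_add, LinearEquiv.map_add, ha, hb]
  | tmul y z =>
  induction t using TensorProduct.induction_on with
  | zero => simp
  | add a b ha hb => simp only [mul_add, LinearMap.map_add, LinearEquiv.map_add, ha, hb]
  | tmul x' t =>
  induction t using TensorProduct.induction_on with
  | zero => simp
  | add a b ha hb => simp only [TensorProduct.tmul_add, mul_add, LinearMap.map_add, LinearEquiv.map_add, ha, hb]
  | tmul y' z' =>
  rw [Algebra.TensorProduct.tmul_mul_tmul, Algebra.TensorProduct.tmul_mul_tmul]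
  ext b v
  show act3 p ((x * x') ⊗ₜ ((y * y') ⊗ₜ (z * z'))) (b ⊗ₜ v) =
    act3 p (x ⊗ₜ (y ⊗ₜ z)) (act3 p (x' ⊗ₜ (y' ⊗ₜ z')) (b ⊗ₜ v))
  rw [act3_tmul, act3_tmul, act3_tmul, hp.actL_mul, hp.actR_mul, mul_assoc]
  congr 1
  have := LinearMap.congr_fun (actL_actR (p := p) x' z) (actR p z' b)
  exact congrArg (actL p x) this

theorem comul3_one : comul3 k V 1 = 1 := by
  simp [comul3, Algebra.TensorProduct.one_def]

theorem comul3_mul (x y : V) : comul3 k V (x * y) = comul3 k V x * comul3 k V y := by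
  exact map_mul ((Algebra.TensorProduct.map (AlgHom.id k V) (Bialgebra.comulAlgHom k V)).comp
    (Bialgebra.comulAlgHom k V)) x y

/-- `b₁ ⊗ b₂ ↦ (x ↦ p(b₁, x) b₂)`. -/
def lamL (p : B →ₗ[k] V →ₗ[k] k) : B ⊗[k] B →ₗ[k] V →ₗ[k] B :=
  TensorProduct.lift (LinearMap.smulRightₗ ∘ₗ p)

/-- `b₁ ⊗ b₂ ↦ (x ↦ b₁ p(S(b₂), x))`. -/
def lamR (p : B →ₗ[k] V →ₗ[k] k) : B ⊗[k] B →ₗ[k] V →ₗ[k] B :=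
  TensorProduct.lift (LinearMap.smulRightₗ ∘ₗ p ∘ₗ antipode k) ∘ₗ
    (TensorProduct.comm k B B).toLinearMap

theorem actL_flip (b : B) : (actL p).flip b = lamL p (comul b) := by
  ext x
  show hitL (p.flip x) b = _
  rw [hitL_apply]
  induction comul (R := k) b using TensorProduct.induction_on with
  | zero => simp
  | add u v hu hv => simp only [LinearMap.map_add, LinearEquiv.map_add, LinearMap.add_apply, hu, hv]
  | tmul u v => simp [lamL]

theorem actR_flip (b : B) : (actR p).flip b = lamR p (comul b) := by
  ext x
  show hitR (p.flip x ∘ₗ antipode k) b = _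
  rw [hitR_apply]
  induction comul (R := k) b using TensorProduct.induction_on with
  | zero => simp
  | add u v hu hv => simp only [LinearMap.map_add, LinearEquiv.map_add, LinearMap.add_apply, hu, hv]
  | tmul u v => simp [lamR]

theorem lamL_mul (hp : IsSkewPairing p) (s t : B ⊗[k] B) (x : V) : lamL p (s * t) x =
    LinearMap.mul' k B (TensorProduct.map (lamL p s) (lamL p t) (comul (R := k) x)) := by
  induction s using TensorProduct.induction_on with
  | zero => simp
  | add a b ha hb =>
    simp only [add_mul, LinearMap.map_add, LinearEquiv.map_add, LinearMap.add_apply, ha, hb, TensorProduct.map_add_left]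
  | tmul b1 b2 =>
  induction t using TensorProduct.induction_on with
  | zero => simp
  | add a b ha hb =>
    simp only [mul_add, LinearMap.map_add, LinearEquiv.map_add, LinearMap.add_apply, ha, hb, TensorProduct.map_add_right]
  | tmul c1 c2 =>
  rw [Algebra.TensorProduct.tmul_mul_tmul]
  show p (b1 * c1) x • (b2 * c2) = _
  rw [hp.mul_left]
  induction comul (R := k) x using TensorProduct.induction_on with
  | zero => simp
  | add u v hu hv => simp only [LinearMap.map_add, LinearEquiv.map_add, add_smul, hu, hv]
  | tmul u v => simp [lamL, smul_smul, mul_comm]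

theorem lamR_mul (hp : IsSkewPairing p) (s t : B ⊗[k] B) (x : V) : lamR p (s * t) x =
    LinearMap.mul' k B (TensorProduct.map (lamR p s) (lamR p t)
      (TensorProduct.comm k V V (comul (R := k) x))) := by
  induction s using TensorProduct.induction_on with
  | zero => simp
  | add a b ha hb =>
    simp only [add_mul, LinearMap.map_add, LinearEquiv.map_add, LinearMap.add_apply, ha, hb, TensorProduct.map_add_left]
  | tmul b1 b2 =>
  induction t using TensorProduct.induction_on with
  | zero => simp
  | add a b ha hb =>
    simp only [mul_add, LinearMap.map_add, LinearEquiv.map_add, LinearMap.add_apply, ha, hb, TensorProduct.map_add_right]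
  | tmul c1 c2 =>
  rw [Algebra.TensorProduct.tmul_mul_tmul]
  show p (antipode k (b2 * c2)) x • (b1 * c1) = _
  rw [antipode_mul_antidistrib, hp.mul_left]
  induction comul (R := k) x using TensorProduct.induction_on with
  | zero => simp
  | add u v hu hv => simp only [LinearMap.map_add, LinearEquiv.map_add, add_smul, hu, hv]
  | tmul u v => simp [lamR, smul_smul, mul_comm]

theorem actL_apply_mul (hp : IsSkewPairing p) (x : V) (b c : B) : actL p x (b * c) =
    LinearMap.mul' k B (TensorProduct.map ((actL p).flip b) ((actL p).flip c)
      (comul (R := k) x)) := by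
  rw [← LinearMap.flip_apply (actL p), actL_flip, actL_flip, actL_flip, Bialgebra.comul_mul,
    hp.lamL_mul]

theorem actR_apply_mul (hp : IsSkewPairing p) (x : V) (b c : B) : actR p x (b * c) =
    LinearMap.mul' k B (TensorProduct.map ((actR p).flip b) ((actR p).flip c)
      (TensorProduct.comm k V V (comul (R := k) x))) := by
  rw [← LinearMap.flip_apply (actR p), actR_flip, actR_flip, actR_flip, Bialgebra.comul_mul,
    hp.lamR_mul]

theorem actL_apply_one (hp : IsSkewPairing p) (x : V) : actL p x 1 = counit (R := k) x • 1 := by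
  rw [← LinearMap.flip_apply (actL p), actL_flip, Bialgebra.comul_one,
    Algebra.TensorProduct.one_def]
  simp [lamL, hp.one_left]

theorem actR_apply_one (hp : IsSkewPairing p) (x : V) : actR p x 1 = counit (R := k) x • 1 := by
  rw [← LinearMap.flip_apply (actR p), actR_flip, Bialgebra.comul_one,
    Algebra.TensorProduct.one_def]
  simp [lamR, hp.one_left]

/-- `x ⊗ z ↦ p(b₁, x) b₂ p(S(b₃), z)`. -/
def actLR (p : B →ₗ[k] V →ₗ[k] k) (b : B) : V ⊗[k] V →ₗ[k] B :=
  LinearMap.applyₗ b ∘ₗ LinearMap.mul' k (Module.End k B) ∘ₗ TensorProduct.map (actL p) (actR p)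

theorem actLR_tmul (b : B) (x z : V) : actLR p b (x ⊗ₜ z) = actL p x (actR p z b) := rfl

theorem actLR_mul (hp : IsSkewPairing p) (b c : B) (x z : V) :
    actL p x (actR p z (b * c)) = LinearMap.mul' k B
      (TensorProduct.map (actLR p b) (actLR p c) (TensorProduct.tensorTensorTensorComm k V V V V
        (comul (R := k) x ⊗ₜ TensorProduct.comm k V V (comul (R := k) z)))) := by
  rw [hp.actR_apply_mul]
  induction TensorProduct.comm k V V (comul (R := k) z) using TensorProduct.induction_on with
  | zero => simp
  | add u v hu hv => simp only [LinearMap.map_add, LinearEquiv.map_add, TensorProduct.tmul_add, hu, hv]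
  | tmul z1 z2 =>
    simp only [TensorProduct.map_tmul, LinearMap.mul'_apply, LinearMap.flip_apply]
    rw [hp.actL_apply_mul]
    induction comul (R := k) x using TensorProduct.induction_on with
    | zero => simp
    | add u v hu hv => simp only [LinearMap.map_add, LinearEquiv.map_add, TensorProduct.add_tmul, hu, hv]
    | tmul x1 x2 => simp [actLR_tmul]

theorem act3_mulLeft (hp : IsSkewPairing p) (h : V) (b : B) (w : B ⊗[k] V) :
    act3 p (comul3 k V h) ((LinearMap.mulLeft k b).rTensor V w) =
      doubleMul p (act3 p (comul3 k V h) (b ⊗ₜ 1)) w := by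
  induction w using TensorProduct.induction_on with
  | zero => simp
  | add u v hu hv => simp only [LinearMap.map_add, LinearEquiv.map_add, hu, hv]
  | tmul c v =>
  -- `x₁ ⊗ (x₂ ⊗ (y ⊗ (z₁ ⊗ z₂)))` is sent to the product of the two `actLR`, tensor `y v`
  let F : V ⊗[k] (V ⊗[k] (V ⊗[k] (V ⊗[k] V))) →ₗ[k] B ⊗[k] V :=
    TensorProduct.map (LinearMap.mul' k B ∘ₗ (TensorProduct.comm k B B).toLinearMap ∘ₗ
        TensorProduct.map (actLR p c) (actLR p b)) (LinearMap.mulRight k v) ∘ₗ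
      (TensorProduct.assoc k (V ⊗[k] V) (V ⊗[k] V) V).symm.toLinearMap ∘ₗ
      ((TensorProduct.assoc k V V V).symm.toLinearMap ∘ₗ
        (TensorProduct.comm k V V).toLinearMap.lTensor V).lTensor (V ⊗[k] V) ∘ₗ
      (TensorProduct.leftComm k V (V ⊗[k] V) (V ⊗[k] V)).toLinearMap ∘ₗ
      ((TensorProduct.assoc k V V (V ⊗[k] V)).symm.toLinearMap ∘ₗ
        (TensorProduct.leftComm k V V V).toLinearMap.lTensor V).lTensor V
  have hF : ∀ x1 x2 y z1 z2 : V, F (x1 ⊗ₜ (x2 ⊗ₜ (y ⊗ₜ (z1 ⊗ₜ z2)))) =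
      (actLR p b (x1 ⊗ₜ z2) * actLR p c (x2 ⊗ₜ z1)) ⊗ₜ (y * v) := by
    intros; simp [F]
  clear_value F
  have e : (TensorProduct.assoc k V V (V ⊗[k] (V ⊗[k] V))).toLinearMap ∘ₗ
      TensorProduct.map (comul (R := k)) ((comul (R := k)).lTensor V) ∘ₗ comul3 k V =
      ((TensorProduct.assoc k V V V).toLinearMap.lTensor V ∘ₗ
        (TensorProduct.assoc k V (V ⊗[k] V) V).toLinearMap ∘ₗ
        (comul3 k V).rTensor V).lTensor V ∘ₗ comul3 k V := by
    simp only [comul3, coassoc_simps]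
  have hl : ∀ s : V ⊗[k] (V ⊗[k] V), act3 p s ((b * c) ⊗ₜ v) =
      F (TensorProduct.assoc k V V (V ⊗[k] (V ⊗[k] V))
        (TensorProduct.map (comul (R := k)) ((comul (R := k)).lTensor V) s)) := by
    intro s
    induction s using TensorProduct.induction_on with
    | zero => simp
    | add u v hu hv => simp only [LinearMap.map_add, LinearEquiv.map_add, LinearMap.add_apply, hu, hv]
    | tmul x s =>
    induction s using TensorProduct.induction_on with
    | zero => simp
    | add u v hu hv => simp only [TensorProduct.tmul_add, LinearMap.map_add, LinearEquiv.map_add, LinearMap.add_apply, hu, hv]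
    | tmul y z =>
    rw [act3_tmul, hp.actLR_mul, TensorProduct.map_tmul, LinearMap.lTensor_tmul]
    induction comul (R := k) x using TensorProduct.induction_on with
    | zero => simp
    | add u v hu hv => simp only [TensorProduct.add_tmul, LinearMap.map_add, LinearEquiv.map_add, hu, hv]
    | tmul x1 x2 =>
    induction comul (R := k) z using TensorProduct.induction_on with
    | zero => simp
    | add u v hu hv => simp only [TensorProduct.tmul_add, TensorProduct.add_tmul, LinearMap.map_add, LinearEquiv.map_add, hu, hv]
    | tmul z1 z2 => simp [hF]
  have hr : ∀ s : V ⊗[k] (V ⊗[k] V), doubleMul p (act3 p s (b ⊗ₜ 1)) (c ⊗ₜ v) =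
      F (((TensorProduct.assoc k V V V).toLinearMap.lTensor V ∘ₗ
        (TensorProduct.assoc k V (V ⊗[k] V) V).toLinearMap ∘ₗ
        (comul3 k V).rTensor V).lTensor V s) := by
    intro s
    induction s using TensorProduct.induction_on with
    | zero => simp
    | add u v hu hv => simp only [LinearMap.map_add, LinearEquiv.map_add, LinearMap.add_apply, hu, hv]
    | tmul x s =>
    induction s using TensorProduct.induction_on with
    | zero => simp
    | add u v hu hv => simp only [TensorProduct.tmul_add, LinearMap.map_add, LinearEquiv.map_add, LinearMap.add_apply, hu, hv]
    | tmul y z =>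
    rw [act3_tmul, mul_one, doubleMul_tmul, LinearMap.lTensor_tmul, LinearMap.comp_apply,
      LinearMap.comp_apply, LinearMap.rTensor_tmul]
    induction comul3 k V y using TensorProduct.induction_on with
    | zero => simp
    | add u v hu hv =>
      simp only [TensorProduct.tmul_add, TensorProduct.add_tmul, LinearMap.map_add, LinearEquiv.map_add, LinearMap.add_apply,
        hu, hv]
    | tmul y1 t =>
    induction t using TensorProduct.induction_on with
    | zero => simp
    | add u v hu hv =>
      simp only [TensorProduct.tmul_add, TensorProduct.add_tmul, LinearMap.map_add, LinearEquiv.map_add, LinearMap.add_apply,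
        hu, hv]
    | tmul y2 y3 =>
      rw [act3_tmul]
      simp [hF, actLR_tmul]
  rw [LinearMap.rTensor_tmul, LinearMap.mulLeft_apply, hl, hr]
  exact congrArg F (LinearMap.congr_fun e h)

theorem doubleMul_assoc (hp : IsSkewPairing p) (s t w : B ⊗[k] V) :
    doubleMul p (doubleMul p s t) w = doubleMul p s (doubleMul p t w) := by
  induction s using TensorProduct.induction_on with
  | zero => simp
  | add u v hu hv => simp only [LinearMap.map_add, LinearEquiv.map_add, LinearMap.add_apply, hu, hv]
  | tmul b h =>
  induction t using TensorProduct.induction_on with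
  | zero => simp
  | add u v hu hv => simp only [LinearMap.map_add, LinearEquiv.map_add, LinearMap.add_apply, hu, hv]
  | tmul c v =>
  have key : ∀ (a : B) (s : B ⊗[k] V), doubleMul p ((LinearMap.mulLeft k a).rTensor V s) w =
      (LinearMap.mulLeft k a).rTensor V (doubleMul p s w) := by
    intro a s
    induction s using TensorProduct.induction_on with
    | zero => simp
    | add u v hu hv => simp only [LinearMap.map_add, LinearEquiv.map_add, LinearMap.add_apply, hu, hv]
    | tmul d x =>
      rw [LinearMap.rTensor_tmul, doubleMul_tmul, doubleMul_tmul, LinearMap.mulLeft_apply,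
        LinearMap.mulLeft_mul, LinearMap.rTensor_comp]
      rfl
  have key2 : ∀ s : V ⊗[k] (V ⊗[k] V), doubleMul p (act3 p s (c ⊗ₜ v)) w =
      doubleMul p (act3 p s (c ⊗ₜ 1)) (act3 p (comul3 k V v) w) := by
    intro s
    induction s using TensorProduct.induction_on with
    | zero => simp
    | add u v hu hv => simp only [LinearMap.map_add, LinearEquiv.map_add, LinearMap.add_apply, hu, hv]
    | tmul x s =>
    induction s using TensorProduct.induction_on with
    | zero => simp
    | add u v hu hv => simp only [TensorProduct.tmul_add, LinearMap.map_add, LinearEquiv.map_add, LinearMap.add_apply, hu, hv]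
    | tmul y z =>
    rw [act3_tmul, act3_tmul, doubleMul_tmul, doubleMul_tmul, comul3_mul, hp.act3_mul, mul_one]
    rfl
  rw [doubleMul_tmul, key, doubleMul_tmul, doubleMul_tmul, hp.act3_mulLeft, key2]

theorem act3_comul3_one (hp : IsSkewPairing p) (h v : V) :
    act3 p (comul3 k V h) (1 ⊗ₜ v) = 1 ⊗ₜ (h * v) := by
  have h1 : ∀ s : V ⊗[k] (V ⊗[k] V), act3 p s (1 ⊗ₜ v) = 1 ⊗ₜ (TensorProduct.lid k V
      ((counit (R := k)).rTensor V ((TensorProduct.rid k V).toLinearMap.lTensor V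
        (((counit (R := k)).lTensor V).lTensor V s))) * v) := by
    intro s
    induction s using TensorProduct.induction_on with
    | zero => simp
    | add u v hu hv =>
      simp only [LinearMap.map_add, LinearEquiv.map_add, LinearMap.add_apply, hu, hv, add_mul, TensorProduct.tmul_add]
    | tmul x s =>
    induction s using TensorProduct.induction_on with
    | zero => simp
    | add u v hu hv =>
      simp only [TensorProduct.tmul_add, LinearMap.map_add, LinearEquiv.map_add, LinearMap.add_apply, hu, hv, add_mul]
    | tmul y z =>
    rw [act3_tmul, hp.actR_apply_one, map_smul, hp.actL_apply_one]
    simp [smul_smul, mul_comm, TensorProduct.smul_tmul']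
  rw [h1, comul3]
  have h2 : (TensorProduct.rid k V).toLinearMap.lTensor V (((counit (R := k)).lTensor V).lTensor V
      ((comul (R := k)).lTensor V (comul (R := k) h))) = comul (R := k) h := by
    rw [← LinearMap.comp_apply, ← LinearMap.comp_apply, ← LinearMap.lTensor_comp,
      ← LinearMap.lTensor_comp, LinearMap.comp_assoc, Coalgebra.lTensor_counit_comp_comul]
    have : (TensorProduct.rid k V).toLinearMap ∘ₗ (TensorProduct.mk k V k).flip 1 =
      LinearMap.id := by ext; simp
    rw [this]; simp
  rw [LinearMap.comp_apply, h2, Coalgebra.rTensor_counit_comul]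
  simp

theorem one_doubleMul (hp : IsSkewPairing p) (w : B ⊗[k] V) :
    doubleMul p (1 ⊗ₜ 1) w = w := by
  rw [doubleMul_tmul, comul3_one, hp.act3_one, LinearMap.mulLeft_one]
  simp

theorem doubleMul_one (hp : IsSkewPairing p) (w : B ⊗[k] V) :
    doubleMul p w (1 ⊗ₜ 1) = w := by
  induction w using TensorProduct.induction_on with
  | zero => simp
  | add u v hu hv => simp only [LinearMap.map_add, LinearEquiv.map_add, LinearMap.add_apply, hu, hv]
  | tmul b h => rw [doubleMul_tmul, hp.act3_comul3_one]; simp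

/-- `x ⊗ y ↦ (b ⊗ c ↦ b₁ p(S(b₂), x) ⊗ p(c₁, y) c₂)`. -/
def actRL (p : B →ₗ[k] V →ₗ[k] k) : V ⊗[k] V →ₗ[k] Module.End k (B ⊗[k] B) :=
  TensorProduct.lift (TensorProduct.mapBilinear (RingHom.id k) B B B B) ∘ₗ
    TensorProduct.map (actR p) (actL p)

theorem actRL_tmul (x y : V) (b c : B) :
    actRL p (x ⊗ₜ y) (b ⊗ₜ c) = actR p x b ⊗ₜ actL p y c := rfl

theorem actRL_comul (hp : IsSkewPairing p) (m : V) (b : B) :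
    actRL p (comul (R := k) m) (comul (R := k) b) = counit (R := k) m • comul (R := k) b := by
  -- `c₁ ⊗ ((c₂ ⊗ d₁) ⊗ d₂) ↦ p(S(c₂) d₁, m) c₁ ⊗ d₂`
  let G : B ⊗[k] ((B ⊗[k] B) ⊗[k] B) →ₗ[k] B ⊗[k] B :=
    ((TensorProduct.lid k B).toLinearMap ∘ₗ (p.flip m ∘ₗ LinearMap.mul' k B ∘ₗ
      (antipode k).rTensor B).rTensor B).lTensor B
  have hG : ∀ c1 c2 d1 d2 : B, G (c1 ⊗ₜ ((c2 ⊗ₜ d1) ⊗ₜ d2)) =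
      p (antipode k c2 * d1) m • c1 ⊗ₜ d2 := by
    intros; simp [G]
  have e2 : ((comul (R := k) (A := B)).rTensor B).lTensor B ∘ₗ (comul (R := k)).lTensor B ∘ₗ comul =
      ((TensorProduct.assoc k B B B).symm.toLinearMap.lTensor B ∘ₗ
        (TensorProduct.assoc k B B (B ⊗[k] B)).toLinearMap) ∘ₗ
        TensorProduct.map (comul (R := k)) (comul (R := k)) ∘ₗ comul := by
    simp only [coassoc_simps]
  have h1 : ∀ s : B ⊗[k] B, actRL p (comul (R := k) m) s =
      G ((TensorProduct.assoc k B B B).symm.toLinearMap.lTensor B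
        (TensorProduct.assoc k B B (B ⊗[k] B)
          (TensorProduct.map (comul (R := k)) (comul (R := k)) s))) := by
    intro s
    induction s using TensorProduct.induction_on with
    | zero => simp
    | add u v hu hv => simp only [LinearMap.map_add, LinearEquiv.map_add, hu, hv]
    | tmul c d =>
    have h2 : ∀ t : V ⊗[k] V, actRL p t (c ⊗ₜ d) =
        TensorProduct.map (lamR p (comul c)) (lamL p (comul d)) t := by
      intro t
      rw [← actR_flip, ← actL_flip]
      induction t using TensorProduct.induction_on with
      | zero => simp
      | add u v hu hv => simp only [LinearMap.map_add, LinearEquiv.map_add, LinearMap.add_apply, hu, hv]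
      | tmul x y => rfl
    rw [h2, TensorProduct.map_tmul]
    clear_value G
    induction comul (R := k) c using TensorProduct.induction_on with
    | zero => simp
    | add u v hu hv =>
      simp only [LinearMap.map_add, LinearEquiv.map_add, TensorProduct.add_tmul, TensorProduct.map_add_left, LinearMap.add_apply,
        hu, hv]
    | tmul c1 c2 =>
    induction comul (R := k) d using TensorProduct.induction_on with
    | zero => simp
    | add u v hu hv =>
      simp only [LinearMap.map_add, LinearEquiv.map_add, TensorProduct.tmul_add, TensorProduct.map_add_right, LinearMap.add_apply,
        hu, hv]
    | tmul d1 d2 =>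
    simp only [TensorProduct.assoc_tmul, LinearMap.lTensor_tmul, LinearEquiv.coe_coe,
      TensorProduct.assoc_symm_tmul, hG]
    rw [hp.mul_left]
    induction comul (R := k) m using TensorProduct.induction_on with
    | zero => simp
    | add u v hu hv => simp only [LinearMap.map_add, LinearEquiv.map_add, add_smul, hu, hv]
    | tmul x y => simp [lamL, lamR, TensorProduct.smul_tmul', TensorProduct.tmul_smul, smul_smul,
        mul_comm]
  have h3 : G ∘ₗ ((comul (R := k)).rTensor B).lTensor B = counit (R := k) m •
      ((TensorProduct.lid k B).toLinearMap ∘ₗ (counit (R := k)).rTensor B).lTensor B := by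
    ext a b c
    simp [G, Algebra.algebraMap_eq_smul_one, hp.one_left, smul_smul, mul_comm,
      TensorProduct.tmul_smul]
  have h4 : ((TensorProduct.lid k B).toLinearMap ∘ₗ (counit (R := k)).rTensor B).lTensor B
      ((comul (R := k)).lTensor B (comul (R := k) b)) = comul (R := k) b := by
    rw [← LinearMap.comp_apply, ← LinearMap.lTensor_comp, LinearMap.comp_assoc,
      Coalgebra.rTensor_counit_comp_comul]
    have : (TensorProduct.lid k B).toLinearMap ∘ₗ TensorProduct.mk k k B 1 = LinearMap.id := by
      ext; simp
    rw [this]; simp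
  have h5 := LinearMap.congr_fun e2 b
  have h6 := LinearMap.congr_fun h3 ((comul (R := k)).lTensor B (comul (R := k) b))
  simp only [LinearMap.comp_apply, LinearEquiv.coe_coe] at h5 h6
  rw [h1, ← h5, h6, LinearMap.smul_apply, h4]

/-- `h ↦ (b ↦ p(b₁, h₁) b₂ p(S(b₃), h₃) ⊗ h₂)`, the product `(1 ⊗ h)(b ⊗ 1)`. -/
def swap (p : B →ₗ[k] V →ₗ[k] k) : V →ₗ[k] B →ₗ[k] B ⊗[k] V :=
  LinearMap.lcomp k (B ⊗[k] V) ((TensorProduct.mk k B V).flip 1) ∘ₗ act3 p ∘ₗ comul3 k V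

theorem swap_apply (h : V) (b : B) : swap p h b = act3 p (comul3 k V h) (b ⊗ₜ 1) := rfl

/-- `x ⊗ y ↦ (b ⊗ c ↦ p(b₁, x) b₂ ⊗ c₁ p(S(c₂), y))`. -/
def actLRB (p : B →ₗ[k] V →ₗ[k] k) : V ⊗[k] V →ₗ[k] Module.End k (B ⊗[k] B) :=
  TensorProduct.lift (TensorProduct.mapBilinear (RingHom.id k) B B B B) ∘ₗ
    TensorProduct.map (actL p) (actR p)

theorem actLRB_tmul (x y : V) (b c : B) :
    actLRB p (x ⊗ₜ y) (b ⊗ₜ c) = actL p x b ⊗ₜ actR p y c := rfl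

theorem comul_swap (hp : IsSkewPairing p) (h : V) (b : B) :
    TensorProduct.tensorTensorTensorComm k B B V V
      (TensorProduct.map (comul (R := k)) (comul (R := k)) (swap p h b)) =
    TensorProduct.lift (TensorProduct.mapBilinear (RingHom.id k) B B (B ⊗[k] V) (B ⊗[k] V))
      (TensorProduct.map (swap p) (swap p) (comul (R := k) h)) (comul (R := k) b) := by
  -- `x ⊗ (y₁ ⊗ (y₂ ⊗ z))` acts by `x` on the left and by `z` on the right
  let F0 : B ⊗[k] B → V ⊗[k] (V ⊗[k] (V ⊗[k] V)) →ₗ[k] (B ⊗[k] V) ⊗[k] (B ⊗[k] V) := fun β =>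
    (TensorProduct.tensorTensorTensorComm k B B V V).toLinearMap ∘ₗ
      (LinearMap.applyₗ β ∘ₗ actLRB p).rTensor (V ⊗[k] V) ∘ₗ
      (TensorProduct.assoc k V V (V ⊗[k] V)).symm.toLinearMap ∘ₗ
      ((TensorProduct.leftComm k V V V).toLinearMap ∘ₗ
        (TensorProduct.comm k V V).toLinearMap.lTensor V).lTensor V
  have hF0 : ∀ β x y1 y2 z, F0 β (x ⊗ₜ (y1 ⊗ₜ (y2 ⊗ₜ z))) =
      TensorProduct.tensorTensorTensorComm k B B V V (actLRB p (x ⊗ₜ z) β ⊗ₜ (y1 ⊗ₜ y2)) := by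
    intros; simp [F0]
  let F : B ⊗[k] B → V ⊗[k] (V ⊗[k] (((V ⊗[k] V) ⊗[k] V) ⊗[k] V)) →ₗ[k]
      (B ⊗[k] V) ⊗[k] (B ⊗[k] V) := fun β =>
    (TensorProduct.tensorTensorTensorComm k B B V V).toLinearMap ∘ₗ
      (LinearMap.applyₗ β ∘ₗ LinearMap.mul' k (Module.End k (B ⊗[k] B)) ∘ₗ
        TensorProduct.map (actLRB p) (actRL p)).rTensor (V ⊗[k] V) ∘ₗ
      ((TensorProduct.assoc k V V (V ⊗[k] V)).symm.toLinearMap).rTensor (V ⊗[k] V) ∘ₗ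
      (TensorProduct.assoc k V (V ⊗[k] (V ⊗[k] V)) (V ⊗[k] V)).symm.toLinearMap ∘ₗ
      ((TensorProduct.leftComm k V (V ⊗[k] (V ⊗[k] V)) V).toLinearMap ∘ₗ
        ((TensorProduct.assoc k V (V ⊗[k] V) V).symm.toLinearMap ∘ₗ
          (TensorProduct.comm k ((V ⊗[k] V) ⊗[k] V) V).toLinearMap).lTensor V).lTensor V
  have hF : ∀ β x y1 m y2 z, F β (x ⊗ₜ (y1 ⊗ₜ ((m ⊗ₜ y2) ⊗ₜ z))) =
      TensorProduct.tensorTensorTensorComm k B B V V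
        (actLRB p (x ⊗ₜ z) (actRL p m β) ⊗ₜ (y1 ⊗ₜ y2)) := by
    intros; simp [F]
  have hFadd : ∀ β β', F (β + β') = F β + F β' := by
    intro β β'
    refine LinearMap.ext fun t => ?_
    simp only [F, LinearMap.map_add, LinearEquiv.map_add, LinearMap.add_comp, LinearMap.comp_add, LinearMap.add_apply,
      LinearMap.rTensor_add]
  have hF0' : F 0 = 0 := by
    refine LinearMap.ext fun t => ?_
    simp [F]
  clear_value F F0
  have hL : TensorProduct.tensorTensorTensorComm k B B V V
      (TensorProduct.map (comul (R := k)) (comul (R := k)) (swap p h b)) =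
      F0 (comul b) ((TensorProduct.assoc k V V V).toLinearMap.lTensor V
        (((comul (R := k)).rTensor V).lTensor V (comul3 k V h))) := by
    rw [swap_apply]
    induction comul3 k V h using TensorProduct.induction_on with
    | zero => simp
    | add u v hu hv => simp only [LinearMap.map_add, LinearEquiv.map_add, LinearMap.add_apply, hu, hv]
    | tmul x s =>
    induction s using TensorProduct.induction_on with
    | zero => simp
    | add u v hu hv => simp only [TensorProduct.tmul_add, LinearMap.map_add, LinearEquiv.map_add, LinearMap.add_apply, hu, hv]
    | tmul y z =>
    rw [act3_tmul, mul_one, TensorProduct.map_tmul]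
    have e : comul (R := k) (actL p x (actR p z b)) = actLRB p (x ⊗ₜ z) (comul b) := by
      refine (comul_hitL _ _).trans ?_
      have e2 : comul (R := k) (actR p z b) = (actR p z).lTensor B (comul (R := k) b) :=
        comul_hitR _ _
      rw [e2]
      induction comul (R := k) b using TensorProduct.induction_on with
      | zero => simp
      | add u v hu hv => simp only [LinearMap.map_add, LinearEquiv.map_add, hu, hv]
      | tmul u v => rfl
    rw [e, LinearMap.lTensor_tmul, LinearMap.rTensor_tmul]
    induction comul (R := k) y using TensorProduct.induction_on with
    | zero => simp
    | add u v hu hv => simp only [LinearMap.map_add, LinearEquiv.map_add, TensorProduct.tmul_add, TensorProduct.add_tmul, hu, hv]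
    | tmul y1 y2 => simp [hF0]
  have hR : ∀ t β, TensorProduct.lift
      (TensorProduct.mapBilinear (RingHom.id k) B B (B ⊗[k] V) (B ⊗[k] V))
      (TensorProduct.map (swap p) (swap p) t) β =
      F β (((((TensorProduct.assoc k V V V).symm.toLinearMap.rTensor V) ∘ₗ
        (TensorProduct.assoc k V (V ⊗[k] V) V).symm.toLinearMap ∘ₗ
          (TensorProduct.assoc k V V V).symm.toLinearMap.lTensor V).lTensor V).lTensor V
        ((TensorProduct.assoc k V V (V ⊗[k] (V ⊗[k] (V ⊗[k] V)))
          ((TensorProduct.assoc k (V ⊗[k] V) V (V ⊗[k] (V ⊗[k] V))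
            ((TensorProduct.assoc k V V V).symm.toLinearMap.rTensor _
              (TensorProduct.map (comul3 k V) (comul3 k V) t)))))) ) := by
    intro t β
    induction t using TensorProduct.induction_on with
    | zero => simp
    | add u v hu hv => simp only [LinearMap.map_add, LinearEquiv.map_add, LinearMap.add_apply, hu, hv]
    | tmul h h' =>
    induction β using TensorProduct.induction_on with
    | zero => simp [hF0']
    | add u v hu hv => simp only [LinearMap.map_add, LinearEquiv.map_add, hFadd, LinearMap.add_apply, hu, hv]
    | tmul b c =>
    have e0 : TensorProduct.lift
      (TensorProduct.mapBilinear (RingHom.id k) B B (B ⊗[k] V) (B ⊗[k] V))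
      (TensorProduct.map (swap p) (swap p) (h ⊗ₜ h')) (b ⊗ₜ c) =
        (act3 p (comul3 k V h) (b ⊗ₜ 1)) ⊗ₜ (act3 p (comul3 k V h') (c ⊗ₜ 1)) := rfl
    rw [e0, TensorProduct.map_tmul]
    induction comul3 k V h using TensorProduct.induction_on with
    | zero => simp
    | add u v hu hv => simp only [LinearMap.map_add, LinearEquiv.map_add, TensorProduct.add_tmul, LinearMap.add_apply, hu, hv]
    | tmul x s =>
    induction s using TensorProduct.induction_on with
    | zero => simp
    | add u v hu hv => simp only [TensorProduct.tmul_add, LinearMap.map_add, LinearEquiv.map_add, TensorProduct.add_tmul,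
        LinearMap.add_apply, hu, hv]
    | tmul y z =>
    induction comul3 k V h' using TensorProduct.induction_on with
    | zero => simp
    | add u v hu hv => simp only [LinearMap.map_add, LinearEquiv.map_add, TensorProduct.tmul_add, LinearMap.add_apply, hu, hv]
    | tmul x' s =>
    induction s using TensorProduct.induction_on with
    | zero => simp
    | add u v hu hv => simp only [TensorProduct.tmul_add, LinearMap.map_add, LinearEquiv.map_add,
        LinearMap.add_apply, hu, hv]
    | tmul y' z' =>
    rw [act3_tmul, act3_tmul, mul_one, mul_one]
    simp only [LinearMap.rTensor_tmul, LinearEquiv.coe_coe, TensorProduct.assoc_symm_tmul,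
      TensorProduct.assoc_tmul, LinearMap.lTensor_tmul, LinearMap.comp_apply, hF, actRL_tmul,
      actLRB_tmul, TensorProduct.tensorTensorTensorComm_tmul]
    have e3 : actL p x' (actR p z' c) = actR p z' (actL p x' c) :=
      LinearMap.congr_fun (actL_actR (p := p) x' z') c
    rw [e3]
  have e : ((((TensorProduct.assoc k V V V).symm.toLinearMap.rTensor V) ∘ₗ
        (TensorProduct.assoc k V (V ⊗[k] V) V).symm.toLinearMap ∘ₗ
          (TensorProduct.assoc k V V V).symm.toLinearMap.lTensor V).lTensor V).lTensor V ∘ₗ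
      (TensorProduct.assoc k V V (V ⊗[k] (V ⊗[k] (V ⊗[k] V)))).toLinearMap ∘ₗ
      (TensorProduct.assoc k (V ⊗[k] V) V (V ⊗[k] (V ⊗[k] V))).toLinearMap ∘ₗ
      (TensorProduct.assoc k V V V).symm.toLinearMap.rTensor _ ∘ₗ
      TensorProduct.map (comul3 k V) (comul3 k V) ∘ₗ comul =
      ((((comul (R := k)).rTensor V ∘ₗ comul (R := k)).rTensor V).lTensor V).lTensor V ∘ₗ
        (comul3 k V).lTensor V ∘ₗ comul := by
    simp only [comul3, coassoc_simps]
  have e' : (TensorProduct.assoc k V V V).toLinearMap.lTensor V ∘ₗ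
      ((comul (R := k)).rTensor V).lTensor V ∘ₗ comul3 k V =
      (comul3 k V).lTensor V ∘ₗ comul := by
    simp only [comul3, coassoc_simps]
  have hC : ∀ s, F (comul b) (((((comul (R := k)).rTensor V ∘ₗ
      comul (R := k)).rTensor V).lTensor V).lTensor V s) = F0 (comul b) s := by
    intro s
    induction s using TensorProduct.induction_on with
    | zero => simp
    | add u v hu hv => simp only [LinearMap.map_add, LinearEquiv.map_add, hu, hv]
    | tmul x s =>
    induction s using TensorProduct.induction_on with
    | zero => simp
    | add u v hu hv => simp only [TensorProduct.tmul_add, LinearMap.map_add, LinearEquiv.map_add, hu, hv]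
    | tmul y1 s =>
    induction s using TensorProduct.induction_on with
    | zero => simp
    | add u v hu hv => simp only [TensorProduct.tmul_add, LinearMap.map_add, LinearEquiv.map_add, hu, hv]
    | tmul y z =>
    have c1 : y = TensorProduct.lid k V ((counit (R := k)).rTensor V (comul (R := k) y)) := by
      rw [Coalgebra.rTensor_counit_comul]; simp
    have c2 : ∀ t : V ⊗[k] V, F (comul b) (x ⊗ₜ (y1 ⊗ₜ ((comul (R := k)).rTensor V t ⊗ₜ z))) =
        F0 (comul b) (x ⊗ₜ (y1 ⊗ₜ
          (TensorProduct.lid k V ((counit (R := k)).rTensor V t) ⊗ₜ z))) := by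
      intro t
      induction t using TensorProduct.induction_on with
      | zero => simp
      | add u v hu hv => simp only [TensorProduct.tmul_add, TensorProduct.add_tmul, LinearMap.map_add, LinearEquiv.map_add, hu, hv]
      | tmul m y =>
      simp only [LinearMap.rTensor_tmul, hF, hp.actRL_comul, TensorProduct.lid_tmul, hF0,
        map_smul, TensorProduct.tmul_smul, TensorProduct.smul_tmul']
      simp only [← TensorProduct.tmul_smul, ← TensorProduct.smul_tmul']
    simp only [LinearMap.lTensor_tmul, LinearMap.rTensor_tmul, LinearMap.comp_apply]
    rw [c2, ← c1]
  rw [hL, hR]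
  refine (congrArg (F0 (comul b)) (LinearMap.congr_fun e' h)).trans ?_
  refine (hC _).symm.trans ?_
  exact (congrArg (F (comul b)) (LinearMap.congr_fun e h)).symm

theorem counit_swap (hp : IsSkewPairing p) (h : V) (b : B) :
    LinearMap.mul' k k (TensorProduct.map (counit (R := k)) (counit (R := k)) (swap p h b)) =
      counit (R := k) h * counit (R := k) b := by
  have h1 : ∀ s : V ⊗[k] (V ⊗[k] V), LinearMap.mul' k k (TensorProduct.map (counit (R := k))
      (counit (R := k)) (act3 p s (b ⊗ₜ 1))) =
      TensorProduct.lift (p ∘ₗ lamR p (comul b)).flip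
        (((TensorProduct.lid k V).toLinearMap ∘ₗ (counit (R := k)).rTensor V).lTensor V s) := by
    intro s
    induction s using TensorProduct.induction_on with
    | zero => simp
    | add u v hu hv => simp only [LinearMap.map_add, LinearEquiv.map_add, LinearMap.add_apply, hu, hv]
    | tmul x s =>
    induction s using TensorProduct.induction_on with
    | zero => simp
    | add u v hu hv => simp only [TensorProduct.tmul_add, LinearMap.map_add, LinearEquiv.map_add, LinearMap.add_apply, hu, hv]
    | tmul y z =>
    have e : counit (R := k) (actL p x (actR p z b)) = p (actR p z b) x := counit_hitL _ _
    rw [act3_tmul, mul_one, TensorProduct.map_tmul, e, ← actR_flip]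
    simp [mul_comm]
  have h2 : ∀ β : B ⊗[k] B, TensorProduct.lift (p ∘ₗ lamR p β).flip (comul (R := k) h) =
      p (LinearMap.mul' k B ((antipode k).lTensor B β)) h := by
    intro β
    induction β using TensorProduct.induction_on with
    | zero =>
      simp only [map_zero, LinearMap.zero_apply]
      induction comul (R := k) h using TensorProduct.induction_on with
      | zero => simp
      | add u v hu hv => simp only [LinearMap.map_add, LinearEquiv.map_add, hu, hv, add_zero]
      | tmul x z => simp
    | add u v hu hv =>
      simp only [LinearMap.map_add, LinearEquiv.map_add, LinearMap.add_apply, ← hu, ← hv]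
      induction comul (R := k) h using TensorProduct.induction_on with
      | zero => simp
      | add u v hu hv => simp only [LinearMap.map_add, LinearEquiv.map_add, hu, hv]; abel
      | tmul x z => simp
    | tmul c d =>
      rw [LinearMap.lTensor_tmul, LinearMap.mul'_apply, hp.mul_left]
      induction comul (R := k) h using TensorProduct.induction_on with
      | zero => simp
      | add u v hu hv => simp only [LinearMap.map_add, LinearEquiv.map_add, hu, hv]
      | tmul x z => simp [lamR, mul_comm]
  have h4 : ((TensorProduct.lid k V).toLinearMap ∘ₗ (counit (R := k)).rTensor V).lTensor V
      (comul3 k V h) = comul (R := k) h := by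
    rw [comul3, LinearMap.comp_apply, ← LinearMap.comp_apply, ← LinearMap.lTensor_comp,
      LinearMap.comp_assoc, Coalgebra.rTensor_counit_comp_comul]
    have : (TensorProduct.lid k V).toLinearMap ∘ₗ TensorProduct.mk k k V 1 = LinearMap.id := by
      ext; simp
    rw [this]; simp
  rw [swap_apply, h1, h4, h2, HopfAlgebra.mul_antipode_lTensor_comul_apply,
    Algebra.algebraMap_eq_smul_one, map_smul, LinearMap.smul_apply, hp.one_left, smul_eq_mul,
    mul_comm]

end IsSkewPairing
end Double

section GenDouble

variable {k B V : Type*} [Field k] [Ring B] [HopfAlgebra k B] [Ring V] [HopfAlgebra k V]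
variable {p : B →ₗ[k] V →ₗ[k] k}

/-- The generalized quantum double `D(B, V)` of a skew pairing `p` on `B ⊗ V`: the tensor product
coalgebra `B ⊗ V`, with unit `1 ⊗ 1`, product
`(b ⊗ h)(b' ⊗ h') = p(b'₁, h₁) p(S(b'₃), h₃) b b'₂ ⊗ h₂ h'` and antipode
`S(b ⊗ h) = (1 ⊗ S(h))(S(b) ⊗ 1)`. -/
def GenDouble (_hp : IsSkewPairing p) : Type _ := B ⊗[k] V

namespace GenDouble

instance (hp : IsSkewPairing p) : AddCommGroup (GenDouble hp) :=
  (TensorProduct.addCommGroup : AddCommGroup (B ⊗[k] V))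

instance (hp : IsSkewPairing p) : Ring (GenDouble hp) :=
  { (inferInstance : AddCommGroup (GenDouble hp)) with
    mul := fun s t => doubleMul p s t
    one := (1 : B) ⊗ₜ[k] (1 : V)
    left_distrib := fun s t w => map_add (doubleMul p s) t w
    right_distrib := fun s t w => LinearMap.congr_fun (map_add (doubleMul p) s t) w
    zero_mul := fun s => LinearMap.congr_fun (map_zero (doubleMul p)) s
    mul_zero := fun s => map_zero (doubleMul p s)
    mul_assoc := hp.doubleMul_assoc
    one_mul := hp.one_doubleMul
    mul_one := hp.doubleMul_one }

instance (hp : IsSkewPairing p) : Module k (GenDouble hp) :=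
  inferInstanceAs (Module k (B ⊗[k] V))

instance (hp : IsSkewPairing p) : Algebra k (GenDouble hp) :=
  Algebra.ofModule
    (fun r s t => LinearMap.congr_fun (map_smul (doubleMul p) r s) t)
    (fun r s t => map_smul (doubleMul p s) r t)

instance (hp : IsSkewPairing p) : Coalgebra k (GenDouble hp) :=
  inferInstanceAs (Coalgebra k (B ⊗[k] V))

/-- The element `b ⊗ h` of the double. -/
def tmul (hp : IsSkewPairing p) : B →ₗ[k] V →ₗ[k] GenDouble hp := TensorProduct.mk k B V

variable (hp : IsSkewPairing p)

theorem induction_on {P : GenDouble hp → Prop} (w : GenDouble hp) (zero : P 0)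
    (tm : ∀ b h, P (tmul hp b h)) (add : ∀ s t, P s → P t → P (s + t)) : P w :=
  TensorProduct.induction_on (motive := P) w zero tm add

/-- The map `B → D(B, V)`, `b ↦ b ⊗ 1`. -/
def inl : B →ₗ[k] GenDouble hp := (tmul hp).flip 1

/-- The map `V → D(B, V)`, `h ↦ 1 ⊗ h`. -/
def inr : V →ₗ[k] GenDouble hp := tmul hp 1

theorem tmul_mul (b : B) (h : V) (w : GenDouble hp) : tmul hp b h * w =
    (LinearMap.mulLeft k b).rTensor V (act3 p (comul3 k V h) w) := rfl

theorem inl_mul_tmul (b c : B) (h : V) : inl hp b * tmul hp c h = tmul hp (b * c) h := by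
  have e : act3 p (comul3 k V 1) = 1 := by rw [IsSkewPairing.comul3_one, hp.act3_one]
  refine (tmul_mul hp b 1 _).trans ?_
  rw [e]; rfl

theorem tmul_mul_inr (b : B) (h v : V) : tmul hp b h * inr hp v = tmul hp b (h * v) := by
  refine (tmul_mul hp b h _).trans ?_
  refine (congrArg _ (hp.act3_comul3_one h v)).trans ?_
  exact congrArg (fun c => c ⊗ₜ[k] (h * v)) (mul_one b)

theorem inl_mul_inr (b : B) (h : V) : inl hp b * inr hp h = tmul hp b h :=
  (tmul_mul_inr hp b 1 h).trans (by rw [one_mul])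

theorem inr_mul_inl (b : B) (h : V) : inr hp h * inl hp b = IsSkewPairing.swap p h b := by
  refine (tmul_mul hp 1 h _).trans ?_
  rw [LinearMap.mulLeft_one]
  exact LinearMap.rTensor_id_apply _ _ _

theorem inl_mul (b c : B) : inl hp (b * c) = inl hp b * inl hp c := (inl_mul_tmul hp b c 1).symm

theorem inr_mul (h v : V) : inr hp (h * v) = inr hp h * inr hp v := (tmul_mul_inr hp 1 h v).symm

theorem comul_tmul (b : B) (h : V) : comul (R := k) (tmul hp b h) =
    TensorProduct.map (TensorProduct.lift (tmul hp)) (TensorProduct.lift (tmul hp))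
      (TensorProduct.tensorTensorTensorComm k B B V V
        (comul (R := k) b ⊗ₜ comul (R := k) h)) := by
  have e : TensorProduct.lift (tmul hp) = (LinearMap.id : B ⊗[k] V →ₗ[k] B ⊗[k] V) :=
    TensorProduct.lift_mk
  refine Eq.trans ?_ (congrArg (fun f : B ⊗[k] V →ₗ[k] B ⊗[k] V => TensorProduct.map f f
    (TensorProduct.tensorTensorTensorComm k B B V V
      (comul (R := k) b ⊗ₜ comul (R := k) h))) e).symm
  rw [TensorProduct.map_id]
  rfl

theorem counit_tmul (b : B) (h : V) : counit (R := k) (tmul hp b h) =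
    counit (R := k) b * counit (R := k) h :=
  (TensorProduct.counit_tmul (R := k) (S := k) b h).trans (mul_comm _ _)

theorem comul_inl (b : B) : comul (R := k) (inl hp b) =
    TensorProduct.map (inl hp) (inl hp) (comul (R := k) b) := by
  refine (comul_tmul hp b 1).trans ?_
  rw [Bialgebra.comul_one, Algebra.TensorProduct.one_def]
  induction comul (R := k) b using TensorProduct.induction_on with
  | zero => simp
  | add u v hu hv => simp only [TensorProduct.add_tmul, LinearMap.map_add, LinearEquiv.map_add, hu, hv]
  | tmul u v => simp [inl]

theorem comul_inr (h : V) : comul (R := k) (inr hp h) =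
    TensorProduct.map (inr hp) (inr hp) (comul (R := k) h) := by
  refine (comul_tmul hp 1 h).trans ?_
  rw [Bialgebra.comul_one, Algebra.TensorProduct.one_def]
  induction comul (R := k) h using TensorProduct.induction_on with
  | zero => simp
  | add u v hu hv => simp only [TensorProduct.tmul_add, LinearMap.map_add, LinearEquiv.map_add, hu, hv]
  | tmul u v => simp [inr]

theorem comul_inl_mul (b : B) (w : GenDouble hp) :
    comul (R := k) (inl hp b * w) = comul (R := k) (inl hp b) * comul (R := k) w := by
  induction w using induction_on hp with
  | zero => simp
  | add s t hs ht => simp only [mul_add, LinearMap.map_add, LinearEquiv.map_add, hs, ht]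
  | tm c h =>
  rw [inl_mul_tmul, comul_tmul, comul_inl, comul_tmul, Bialgebra.comul_mul]
  induction comul (R := k) b using TensorProduct.induction_on with
  | zero => simp
  | add s t hs ht => simp only [TensorProduct.add_tmul, add_mul, LinearMap.map_add, LinearEquiv.map_add, hs, ht]
  | tmul b1 b2 =>
  induction comul (R := k) c using TensorProduct.induction_on with
  | zero => simp
  | add s t hs ht => simp only [TensorProduct.add_tmul, mul_add, LinearMap.map_add, LinearEquiv.map_add, hs, ht]
  | tmul c1 c2 =>
  induction comul (R := k) h using TensorProduct.induction_on with
  | zero => simp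
  | add s t hs ht => simp only [TensorProduct.tmul_add, mul_add, LinearMap.map_add, LinearEquiv.map_add, hs, ht]
  | tmul h1 h2 =>
  simp only [Algebra.TensorProduct.tmul_mul_tmul, TensorProduct.tensorTensorTensorComm_tmul,
    TensorProduct.map_tmul, TensorProduct.lift.tmul, inl_mul_tmul]

theorem comul_mul_inr (w : GenDouble hp) (v : V) :
    comul (R := k) (w * inr hp v) = comul (R := k) w * comul (R := k) (inr hp v) := by
  induction w using induction_on hp with
  | zero => simp
  | add s t hs ht => simp only [add_mul, LinearMap.map_add, LinearEquiv.map_add, hs, ht]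
  | tm c h =>
  rw [tmul_mul_inr, comul_tmul, comul_inr, comul_tmul, Bialgebra.comul_mul]
  induction comul (R := k) v using TensorProduct.induction_on with
  | zero => simp
  | add s t hs ht => simp only [TensorProduct.tmul_add, mul_add, LinearMap.map_add, LinearEquiv.map_add, hs, ht]
  | tmul b1 b2 =>
  induction comul (R := k) c using TensorProduct.induction_on with
  | zero => simp
  | add s t hs ht => simp only [TensorProduct.add_tmul, add_mul, LinearMap.map_add, LinearEquiv.map_add, hs, ht]
  | tmul c1 c2 =>
  induction comul (R := k) h using TensorProduct.induction_on with
  | zero => simp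
  | add s t hs ht => simp only [TensorProduct.tmul_add, add_mul, LinearMap.map_add, LinearEquiv.map_add, hs, ht]
  | tmul h1 h2 =>
  simp only [Algebra.TensorProduct.tmul_mul_tmul, TensorProduct.tensorTensorTensorComm_tmul,
    TensorProduct.map_tmul, TensorProduct.lift.tmul, tmul_mul_inr]

theorem comul_inr_mul_inl (h : V) (b : B) : comul (R := k) (inr hp h * inl hp b) =
    comul (R := k) (inr hp h) * comul (R := k) (inl hp b) := by
  rw [inr_mul_inl]
  refine (hp.comul_swap h b).trans ?_
  rw [comul_inr, comul_inl]
  induction comul (R := k) h using TensorProduct.induction_on with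
  | zero => simp; rfl
  | add s t hs ht => simp only [add_mul, LinearMap.map_add, LinearEquiv.map_add, LinearMap.add_apply, hs, ht]; rfl
  | tmul h1 h2 =>
  induction comul (R := k) b using TensorProduct.induction_on with
  | zero => simp; rfl
  | add s t hs ht => simp only [mul_add, LinearMap.map_add, LinearEquiv.map_add, hs, ht]; rfl
  | tmul b1 b2 =>
  simp only [TensorProduct.map_tmul, Algebra.TensorProduct.tmul_mul_tmul, inr_mul_inl]
  rfl

theorem comul_mul (s t : GenDouble hp) :
    comul (R := k) (s * t) = comul (R := k) s * comul (R := k) t := by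
  induction s using induction_on hp with
  | zero => simp
  | add s t hs ht => simp only [add_mul, LinearMap.map_add, LinearEquiv.map_add, hs, ht]
  | tm b h =>
  induction t using induction_on hp with
  | zero => simp
  | add s t hs ht => simp only [mul_add, LinearMap.map_add, LinearEquiv.map_add, hs, ht]
  | tm c v =>
  rw [← inl_mul_inr hp b h, ← inl_mul_inr hp c v, mul_assoc, ← mul_assoc (inr hp h),
    comul_inl_mul, comul_mul_inr, comul_inr_mul_inl, comul_inl_mul, comul_inl_mul]
  simp only [mul_assoc]

theorem counit_inl_mul (b : B) (w : GenDouble hp) :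
    counit (R := k) (inl hp b * w) = counit (R := k) b * counit (R := k) w := by
  induction w using induction_on hp with
  | zero => simp
  | add s t hs ht => simp only [mul_add, LinearMap.map_add, LinearEquiv.map_add, hs, ht]
  | tm c h => rw [inl_mul_tmul, counit_tmul, counit_tmul, Bialgebra.counit_mul, mul_assoc]

theorem counit_mul_inr (w : GenDouble hp) (v : V) :
    counit (R := k) (w * inr hp v) = counit (R := k) w * counit (R := k) v := by
  induction w using induction_on hp with
  | zero => simp
  | add s t hs ht => simp only [add_mul, LinearMap.map_add, LinearEquiv.map_add, hs, ht]
  | tm c h => rw [tmul_mul_inr, counit_tmul, counit_tmul, Bialgebra.counit_mul, mul_assoc]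

theorem counit_inr_mul_inl (h : V) (b : B) : counit (R := k) (inr hp h * inl hp b) =
    counit (R := k) h * counit (R := k) b := by
  rw [inr_mul_inl]
  refine Eq.trans ?_ (hp.counit_swap h b)
  induction IsSkewPairing.swap p h b using TensorProduct.induction_on with
  | zero => exact (map_zero _).trans (by simp)
  | add s t hs ht =>
    refine (map_add (counit (R := k) (A := GenDouble hp)) s t).trans ?_
    simp only [LinearMap.map_add, LinearEquiv.map_add]
    exact congrArg₂ _ hs ht
  | tmul c v => exact counit_tmul hp c v

theorem counit_mul (s t : GenDouble hp) :
    counit (R := k) (s * t) = counit (R := k) s * counit (R := k) t := by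
  induction s using induction_on hp with
  | zero => simp
  | add s t hs ht => simp only [add_mul, LinearMap.map_add, LinearEquiv.map_add, hs, ht]
  | tm b h =>
  induction t using induction_on hp with
  | zero => simp
  | add s t hs ht => simp only [mul_add, LinearMap.map_add, LinearEquiv.map_add, hs, ht]
  | tm c v =>
  rw [← inl_mul_inr hp b h, ← inl_mul_inr hp c v, mul_assoc, ← mul_assoc (inr hp h),
    counit_inl_mul, counit_mul_inr, counit_inr_mul_inl, inl_mul_inr, inl_mul_inr, counit_tmul,
    counit_tmul]
  ring

theorem one_eq : (1 : GenDouble hp) = tmul hp 1 1 := rfl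

instance : Bialgebra k (GenDouble hp) :=
  Bialgebra.mk' k (GenDouble hp)
    (by rw [one_eq, counit_tmul, Bialgebra.counit_one, Bialgebra.counit_one, one_mul])
    (fun {a b} => counit_mul hp a b)
    (by
      rw [one_eq, comul_tmul, Bialgebra.comul_one, Bialgebra.comul_one,
        Algebra.TensorProduct.one_def, Algebra.TensorProduct.one_def]
      rfl)
    (fun {a b} => comul_mul hp a b)

/-- `S(b ⊗ h) = (1 ⊗ S(h))(S(b) ⊗ 1)`. -/
def antipodeAux : GenDouble hp →ₗ[k] GenDouble hp :=
  TensorProduct.lift (((LinearMap.mul k (GenDouble hp)).compl₁₂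
    (inr hp ∘ₗ antipode k) (inl hp ∘ₗ antipode k)).flip)

theorem antipodeAux_tmul (b : B) (h : V) : antipodeAux hp (tmul hp b h) =
    inr hp (antipode k h) * inl hp (antipode k b) := rfl

theorem inl_algebraMap (r : k) : inl hp (algebraMap k B r) = algebraMap k (GenDouble hp) r := by
  rw [Algebra.algebraMap_eq_smul_one, map_smul, Algebra.algebraMap_eq_smul_one]; rfl

theorem inr_algebraMap (r : k) : inr hp (algebraMap k V r) = algebraMap k (GenDouble hp) r := by
  rw [Algebra.algebraMap_eq_smul_one, map_smul, Algebra.algebraMap_eq_smul_one]; rfl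

theorem antipode_left (b : B) (h : V) : LinearMap.mul' k (GenDouble hp)
    ((antipodeAux hp).rTensor (GenDouble hp) (comul (R := k) (tmul hp b h))) =
      algebraMap k (GenDouble hp) (counit (R := k) (tmul hp b h)) := by
  rw [comul_tmul, counit_tmul]
  have e : ∀ (s : B ⊗[k] B) (t : V ⊗[k] V), LinearMap.mul' k (GenDouble hp)
      ((antipodeAux hp).rTensor (GenDouble hp)
        (TensorProduct.map (TensorProduct.lift (tmul hp)) (TensorProduct.lift (tmul hp))
          (TensorProduct.tensorTensorTensorComm k B B V V (s ⊗ₜ t)))) =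
      LinearMap.mul' k (GenDouble hp) (TensorProduct.map (inr hp ∘ₗ antipode k)
        (LinearMap.mulLeft k (inl hp (LinearMap.mul' k B ((antipode k).rTensor B s))) ∘ₗ inr hp)
          t) := by
    intro s t
    induction s using TensorProduct.induction_on with
    | zero => simp
    | add u v hu hv =>
      rw [TensorProduct.add_tmul]
      simp only [LinearMap.map_add, LinearEquiv.map_add, hu, hv]
      rw [← map_add, ← LinearMap.add_apply, ← TensorProduct.map_add_right]
      congr 3
    | tmul b1 b2 =>
    induction t using TensorProduct.induction_on with
    | zero => simp
    | add u v hu hv => simp only [TensorProduct.tmul_add, LinearMap.map_add, LinearEquiv.map_add, hu, hv]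
    | tmul h1 h2 =>
    simp only [TensorProduct.tensorTensorTensorComm_tmul, TensorProduct.map_tmul,
      TensorProduct.lift.tmul, LinearMap.rTensor_tmul, LinearMap.mul'_apply, antipodeAux_tmul,
      LinearMap.comp_apply, LinearMap.mulLeft_apply, inl_mul, ← inl_mul_inr hp b2 h2, mul_assoc]
  rw [e, HopfAlgebra.mul_antipode_rTensor_comul_apply, inl_algebraMap]
  have e2 : ∀ t : V ⊗[k] V, LinearMap.mul' k (GenDouble hp) (TensorProduct.map
      (inr hp ∘ₗ antipode k) (LinearMap.mulLeft k (algebraMap k (GenDouble hp)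
        (counit (R := k) b)) ∘ₗ inr hp) t) = algebraMap k (GenDouble hp) (counit (R := k) b) *
          inr hp (LinearMap.mul' k V ((antipode k).rTensor V t)) := by
    intro t
    induction t using TensorProduct.induction_on with
    | zero => simp
    | add u v hu hv => simp only [LinearMap.map_add, LinearEquiv.map_add, mul_add, hu, hv]
    | tmul x y =>
      simp only [TensorProduct.map_tmul, LinearMap.mul'_apply, LinearMap.comp_apply,
        LinearMap.mulLeft_apply, LinearMap.rTensor_tmul, inr_mul]
      rw [Algebra.left_comm]
  rw [e2, HopfAlgebra.mul_antipode_rTensor_comul_apply, inr_algebraMap, map_mul]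

theorem antipode_right (b : B) (h : V) : LinearMap.mul' k (GenDouble hp)
    ((antipodeAux hp).lTensor (GenDouble hp) (comul (R := k) (tmul hp b h))) =
      algebraMap k (GenDouble hp) (counit (R := k) (tmul hp b h)) := by
  rw [comul_tmul, counit_tmul]
  have e : ∀ (s : B ⊗[k] B) (t : V ⊗[k] V), LinearMap.mul' k (GenDouble hp)
      ((antipodeAux hp).lTensor (GenDouble hp)
        (TensorProduct.map (TensorProduct.lift (tmul hp)) (TensorProduct.lift (tmul hp))
          (TensorProduct.tensorTensorTensorComm k B B V V (s ⊗ₜ t)))) =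
      LinearMap.mul' k (GenDouble hp) (TensorProduct.map (inl hp)
        (LinearMap.mulLeft k (inr hp (LinearMap.mul' k V ((antipode k).lTensor V t))) ∘ₗ
          inl hp ∘ₗ antipode k) s) := by
    intro s t
    induction t using TensorProduct.induction_on with
    | zero => simp
    | add u v hu hv =>
      rw [TensorProduct.tmul_add]
      simp only [LinearMap.map_add, LinearEquiv.map_add, hu, hv]
      rw [← map_add, ← LinearMap.add_apply, ← TensorProduct.map_add_right]
      congr 3
    | tmul h1 h2 =>
    induction s using TensorProduct.induction_on with
    | zero => simp
    | add u v hu hv => simp only [TensorProduct.add_tmul, LinearMap.map_add, LinearEquiv.map_add, hu, hv]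
    | tmul b1 b2 =>
    simp only [TensorProduct.tensorTensorTensorComm_tmul, TensorProduct.map_tmul,
      TensorProduct.lift.tmul, LinearMap.lTensor_tmul, LinearMap.mul'_apply, antipodeAux_tmul,
      LinearMap.comp_apply, LinearMap.mulLeft_apply, inr_mul, ← inl_mul_inr hp b1 h1, mul_assoc]
  rw [e, HopfAlgebra.mul_antipode_lTensor_comul_apply, inr_algebraMap]
  have e2 : ∀ t : B ⊗[k] B, LinearMap.mul' k (GenDouble hp) (TensorProduct.map
      (inl hp) (LinearMap.mulLeft k (algebraMap k (GenDouble hp)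
        (counit (R := k) h)) ∘ₗ inl hp ∘ₗ antipode k) t) =
        inl hp (LinearMap.mul' k B ((antipode k).lTensor B t)) *
          algebraMap k (GenDouble hp) (counit (R := k) h) := by
    intro t
    induction t using TensorProduct.induction_on with
    | zero => simp
    | add u v hu hv => simp only [LinearMap.map_add, LinearEquiv.map_add, add_mul, hu, hv]
    | tmul x y =>
      simp only [TensorProduct.map_tmul, LinearMap.mul'_apply, LinearMap.comp_apply,
        LinearMap.mulLeft_apply, LinearMap.lTensor_tmul, inl_mul]
      rw [mul_assoc, Algebra.commutes]
  rw [e2, HopfAlgebra.mul_antipode_lTensor_comul_apply, inl_algebraMap, map_mul]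

instance : HopfAlgebra k (GenDouble hp) where
  antipode := antipodeAux hp
  mul_antipode_rTensor_comul := by
    refine LinearMap.ext fun w => ?_
    induction w using induction_on hp with
    | zero => simp
    | add s t hs ht => rw [map_add, hs, ht, map_add]
    | tm b h => exact antipode_left hp b h
  mul_antipode_lTensor_comul := by
    refine LinearMap.ext fun w => ?_
    induction w using induction_on hp with
    | zero => simp
    | add s t hs ht => rw [map_add, hs, ht, map_add]
    | tm b h => exact antipode_right hp b h

end GenDouble
end GenDouble

section Evaluation

variable {k H : Type*} [Field k] [Ring H] [HopfAlgebra k H]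

/-- The evaluation pairing `⟨f, x⟩ = f(x)` on `K^cop ⊗ X`, for sub-Hopf algebras `K ⊆ H⁰` and
`X ⊆ H`. -/
def evalPairing (K : SubHopfAlgebra k (FiniteDual k H)) (X : SubHopfAlgebra k H) :
    Cop k K →ₗ[k] X →ₗ[k] k :=
  LinearMap.compl₁₂ (FiniteDual.ev k H) (K.incl ∘ₗ (Cop.of k K).symm.toLinearMap) X.incl

theorem evalPairing_of (K : SubHopfAlgebra k (FiniteDual k H)) (X : SubHopfAlgebra k H) (f : K)
    (x : X) : evalPairing K X (Cop.of k K f) x = FiniteDual.ev k H f x := rfl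

theorem isSkewPairing_evalPairing (K : SubHopfAlgebra k (FiniteDual k H))
    (X : SubHopfAlgebra k H) [BijectiveAntipode k K] : IsSkewPairing (evalPairing K X) where
  mul_left b b' h := by
    have h1 := FiniteDual.ev_mul k H (K.incl b) (K.incl b') (h : H)
    rw [← X.map_incl_comul] at h1
    refine h1.trans ?_
    induction comul (R := k) h using TensorProduct.induction_on with
    | zero => simp
    | add u v hu hv => simp only [LinearMap.map_add, LinearEquiv.map_add, hu, hv]
    | tmul u v => rfl
  mul_right b h h' := by
    have h1 := FiniteDual.ev2_comul k H (K.incl b) (h : H) (h' : H)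
    refine h1.symm.trans ?_
    have h2 := K.map_incl_comul b
    have h3 : ∀ t : K ⊗[k] K, FiniteDual.ev2 k H (TensorProduct.map K.incl K.incl t)
        ((h : H) ⊗ₜ (h' : H)) = LinearMap.mul' k k (TensorProduct.map
          ((evalPairing K X).flip h' ∘ₗ (Cop.of k K).toLinearMap)
          ((evalPairing K X).flip h ∘ₗ (Cop.of k K).toLinearMap)
            (TensorProduct.comm k K K t)) := by
      intro t
      induction t using TensorProduct.induction_on with
      | zero => simp
      | add u v hu hv => simp only [LinearMap.map_add, LinearEquiv.map_add, LinearMap.add_apply, hu, hv]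
      | tmul u v =>
        rw [TensorProduct.comm_tmul, TensorProduct.map_tmul, TensorProduct.map_tmul,
          FiniteDual.ev2_tmul, mul_comm]
        rfl
    refine (congrArg (fun t => FiniteDual.ev2 k H t ((h : H) ⊗ₜ (h' : H))) h2.symm).trans ?_
    exact h3 _
  one_left h := rfl
  one_right b := rfl

end Evaluation

section Coquasitriangular

variable {k H : Type*} [Field k] [Ring H] [HopfAlgebra k H]

/-- `σ` is a coquasitriangular structure on `H`: a convolution invertible skew pairing
`σ : H ⊗ H → k` with `σ(h₁, g₁) h₂ g₂ = g₁ h₁ σ(h₂, g₂)`. -/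
structure IsCoquasitriangular (σ : H →ₗ[k] H →ₗ[k] k) : Prop extends IsSkewPairing σ where
  isUnit : IsUnit (WithConv.toConv (TensorProduct.lift σ) : WithConv (H ⊗[k] H →ₗ[k] k))
  comm : ∀ h g : H,
    TensorProduct.lid k H (TensorProduct.map (TensorProduct.lift σ) (LinearMap.mul' k H)
      (comul (R := k) (h ⊗ₜ[k] g))) =
    TensorProduct.rid k H (TensorProduct.map
      (LinearMap.mul' k H ∘ₗ (TensorProduct.comm k H H).toLinearMap) (TensorProduct.lift σ)
      (comul (R := k) (h ⊗ₜ[k] g)))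

/-- `H_{l_X} = {l_x = σ(-, x) | x ∈ X}`, as a subspace of the convolution algebra `H^*`. -/
def leftFunctionals (σ : H →ₗ[k] H →ₗ[k] k) (X : SubHopfAlgebra k H) :
    Submodule k (WithConv (H →ₗ[k] k)) :=
  LinearMap.range ((WithConv.linearEquiv k (H →ₗ[k] k)).symm.toLinearMap ∘ₗ σ.flip ∘ₗ X.incl)

/-- `H_{r_A} = {r_a = σ(a, -) | a ∈ A}`, as a subspace of the convolution algebra `H^*`. -/
def rightFunctionals (σ : H →ₗ[k] H →ₗ[k] k) (A : SubHopfAlgebra k H) :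
    Submodule k (WithConv (H →ₗ[k] k)) :=
  LinearMap.range ((WithConv.linearEquiv k (H →ₗ[k] k)).symm.toLinearMap ∘ₗ σ ∘ₗ A.incl)

/-- A sub-Hopf algebra of `H⁰`, as a subspace of the convolution algebra `H^*`. -/
def SubHopfAlgebra.functionals (K : SubHopfAlgebra k (FiniteDual k H)) :
    Submodule k (WithConv (H →ₗ[k] k)) :=
  LinearMap.range ((finiteDualSubalgebra k H).val.toLinearMap ∘ₗ K.incl)

end Coquasitriangular

section YetterDrinfeld

/-- A candidate for a left-left Yetter–Drinfeld module over `K`: a vector space with an action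
`κ ⊗ m ↦ κ · m` and a coaction `m ↦ m₋₁ ⊗ m₀` of `K`. -/
structure ModComod (k K M : Type*) [Field k] [Ring K] [HopfAlgebra k K] [AddCommGroup M]
    [Module k M] where
  act : K →ₗ[k] M →ₗ[k] M
  coact : M →ₗ[k] K ⊗[k] M

namespace ModComod

variable {k K M N : Type*} [Field k] [Ring K] [HopfAlgebra k K] [AddCommGroup M] [Module k M]
  [AddCommGroup N] [Module k N]

/-- `M` is a left-left Yetter–Drinfeld module: a left module and a left comodule with
`κ₁ m₋₁ ⊗ κ₂ · m₀ = (κ₁ · m)₋₁ κ₂ ⊗ (κ₁ · m)₀`. -/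
structure IsYetterDrinfeld (P : ModComod k K M) : Prop where
  one_act : ∀ m, P.act 1 m = m
  mul_act : ∀ κ κ' m, P.act (κ * κ') m = P.act κ (P.act κ' m)
  coassoc : ∀ m, TensorProduct.assoc k K K M ((comul (R := k)).rTensor M (P.coact m)) =
    P.coact.lTensor K (P.coact m)
  counit_coact : ∀ m, TensorProduct.lid k M ((counit (R := k)).rTensor M (P.coact m)) = m
  compat : ∀ κ m,
    TensorProduct.map (LinearMap.mul' k K) (TensorProduct.lift P.act)
      (TensorProduct.tensorTensorTensorComm k K K K M (comul (R := k) κ ⊗ₜ P.coact m)) =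
    (LinearMap.mul' k K).rTensor M (TensorProduct.rightComm k K M K
      ((P.coact ∘ₗ P.act.flip m).rTensor K (comul (R := k) κ)))

/-- The tensor product: `κ · (m ⊗ n) = κ₁ · m ⊗ κ₂ · n` and
`m ⊗ n ↦ m₋₁ n₋₁ ⊗ (m₀ ⊗ n₀)`. -/
def tensor (P : ModComod k K M) (Q : ModComod k K N) : ModComod k K (M ⊗[k] N) where
  act := TensorProduct.lift (TensorProduct.mapBilinear (RingHom.id k) M N M N) ∘ₗ
    TensorProduct.map P.act Q.act ∘ₗ comul
  coact := (LinearMap.mul' k K).rTensor (M ⊗[k] N) ∘ₗ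
    (TensorProduct.tensorTensorTensorComm k K M K N).toLinearMap ∘ₗ
      TensorProduct.map P.coact Q.coact

/-- The unit object `k`: `κ · r = ε(κ) r` and `r ↦ 1 ⊗ r`. -/
def unit (k K : Type*) [Field k] [Ring K] [HopfAlgebra k K] : ModComod k K k where
  act := LinearMap.mul k k ∘ₗ counit
  coact := TensorProduct.mk k K k 1

/-- Linear and colinear maps, the morphisms of Yetter–Drinfeld modules. -/
structure IsHom (P : ModComod k K M) (Q : ModComod k K N) (f : M →ₗ[k] N) : Prop where
  act : ∀ κ m, f (P.act κ m) = Q.act κ (f m)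
  coact : ∀ m, f.lTensor K (P.coact m) = Q.coact (f m)

/-- The braiding `m ⊗ n ↦ m₋₁ · n ⊗ m₀`. -/
def braiding (P : ModComod k K M) (Q : ModComod k K N) : M ⊗[k] N →ₗ[k] N ⊗[k] M :=
  (TensorProduct.lift Q.act).rTensor M ∘ₗ (TensorProduct.rightComm k K M N).toLinearMap ∘ₗ
    P.coact.rTensor N

end ModComod

/-- A Hopf algebra in the braided category of left-left Yetter–Drinfeld modules over `K`, with
underlying vector space `X`. -/
structure BraidedHopfAlgebra (k K X : Type*) [Field k] [Ring K] [HopfAlgebra k K]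
    [AddCommGroup X] [Module k X] extends ModComod k K X where
  isYetterDrinfeld : toModComod.IsYetterDrinfeld
  mul : X →ₗ[k] X →ₗ[k] X
  one : X
  comul : X →ₗ[k] X ⊗[k] X
  counit : X →ₗ[k] k
  antipode : X →ₗ[k] X
  isHom_mul : (toModComod.tensor toModComod).IsHom toModComod (TensorProduct.lift mul)
  isHom_one : (ModComod.unit k K).IsHom toModComod (LinearMap.toSpanSingleton k X one)
  isHom_comul : toModComod.IsHom (toModComod.tensor toModComod) comul
  isHom_counit : toModComod.IsHom (ModComod.unit k K) counit
  isHom_antipode : toModComod.IsHom toModComod antipode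
  mul_assoc : ∀ x y z, mul (mul x y) z = mul x (mul y z)
  one_mul : ∀ x, mul one x = x
  mul_one : ∀ x, mul x one = x
  coassoc : ∀ x, TensorProduct.assoc k X X X (comul.rTensor X (comul x)) =
    comul.lTensor X (comul x)
  counit_comul : ∀ x, TensorProduct.lid k X (counit.rTensor X (comul x)) = x
  comul_counit : ∀ x, TensorProduct.rid k X (counit.lTensor X (comul x)) = x
  /-- `Δ` is multiplicative for the product `(m ⊗ m)(id ⊗ c ⊗ id)` on `X ⊗ X`. -/
  comul_mul : ∀ x y, comul (mul x y) =
    TensorProduct.map (TensorProduct.lift mul) (TensorProduct.lift mul)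
      ((TensorProduct.assoc k X X (X ⊗[k] X)).symm
        (((TensorProduct.assoc k X X X).toLinearMap ∘ₗ
          (toModComod.braiding toModComod).rTensor X ∘ₗ
            (TensorProduct.assoc k X X X).symm.toLinearMap).lTensor X
          (TensorProduct.assoc k X X (X ⊗[k] X) (comul x ⊗ₜ comul y))))
  comul_one : comul one = one ⊗ₜ one
  counit_mul : ∀ x y, counit (mul x y) = counit x * counit y
  counit_one : counit one = 1
  antipode_left : ∀ x, TensorProduct.lift mul (antipode.rTensor X (comul x)) = counit x • one
  antipode_right : ∀ x, TensorProduct.lift mul (antipode.lTensor X (comul x)) = counit x • one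

namespace BraidedHopfAlgebra

variable {k K X : Type*} [Field k] [Ring K] [HopfAlgebra k K] [AddCommGroup X] [Module k X]

/-- The product `(x × κ)(y × κ') = x (κ₁ · y) × κ₂ κ'` of the biproduct `X × K` on `X ⊗ K`. -/
def biproductMul (P : BraidedHopfAlgebra k K X) :
    (X ⊗[k] K) ⊗[k] (X ⊗[k] K) →ₗ[k] X ⊗[k] K :=
  TensorProduct.map (TensorProduct.lift P.mul) (LinearMap.mul' k K) ∘ₗ
    (TensorProduct.assoc k X X (K ⊗[k] K)).symm.toLinearMap ∘ₗ
    ((TensorProduct.lift P.act).rTensor (K ⊗[k] K) ∘ₗ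
      (TensorProduct.tensorTensorTensorComm k K K X K).toLinearMap ∘ₗ
        (Coalgebra.comul (R := k)).rTensor (X ⊗[k] K)).lTensor X ∘ₗ
    (TensorProduct.assoc k X K (X ⊗[k] K)).toLinearMap

/-- The coproduct `x × κ ↦ (x₁ × (x₂)₋₁ κ₁) ⊗ ((x₂)₀ × κ₂)` of the biproduct `X × K`. -/
def biproductComul (P : BraidedHopfAlgebra k K X) :
    X ⊗[k] K →ₗ[k] (X ⊗[k] K) ⊗[k] (X ⊗[k] K) :=
  (TensorProduct.assoc k X K (X ⊗[k] K)).symm.toLinearMap ∘ₗ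
    ((LinearMap.mul' k K).rTensor (X ⊗[k] K) ∘ₗ
      (TensorProduct.tensorTensorTensorComm k K X K K).toLinearMap ∘ₗ
        TensorProduct.map P.coact Coalgebra.comul).lTensor X ∘ₗ
    (TensorProduct.assoc k X X K).toLinearMap ∘ₗ P.comul.rTensor K

end BraidedHopfAlgebra

end YetterDrinfeld

section Radford

variable {k K D : Type*} [Field k] [Ring K] [HopfAlgebra k K] [Ring D] [HopfAlgebra k D]

/-- The coinvariants `{a | a₁ ⊗ π(a₂) = a ⊗ 1}` of `π : D → K`. -/
def coinvariants (π : D →ₗ[k] K) : Submodule k D :=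
  LinearMap.eqLocus (π.lTensor D ∘ₗ comul) ((TensorProduct.mk k D K).flip 1)

/-- The adjoint action `κ ▷ a = i(κ₁) a i(S(κ₂))` of `K` on `D`. -/
def adjointAct (i : K →ₗ[k] D) (κ : K) (a : D) : D :=
  TensorProduct.lift (LinearMap.compl₁₂ (LinearMap.mul k D)
    (LinearMap.mulRight k a ∘ₗ i) (i ∘ₗ antipode k)) (comul (R := k) κ)

/-- The projection `a ↦ a₁ i(S(π(a₂)))` of `D` onto the coinvariants. -/
def coinvProj (i : K →ₗ[k] D) (π : D →ₗ[k] K) : D →ₗ[k] D :=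
  LinearMap.mul' k D ∘ₗ (i ∘ₗ antipode k ∘ₗ π).lTensor D ∘ₗ comul

/-- The braided antipode `b ↦ i(π(b₁)) S(b₂)` of the coinvariants. -/
def coinvAntipode (i : K →ₗ[k] D) (π : D →ₗ[k] K) : D →ₗ[k] D :=
  LinearMap.mul' k D ∘ₗ TensorProduct.map (i ∘ₗ π) (antipode k) ∘ₗ comul

/-- The linear isomorphism `θ` identifies the braided Hopf algebra `P` with the one which the
coinvariants of a Hopf algebra projection `π : D → K`, split by `i : K → D`, carry: action
`κ ▷ b = i(κ₁) b i(S(κ₂))`, coaction `b ↦ π(b₁) ⊗ b₂`, product, unit and counit of `D`, coproduct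
`Π(a) ↦ Π(a₁) ⊗ Π(a₂)` with `Π(a) = a₁ i(S(π(a₂)))`, and antipode `b ↦ i(π(b₁)) S(b₂)`. -/
structure IsCoinvariantsIso {X : Type*} [AddCommGroup X] [Module k X] (i : K →ₗ[k] D)
    (π : D →ₗ[k] K) (P : BraidedHopfAlgebra k K X) (θ : X →ₗ[k] D) : Prop where
  injective : Function.Injective θ
  range : LinearMap.range θ = coinvariants π
  act : ∀ κ x, θ (P.act κ x) = adjointAct i κ (θ x)
  coact : ∀ x, θ.lTensor K (P.coact x) = π.rTensor D (comul (R := k) (θ x))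
  mul : ∀ x y, θ (P.mul x y) = θ x * θ y
  one : θ P.one = 1
  comul : ∀ x a, θ x = coinvProj i π a → TensorProduct.map θ θ (P.comul x) =
    TensorProduct.map (coinvProj i π) (coinvProj i π) (comul (R := k) a)
  counit : ∀ x, P.counit x = counit (R := k) (θ x)
  antipode : ∀ x, θ (P.antipode x) = coinvAntipode i π (θ x)

/-- `χ` is an isomorphism of Hopf algebras from the biproduct `X × K`, with unit `1 × 1` and counit
`ε ⊗ ε`, onto `D`. -/
structure IsBiproductIso {X : Type*} [AddCommGroup X] [Module k X]
    (P : BraidedHopfAlgebra k K X) (χ : X ⊗[k] K →ₗ[k] D) : Prop where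
  bijective : Function.Bijective χ
  mul : ∀ s t, χ (P.biproductMul (s ⊗ₜ t)) = χ s * χ t
  one : χ (P.one ⊗ₜ 1) = 1
  comul : ∀ s, TensorProduct.map χ χ (P.biproductComul s) = comul (R := k) (χ s)
  counit : ∀ x κ, counit (R := k) (χ (x ⊗ₜ κ)) = P.counit x * counit (R := k) κ

end Radford

section Sweedler

variable (k H : Type*) [Field k] [Ring H] [HopfAlgebra k H]

/-- The coproduct `h ↦ h₁ ⊗ (h₂ ⊗ (h₃ ⊗ h₄))`. -/
def comul4 : H →ₗ[k] H ⊗[k] (H ⊗[k] (H ⊗[k] H)) := (comul3 k H).lTensor H ∘ₗ comul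

/-- The coproduct `h ↦ h₁ ⊗ (h₂ ⊗ (h₃ ⊗ (h₄ ⊗ (h₅ ⊗ h₆))))`. -/
def comul6 : H →ₗ[k] H ⊗[k] (H ⊗[k] (H ⊗[k] (H ⊗[k] (H ⊗[k] H)))) :=
  (((comul4 k H).lTensor H ∘ₗ comul).lTensor H) ∘ₗ comul

end Sweedler

end BraidedCQT

end

open BraidedCQT

open TensorProduct Coalgebra HopfAlgebra

noncomputable section

set_option linter.unusedSectionVars false

/-! The engine is Radford's theorem on Hopf algebras with a projection. If `π : D → K` is a Hopf
algebra morphism split by `i : K → D`, the coinvariants of `π` are the image of `Π(d) = d₁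
i(S(π(d₂)))`, they form a Hopf algebra in the Yetter–Drinfeld modules over `K`, and `D` is the
biproduct of the coinvariants with `K`. The structure is transported to a space `X` by a map `θ : X
→ D` onto the coinvariants and a map `p : D → X` with `θ p = Π` and `p θ = id` (`CoinvSplitting`);
the results are `inducedBraidedHopfAlgebra`, `isCoinvariantsIso` and `isBiproductIso`. Sweedler
computations are carried out as identities between products in convolution algebras.

For the double of a skew pairing `p` on `B ⊗ V`, a bialgebra map `γ : V → B` gives a projection `b ⊗
h ↦ b γ(h)` as soon as `p(κ₁, y₁) κ₂ γ(y₂) = γ(y₁) κ₁ p(κ₂, y₂)` (`Intertwines`, `projLin_mul`). Its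
coinvariants are parametrized by `sec(x) = γ(S⁻¹(x₂)) ⊗ x₁`, because `1 ⊗ x = γ(x₂) sec(x₁)`, and `ε
⊗ id` recovers `x` from `sec(x)`. As `ε ⊗ id` turns left multiplication by `b ⊗ 1` into the scalar
`ε(b)`, the induced structure can be computed from the single exchange `(1 ⊗ y)(κ ⊗ 1)`.

Here `γ(y) = l_{S⁻¹(y)}`. Since `σ(h, S⁻¹(y)) = σ(S(h), y)`, this is the convolution inverse of `σ`,
and the intertwining relation is the coquasitriangular identity conjugated by that inverse: `f(h₁
g₁) σ⁻¹(h₂, g₂) = σ⁻¹(h₁, g₁) f(g₂ h₂)` (`BraidedComm.mul_invForm`). For `f = r_a` the same identity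
is an exchange rule between the functionals `l` and `r`; it gives `H_{l_X} H_{r_A} = H_{r_A}
H_{l_X}`, and hence that this space is a sub-Hopf algebra of the finite dual.

Bijectivity of the antipodes comes from Drinfeld's functional `u(h) = σ(h₁, S(h₂))`, which
implements the square of the antipode, `h₁ u(h₂) = u(h₁) S²(h₂)`, and has the convolution right
inverse `v(h) = σ(S²(h₁), h₂)`. -/

namespace BraidedCQT

/-! ### Calculus in convolution algebras -/

section Convolution

variable {k C C' A A' A'' : Type*} [Field k] [AddCommGroup C] [Module k C] [Coalgebra k C]
  [AddCommGroup C'] [Module k C'] [Coalgebra k C']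
  [Ring A] [Algebra k A] [Ring A'] [Algebra k A'] [Ring A''] [Algebra k A'']

/-- A linear map `C → A`, as an element of the convolution algebra. -/
abbrev cv (f : C →ₗ[k] A) : WithConv (C →ₗ[k] A) := WithConv.toConv f

theorem cv_apply (f : C →ₗ[k] A) (c : C) : cv f c = f c := rfl

theorem conv_ext {F G : WithConv (C →ₗ[k] A)} (h : ∀ c, F c = G c) : F = G :=
  WithConv.ext (LinearMap.ext h)

theorem conv_mul_apply (F G : WithConv (C →ₗ[k] A)) (c : C) : (F * G) c =
    LinearMap.mul' k A (TensorProduct.map F.ofConv G.ofConv (comul (R := k) c)) := rfl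

theorem conv_one_apply (c : C) : (1 : WithConv (C →ₗ[k] A)) c = counit (R := k) c • 1 :=
  Algebra.algebraMap_eq_smul_one _

/-- Postcomposition with an algebra morphism, as a ring morphism of convolution algebras. -/
def convPush (φ : A →ₐ[k] A') : WithConv (C →ₗ[k] A) →+* WithConv (C →ₗ[k] A') where
  toFun F := cv (φ.toLinearMap ∘ₗ F.ofConv)
  map_one' := conv_ext fun c => by
    show φ (algebraMap k A _) = algebraMap k A' _
    exact φ.commutes _
  map_mul' F G := by
    refine WithConv.ext ?_
    exact LinearMap.algHom_comp_convMul_distrib φ F G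
  map_zero' := conv_ext fun c => map_zero φ
  map_add' F G := conv_ext fun c => map_add φ _ _

theorem convPush_apply (φ : A →ₐ[k] A') (F : WithConv (C →ₗ[k] A)) (c : C) :
    convPush φ F c = φ (F c) := rfl

theorem convPush_smul (φ : A →ₐ[k] A') (r : k) (F : WithConv (C →ₗ[k] A)) :
    convPush φ (r • F) = r • convPush φ F := conv_ext fun c => map_smul φ r (F c)

theorem convPush_convPush (ψ : A' →ₐ[k] A'') (φ : A →ₐ[k] A') (F : WithConv (C →ₗ[k] A)) :
    convPush ψ (convPush φ F) = convPush (ψ.comp φ) F := rfl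

/-- Precomposition with a coalgebra morphism, as a ring morphism of convolution algebras. -/
def convPull (f : C' →ₗ[k] C) (hf : ∀ c, comul (R := k) (f c) = TensorProduct.map f f (comul c))
    (hε : ∀ c, counit (R := k) (f c) = counit (R := k) c) :
    WithConv (C →ₗ[k] A) →+* WithConv (C' →ₗ[k] A) where
  toFun F := cv (F.ofConv ∘ₗ f)
  map_one' := conv_ext fun c => by
    show algebraMap k A _ = algebraMap k A _
    rw [hε]
  map_mul' F G := conv_ext fun c => by
    show LinearMap.mul' k A (TensorProduct.map F.ofConv G.ofConv (comul (f c))) =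
      LinearMap.mul' k A (TensorProduct.map (F.ofConv ∘ₗ f) (G.ofConv ∘ₗ f) (comul c))
    rw [hf, ← LinearMap.comp_apply (TensorProduct.map _ _), ← TensorProduct.map_comp]
  map_zero' := rfl
  map_add' F G := rfl

/-- The map `c ↦ ε(c) a`. -/
def cst (C : Type*) [AddCommGroup C] [Module k C] [Coalgebra k C] (a : A) :
    WithConv (C →ₗ[k] A) := cv ((counit (R := k) (A := C)).smulRight a)

theorem cst_apply (a : A) (c : C) : (cst C a : WithConv (C →ₗ[k] A)) c = counit (R := k) c • a :=
  rfl

theorem convPush_cst (φ : A →ₐ[k] A') (a : A) :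
    convPush φ (cst C a : WithConv (C →ₗ[k] A)) = cst C (φ a) :=
  conv_ext fun c => by rw [convPush_apply, cst_apply, cst_apply, map_smul]

/-- The counit absorbs one leg. Constants `ε(c) a` let a fixed element of `A` take part in
convolution products. -/
theorem cst_mul_apply (a : A) (F : WithConv (C →ₗ[k] A)) (c : C) :
    (cst C a * F : WithConv (C →ₗ[k] A)) c = a * F c := by
  have h : ∀ t : C ⊗[k] C, LinearMap.mul' k A (TensorProduct.map
      ((counit (R := k) (A := C)).smulRight a) F.ofConv t) =
      a * F.ofConv (TensorProduct.lid k C ((counit (R := k)).rTensor C t)) := by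
    intro t
    induction t using TensorProduct.induction_on with
    | zero => simp
    | add u v hu hv => simp only [map_add, hu, hv, mul_add]
    | tmul u v => simp
  refine (h _).trans ?_
  rw [Coalgebra.rTensor_counit_comul, TensorProduct.lid_tmul, one_smul]

theorem mul_cst_apply (a : A) (F : WithConv (C →ₗ[k] A)) (c : C) :
    (F * cst C a : WithConv (C →ₗ[k] A)) c = F c * a := by
  have h : ∀ t : C ⊗[k] C, LinearMap.mul' k A (TensorProduct.map F.ofConv
      ((counit (R := k) (A := C)).smulRight a) t) =
      F.ofConv (TensorProduct.rid k C ((counit (R := k)).lTensor C t)) * a := by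
    intro t
    induction t using TensorProduct.induction_on with
    | zero => simp
    | add u v hu hv => simp only [map_add, hu, hv, add_mul]
    | tmul u v => simp
  refine (h _).trans ?_
  rw [Coalgebra.lTensor_counit_comul, TensorProduct.rid_tmul, one_smul]

theorem cst_mul_cst (a b : A) :
    (cst C a * cst C b : WithConv (C →ₗ[k] A)) = cst C (a * b) :=
  conv_ext fun c => by rw [cst_mul_apply, cst_apply, cst_apply, mul_smul_comm]

theorem cst_smul (r : k) (a : A) :
    (cst C (r • a) : WithConv (C →ₗ[k] A)) = r • cst C a :=
  conv_ext fun _ => smul_comm _ _ _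

theorem cst_add (a b : A) :
    (cst C (a + b) : WithConv (C →ₗ[k] A)) = cst C a + cst C b :=
  conv_ext fun _ => smul_add _ _ _

theorem cst_mul_eq (a : A) (F : WithConv (C →ₗ[k] A)) :
    cst C a * F = cv (LinearMap.mulLeft k a ∘ₗ F.ofConv) :=
  conv_ext fun c => cst_mul_apply a F c

theorem mul_cst_eq (a : A) (F : WithConv (C →ₗ[k] A)) :
    F * cst C a = cv (LinearMap.mulRight k a ∘ₗ F.ofConv) :=
  conv_ext fun c => mul_cst_apply a F c

theorem cst_one : (cst C (1 : A) : WithConv (C →ₗ[k] A)) = 1 :=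
  conv_ext fun c => by rw [cst_apply, conv_one_apply]

theorem cst_commute (a : A) (F : WithConv (C →ₗ[k] A)) (h : ∀ c, a * F c = F c * a) :
    cst C a * F = F * cst C a :=
  conv_ext fun c => by rw [cst_mul_apply, mul_cst_apply, h]

/-- The inclusion `a ↦ a ⊗ 1`. -/
abbrev inL : A →ₐ[k] A ⊗[k] A' := Algebra.TensorProduct.includeLeft

/-- The inclusion `a ↦ 1 ⊗ a`. -/
abbrev inR : A' →ₐ[k] A ⊗[k] A' := Algebra.TensorProduct.includeRight

/-- In `A ⊗ A'` the elements `F(c₁) ⊗ 1` and `1 ⊗ G(c₂)` multiply to `F(c₁) ⊗ G(c₂)`. Expressions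
with several tensor legs thus become products in one convolution ring, where associativity and
cancellation of inverses replace Sweedler bookkeeping. -/
theorem map_comul_eq (F : WithConv (C →ₗ[k] A)) (G : WithConv (C →ₗ[k] A')) (c : C) :
    TensorProduct.map F.ofConv G.ofConv (comul (R := k) c) =
      (convPush inL F * convPush inR G : WithConv (C →ₗ[k] A ⊗[k] A')) c := by
  rw [conv_mul_apply]
  induction comul (R := k) c using TensorProduct.induction_on with
  | zero => simp
  | add u v hu hv => simp only [map_add, hu, hv]
  | tmul u v =>
    rw [TensorProduct.map_tmul, TensorProduct.map_tmul, LinearMap.mul'_apply]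
    show _ = (F.ofConv u ⊗ₜ[k] (1 : A')) * ((1 : A) ⊗ₜ[k] G.ofConv v)
    rw [Algebra.TensorProduct.tmul_mul_tmul, mul_one, one_mul]

theorem map_comp_inL {B B' : Type*} [Ring B] [Algebra k B] [Ring B'] [Algebra k B']
    (f : A →ₐ[k] B) (g : A' →ₐ[k] B') :
    (Algebra.TensorProduct.map f g).comp inL = inL.comp f :=
  AlgHom.ext fun a => by simp

theorem map_comp_inR {B B' : Type*} [Ring B] [Algebra k B] [Ring B'] [Algebra k B']
    (f : A →ₐ[k] B) (g : A' →ₐ[k] B') :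
    (Algebra.TensorProduct.map f g).comp inR = inR.comp g :=
  AlgHom.ext fun a => by simp

/-- If right multiplication by the values of `G` is absorbed by `q`, so is the convolution with
`G`. -/
theorem conv_absorb {M : Type*} [AddCommGroup M] [Module k M] (q : A →ₗ[k] M)
    (F G : WithConv (C →ₗ[k] A)) (h : ∀ a c, q (a * G c) = counit (R := k) c • q a) (c : C) :
    q ((F * G) c) = q (F c) := by
  have h1 : ∀ t : C ⊗[k] C, q (LinearMap.mul' k A (TensorProduct.map F.ofConv G.ofConv t)) =
      q (F.ofConv (TensorProduct.rid k C ((counit (R := k)).lTensor C t))) := by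
    intro t
    induction t using TensorProduct.induction_on with
    | zero => simp
    | add u v hu hv => simp only [map_add, hu, hv]
    | tmul u v =>
      refine (h (F.ofConv u) v).trans ?_
      simp
  refine (h1 _).trans ?_
  rw [Coalgebra.lTensor_counit_comul, TensorProduct.rid_tmul, one_smul]

/-- If left multiplication by the values of `G` is absorbed by `q`, so is the convolution with
`G`. -/
theorem conv_absorb_left {M : Type*} [AddCommGroup M] [Module k M] (q : A →ₗ[k] M)
    (F G : WithConv (C →ₗ[k] A)) (h : ∀ a c, q (G c * a) = counit (R := k) c • q a) (c : C) :
    q ((G * F) c) = q (F c) := by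
  have h1 : ∀ t : C ⊗[k] C, q (LinearMap.mul' k A (TensorProduct.map G.ofConv F.ofConv t)) =
      q (F.ofConv (TensorProduct.lid k C ((counit (R := k)).rTensor C t))) := by
    intro t
    induction t using TensorProduct.induction_on with
    | zero => simp
    | add u v hu hv => simp only [map_add, hu, hv]
    | tmul u v =>
      refine (h (F.ofConv v) u).trans ?_
      simp
  refine (h1 _).trans ?_
  rw [Coalgebra.rTensor_counit_comul, TensorProduct.lid_tmul, one_smul]

end Convolution

/-! ### Identity, antipode and coproduct in the convolution algebra -/

section HopfConvolution

variable {k D : Type*} [Field k] [Ring D] [HopfAlgebra k D]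

theorem convPush_comul_id : convPush (Bialgebra.comulAlgHom k D) (cv (LinearMap.id (R := k))) =
    convPush inL (cv LinearMap.id) * convPush inR (cv LinearMap.id) :=
  conv_ext fun c => by
    rw [← map_comul_eq]
    exact (LinearMap.congr_fun TensorProduct.map_id _).symm

/-- The antipode reverses the coproduct, so the factor in the second leg stands first in the
convolution product. -/
theorem convPush_comul_antipode : convPush (Bialgebra.comulAlgHom k D) (cv (antipode k)) =
    convPush inR (cv (antipode k)) * convPush inL (cv (antipode k)) :=
  conv_ext fun c => by
    refine (comul_antipode c).trans ?_
    rw [conv_mul_apply]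
    induction comul (R := k) c using TensorProduct.induction_on with
    | zero => simp
    | add u v hu hv => simp only [map_add, hu, hv]
    | tmul u v =>
      show antipode k v ⊗ₜ[k] antipode k u =
        ((1 : D) ⊗ₜ[k] antipode k u) * (antipode k v ⊗ₜ[k] (1 : D))
      rw [Algebra.TensorProduct.tmul_mul_tmul, mul_one, one_mul]

theorem cv_id_mul_antipode :
    (cv LinearMap.id * cv (antipode k) : WithConv (D →ₗ[k] D)) = 1 := LinearMap.id_mul_antipode

theorem cv_antipode_mul_id :
    (cv (antipode k) * cv LinearMap.id : WithConv (D →ₗ[k] D)) = 1 := LinearMap.antipode_mul_id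

end HopfConvolution

/-! ### The projection onto the coinvariants of a split Hopf algebra map -/

section RadfordProjection

variable {k K D : Type*} [Field k] [Ring K] [HopfAlgebra k K] [Ring D] [HopfAlgebra k D]

/-- Precomposition with a morphism of bialgebras. -/
def convPullHom {A : Type*} [Ring A] [Algebra k A] (f : D →ₐc[k] K) :
    WithConv (K →ₗ[k] A) →+* WithConv (D →ₗ[k] A) :=
  convPull (f : D →ₗ[k] K) (fun c => (CoalgHomClass.map_comp_comul_apply f c).symm)
    (fun c => CoalgHomClass.counit_comp_apply f c)

theorem convPullHom_apply {A : Type*} [Ring A] [Algebra k A] (f : D →ₐc[k] K)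
    (F : WithConv (K →ₗ[k] A)) (d : D) : convPullHom f F d = F (f d) := rfl

theorem convPullHom_cst {A : Type*} [Ring A] [Algebra k A] (f : D →ₐc[k] K) (a : A) :
    convPullHom f (cst K a) = (cst D a : WithConv (D →ₗ[k] A)) :=
  conv_ext fun d => by
    rw [convPullHom_apply, cst_apply, cst_apply, CoalgHomClass.counit_comp_apply]

variable (i : K →ₐc[k] D) (π : D →ₐc[k] K)

/-- The map `d ↦ i(π(d))`. -/
def cvJ : WithConv (D →ₗ[k] D) := cv ((i : K →ₗ[k] D) ∘ₗ (π : D →ₗ[k] K))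

/-- The map `d ↦ i(S(π(d)))`. -/
def cvQ : WithConv (D →ₗ[k] D) := cv ((i : K →ₗ[k] D) ∘ₗ antipode k ∘ₗ (π : D →ₗ[k] K))

theorem cvJ_eq : cvJ i π = convPullHom π (convPush (i : K →ₐ[k] D) (cv LinearMap.id)) := rfl

theorem cvQ_eq : cvQ i π = convPullHom π (convPush (i : K →ₐ[k] D) (cv (antipode k))) := rfl

/-- Both maps come from `K`, where `S` and the identity are inverse to each other. This cancellation
drives the braided multiplicativity of the coproduct, the antipode axiom and the biproduct. -/
theorem cvQ_mul_cvJ : cvQ i π * cvJ i π = 1 := by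
  rw [cvJ_eq, cvQ_eq, ← map_mul, ← map_mul, cv_antipode_mul_id, map_one, map_one]

theorem convPush_comul_comp {C : Type*} [AddCommGroup C] [Module k C] [Coalgebra k C]
    (F : WithConv (C →ₗ[k] K)) :
    convPush (Bialgebra.comulAlgHom k D) (convPush (i : K →ₐ[k] D) F) =
      convPush (Algebra.TensorProduct.map (i : K →ₐ[k] D) (i : K →ₐ[k] D))
        (convPush (Bialgebra.comulAlgHom k K) F) := by
  rw [convPush_convPush, convPush_convPush, BialgHom.map_comp_comulAlgHom]

theorem convPush_comul_incl_id :
    convPush (Bialgebra.comulAlgHom k D) (convPush (i : K →ₐ[k] D) (cv LinearMap.id)) =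
      convPush inL (convPush (i : K →ₐ[k] D) (cv LinearMap.id)) *
        convPush inR (convPush (i : K →ₐ[k] D) (cv LinearMap.id)) := by
  rw [convPush_comul_comp, convPush_comul_id, map_mul, convPush_convPush, convPush_convPush,
    map_comp_inL, map_comp_inR]; rfl

theorem convPush_comul_incl_antipode :
    convPush (Bialgebra.comulAlgHom k D) (convPush (i : K →ₐ[k] D) (cv (antipode k))) =
      convPush inR (convPush (i : K →ₐ[k] D) (cv (antipode k))) *
        convPush inL (convPush (i : K →ₐ[k] D) (cv (antipode k))) := by
  rw [convPush_comul_comp, convPush_comul_antipode, map_mul, convPush_convPush, convPush_convPush,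
    map_comp_inL, map_comp_inR]; rfl

theorem convPush_comul_cvJ : convPush (Bialgebra.comulAlgHom k D) (cvJ i π) =
    convPush inL (cvJ i π) * convPush inR (cvJ i π) :=
  (congrArg (convPullHom π) (convPush_comul_incl_id i)).trans (map_mul _ _ _)

theorem convPush_comul_cvQ : convPush (Bialgebra.comulAlgHom k D) (cvQ i π) =
    convPush inR (cvQ i π) * convPush inL (cvQ i π) :=
  (congrArg (convPullHom π) (convPush_comul_incl_antipode i)).trans (map_mul _ _ _)

theorem cv_coinvProj : cv (coinvProj (i : K →ₗ[k] D) (π : D →ₗ[k] K)) =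
    cv LinearMap.id * cvQ i π := rfl

theorem cv_coinvAntipode : cv (coinvAntipode (i : K →ₗ[k] D) (π : D →ₗ[k] K)) =
    cvJ i π * cv (antipode k) := rfl

theorem adjointAct_eq (κ : K) (a : D) : adjointAct (i : K →ₗ[k] D) κ a =
    (convPush (i : K →ₐ[k] D) (cv LinearMap.id) * cst K a *
      convPush (i : K →ₐ[k] D) (cv (antipode k)) : WithConv (K →ₗ[k] D)) κ := by
  rw [mul_cst_eq, conv_mul_apply, adjointAct]
  induction comul (R := k) κ using TensorProduct.induction_on with
  | zero => simp
  | add u v hu hv => simp only [map_add, hu, hv]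
  | tmul u v => rfl

/-- The coaction `d ↦ π(d₁) ⊗ d₂` of `K` on `D`. -/
def coactHom : D →ₐ[k] K ⊗[k] D :=
  (Algebra.TensorProduct.map (π : D →ₐ[k] K) (AlgHom.id k D)).comp (Bialgebra.comulAlgHom k D)

theorem coactHom_apply (d : D) : coactHom π d = (π : D →ₗ[k] K).rTensor D (comul (R := k) d) := rfl

theorem convPush_coactHom {C : Type*} [AddCommGroup C] [Module k C] [Coalgebra k C]
    (F : WithConv (C →ₗ[k] D)) : convPush (coactHom π) F =
      convPush (Algebra.TensorProduct.map (π : D →ₐ[k] K) (AlgHom.id k D))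
        (convPush (Bialgebra.comulAlgHom k D) F) := rfl

theorem convPush_map_inL {C : Type*} [AddCommGroup C] [Module k C] [Coalgebra k C]
    (F : WithConv (C →ₗ[k] D)) :
    convPush (Algebra.TensorProduct.map (π : D →ₐ[k] K) (AlgHom.id k D)) (convPush inL F) =
      convPush inL (convPush (π : D →ₐ[k] K) F) := by
  rw [convPush_convPush, map_comp_inL]; rfl

theorem convPush_map_inR {C : Type*} [AddCommGroup C] [Module k C] [Coalgebra k C]
    (F : WithConv (C →ₗ[k] D)) :
    convPush (Algebra.TensorProduct.map (π : D →ₐ[k] K) (AlgHom.id k D)) (convPush inR F) =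
      convPush inR F := by
  rw [convPush_convPush, map_comp_inR]; rfl

theorem convPush_coactHom_id : convPush (coactHom π) (cv (LinearMap.id (R := k))) =
    convPush inL (cv (π : D →ₗ[k] K)) * convPush inR (cv LinearMap.id) := by
  rw [convPush_coactHom, convPush_comul_id, map_mul, convPush_map_inL, convPush_map_inR]; rfl

theorem coactHom_coassoc (d : D) : TensorProduct.assoc k K K D
    ((comul (R := k)).rTensor D (coactHom π d)) =
      (coactHom π).toLinearMap.lTensor K (coactHom π d) := by
  have h : (TensorProduct.assoc k K K D).toLinearMap ∘ₗ (comul (R := k)).rTensor D ∘ₗ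
      (π : D →ₗ[k] K).rTensor D ∘ₗ comul = ((π : D →ₗ[k] K).rTensor D ∘ₗ comul).lTensor K ∘ₗ
        (π : D →ₗ[k] K).rTensor D ∘ₗ comul := by
    have e : comul (R := k) ∘ₗ (π : D →ₗ[k] K) =
        TensorProduct.map (π : D →ₗ[k] K) (π : D →ₗ[k] K) ∘ₗ comul :=
      (CoalgHomClass.map_comp_comul π).symm
    rw [← LinearMap.comp_assoc comul _ ((comul (R := k)).rTensor D), ← LinearMap.rTensor_comp, e]
    simp only [coassoc_simps]
  exact LinearMap.congr_fun h d

/-- The relation `b₁ ⊗ π(b₂) = b ⊗ 1` evaluates at `1` whatever is applied to the last leg through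
`π`. This is the form in which coinvariance enters convolution computations. -/
theorem conv_mul_pull_of_coinvariant {A : Type*} [Ring A] [Algebra k A] {b : D}
    (hb : b ∈ coinvariants (π : D →ₗ[k] K)) (F : WithConv (D →ₗ[k] A))
    (G : WithConv (K →ₗ[k] A)) : (F * convPullHom π G) b = F b * G 1 := by
  have hb' : (π : D →ₗ[k] K).lTensor D (comul (R := k) b) = b ⊗ₜ 1 := hb
  rw [conv_mul_apply]
  have e : TensorProduct.map F.ofConv (convPullHom π G).ofConv (comul (R := k) b) =
      TensorProduct.map F.ofConv G.ofConv ((π : D →ₗ[k] K).lTensor D (comul (R := k) b)) := by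
    rw [← LinearMap.comp_apply (TensorProduct.map F.ofConv G.ofConv), LinearMap.map_comp_lTensor]
    rfl
  rw [e, hb']; rfl

theorem coinvProj_of_coinvariant {b : D} (hb : b ∈ coinvariants (π : D →ₗ[k] K)) :
    coinvProj (i : K →ₗ[k] D) (π : D →ₗ[k] K) b = b := by
  show cv (coinvProj (i : K →ₗ[k] D) (π : D →ₗ[k] K)) b = b
  rw [cv_coinvProj, cvQ_eq, conv_mul_pull_of_coinvariant π hb]
  show b * i (antipode k 1) = b
  rw [antipode_one, map_one, mul_one]

theorem map_of_coinvariant {b : D} (hb : b ∈ coinvariants (π : D →ₗ[k] K)) :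
    π b = counit (R := k) b • 1 := by
  have h := conv_mul_pull_of_coinvariant π hb (1 : WithConv (D →ₗ[k] K)) (cv LinearMap.id)
  rw [one_mul, conv_one_apply] at h
  exact h.trans (mul_one _)

/-- Since `S` reverses products, `i(S(π(e₂)))` ends up next to `e₁` and the projection of `e`
appears nested inside. Taking `e` in `i(K)` gives right invariance, taking `d` in `i(K)` gives
equivariance for the adjoint action. -/
theorem coinvProj_mul (d e : D) : coinvProj (i : K →ₗ[k] D) (π : D →ₗ[k] K) (d * e) =
    (cv LinearMap.id * cst D (coinvProj (i : K →ₗ[k] D) (π : D →ₗ[k] K) e) * cvQ i π :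
      WithConv (D →ₗ[k] D)) d := by
  rw [mul_assoc, cst_mul_eq, conv_mul_apply, coinvProj, LinearMap.comp_apply, LinearMap.comp_apply,
    LinearMap.comp_apply, LinearMap.comp_apply, Bialgebra.comul_mul]
  induction comul (R := k) d using TensorProduct.induction_on with
  | zero => simp
  | add u v hu hv => simp only [add_mul, map_add, hu, hv]
  | tmul a b =>
    rw [TensorProduct.map_tmul, LinearMap.mul'_apply, LinearMap.comp_apply,
      LinearMap.mulLeft_apply]
    induction comul (R := k) e using TensorProduct.induction_on with
    | zero => simp
    | add u v hu hv => simp only [mul_add, add_mul, map_add, hu, hv]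
    | tmul c e =>
      rw [Algebra.TensorProduct.tmul_mul_tmul]
      show a * c * i (antipode k (π (b * e))) = a * (c * i (antipode k (π e)) * i (antipode k (π b)))
      rw [map_mul π, antipode_mul_antidistrib, map_mul i, mul_assoc, mul_assoc]


/-- Both `S ∘ i` and `i ∘ S` are convolution inverses of `i`. -/
theorem antipode_comp_bialgHom (κ : K) : antipode k (i κ) = i (antipode k κ) := by
  have e : convPush (i : K →ₐ[k] D) (cv LinearMap.id) =
      convPullHom i (cv (LinearMap.id (R := k) (M := D))) := rfl
  have h1 : convPullHom i (cv (antipode k)) * convPush (i : K →ₐ[k] D) (cv LinearMap.id) = 1 := by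
    rw [e, ← map_mul, cv_antipode_mul_id, map_one]
  have h2 : convPush (i : K →ₐ[k] D) (cv LinearMap.id) *
      convPush (i : K →ₐ[k] D) (cv (antipode k)) = 1 := by
    rw [← map_mul, cv_id_mul_antipode, map_one]
  exact congrArg (fun F : WithConv (K →ₗ[k] D) => F κ) (left_inv_eq_right_inv h1 h2)

/-- The same nesting as in `coinvProj_mul`, now because `S(b e)` puts `S(e)` next to `i(π(c))`. -/
theorem coinvAntipode_mul (d e : D) : coinvAntipode (i : K →ₗ[k] D) (π : D →ₗ[k] K) (d * e) =
    (cvJ i π * cst D (coinvAntipode (i : K →ₗ[k] D) (π : D →ₗ[k] K) e) * cv (antipode k) :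
      WithConv (D →ₗ[k] D)) d := by
  rw [mul_assoc, cst_mul_eq, conv_mul_apply, coinvAntipode, LinearMap.comp_apply,
    LinearMap.comp_apply, LinearMap.comp_apply, LinearMap.comp_apply, Bialgebra.comul_mul]
  induction comul (R := k) d using TensorProduct.induction_on with
  | zero => simp
  | add u v hu hv => simp only [add_mul, map_add, hu, hv]
  | tmul a b =>
    rw [TensorProduct.map_tmul, LinearMap.mul'_apply, LinearMap.comp_apply,
      LinearMap.mulLeft_apply]
    induction comul (R := k) e using TensorProduct.induction_on with
    | zero => simp
    | add u v hu hv => simp only [mul_add, add_mul, map_add, hu, hv]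
    | tmul c e =>
      rw [Algebra.TensorProduct.tmul_mul_tmul]
      show i (π (a * c)) * antipode k (b * e) =
        i (π a) * (i (π c) * antipode k e * antipode k b)
      rw [map_mul π, antipode_mul_antidistrib, map_mul i, mul_assoc, mul_assoc]

/-- The map `κ ↦ i(κ₁) b i(S(κ₂))`. -/
def cvAdj (b : D) : WithConv (K →ₗ[k] D) :=
  convPush (i : K →ₐ[k] D) (cv LinearMap.id) * cst K b *
    convPush (i : K →ₐ[k] D) (cv (antipode k))

theorem incl_antipode_mul_id : convPush (i : K →ₐ[k] D) (cv (antipode k)) *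
    convPush (i : K →ₐ[k] D) (cv LinearMap.id) = 1 := by
  rw [← map_mul, cv_antipode_mul_id, map_one]

theorem incl_id_mul_antipode : convPush (i : K →ₐ[k] D) (cv LinearMap.id) *
    convPush (i : K →ₐ[k] D) (cv (antipode k)) = 1 := by
  rw [← map_mul, cv_id_mul_antipode, map_one]

/-- The inner factors `i(S(κ₂)) i(κ₃)` cancel. This is the module algebra property of the adjoint
action. -/
theorem cvAdj_mul_cvAdj (b c : D) : cvAdj i b * cvAdj i c = cvAdj i (b * c) := by
  rw [cvAdj, cvAdj, mul_assoc, mul_assoc (convPush (i : K →ₐ[k] D) (cv LinearMap.id)) (cst K c),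
    ← mul_assoc (convPush (i : K →ₐ[k] D) (cv (antipode k))), incl_antipode_mul_id, one_mul,
    cvAdj, ← cst_mul_cst]
  simp only [mul_assoc]

/-- The commutation rule `(κ₁ ▷ b) i(κ₂) = i(κ) b`, which becomes the product of the biproduct. -/
theorem cvAdj_mul_incl (b : D) : cvAdj i b * convPush (i : K →ₐ[k] D) (cv LinearMap.id) =
    convPush (i : K →ₐ[k] D) (cv LinearMap.id) * cst K b := by
  rw [cvAdj, mul_assoc, incl_antipode_mul_id, mul_one]

/-- `θ : X → D` and `p : D → X` split the projection `a ↦ a₁ i(S(π(a₂)))` of `D` onto the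
coinvariants of `π`, where `π` is split by `i`. -/
structure CoinvSplitting {X : Type*} [AddCommGroup X] [Module k X] (θ : X →ₗ[k] D)
    (p : D →ₗ[k] X) : Prop where
  retract : ∀ κ, π (i κ) = κ
  section_proj : ∀ d, θ (p d) = coinvProj (i : K →ₗ[k] D) (π : D →ₗ[k] K) d
  proj_section : ∀ x, p (θ x) = x

namespace CoinvSplitting

variable {i π} {X : Type*} [AddCommGroup X] [Module k X] {θ : X →ₗ[k] D} {p : D →ₗ[k] X}
  (h : CoinvSplitting i π θ p)

theorem push_cvJ (h : CoinvSplitting i π θ p) :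
    convPush (π : D →ₐ[k] K) (cvJ i π) = cv (π : D →ₗ[k] K) :=
  conv_ext fun d => h.retract (π d)

theorem push_cvQ (hr : ∀ κ, π (i κ) = κ) :
    convPush (π : D →ₐ[k] K) (cvQ i π) = cv (antipode k ∘ₗ (π : D →ₗ[k] K)) :=
  conv_ext fun d => hr (antipode k (π d))

theorem push_incl (h : CoinvSplitting i π θ p) {C : Type*} [AddCommGroup C] [Module k C]
    [Coalgebra k C] (F : WithConv (C →ₗ[k] K)) :
    convPush (π : D →ₐ[k] K) (convPush (i : K →ₐ[k] D) F) = F :=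
  conv_ext fun d => h.retract (F d)

theorem pull_cvJ (h : CoinvSplitting i π θ p) :
    convPullHom i (cvJ i π) = convPush (i : K →ₐ[k] D) (cv LinearMap.id) :=
  conv_ext fun κ => congrArg i (h.retract κ)

theorem pull_cvQ (h : CoinvSplitting i π θ p) :
    convPullHom i (cvQ i π) = convPush (i : K →ₐ[k] D) (cv (antipode k)) :=
  conv_ext fun κ => congrArg (fun c => i (antipode k c)) (h.retract κ)

theorem pull_antipode : convPullHom i (cv (antipode k)) =
    convPush (i : K →ₐ[k] D) (cv (antipode k)) :=
  conv_ext fun κ => antipode_comp_bialgHom i κ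

theorem section_injective (h : CoinvSplitting i π θ p) : Function.Injective θ :=
  Function.LeftInverse.injective h.proj_section

theorem lTensor_section_injective (h : CoinvSplitting i π θ p) (M : Type*) [AddCommGroup M]
    [Module k M] : Function.Injective (θ.lTensor M) :=
  Module.Flat.lTensor_preserves_injective_linearMap _ h.section_injective

theorem map_section_injective (h : CoinvSplitting i π θ p) :
    Function.Injective (TensorProduct.map θ θ) :=
  TensorProduct.map_injective_of_flat_flat _ _ h.section_injective h.section_injective

theorem coinvProj_incl (h : CoinvSplitting i π θ p) (κ : K) :
    coinvProj (i : K →ₗ[k] D) (π : D →ₗ[k] K) (i κ) = counit (R := k) κ • 1 := by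
  show convPullHom i (cv (coinvProj (i : K →ₗ[k] D) (π : D →ₗ[k] K))) κ = _
  rw [cv_coinvProj, map_mul, h.pull_cvQ]
  exact (congrArg (fun F : WithConv (K →ₗ[k] D) => F κ) (incl_id_mul_antipode i)).trans
    (conv_one_apply κ)

/-- In the nested form of `coinvProj_mul` the inner projection of `i(κ)` is the scalar `ε(κ)`. Hence
`p` factors through the quotient of `D` by right multiplication with the augmentation ideal of
`i(K)`. -/
theorem coinvProj_mul_incl (h : CoinvSplitting i π θ p) (d : D) (κ : K) :
    coinvProj (i : K →ₗ[k] D) (π : D →ₗ[k] K) (d * i κ) =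
      counit (R := k) κ • coinvProj (i : K →ₗ[k] D) (π : D →ₗ[k] K) d := by
  rw [coinvProj_mul, h.coinvProj_incl, cst_smul, cst_one, mul_smul_comm, mul_one, smul_mul_assoc]
  rfl

/-- Pulled back along `i`, the factor `i(S(π(d₂)))` becomes `i(S(κ₂))`. So left multiplication by
`i(κ)` followed by the projection is already the adjoint action, which explains the definition of
the action on `X`. -/
theorem coinvProj_incl_mul (h : CoinvSplitting i π θ p) (κ : K) (d : D) :
    coinvProj (i : K →ₗ[k] D) (π : D →ₗ[k] K) (i κ * d) =
      cvAdj i (coinvProj (i : K →ₗ[k] D) (π : D →ₗ[k] K) d) κ := by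
  rw [coinvProj_mul, ← convPullHom_apply i, map_mul, map_mul, h.pull_cvQ, convPullHom_cst]
  rfl

theorem coinvAntipode_incl (h : CoinvSplitting i π θ p) (κ : K) :
    coinvAntipode (i : K →ₗ[k] D) (π : D →ₗ[k] K) (i κ) = counit (R := k) κ • 1 := by
  show convPullHom i (cv (coinvAntipode (i : K →ₗ[k] D) (π : D →ₗ[k] K))) κ = _
  rw [cv_coinvAntipode, map_mul, h.pull_cvJ, pull_antipode]
  exact (congrArg (fun F : WithConv (K →ₗ[k] D) => F κ) (incl_id_mul_antipode i)).trans
    (conv_one_apply κ)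

theorem coinvAntipode_mul_incl (h : CoinvSplitting i π θ p) (d : D) (κ : K) :
    coinvAntipode (i : K →ₗ[k] D) (π : D →ₗ[k] K) (d * i κ) =
      counit (R := k) κ • coinvAntipode (i : K →ₗ[k] D) (π : D →ₗ[k] K) d := by
  rw [coinvAntipode_mul, h.coinvAntipode_incl, cst_smul, cst_one, mul_smul_comm, mul_one,
    smul_mul_assoc]
  rfl

theorem coinvAntipode_incl_mul (h : CoinvSplitting i π θ p) (κ : K) (d : D) :
    coinvAntipode (i : K →ₗ[k] D) (π : D →ₗ[k] K) (i κ * d) =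
      cvAdj i (coinvAntipode (i : K →ₗ[k] D) (π : D →ₗ[k] K) d) κ := by
  rw [coinvAntipode_mul, ← convPullHom_apply i, map_mul, map_mul, h.pull_cvJ, convPullHom_cst,
    pull_antipode]
  rfl

theorem mem_coinvariants_iff (b : D) : b ∈ coinvariants (π : D →ₗ[k] K) ↔
    ((Algebra.TensorProduct.map (AlgHom.id k D) (π : D →ₐ[k] K)).comp
      (Bialgebra.comulAlgHom k D)) b = (inL : D →ₐ[k] D ⊗[k] K) b := Iff.rfl

theorem mul_mem_coinvariants {b c : D} (hb : b ∈ coinvariants (π : D →ₗ[k] K))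
    (hc : c ∈ coinvariants (π : D →ₗ[k] K)) : b * c ∈ coinvariants (π : D →ₗ[k] K) := by
  rw [mem_coinvariants_iff] at *
  rw [map_mul, map_mul, hb, hc]

theorem one_mem_coinvariants : (1 : D) ∈ coinvariants (π : D →ₗ[k] K) := by
  rw [mem_coinvariants_iff, map_one, map_one]

theorem push_coinv_id : convPush ((Algebra.TensorProduct.map (AlgHom.id k D)
    (π : D →ₐ[k] K)).comp (Bialgebra.comulAlgHom k D)) (cv LinearMap.id) =
      convPush inL (cv LinearMap.id) * convPush inR (cv (π : D →ₗ[k] K)) := by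
  rw [← convPush_convPush, convPush_comul_id, map_mul, convPush_convPush, convPush_convPush,
    map_comp_inL, map_comp_inR]; rfl

theorem push_coinv_cvQ (hr : ∀ κ, π (i κ) = κ) :
    convPush ((Algebra.TensorProduct.map (AlgHom.id k D)
      (π : D →ₐ[k] K)).comp (Bialgebra.comulAlgHom k D)) (cvQ i π) =
      convPush inR (cv (antipode k ∘ₗ (π : D →ₗ[k] K))) * convPush inL (cvQ i π) := by
  rw [← convPush_convPush, convPush_comul_cvQ, map_mul, convPush_convPush, convPush_convPush,
    map_comp_inL, map_comp_inR, ← push_cvQ hr]; rfl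

theorem cv_eq_pull_id : cv (π : D →ₗ[k] K) = convPullHom π (cv LinearMap.id) := rfl

theorem cv_antipode_comp_eq_pull :
    cv (antipode k ∘ₗ (π : D →ₗ[k] K)) = convPullHom π (cv (antipode k)) := rfl

theorem cv_eq_push_id : cv (π : D →ₗ[k] K) = convPush (π : D →ₐ[k] K) (cv LinearMap.id) := rfl

theorem cv_mul_antipode_comp : cv (π : D →ₗ[k] K) * cv (antipode k ∘ₗ (π : D →ₗ[k] K)) = 1 := by
  rw [cv_antipode_comp_eq_pull, cv_eq_pull_id, ← map_mul, cv_id_mul_antipode, map_one]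

theorem cv_antipode_comp_mul : cv (antipode k ∘ₗ (π : D →ₗ[k] K)) * cv (π : D →ₗ[k] K) = 1 := by
  rw [cv_antipode_comp_eq_pull, cv_eq_pull_id, ← map_mul, cv_antipode_mul_id, map_one]

/-- After `id ⊗ π` the second leg of the coproduct of `Π(d)` is `π(d₂) S(π(d₃))`; the reversal of
legs by the antipode makes these factors adjacent, and they cancel. Only the retraction is assumed,
because the result is needed to construct a splitting. -/
theorem coinvProj_mem_of_retract (hr : ∀ κ, π (i κ) = κ) (d : D) :
    coinvProj (i : K →ₗ[k] D) (π : D →ₗ[k] K) d ∈ coinvariants (π : D →ₗ[k] K) := by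
  rw [mem_coinvariants_iff]
  show convPush ((Algebra.TensorProduct.map (AlgHom.id k D) (π : D →ₐ[k] K)).comp
    (Bialgebra.comulAlgHom k D)) (cv (coinvProj (i : K →ₗ[k] D) (π : D →ₗ[k] K))) d =
    convPush inL (cv (coinvProj (i : K →ₗ[k] D) (π : D →ₗ[k] K))) d
  rw [cv_coinvProj, map_mul, push_coinv_id, push_coinv_cvQ hr, mul_assoc,
    ← mul_assoc (convPush inR _), ← map_mul, cv_mul_antipode_comp, map_one, one_mul, map_mul]

theorem coinvProj_mem (h : CoinvSplitting i π θ p) (d : D) :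
    coinvProj (i : K →ₗ[k] D) (π : D →ₗ[k] K) d ∈ coinvariants (π : D →ₗ[k] K) :=
  coinvProj_mem_of_retract h.retract d

theorem coinvAntipode_mem (h : CoinvSplitting i π θ p) (d : D) :
    coinvAntipode (i : K →ₗ[k] D) (π : D →ₗ[k] K) d ∈ coinvariants (π : D →ₗ[k] K) := by
  rw [mem_coinvariants_iff]
  show convPush ((Algebra.TensorProduct.map (AlgHom.id k D) (π : D →ₐ[k] K)).comp
    (Bialgebra.comulAlgHom k D)) (cv (coinvAntipode (i : K →ₗ[k] D) (π : D →ₗ[k] K))) d =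
    convPush inL (cv (coinvAntipode (i : K →ₗ[k] D) (π : D →ₗ[k] K))) d
  rw [cv_coinvAntipode, map_mul, ← convPush_convPush, ← convPush_convPush, convPush_comul_cvJ,
    convPush_comul_antipode, map_mul, map_mul]
  simp only [convPush_convPush, map_comp_inL, map_comp_inR]
  simp only [← convPush_convPush]
  rw [h.push_cvJ, mul_assoc, ← mul_assoc (convPush inR _), ← map_mul]
  -- The adjacent factors `π(d₂)` and `π(S(d₃))` of the second leg cancel.
  have e : cv (π : D →ₗ[k] K) * convPush (π : D →ₐ[k] K) (cv (antipode k)) = 1 := by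
    rw [cv_eq_push_id, ← map_mul, cv_id_mul_antipode, map_one]
  rw [e, map_one, one_mul, map_mul]
  rfl

theorem section_mem (h : CoinvSplitting i π θ p) (x : X) :
    θ x ∈ coinvariants (π : D →ₗ[k] K) := by
  rw [← h.proj_section x, h.section_proj]
  exact h.coinvProj_mem _

theorem section_proj_of_mem (h : CoinvSplitting i π θ p) {b : D}
    (hb : b ∈ coinvariants (π : D →ₗ[k] K)) : θ (p b) = b := by
  rw [h.section_proj, coinvProj_of_coinvariant i π hb]

theorem range_section (h : CoinvSplitting i π θ p) :
    LinearMap.range θ = coinvariants (π : D →ₗ[k] K) := by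
  refine le_antisymm ?_ fun b hb => ⟨p b, h.section_proj_of_mem hb⟩
  rintro _ ⟨x, rfl⟩
  exact h.section_mem x

theorem proj_mul_incl (h : CoinvSplitting i π θ p) (d : D) (κ : K) :
    p (d * i κ) = counit (R := k) κ • p d := by
  apply h.section_injective
  rw [h.section_proj, h.coinvProj_mul_incl, map_smul, h.section_proj]

theorem section_proj_incl_mul (h : CoinvSplitting i π θ p) (κ : K) (x : X) :
    θ (p (i κ * θ x)) = cvAdj i (θ x) κ := by
  rw [h.section_proj, h.coinvProj_incl_mul, coinvProj_of_coinvariant i π (h.section_mem x)]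

/-- The value of `p` on `i(κ) d` depends on `d` only through `p(d)`. This gives the associativity of
the induced action. -/
theorem proj_incl_mul (h : CoinvSplitting i π θ p) (κ : K) (d : D) :
    p (i κ * θ (p d)) = p (i κ * d) := by
  apply h.section_injective
  rw [h.section_proj_incl_mul, h.section_proj, h.section_proj, h.coinvProj_incl_mul]

/-- The right factor of `Π(d)` lies in `i(K)` and is absorbed by the counit. -/
theorem counit_coinvProj (d : D) :
    counit (R := k) (coinvProj (i : K →ₗ[k] D) (π : D →ₗ[k] K) d) = counit (R := k) d := by
  show (counit (R := k) (A := D)) ((cv LinearMap.id * cvQ i π : WithConv (D →ₗ[k] D)) d) = _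
  refine conv_absorb (counit (R := k) (A := D)) _ _ (fun a c => ?_) d
  show counit (R := k) (a * i (antipode k (π c))) = _
  rw [Bialgebra.counit_mul, CoalgHomClass.counit_comp_apply, HopfAlgebra.counit_antipode,
    CoalgHomClass.counit_comp_apply, smul_eq_mul, mul_comm]

theorem counit_section_proj (h : CoinvSplitting i π θ p) (d : D) :
    counit (R := k) (θ (p d)) = counit (R := k) d := by
  rw [h.section_proj, counit_coinvProj]

/-- Projecting the second leg appends `i(S(π(b₃)))`, a function of `π` of the last leg, which is
trivial by coinvariance. So the coproduct maps the coinvariants `B` into `D ⊗ B`. -/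
theorem lTensor_coinvProj_comul {b : D} (hb : b ∈ coinvariants (π : D →ₗ[k] K)) :
    (coinvProj (i : K →ₗ[k] D) (π : D →ₗ[k] K)).lTensor D (comul (R := k) b) = comul b := by
  have e0 : (coinvProj (i : K →ₗ[k] D) (π : D →ₗ[k] K)).lTensor D =
    TensorProduct.map (cv LinearMap.id : WithConv (D →ₗ[k] D)).ofConv
      (cv (coinvProj (i : K →ₗ[k] D) (π : D →ₗ[k] K))).ofConv := rfl
  rw [e0, map_comul_eq, cv_coinvProj, map_mul, ← mul_assoc, ← convPush_comul_id]
  have e : (convPush inR (cvQ i π) : WithConv (D →ₗ[k] D ⊗[k] D)) =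
      convPullHom π (convPush inR (convPush (i : K →ₐ[k] D) (cv (antipode k)))) := rfl
  rw [e, conv_mul_pull_of_coinvariant π hb]
  show comul (R := k) b * ((1 : D) ⊗ₜ[k] i (antipode k 1)) = _
  rw [antipode_one, map_one]
  exact mul_one _

theorem map_counit_comul (κ : K) : LinearMap.mul' k k (TensorProduct.map (counit (R := k))
    (counit (R := k)) (comul (R := k) κ)) = counit (R := k) κ :=
  congrArg (fun F : WithConv (K →ₗ[k] k) => F κ) (one_mul (1 : WithConv (K →ₗ[k] k)))

/-- Leg by leg, `p ⊗ p` absorbs `i(κ₁) ⊗ i(κ₂)` into counits. -/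
theorem map_proj_mul_comul_incl (h : CoinvSplitting i π θ p) (t : D ⊗[k] D) (κ : K) :
    TensorProduct.map p p (t * comul (R := k) (i κ)) =
      counit (R := k) κ • TensorProduct.map p p t := by
  rw [← map_counit_comul κ, ← CoalgHomClass.map_comp_comul_apply i]
  induction t using TensorProduct.induction_on with
  | zero => simp
  | add u v hu hv => simp only [add_mul, map_add, smul_add, hu, hv]
  | tmul a b =>
    induction comul (R := k) κ using TensorProduct.induction_on with
    | zero => simp
    | add u v hu hv => simp only [mul_add, map_add, add_smul, hu, hv]
    | tmul c d =>
      rw [TensorProduct.map_tmul, TensorProduct.map_tmul, Algebra.TensorProduct.tmul_mul_tmul,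
        TensorProduct.map_tmul, TensorProduct.map_tmul]
      refine (congrArg₂ _ (h.proj_mul_incl a c) (h.proj_mul_incl b d)).trans ?_
      rw [LinearMap.mul'_apply, TensorProduct.smul_tmul_smul]

/-- `Π(d)` is `d₁` times a right factor in `i(K)`, whose coproduct is invisible to `p ⊗ p`. Hence
the coproduct of `D` descends along `p`, and coassociativity and the action on coproducts can be
read off in `D`. -/
theorem map_proj_comul_section_proj (h : CoinvSplitting i π θ p) (d : D) :
    TensorProduct.map p p (comul (R := k) (θ (p d))) =
      TensorProduct.map p p (comul (R := k) d) := by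
  rw [h.section_proj]
  show TensorProduct.map p p (convPush (Bialgebra.comulAlgHom k D)
    (cv LinearMap.id * cvQ i π) d) = _
  rw [map_mul]
  refine conv_absorb (TensorProduct.map p p) _ _ (fun a c => ?_) d
  refine (h.map_proj_mul_comul_incl a (antipode k (π c))).trans ?_
  rw [HopfAlgebra.counit_antipode, CoalgHomClass.counit_comp_apply]

/-- The second leg of the coproduct of a coinvariant is already coinvariant, so only the first leg
needs projecting. -/
theorem map_section_map_proj_comul (h : CoinvSplitting i π θ p) (x : X) :
    TensorProduct.map θ θ (TensorProduct.map p p (comul (R := k) (θ x))) =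
      (coinvProj (i : K →ₗ[k] D) (π : D →ₗ[k] K)).rTensor D (comul (R := k) (θ x)) := by
  have e : θ ∘ₗ p = coinvProj (i : K →ₗ[k] D) (π : D →ₗ[k] K) := LinearMap.ext h.section_proj
  rw [← LinearMap.comp_apply, ← TensorProduct.map_comp, e, ← LinearMap.rTensor_comp_lTensor,
    LinearMap.comp_apply, lTensor_coinvProj_comul (h.section_mem x)]

theorem lTensor_section_map_proj (h : CoinvSplitting i π θ p) (x : X) :
    θ.lTensor K (TensorProduct.map (π : D →ₗ[k] K) p (comul (R := k) (θ x))) =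
      coactHom π (θ x) := by
  have e : θ ∘ₗ p = coinvProj (i : K →ₗ[k] D) (π : D →ₗ[k] K) := LinearMap.ext h.section_proj
  rw [← LinearMap.comp_apply, LinearMap.lTensor_comp_map, e, ← LinearMap.rTensor_comp_lTensor,
    LinearMap.comp_apply, lTensor_coinvProj_comul (h.section_mem x), coactHom_apply]

end CoinvSplitting

end RadfordProjection

/-! ### The induced Yetter–Drinfeld module -/

namespace CoinvSplitting

variable {k K D : Type*} [Field k] [Ring K] [HopfAlgebra k K] [Ring D] [HopfAlgebra k D]
variable {i : K →ₐc[k] D} {π : D →ₐc[k] K}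
variable {X : Type*} [AddCommGroup X] [Module k X] {θ : X →ₗ[k] D} {p : D →ₗ[k] X}

/-- The action and coaction of `K` on `X` transported from the coinvariants. -/
def inducedModComod (_h : CoinvSplitting i π θ p) : ModComod k K X where
  act := ((LinearMap.mul k D).compl₁₂ (i : K →ₗ[k] D) θ).compr₂ p
  coact := TensorProduct.map (π : D →ₗ[k] K) p ∘ₗ comul ∘ₗ θ

variable (h : CoinvSplitting i π θ p)

theorem act_apply (κ : K) (x : X) : h.inducedModComod.act κ x = p (i κ * θ x) := rfl

theorem act_proj (κ : K) (d : D) : h.inducedModComod.act κ (p d) = p (i κ * d) :=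
  h.proj_incl_mul κ d

theorem section_act (κ : K) (x : X) : θ (h.inducedModComod.act κ x) = cvAdj i (θ x) κ :=
  h.section_proj_incl_mul κ x

theorem section_coact (x : X) : θ.lTensor K (h.inducedModComod.coact x) = coactHom π (θ x) :=
  h.lTensor_section_map_proj x

/-- The coaction is an algebra map, so on `i(κ₁) b i(S(κ₂))` it gives `(κ₁ ⊗ i(κ₂)) (b₋₁ ⊗ b₀)
(S(κ₄) ⊗ i(S(κ₃)))`. The trailing `S(κ₄)` is what the Yetter–Drinfeld condition cancels. -/
theorem convPush_coactHom_cvAdj (h : CoinvSplitting i π θ p) (b : D) : convPush (coactHom π) (cvAdj i b) =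
    convPush inL (cv LinearMap.id) * convPush inR (convPush (i : K →ₐ[k] D) (cv LinearMap.id)) *
      cst K (coactHom π b) * (convPush inR (convPush (i : K →ₐ[k] D) (cv (antipode k))) *
        convPush inL (cv (antipode k))) := by
  rw [cvAdj, map_mul, map_mul, convPush_cst]
  simp only [convPush_coactHom, convPush_comul_incl_id, convPush_comul_incl_antipode, map_mul,
    convPush_map_inL, convPush_map_inR, h.push_incl]

/-- This writes one side of the Yetter–Drinfeld condition as a convolution product in `K ⊗ D`. On a
pure tensor `c ⊗ x` the constant splits into `c ⊗ 1` and `1 ⊗ θ(x)`, and the first commutes with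
everything in the second leg. -/
theorem lTensor_section_smash (κ : K) (t : K ⊗[k] X) :
    θ.lTensor K (TensorProduct.map (LinearMap.mul' k K) (TensorProduct.lift h.inducedModComod.act)
      (TensorProduct.tensorTensorTensorComm k K K K X (comul (R := k) κ ⊗ₜ t))) =
    (convPush inL (cv LinearMap.id) * convPush inR (convPush (i : K →ₐ[k] D) (cv LinearMap.id)) *
      cst K (θ.lTensor K t) * convPush inR (convPush (i : K →ₐ[k] D) (cv (antipode k))) :
        WithConv (K →ₗ[k] K ⊗[k] D)) κ := by
  induction t using TensorProduct.induction_on with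
  | zero =>
    rw [TensorProduct.tmul_zero, map_zero, map_zero, map_zero]
    have : (cst K (0 : K ⊗[k] D) : WithConv (K →ₗ[k] K ⊗[k] D)) = 0 :=
      conv_ext fun c => smul_zero _
    rw [this, mul_zero, zero_mul]; rfl
  | add u v hu hv =>
    rw [TensorProduct.tmul_add]
    simp only [map_add, hu, hv, cst_add, mul_add, add_mul]
    rfl
  | tmul c x =>
    rw [LinearMap.lTensor_tmul]
    have e1 : (cst K (c ⊗ₜ[k] θ x) : WithConv (K →ₗ[k] K ⊗[k] D)) =
        cst K ((inL : K →ₐ[k] K ⊗[k] D) c) * cst K ((inR : D →ₐ[k] K ⊗[k] D) (θ x)) := by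
      rw [cst_mul_cst]; congr 1; simp
    have e2 : convPush inR (convPush (i : K →ₐ[k] D) (cv LinearMap.id)) *
        cst K ((inL : K →ₐ[k] K ⊗[k] D) c) = cst K ((inL : K →ₐ[k] K ⊗[k] D) c) *
          convPush inR (convPush (i : K →ₐ[k] D) (cv LinearMap.id)) :=
      (cst_commute _ _ fun κ' => by
        rw [convPush_apply]; simp).symm
    rw [e1, ← mul_assoc, mul_assoc (convPush inL _), e2, ← mul_assoc, ← convPush_cst,
      ← convPush_cst, mul_assoc, mul_assoc, ← map_mul, ← map_mul, ← map_mul, ← mul_assoc, ← cvAdj,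
      ← map_comul_eq, mul_cst_eq]
    induction comul (R := k) κ using TensorProduct.induction_on with
    | zero => simp
    | add u v hu hv => simp only [TensorProduct.add_tmul, map_add, hu, hv]
    | tmul a b =>
      exact congrArg (fun z => (a * c) ⊗ₜ[k] z) (h.section_act b x)

/-- In the other side of the Yetter–Drinfeld condition, the factor `κ₂` on the right of the first
leg is a convolution with `κ ↦ κ ⊗ 1`. -/
theorem lTensor_section_smash' (κ : K) (x : X) :
    θ.lTensor K ((LinearMap.mul' k K).rTensor X (TensorProduct.rightComm k K X K
      ((h.inducedModComod.coact ∘ₗ h.inducedModComod.act.flip x).rTensor K (comul (R := k) κ)))) =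
    (convPush (coactHom π) (cvAdj i (θ x)) * convPush inL (cv LinearMap.id) :
      WithConv (K →ₗ[k] K ⊗[k] D)) κ := by
  rw [conv_mul_apply]
  have e : ∀ (t : K ⊗[k] X) (b : K), θ.lTensor K ((LinearMap.mul' k K).rTensor X
      (TensorProduct.rightComm k K X K (t ⊗ₜ b))) = θ.lTensor K t * (b ⊗ₜ 1) := by
    intro t b
    induction t using TensorProduct.induction_on with
    | zero => simp
    | add u v hu hv => simp only [TensorProduct.add_tmul, map_add, add_mul, hu, hv]
    | tmul c x => simp
  induction comul (R := k) κ using TensorProduct.induction_on with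
  | zero => simp
  | add u v hu hv => simp only [map_add, hu, hv]
  | tmul a b =>
    rw [LinearMap.rTensor_tmul, e, LinearMap.comp_apply, LinearMap.flip_apply, h.section_coact,
      h.section_act]
    rfl

theorem isYetterDrinfeld : h.inducedModComod.IsYetterDrinfeld where
  one_act x := by rw [act_apply, map_one, one_mul, h.proj_section]
  mul_act κ κ' x := by rw [h.act_apply κ' x, h.act_proj, act_apply, map_mul i, mul_assoc]
  coassoc x := by
    -- Over a field `θ` stays injective after tensoring, so identities on `X` may be checked on the
    -- coinvariants inside `D`.
    apply (TensorProduct.map_injective_of_flat_flat (LinearMap.id (R := k) (M := K)) (θ.lTensor K)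
      Function.injective_id (h.lTensor_section_injective K))
    have e1 : ∀ t : K ⊗[k] X, TensorProduct.map LinearMap.id (θ.lTensor K)
        (TensorProduct.assoc k K K X ((comul (R := k)).rTensor X t)) =
        TensorProduct.assoc k K K D ((comul (R := k)).rTensor D (θ.lTensor K t)) := by
      intro t
      induction t using TensorProduct.induction_on with
      | zero => simp
      | add u v hu hv => simp only [map_add, hu, hv]
      | tmul a b =>
        simp only [LinearMap.rTensor_tmul, LinearMap.lTensor_tmul]
        induction comul (R := k) a using TensorProduct.induction_on with
        | zero => simp
        | add u v hu hv => simp only [TensorProduct.add_tmul, map_add, hu, hv]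
        | tmul c d => simp
    have e2 : ∀ t : K ⊗[k] X, TensorProduct.map LinearMap.id (θ.lTensor K)
        (h.inducedModComod.coact.lTensor K t) =
        (coactHom π).toLinearMap.lTensor K (θ.lTensor K t) := by
      intro t
      induction t using TensorProduct.induction_on with
      | zero => simp
      | add u v hu hv => simp only [map_add, hu, hv]
      | tmul a b =>
        rw [LinearMap.lTensor_tmul, TensorProduct.map_tmul, h.section_coact]; rfl
    rw [e1, e2, h.section_coact, coactHom_coassoc]
  counit_coact x := by
    apply h.section_injective
    have e : ∀ t : K ⊗[k] X, θ (TensorProduct.lid k X ((counit (R := k)).rTensor X t)) =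
        TensorProduct.lid k D ((counit (R := k)).rTensor D (θ.lTensor K t)) := by
      intro t
      induction t using TensorProduct.induction_on with
      | zero => simp
      | add u v hu hv => simp only [map_add, hu, hv]
      | tmul a b => simp
    have e2 : (counit (R := k)) ∘ₗ (π : D →ₗ[k] K) = counit :=
      CoalgHomClass.counit_comp π
    rw [e, h.section_coact, coactHom_apply, ← LinearMap.rTensor_comp_apply, e2,
      Coalgebra.rTensor_counit_comul, TensorProduct.lid_tmul, one_smul]
  compat κ x := by
    apply h.lTensor_section_injective K
    -- The trailing `S(κ₄)` of the coaction meets the extra factor `κ₅` in the first leg.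
    have e : convPush inL (cv (antipode k)) * convPush inL (cv LinearMap.id) =
        (1 : WithConv (K →ₗ[k] K ⊗[k] D)) := by rw [← map_mul, cv_antipode_mul_id, map_one]
    rw [h.lTensor_section_smash, h.lTensor_section_smash', h.section_coact,
      h.convPush_coactHom_cvAdj, mul_assoc _ (_ * _) (convPush inL _),
      mul_assoc (convPush inR _), e, mul_one]

end CoinvSplitting

/-! ### The structure maps are linear and colinear -/

namespace CoinvSplitting

variable {k K D : Type*} [Field k] [Ring K] [HopfAlgebra k K] [Ring D] [HopfAlgebra k D]
variable {i : K →ₐc[k] D} {π : D →ₐc[k] K}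
variable {X : Type*} [AddCommGroup X] [Module k X] {θ : X →ₗ[k] D} {p : D →ₗ[k] X}

/-- The product of `X` transported from the coinvariants. -/
def inducedMul (_h : CoinvSplitting i π θ p) : X →ₗ[k] X →ₗ[k] X :=
  ((LinearMap.mul k D).compl₁₂ θ θ).compr₂ p

/-- The coproduct of `X` transported from the coinvariants. -/
def inducedComul (_h : CoinvSplitting i π θ p) : X →ₗ[k] X ⊗[k] X :=
  TensorProduct.map p p ∘ₗ comul ∘ₗ θ

/-- The antipode of `X` transported from the coinvariants. -/
def inducedAntipode (_h : CoinvSplitting i π θ p) : X →ₗ[k] X :=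
  p ∘ₗ coinvAntipode (i : K →ₗ[k] D) (π : D →ₗ[k] K) ∘ₗ θ

variable (h : CoinvSplitting i π θ p)

theorem section_mul (x y : X) : θ (h.inducedMul x y) = θ x * θ y :=
  h.section_proj_of_mem (mul_mem_coinvariants (h.section_mem x) (h.section_mem y))

theorem section_antipode (x : X) : θ (h.inducedAntipode x) =
    coinvAntipode (i : K →ₗ[k] D) (π : D →ₗ[k] K) (θ x) :=
  h.section_proj_of_mem (h.coinvAntipode_mem _)

theorem comul_proj (d : D) :
    h.inducedComul (p d) = TensorProduct.map p p (comul (R := k) d) :=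
  h.map_proj_comul_section_proj d

theorem map_section_comul (x : X) : TensorProduct.map θ θ (h.inducedComul x) =
    (coinvProj (i : K →ₗ[k] D) (π : D →ₗ[k] K)).rTensor D (comul (R := k) (θ x)) :=
  h.map_section_map_proj_comul x

theorem rTensor_comul_eq {A : Type*} [Ring A] [Algebra k A] (F : WithConv (D →ₗ[k] A)) (d : D) :
    F.ofConv.rTensor D (comul (R := k) d) =
      (convPush inL F * convPush inR (cv LinearMap.id) : WithConv (D →ₗ[k] A ⊗[k] D)) d :=
  map_comul_eq F (cv LinearMap.id) d

theorem section_one (h : CoinvSplitting i π θ p) : θ (p 1) = 1 := h.section_proj_of_mem one_mem_coinvariants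

/-- Linearity is the module algebra property `cvAdj_mul_cvAdj`; colinearity holds because `d ↦ π(d₁)
⊗ d₂` is an algebra map. -/
theorem isHom_mul : (h.inducedModComod.tensor h.inducedModComod).IsHom h.inducedModComod
    (TensorProduct.lift h.inducedMul) where
  act κ m := by
    induction m using TensorProduct.induction_on with
    | zero => simp
    | add u v hu hv => simp only [map_add, hu, hv]
    | tmul x y =>
      apply h.section_injective
      rw [h.section_act, TensorProduct.lift.tmul, h.section_mul, ← cvAdj_mul_cvAdj, conv_mul_apply]
      show θ (TensorProduct.lift h.inducedMul (TensorProduct.lift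
        (TensorProduct.mapBilinear (RingHom.id k) X X X X) (TensorProduct.map h.inducedModComod.act
          h.inducedModComod.act (comul (R := k) κ)) (x ⊗ₜ y))) = _
      induction comul (R := k) κ using TensorProduct.induction_on with
      | zero => simp
      | add u v hu hv => simp only [map_add, LinearMap.add_apply, hu, hv]
      | tmul a b =>
        refine (h.section_mul _ _).trans ?_
        exact congrArg₂ _ (h.section_act a x) (h.section_act b y)
  coact m := by
    induction m using TensorProduct.induction_on with
    | zero => simp
    | add u v hu hv => simp only [map_add, hu, hv]
    | tmul x y =>
      apply h.lTensor_section_injective K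
      rw [TensorProduct.lift.tmul, h.section_coact, h.section_mul, map_mul, ← h.section_coact,
        ← h.section_coact]
      show θ.lTensor K ((TensorProduct.lift h.inducedMul).lTensor K
        ((LinearMap.mul' k K).rTensor (X ⊗[k] X) (TensorProduct.tensorTensorTensorComm k K X K X
          (h.inducedModComod.coact x ⊗ₜ h.inducedModComod.coact y)))) = _
      induction h.inducedModComod.coact x using TensorProduct.induction_on with
      | zero => simp
      | add u v hu hv => simp only [TensorProduct.add_tmul, map_add, hu, hv, add_mul]
      | tmul a b =>
        induction h.inducedModComod.coact y using TensorProduct.induction_on with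
        | zero => simp
        | add u v hu hv => simp only [TensorProduct.tmul_add, map_add, hu, hv, mul_add]
        | tmul c d =>
          refine (congrArg (fun z => (a * c) ⊗ₜ[k] z) (h.section_mul b d)).trans ?_
          rw [LinearMap.lTensor_tmul, LinearMap.lTensor_tmul, Algebra.TensorProduct.tmul_mul_tmul]

theorem isHom_one : (ModComod.unit k K).IsHom h.inducedModComod
    (LinearMap.toSpanSingleton k X (p 1)) where
  act κ r := by
    show (counit (R := k) κ * r) • p 1 = h.inducedModComod.act κ (r • p 1)
    rw [map_smul, h.act_proj, mul_one, ← one_mul (i κ), h.proj_mul_incl, smul_smul, mul_comm]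
  coact r := by
    apply h.lTensor_section_injective K
    show θ.lTensor K ((LinearMap.toSpanSingleton k X (p 1)).lTensor K ((1 : K) ⊗ₜ[k] r)) =
      θ.lTensor K (h.inducedModComod.coact (r • p 1))
    rw [h.section_coact, map_smul, h.section_one, map_smul, map_one (coactHom π), LinearMap.lTensor_tmul,
      LinearMap.lTensor_tmul, LinearMap.toSpanSingleton_apply, map_smul, h.section_one,
      TensorProduct.tmul_smul]
    rfl

/-- Both sides are `p(i(κ₁) d₁) ⊗ p(i(κ₂) d₂)` with `d = θ(x)`, since the coproduct and left
multiplication by `i(K)` descend along `p`. -/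
theorem isHom_comul_act (κ : K) (x : X) : h.inducedComul (h.inducedModComod.act κ x) =
    (h.inducedModComod.tensor h.inducedModComod).act κ (h.inducedComul x) := by
  rw [act_apply, h.comul_proj, Bialgebra.comul_mul, ← CoalgHomClass.map_comp_comul_apply i]
  show _ = TensorProduct.lift (TensorProduct.mapBilinear (RingHom.id k) X X X X)
    (TensorProduct.map h.inducedModComod.act h.inducedModComod.act (comul (R := k) κ))
      (TensorProduct.map p p (comul (R := k) (θ x)))
  induction comul (R := k) κ using TensorProduct.induction_on with
  | zero => simp
  | add u v hu hv => simp only [add_mul, map_add, LinearMap.add_apply, hu, hv]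
  | tmul a b =>
    induction comul (R := k) (θ x) using TensorProduct.induction_on with
    | zero => simp
    | add u v hu hv => simp only [mul_add, map_add, hu, hv]
    | tmul c d =>
      rw [TensorProduct.map_tmul, Algebra.TensorProduct.tmul_mul_tmul, TensorProduct.map_tmul]
      exact (congrArg₂ _ (h.act_proj a c) (h.act_proj b d)).symm

/-- The inclusion `κ ⊗ d ↦ κ ⊗ (d ⊗ 1)`. -/
def inLL : K ⊗[k] D →ₐ[k] K ⊗[k] (D ⊗[k] D) := Algebra.TensorProduct.map (AlgHom.id k K) inL

/-- The inclusion `κ ⊗ d ↦ κ ⊗ (1 ⊗ d)`. -/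
def inLR : K ⊗[k] D →ₐ[k] K ⊗[k] (D ⊗[k] D) := Algebra.TensorProduct.map (AlgHom.id k K) inR

/-- The correction factor of `Π` contributes `S(π(d₃))` to the first leg: `Π` intertwines the
coadjoint coaction `d ↦ π(d₁) S(π(d₃)) ⊗ d₂` with the coaction on coinvariants. -/
theorem convPush_coactHom_coinvProj (h : CoinvSplitting i π θ p) :
    convPush (coactHom π) (cv (coinvProj (i : K →ₗ[k] D) (π : D →ₗ[k] K))) =
      convPush inL (cv (π : D →ₗ[k] K)) *
        convPush inR (cv (coinvProj (i : K →ₗ[k] D) (π : D →ₗ[k] K))) *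
          convPush inL (cv (antipode k ∘ₗ (π : D →ₗ[k] K))) := by
  rw [cv_coinvProj, map_mul, map_mul, convPush_coactHom_id, convPush_coactHom, convPush_comul_cvQ,
    map_mul, convPush_map_inL, convPush_map_inR, push_cvQ h.retract]
  simp only [mul_assoc]

theorem lTensor_section_tensor_coact (s : X ⊗[k] X) : (TensorProduct.map θ θ).lTensor K
    ((h.inducedModComod.tensor h.inducedModComod).coact s) =
    LinearMap.mul' k (K ⊗[k] (D ⊗[k] D)) (TensorProduct.map
      (inLL.toLinearMap ∘ₗ (coactHom π).toLinearMap) (inLR.toLinearMap ∘ₗ (coactHom π).toLinearMap)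
        (TensorProduct.map θ θ s)) := by
  induction s using TensorProduct.induction_on with
  | zero => simp
  | add u v hu hv => simp only [map_add, hu, hv]
  | tmul x y =>
    rw [TensorProduct.map_tmul, TensorProduct.map_tmul, LinearMap.mul'_apply]
    show (TensorProduct.map θ θ).lTensor K ((LinearMap.mul' k K).rTensor (X ⊗[k] X)
      (TensorProduct.tensorTensorTensorComm k K X K X
        (h.inducedModComod.coact x ⊗ₜ h.inducedModComod.coact y))) =
      inLL (coactHom π (θ x)) * inLR (coactHom π (θ y))
    rw [← h.section_coact, ← h.section_coact]
    induction h.inducedModComod.coact x using TensorProduct.induction_on with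
    | zero => simp
    | add u v hu hv => simp only [TensorProduct.add_tmul, map_add, hu, hv, add_mul]
    | tmul a b =>
      induction h.inducedModComod.coact y using TensorProduct.induction_on with
      | zero => simp
      | add u v hu hv => simp only [TensorProduct.tmul_add, map_add, hu, hv, mul_add]
      | tmul c d => simp [inLL, inLR]

/-- The codiagonal coaction of `Π(d₁) ⊗ d₂` has first leg `π(d₁) S(π(d₃)) π(d₄)`. The last two
factors cancel, which leaves `π(d₁) ⊗ Π(d₂) ⊗ d₃`, the coaction followed by the coproduct. -/
theorem isHom_comul_coact (x : X) : h.inducedComul.lTensor K (h.inducedModComod.coact x) =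
    (h.inducedModComod.tensor h.inducedModComod).coact (h.inducedComul x) := by
  have hinj : Function.Injective ((TensorProduct.map θ θ).lTensor K) :=
    Module.Flat.lTensor_preserves_injective_linearMap _ h.map_section_injective
  apply hinj
  rw [h.lTensor_section_tensor_coact, h.map_section_comul]
  let G : WithConv (D →ₗ[k] D ⊗[k] D) :=
    convPush inL (cv (coinvProj (i : K →ₗ[k] D) (π : D →ₗ[k] K))) *
      convPush inR (cv LinearMap.id)
  have e1 : ∀ t : K ⊗[k] X, (TensorProduct.map θ θ).lTensor K (h.inducedComul.lTensor K t) =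
      G.ofConv.lTensor K (θ.lTensor K t) := by
    intro t
    induction t using TensorProduct.induction_on with
    | zero => simp
    | add u v hu hv => simp only [map_add, hu, hv]
    | tmul a b =>
      rw [LinearMap.lTensor_tmul, LinearMap.lTensor_tmul, LinearMap.lTensor_tmul,
        LinearMap.lTensor_tmul, h.map_section_comul]
      exact congrArg (fun z => a ⊗ₜ[k] z) (rTensor_comul_eq
        (cv (coinvProj (i : K →ₗ[k] D) (π : D →ₗ[k] K))) (θ b))
  rw [e1, h.section_coact, coactHom_apply, ← LinearMap.comp_apply, LinearMap.lTensor_comp_rTensor,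
    ← LinearMap.comp_apply (TensorProduct.map (inLL.toLinearMap ∘ₗ _) _),
    LinearMap.map_comp_rTensor]
  have e2 := map_comul_eq (cv (π : D →ₗ[k] K)) G (θ x)
  refine e2.trans ?_
  show _ = (convPush inLL (convPush (coactHom π) (cv (coinvProj (i : K →ₗ[k] D) (π : D →ₗ[k] K)))) *
    convPush inLR (convPush (coactHom π) (cv LinearMap.id)) :
      WithConv (D →ₗ[k] K ⊗[k] (D ⊗[k] D))) (θ x)
  have a1 : (inLL : K ⊗[k] D →ₐ[k] K ⊗[k] (D ⊗[k] D)).comp inL = inL :=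
    map_comp_inL (AlgHom.id k K) _
  have a2 : (inLL : K ⊗[k] D →ₐ[k] K ⊗[k] (D ⊗[k] D)).comp inR = inR.comp inL :=
    map_comp_inR (AlgHom.id k K) _
  have a3 : (inLR : K ⊗[k] D →ₐ[k] K ⊗[k] (D ⊗[k] D)).comp inL = inL :=
    map_comp_inL (AlgHom.id k K) _
  have a4 : (inLR : K ⊗[k] D →ₐ[k] K ⊗[k] (D ⊗[k] D)).comp inR = inR.comp inR :=
    map_comp_inR (AlgHom.id k K) _
  have e3 : convPush inL (cv (antipode k ∘ₗ (π : D →ₗ[k] K))) * convPush inL (cv (π : D →ₗ[k] K)) =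
      (1 : WithConv (D →ₗ[k] K ⊗[k] (D ⊗[k] D))) := by
    rw [← map_mul, cv_antipode_comp_mul, map_one]
  have e4 : (convPush inR G : WithConv (D →ₗ[k] K ⊗[k] (D ⊗[k] D))) =
      convPush (inR.comp inL) (cv (coinvProj (i : K →ₗ[k] D) (π : D →ₗ[k] K))) *
        convPush (inR.comp inR) (cv LinearMap.id) := map_mul _ _ _
  rw [h.convPush_coactHom_coinvProj, convPush_coactHom_id, e4]
  simp only [map_mul, convPush_convPush, a1, a2, a3, a4]
  rw [mul_assoc _ (convPush inL _) (_ * _), ← mul_assoc (convPush inL _) (convPush inL _) _,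
    e3, one_mul, mul_assoc]

/-- Colinearity reduces to `π(b) = ε(b) 1` for a coinvariant `b`. -/
theorem isHom_counit : h.inducedModComod.IsHom (ModComod.unit k K) (counit (R := k) ∘ₗ θ) where
  act κ x := by
    show counit (R := k) (θ (p (i κ * θ x))) = counit (R := k) κ * counit (R := k) (θ x)
    rw [h.counit_section_proj, Bialgebra.counit_mul, CoalgHomClass.counit_comp_apply]
  coact x := by
    rw [LinearMap.lTensor_comp_apply, h.section_coact, coactHom_apply, ← LinearMap.comp_apply,
      LinearMap.lTensor_comp_rTensor, ← LinearMap.rTensor_comp_lTensor, LinearMap.comp_apply,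
      Coalgebra.lTensor_counit_comul, LinearMap.rTensor_tmul]
    show π (θ x) ⊗ₜ[k] (1 : k) = (1 : K) ⊗ₜ[k] (counit (R := k) (θ x))
    rw [map_of_coinvariant π (h.section_mem x), TensorProduct.smul_tmul, smul_eq_mul, mul_one]

/-- The map `b ↦ i(π(b₁)) S(b₂)` absorbs right factors in `i(K)` and is equivariant for left ones,
so applying it to `i(κ₁) b i(S(κ₂))` leaves the adjoint action. -/
theorem isHom_antipode : h.inducedModComod.IsHom h.inducedModComod h.inducedAntipode where
  act κ x := by
    apply h.section_injective
    rw [h.section_antipode, h.section_act, h.section_act, h.section_antipode,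
      ← h.coinvAntipode_incl_mul, cvAdj, conv_absorb, mul_cst_apply]
    · rfl
    · intro a c
      refine (h.coinvAntipode_mul_incl a (antipode k c)).trans ?_
      rw [HopfAlgebra.counit_antipode]
  coact x := by
    apply h.lTensor_section_injective K
    have e1 : ∀ t : K ⊗[k] X, θ.lTensor K (h.inducedAntipode.lTensor K t) =
        (coinvAntipode (i : K →ₗ[k] D) (π : D →ₗ[k] K)).lTensor K (θ.lTensor K t) := by
      intro t
      induction t using TensorProduct.induction_on with
      | zero => simp
      | add u v hu hv => simp only [map_add, hu, hv]
      | tmul a b =>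
        rw [LinearMap.lTensor_tmul, LinearMap.lTensor_tmul, LinearMap.lTensor_tmul,
          LinearMap.lTensor_tmul, h.section_antipode]
    rw [e1, h.section_coact, h.section_coact, h.section_antipode, coactHom_apply,
      ← LinearMap.comp_apply, LinearMap.lTensor_comp_rTensor]
    have e2 := map_comul_eq (cv (π : D →ₗ[k] K))
      (cv (coinvAntipode (i : K →ₗ[k] D) (π : D →ₗ[k] K))) (θ x)
    refine e2.trans ?_
    -- The coaction of `i(π(d₁)) S(d₂)` has `π(S(d₃)) = S(π(d₃))` as trailing factor; on a
    -- coinvariant this last leg is evaluated at `1`.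
    have e3 : convPush (coactHom π) (cv (coinvAntipode (i : K →ₗ[k] D) (π : D →ₗ[k] K))) =
        convPush inL (cv (π : D →ₗ[k] K)) *
          convPush inR (cv (coinvAntipode (i : K →ₗ[k] D) (π : D →ₗ[k] K))) *
        convPullHom π (convPush inL (cv (antipode k))) := by
      have e4 : convPullHom π (convPush inL (cv (antipode k))) =
          (convPush inL (convPush (π : D →ₐ[k] K) (cv (antipode k))) :
            WithConv (D →ₗ[k] K ⊗[k] D)) :=
        conv_ext fun d => congrArg (inL : K →ₐ[k] K ⊗[k] D) (antipode_comp_bialgHom π d)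
      rw [e4, cv_coinvAntipode, map_mul, map_mul, convPush_coactHom, convPush_coactHom,
        convPush_comul_cvJ, convPush_comul_antipode, map_mul, map_mul, convPush_map_inL,
        convPush_map_inR, convPush_map_inL, convPush_map_inR, h.push_cvJ]
      simp only [mul_assoc]
    have e5 : coactHom π (coinvAntipode (i : K →ₗ[k] D) (π : D →ₗ[k] K) (θ x)) =
        convPush (coactHom π) (cv (coinvAntipode (i : K →ₗ[k] D) (π : D →ₗ[k] K))) (θ x) := rfl
    rw [e5, e3, conv_mul_pull_of_coinvariant π (h.section_mem x)]
    have e6 : (convPush inL (cv (antipode k)) : WithConv (K →ₗ[k] K ⊗[k] D)) 1 = 1 := by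
      rw [convPush_apply, cv_apply, antipode_one, map_one]
    rw [e6, mul_one]

end CoinvSplitting

/-! ### The braided Hopf algebra axioms -/

namespace CoinvSplitting

variable {k K D : Type*} [Field k] [Ring K] [HopfAlgebra k K] [Ring D] [HopfAlgebra k D]
variable {i : K →ₐc[k] D} {π : D →ₐc[k] K}
variable {X : Type*} [AddCommGroup X] [Module k X] {θ : X →ₗ[k] D} {p : D →ₗ[k] X}

theorem coinvAntipode_coinvProj (h : CoinvSplitting i π θ p) (d : D) :
    coinvAntipode (i : K →ₗ[k] D) (π : D →ₗ[k] K)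
      (coinvProj (i : K →ₗ[k] D) (π : D →ₗ[k] K) d) =
        coinvAntipode (i : K →ₗ[k] D) (π : D →ₗ[k] K) d := by
  refine conv_absorb (coinvAntipode (i : K →ₗ[k] D) (π : D →ₗ[k] K)) (cv LinearMap.id) (cvQ i π)
    (fun a c => ?_) d
  refine (h.coinvAntipode_mul_incl a (antipode k (π c))).trans ?_
  rw [HopfAlgebra.counit_antipode, CoalgHomClass.counit_comp_apply]

variable (h : CoinvSplitting i π θ p)

theorem section_lift_mul (s : X ⊗[k] X) : θ (TensorProduct.lift h.inducedMul s) =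
    LinearMap.mul' k D (TensorProduct.map θ θ s) := by
  induction s using TensorProduct.induction_on with
  | zero => simp
  | add u v hu hv => simp only [map_add, hu, hv]
  | tmul x y =>
    rw [TensorProduct.lift.tmul, h.section_mul, TensorProduct.map_tmul, LinearMap.mul'_apply]

/-- Write `T` for the braided antipode on `D`. As `T ∘ Π = T`, the left side is `T * id = (i ∘ π) *
S * id = i ∘ π`, which is the counit on coinvariants. -/
theorem antipode_left (x : X) :
    TensorProduct.lift h.inducedMul (h.inducedAntipode.rTensor X (h.inducedComul x)) =
      (counit (R := k) ∘ₗ θ) x • p 1 := by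
  apply h.section_injective
  have e : ∀ s : X ⊗[k] X, TensorProduct.map θ θ (h.inducedAntipode.rTensor X s) =
      (coinvAntipode (i : K →ₗ[k] D) (π : D →ₗ[k] K)).rTensor D (TensorProduct.map θ θ s) := by
    intro s
    induction s using TensorProduct.induction_on with
    | zero => simp
    | add u v hu hv => simp only [map_add, hu, hv]
    | tmul x y =>
      rw [LinearMap.rTensor_tmul, TensorProduct.map_tmul, TensorProduct.map_tmul,
        LinearMap.rTensor_tmul, h.section_antipode]
  have e2 : coinvAntipode (i : K →ₗ[k] D) (π : D →ₗ[k] K) ∘ₗ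
      coinvProj (i : K →ₗ[k] D) (π : D →ₗ[k] K) = coinvAntipode (i : K →ₗ[k] D) (π : D →ₗ[k] K) :=
    LinearMap.ext h.coinvAntipode_coinvProj
  rw [h.section_lift_mul, e, h.map_section_comul, ← LinearMap.rTensor_comp_apply, e2, map_smul,
    h.section_one]
  show (cv (coinvAntipode (i : K →ₗ[k] D) (π : D →ₗ[k] K)) * cv LinearMap.id :
    WithConv (D →ₗ[k] D)) (θ x) = _
  rw [cv_coinvAntipode, mul_assoc, cv_antipode_mul_id, mul_one]
  show i (π (θ x)) = _
  rw [map_of_coinvariant π (h.section_mem x), map_smul, map_one]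
  rfl

/-- With `T` the braided antipode on `D`, `Π * T = id * (i ∘ S ∘ π) * (i ∘ π) * S = id * S`, the
counit on all of `D`. -/
theorem antipode_right (x : X) :
    TensorProduct.lift h.inducedMul (h.inducedAntipode.lTensor X (h.inducedComul x)) =
      (counit (R := k) ∘ₗ θ) x • p 1 := by
  apply h.section_injective
  have e : ∀ s : X ⊗[k] X, TensorProduct.map θ θ (h.inducedAntipode.lTensor X s) =
      (coinvAntipode (i : K →ₗ[k] D) (π : D →ₗ[k] K)).lTensor D (TensorProduct.map θ θ s) := by
    intro s
    induction s using TensorProduct.induction_on with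
    | zero => simp
    | add u v hu hv => simp only [map_add, hu, hv]
    | tmul x y =>
      rw [LinearMap.lTensor_tmul, TensorProduct.map_tmul, TensorProduct.map_tmul,
        LinearMap.lTensor_tmul, h.section_antipode]
  rw [h.section_lift_mul, e, h.map_section_comul, ← LinearMap.comp_apply (LinearMap.lTensor D _),
    LinearMap.lTensor_comp_rTensor, map_smul, h.section_one]
  show (cv (coinvProj (i : K →ₗ[k] D) (π : D →ₗ[k] K)) *
    cv (coinvAntipode (i : K →ₗ[k] D) (π : D →ₗ[k] K)) : WithConv (D →ₗ[k] D)) (θ x) = _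
  rw [cv_coinvAntipode, cv_coinvProj, mul_assoc, ← mul_assoc (cvQ i π), cvQ_mul_cvJ, one_mul,
    cv_id_mul_antipode, conv_one_apply]
  rfl

/-- Because the coproduct descends along `p`, both sides are the image under `p ⊗ p ⊗ p` of the
iterated coproduct of `θ(x)`. -/
theorem coassoc (x : X) : TensorProduct.assoc k X X X (h.inducedComul.rTensor X (h.inducedComul x)) =
    h.inducedComul.lTensor X (h.inducedComul x) := by
  have e1 : ∀ s : D ⊗[k] D, TensorProduct.assoc k X X X (h.inducedComul.rTensor X
      (TensorProduct.map p p s)) = TensorProduct.map p (TensorProduct.map p p)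
        (TensorProduct.assoc k D D D ((comul (R := k)).rTensor D s)) := by
    intro s
    induction s using TensorProduct.induction_on with
    | zero => simp
    | add u v hu hv => simp only [map_add, hu, hv]
    | tmul a b =>
      rw [TensorProduct.map_tmul, LinearMap.rTensor_tmul, LinearMap.rTensor_tmul, h.comul_proj]
      induction comul (R := k) a using TensorProduct.induction_on with
      | zero => simp
      | add u v hu hv => simp only [TensorProduct.add_tmul, map_add, hu, hv]
      | tmul c d => simp
  have e2 : ∀ s : D ⊗[k] D, h.inducedComul.lTensor X (TensorProduct.map p p s) =
      TensorProduct.map p (TensorProduct.map p p) ((comul (R := k)).lTensor D s) := by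
    intro s
    induction s using TensorProduct.induction_on with
    | zero => simp
    | add u v hu hv => simp only [map_add, hu, hv]
    | tmul a b =>
      rw [TensorProduct.map_tmul, LinearMap.lTensor_tmul, LinearMap.lTensor_tmul, h.comul_proj,
        TensorProduct.map_tmul]
  refine (e1 (comul (R := k) (θ x))).trans (Eq.trans ?_ (e2 (comul (R := k) (θ x))).symm)
  rw [Coalgebra.coassoc_apply]

theorem counit_comul (x : X) : TensorProduct.lid k X ((counit (R := k) ∘ₗ θ).rTensor X
    (h.inducedComul x)) = x := by
  have e : (counit (R := k) ∘ₗ θ) ∘ₗ p = counit (R := k) := LinearMap.ext h.counit_section_proj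
  show TensorProduct.lid k X ((counit (R := k) ∘ₗ θ).rTensor X
    (TensorProduct.map p p (comul (R := k) (θ x)))) = x
  rw [← LinearMap.comp_apply (LinearMap.rTensor X _), LinearMap.rTensor_comp_map, e,
    ← LinearMap.lTensor_comp_rTensor, LinearMap.comp_apply, Coalgebra.rTensor_counit_comul,
    LinearMap.lTensor_tmul, TensorProduct.lid_tmul, one_smul, h.proj_section]

theorem comul_counit (x : X) : TensorProduct.rid k X ((counit (R := k) ∘ₗ θ).lTensor X
    (h.inducedComul x)) = x := by
  have e : (counit (R := k) ∘ₗ θ) ∘ₗ p = counit (R := k) := LinearMap.ext h.counit_section_proj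
  show TensorProduct.rid k X ((counit (R := k) ∘ₗ θ).lTensor X
    (TensorProduct.map p p (comul (R := k) (θ x)))) = x
  rw [← LinearMap.comp_apply (LinearMap.lTensor X _), LinearMap.lTensor_comp_map, e,
    ← LinearMap.rTensor_comp_lTensor, LinearMap.comp_apply, Coalgebra.lTensor_counit_comul,
    LinearMap.rTensor_tmul, TensorProduct.rid_tmul, one_smul, h.proj_section]

/-- The map `c ⊗ c' ↦ b₁ c i(S(π(b₂))) ⊗ b₃ c'`. -/
def twistMul (i : K →ₐc[k] D) (π : D →ₐc[k] K) (b : D) : D ⊗[k] D →ₗ[k] D ⊗[k] D :=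
  TensorProduct.lift (LinearMap.mk₂ k (fun c c' =>
    (convPush inL (cv LinearMap.id * cst D c * cvQ i π) * convPush inR (cv LinearMap.id) :
      WithConv (D →ₗ[k] D ⊗[k] D)) b * ((1 : D) ⊗ₜ[k] c'))
    (fun c d c' => by rw [cst_add, mul_add, add_mul, map_add, add_mul]; exact add_mul _ _ _)
    (fun r c c' => by
      rw [cst_smul, mul_smul_comm, smul_mul_assoc, convPush_smul, smul_mul_assoc]
      exact Algebra.smul_mul_assoc r _ _)
    (fun c d d' => by rw [TensorProduct.tmul_add, mul_add])
    (fun r c c' => by rw [TensorProduct.tmul_smul, mul_smul_comm]))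

theorem twistMul_tmul (b c c' : D) : twistMul i π b (c ⊗ₜ c') =
    (convPush inL (cv LinearMap.id * cst D c * cvQ i π) * convPush inR (cv LinearMap.id) :
      WithConv (D →ₗ[k] D ⊗[k] D)) b * ((1 : D) ⊗ₜ[k] c') := rfl

/-- By `coinvProj_mul`, projecting the first leg of `Δ(b) w` requires only `w` with its first leg
projected. For `w = Δ(θ(y))` this is the braided coproduct of `y`. -/
theorem rTensor_coinvProj_comul_mul (b : D) (w : D ⊗[k] D) :
    (coinvProj (i : K →ₗ[k] D) (π : D →ₗ[k] K)).rTensor D (comul (R := k) b * w) =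
      twistMul i π b ((coinvProj (i : K →ₗ[k] D) (π : D →ₗ[k] K)).rTensor D w) := by
  induction w using TensorProduct.induction_on with
  | zero => simp
  | add u v hu hv => simp only [mul_add, map_add, hu, hv]
  | tmul c c' =>
    rw [LinearMap.rTensor_tmul, twistMul_tmul, ← rTensor_comul_eq]
    induction comul (R := k) b using TensorProduct.induction_on with
    | zero => simp
    | add u v hu hv => simp only [add_mul, map_add, hu, hv]
    | tmul u v =>
      rw [Algebra.TensorProduct.tmul_mul_tmul, LinearMap.rTensor_tmul, LinearMap.rTensor_tmul,
        Algebra.TensorProduct.tmul_mul_tmul, mul_one, coinvProj_mul]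

/-- In `D ⊗ D` the braided product of `x₁ ⊗ x₂` and `y₁ ⊗ y₂` reads `θ(x₁) (m₋₁ ▷ θ(y₁)) ⊗ m₀ θ(y₂)`
with `m = θ(x₂)`. -/
theorem map_section_braided_mul_tmul (x₁ x₂ y₁ y₂ : X) : TensorProduct.map θ θ
    (TensorProduct.map (TensorProduct.lift h.inducedMul) (TensorProduct.lift h.inducedMul)
      ((TensorProduct.assoc k X X (X ⊗[k] X)).symm
        (((TensorProduct.assoc k X X X).toLinearMap ∘ₗ
          (h.inducedModComod.braiding h.inducedModComod).rTensor X ∘ₗ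
            (TensorProduct.assoc k X X X).symm.toLinearMap).lTensor X
          (TensorProduct.assoc k X X (X ⊗[k] X) ((x₁ ⊗ₜ x₂) ⊗ₜ (y₁ ⊗ₜ y₂)))))) =
    (θ x₁ ⊗ₜ 1) * (cvAdj i (θ y₁)).ofConv.rTensor D (coactHom π (θ x₂)) * (1 ⊗ₜ θ y₂) := by
  rw [← h.section_coact, TensorProduct.assoc_tmul, LinearMap.lTensor_tmul, LinearMap.comp_apply,
    LinearMap.comp_apply, LinearEquiv.coe_coe, LinearEquiv.coe_coe, TensorProduct.assoc_symm_tmul,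
    LinearMap.rTensor_tmul, ModComod.braiding, LinearMap.comp_apply, LinearMap.comp_apply,
    LinearMap.rTensor_tmul, LinearEquiv.coe_coe]
  induction h.inducedModComod.coact x₂ using TensorProduct.induction_on with
  | zero => simp
  | add u v hu hv =>
    simp only [TensorProduct.add_tmul, TensorProduct.tmul_add, map_add, mul_add, add_mul, hu, hv]
  | tmul κ m =>
    rw [TensorProduct.rightComm_tmul, LinearMap.rTensor_tmul, TensorProduct.lift.tmul,
      TensorProduct.assoc_tmul, TensorProduct.assoc_symm_tmul, TensorProduct.map_tmul,
      TensorProduct.lift.tmul, TensorProduct.lift.tmul, TensorProduct.map_tmul, h.section_mul,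
      h.section_mul, h.section_act, LinearMap.lTensor_tmul, LinearMap.rTensor_tmul,
      Algebra.TensorProduct.tmul_mul_tmul, Algebra.TensorProduct.tmul_mul_tmul, mul_one, one_mul]

/-- With `d = θ(x)`, and `y₁ ⊗ y₂` standing for the braided coproduct of `y` inside `D ⊗ D`, the
left side is `d₁ y₁ i(S(π(d₂))) ⊗ d₃ y₂`. The braided product gives `Π(d₁) i(π(d₂)) y₁ i(S(π(d₃))) ⊗
d₄ y₂`, and the factor `i(S(π(-)))` inside `Π` cancels against `i(π(-))`. -/
theorem comul_mul (x y : X) : h.inducedComul (h.inducedMul x y) =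
    TensorProduct.map (TensorProduct.lift h.inducedMul) (TensorProduct.lift h.inducedMul)
      ((TensorProduct.assoc k X X (X ⊗[k] X)).symm
        (((TensorProduct.assoc k X X X).toLinearMap ∘ₗ
          (h.inducedModComod.braiding h.inducedModComod).rTensor X ∘ₗ
            (TensorProduct.assoc k X X X).symm.toLinearMap).lTensor X
          (TensorProduct.assoc k X X (X ⊗[k] X) (h.inducedComul x ⊗ₜ h.inducedComul y)))) := by
  apply h.map_section_injective
  rw [h.map_section_comul, h.section_mul, Bialgebra.comul_mul, rTensor_coinvProj_comul_mul,
    ← h.map_section_comul y]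
  induction h.inducedComul y using TensorProduct.induction_on with
  | zero => simp
  | add u v hu hv => simp only [TensorProduct.tmul_add, map_add, hu, hv]
  | tmul y₁ y₂ =>
    have e1 : ∀ s : X ⊗[k] X, TensorProduct.map θ θ
      (TensorProduct.map (TensorProduct.lift h.inducedMul) (TensorProduct.lift h.inducedMul)
        ((TensorProduct.assoc k X X (X ⊗[k] X)).symm
          (((TensorProduct.assoc k X X X).toLinearMap ∘ₗ
            (h.inducedModComod.braiding h.inducedModComod).rTensor X ∘ₗ
              (TensorProduct.assoc k X X X).symm.toLinearMap).lTensor X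
            (TensorProduct.assoc k X X (X ⊗[k] X) (s ⊗ₜ (y₁ ⊗ₜ y₂)))))) =
        LinearMap.mul' k (D ⊗[k] D) (TensorProduct.map (inL : D →ₐ[k] D ⊗[k] D).toLinearMap
          ((cvAdj i (θ y₁)).ofConv.rTensor D ∘ₗ (coactHom π).toLinearMap)
            (TensorProduct.map θ θ s)) * (1 ⊗ₜ θ y₂) := by
      intro s
      induction s using TensorProduct.induction_on with
      | zero => simp
      | add u v hu hv => simp only [TensorProduct.add_tmul, map_add, add_mul, hu, hv]
      | tmul x₁ x₂ =>
        rw [h.map_section_braided_mul_tmul]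
        rfl
    rw [e1, h.map_section_comul, TensorProduct.map_tmul, twistMul_tmul,
      ← LinearMap.comp_apply (TensorProduct.map _ _) ((coinvProj _ _).rTensor D),
      LinearMap.map_comp_rTensor]
    congr 1
    have e2 : (cv ((cvAdj i (θ y₁)).ofConv.rTensor D ∘ₗ (coactHom π).toLinearMap) :
        WithConv (D →ₗ[k] D ⊗[k] D)) =
        convPush inL (cvJ i π * cst D (θ y₁) * cvQ i π) * convPush inR (cv LinearMap.id) := by
      have e3 : convPullHom π (cvAdj i (θ y₁)) = cvJ i π * cst D (θ y₁) * cvQ i π := by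
        rw [cvAdj, map_mul, map_mul, convPullHom_cst]; rfl
      refine conv_ext fun d => ?_
      rw [← e3, ← rTensor_comul_eq]
      show (cvAdj i (θ y₁)).ofConv.rTensor D ((π : D →ₗ[k] K).rTensor D (comul (R := k) d)) = _
      rw [← LinearMap.rTensor_comp_apply]
      rfl
    show _ = (convPush inL (cv (coinvProj (i : K →ₗ[k] D) (π : D →ₗ[k] K))) *
      cv ((cvAdj i (θ y₁)).ofConv.rTensor D ∘ₗ (coactHom π).toLinearMap) :
        WithConv (D →ₗ[k] D ⊗[k] D)) (θ x)
    rw [e2, ← mul_assoc, ← map_mul, cv_coinvProj]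
    have e4 : (cv LinearMap.id * cvQ i π * (cvJ i π * cst D (θ y₁) * cvQ i π) :
        WithConv (D →ₗ[k] D)) = cv LinearMap.id * cst D (θ y₁) * cvQ i π := by
      rw [mul_assoc, mul_assoc (cvJ i π), ← mul_assoc (cvQ i π) (cvJ i π), cvQ_mul_cvJ, one_mul,
        mul_assoc]
    rw [e4]

/-- The braided Hopf algebra structure on `X` transported from the coinvariants. -/
def inducedBraidedHopfAlgebra : BraidedHopfAlgebra k K X where
  toModComod := h.inducedModComod
  isYetterDrinfeld := h.isYetterDrinfeld
  mul := h.inducedMul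
  one := p 1
  comul := h.inducedComul
  counit := counit ∘ₗ θ
  antipode := h.inducedAntipode
  isHom_mul := h.isHom_mul
  isHom_one := h.isHom_one
  isHom_comul := ⟨h.isHom_comul_act, h.isHom_comul_coact⟩
  isHom_counit := h.isHom_counit
  isHom_antipode := h.isHom_antipode
  mul_assoc x y z := h.section_injective <| by
    rw [h.section_mul, h.section_mul, h.section_mul, h.section_mul, mul_assoc]
  one_mul x := h.section_injective <| by rw [h.section_mul, h.section_one, one_mul]
  mul_one x := h.section_injective <| by rw [h.section_mul, h.section_one, mul_one]
  coassoc := h.coassoc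
  counit_comul := h.counit_comul
  comul_counit := h.comul_counit
  comul_mul := h.comul_mul
  comul_one := by rw [h.comul_proj, Bialgebra.comul_one]; rfl
  counit_mul x y := by
    show counit (R := k) (θ (h.inducedMul x y)) = _
    rw [h.section_mul, Bialgebra.counit_mul]; rfl
  counit_one := by
    show counit (R := k) (θ (p 1)) = _
    rw [h.section_one, Bialgebra.counit_one]
  antipode_left := h.antipode_left
  antipode_right := h.antipode_right

theorem isCoinvariantsIso : IsCoinvariantsIso (i : K →ₗ[k] D) (π : D →ₗ[k] K)
    h.inducedBraidedHopfAlgebra θ where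
  injective := h.section_injective
  range := h.range_section
  act κ x := (h.section_act κ x).trans (adjointAct_eq i κ (θ x)).symm
  coact x := h.section_coact x
  mul := h.section_mul
  one := h.section_one
  comul x a hxa := by
    -- Injectivity of `θ` identifies `x` with `p(a)`, so the coproduct formula may be computed from
    -- any lift `a`.
    have hx : x = p a := h.section_injective (hxa.trans (h.section_proj a).symm)
    have e : θ ∘ₗ p = coinvProj (i : K →ₗ[k] D) (π : D →ₗ[k] K) := LinearMap.ext h.section_proj
    show TensorProduct.map θ θ (h.inducedComul x) = _
    rw [hx, h.comul_proj, ← LinearMap.comp_apply, ← TensorProduct.map_comp, e]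
  counit x := rfl
  antipode := h.section_antipode

end CoinvSplitting

/-! ### The biproduct isomorphism -/

namespace CoinvSplitting

variable {k K D : Type*} [Field k] [Ring K] [HopfAlgebra k K] [Ring D] [HopfAlgebra k D]
variable {i : K →ₐc[k] D} {π : D →ₐc[k] K}
variable {X : Type*} [AddCommGroup X] [Module k X] {θ : X →ₗ[k] D} {p : D →ₗ[k] X}

/-- The map `x ⊗ κ ↦ θ(x) i(κ)`. -/
def biproductMap (i : K →ₐc[k] D) (θ : X →ₗ[k] D) : X ⊗[k] K →ₗ[k] D :=
  TensorProduct.lift ((LinearMap.mul k D).compl₁₂ θ (i : K →ₗ[k] D))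

theorem biproductMap_tmul (x : X) (κ : K) : biproductMap i θ (x ⊗ₜ κ) = θ x * i κ := rfl

variable (h : CoinvSplitting i π θ p)

/-- The inverse isomorphism is `d ↦ p(d₁) ⊗ π(d₂)`, since `Π(d₁) i(π(d₂)) = d₁ i(S(π(d₂))) i(π(d₃))
= d`. -/
theorem biproductMap_map_comul (h : CoinvSplitting i π θ p) (d : D) :
    biproductMap i θ (TensorProduct.map p (π : D →ₗ[k] K) (comul (R := k) d)) = d := by
  have e : ∀ s : D ⊗[k] D, biproductMap i θ (TensorProduct.map p (π : D →ₗ[k] K) s) =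
      LinearMap.mul' k D (TensorProduct.map
        (cv (coinvProj (i : K →ₗ[k] D) (π : D →ₗ[k] K))).ofConv (cvJ i π).ofConv s) := by
    intro s
    induction s using TensorProduct.induction_on with
    | zero => simp
    | add u v hu hv => simp only [map_add, hu, hv]
    | tmul a b =>
      rw [TensorProduct.map_tmul, biproductMap_tmul, h.section_proj]; rfl
  rw [e, ← conv_mul_apply, cv_coinvProj, mul_assoc, cvQ_mul_cvJ, mul_one]
  rfl

/-- For `d = θ(x) i(κ)`, coinvariance of `θ(x)` gives `d₁ ⊗ π(d₂) = θ(x) i(κ₁) ⊗ κ₂`, and `p`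
absorbs `i(κ₁)`. -/
theorem map_comul_biproductMap (h : CoinvSplitting i π θ p) (s : X ⊗[k] K) :
    TensorProduct.map p (π : D →ₗ[k] K) (comul (R := k) (biproductMap i θ s)) = s := by
  induction s using TensorProduct.induction_on with
  | zero => simp
  | add u v hu hv => simp only [map_add, hu, hv]
  | tmul x κ =>
    have e1 : ∀ d : D, TensorProduct.map p (π : D →ₗ[k] K) (comul (R := k) d) =
        p.rTensor K (((Algebra.TensorProduct.map (AlgHom.id k D) (π : D →ₐ[k] K)).comp
          (Bialgebra.comulAlgHom k D)) d) := by
      intro d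
      show _ = p.rTensor K ((π : D →ₗ[k] K).lTensor D (comul (R := k) d))
      rw [← LinearMap.comp_apply (LinearMap.rTensor K p), LinearMap.rTensor_comp_lTensor]
    have e2 : ((Algebra.TensorProduct.map (AlgHom.id k D) (π : D →ₐ[k] K)).comp
        (Bialgebra.comulAlgHom k D)) (i κ) = (i : K →ₗ[k] D).rTensor K (comul (R := k) κ) := by
      show (π : D →ₗ[k] K).lTensor D (comul (R := k) (i κ)) = _
      have e3 : (π : D →ₗ[k] K) ∘ₗ (i : K →ₗ[k] D) = LinearMap.id := LinearMap.ext h.retract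
      rw [← CoalgHomClass.map_comp_comul_apply i, ← LinearMap.comp_apply,
        LinearMap.lTensor_comp_map, e3]
      rfl
    have e4 : ∀ t : K ⊗[k] K, p.rTensor K ((inL : D →ₐ[k] D ⊗[k] K) (θ x) *
        (i : K →ₗ[k] D).rTensor K t) =
        x ⊗ₜ TensorProduct.lid k K ((counit (R := k)).rTensor K t) := by
      intro t
      induction t using TensorProduct.induction_on with
      | zero => simp
      | add u v hu hv => simp only [mul_add, map_add, TensorProduct.tmul_add, hu, hv]
      | tmul a b =>
        rw [LinearMap.rTensor_tmul, LinearMap.rTensor_tmul, TensorProduct.lid_tmul]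
        show p.rTensor K ((θ x ⊗ₜ[k] (1 : K)) * (i a ⊗ₜ[k] b)) = _
        rw [Algebra.TensorProduct.tmul_mul_tmul, one_mul, LinearMap.rTensor_tmul, h.proj_mul_incl,
          h.proj_section, TensorProduct.smul_tmul]
    rw [biproductMap_tmul, e1, map_mul, (mem_coinvariants_iff _).1 (h.section_mem x), e2, e4,
      Coalgebra.rTensor_counit_comul, TensorProduct.lid_tmul, one_smul]

/-- The product of the biproduct is designed to match the rule `i(κ) b = (κ₁ ▷ b) i(κ₂)`. -/
theorem biproductMap_mul (s t : X ⊗[k] K) :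
    biproductMap i θ (h.inducedBraidedHopfAlgebra.biproductMul (s ⊗ₜ t)) =
      biproductMap i θ s * biproductMap i θ t := by
  induction s using TensorProduct.induction_on with
  | zero => simp
  | add u v hu hv => simp only [TensorProduct.add_tmul, map_add, add_mul, hu, hv]
  | tmul x κ =>
  induction t using TensorProduct.induction_on with
  | zero => simp
  | add u v hu hv => simp only [TensorProduct.tmul_add, map_add, mul_add, hu, hv]
  | tmul y κ' =>
    have e : biproductMap i θ (h.inducedBraidedHopfAlgebra.biproductMul
        ((x ⊗ₜ κ) ⊗ₜ (y ⊗ₜ κ'))) =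
        θ x * LinearMap.mul' k D (TensorProduct.map (cvAdj i (θ y)).ofConv
          (convPush (i : K →ₐ[k] D) (cv LinearMap.id)).ofConv (comul (R := k) κ)) * i κ' := by
      rw [BraidedHopfAlgebra.biproductMul, LinearMap.comp_apply, LinearMap.comp_apply,
        LinearMap.comp_apply, LinearEquiv.coe_coe, LinearEquiv.coe_coe, TensorProduct.assoc_tmul,
        LinearMap.lTensor_tmul, LinearMap.comp_apply, LinearMap.comp_apply, LinearMap.rTensor_tmul,
        LinearEquiv.coe_coe]
      induction comul (R := k) κ using TensorProduct.induction_on with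
      | zero => simp
      | add u v hu hv =>
        simp only [TensorProduct.add_tmul, TensorProduct.tmul_add, map_add, mul_add, add_mul,
          hu, hv]
      | tmul a b =>
        rw [TensorProduct.tensorTensorTensorComm_tmul, LinearMap.rTensor_tmul,
          TensorProduct.assoc_symm_tmul, TensorProduct.map_tmul, TensorProduct.lift.tmul,
          TensorProduct.lift.tmul, LinearMap.mul'_apply, biproductMap_tmul, TensorProduct.map_tmul,
          LinearMap.mul'_apply]
        refine (congrArg (fun z => z * i (b * κ')) (h.section_mul x _)).trans ?_
        refine (congrArg (fun z => θ x * z * i (b * κ')) (h.section_act a y)).trans ?_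
        rw [map_mul i]
        simp only [mul_assoc]
        rfl
    rw [e, ← conv_mul_apply, cvAdj_mul_incl, mul_cst_apply, biproductMap_tmul, biproductMap_tmul]
    show θ x * (i κ * θ y) * i κ' = _
    simp only [mul_assoc]

/-- On the coinvariant part the claim is `Π(b₁) i(π(b₂)) ⊗ b₃ = b₁ ⊗ b₂`; the `K`-part is a common
right factor. -/
theorem map_biproductMap_comul (s : X ⊗[k] K) :
    TensorProduct.map (biproductMap i θ) (biproductMap i θ)
      (h.inducedBraidedHopfAlgebra.biproductComul s) = comul (R := k) (biproductMap i θ s) := by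
  induction s using TensorProduct.induction_on with
  | zero => simp
  | add u v hu hv => simp only [map_add, hu, hv]
  | tmul x κ =>
    rw [biproductMap_tmul, Bialgebra.comul_mul]
    have e1 : ∀ w : X ⊗[k] X, TensorProduct.map (biproductMap i θ) (biproductMap i θ)
        ((TensorProduct.assoc k X K (X ⊗[k] K)).symm
          (((LinearMap.mul' k K).rTensor (X ⊗[k] K) ∘ₗ
            (TensorProduct.tensorTensorTensorComm k K X K K).toLinearMap ∘ₗ
              TensorProduct.map h.inducedModComod.coact (comul (R := k))).lTensor X
            (TensorProduct.assoc k X X K (w ⊗ₜ κ)))) =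
        LinearMap.mul' k (D ⊗[k] D) (TensorProduct.map (inL : D →ₐ[k] D ⊗[k] D).toLinearMap
          ((i : K →ₗ[k] D).rTensor D ∘ₗ (coactHom π).toLinearMap) (TensorProduct.map θ θ w)) *
            comul (R := k) (i κ) := by
      intro w
      induction w using TensorProduct.induction_on with
      | zero => simp
      | add u v hu hv => simp only [TensorProduct.add_tmul, map_add, add_mul, hu, hv]
      | tmul x₁ x₂ =>
        rw [TensorProduct.map_tmul, TensorProduct.map_tmul, LinearMap.mul'_apply,
          LinearMap.comp_apply, AlgHom.toLinearMap_apply, AlgHom.toLinearMap_apply,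
          ← h.section_coact, TensorProduct.assoc_tmul, LinearMap.lTensor_tmul,
          LinearMap.comp_apply, LinearMap.comp_apply, TensorProduct.map_tmul, LinearEquiv.coe_coe,
          ← CoalgHomClass.map_comp_comul_apply i]
        induction h.inducedModComod.coact x₂ using TensorProduct.induction_on with
        | zero => simp
        | add u v hu hv =>
          simp only [TensorProduct.add_tmul, TensorProduct.tmul_add, map_add, mul_add, add_mul,
            hu, hv]
        | tmul c m =>
          induction comul (R := k) κ using TensorProduct.induction_on with
          | zero => simp
          | add u v hu hv => simp only [TensorProduct.tmul_add, map_add, mul_add, hu, hv]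
          | tmul a b =>
            rw [TensorProduct.tensorTensorTensorComm_tmul, LinearMap.rTensor_tmul,
              TensorProduct.assoc_symm_tmul, TensorProduct.map_tmul, LinearMap.mul'_apply,
              biproductMap_tmul, biproductMap_tmul, TensorProduct.map_tmul,
              LinearMap.lTensor_tmul, LinearMap.rTensor_tmul]
            show _ = (θ x₁ ⊗ₜ[k] (1 : D)) * (i c ⊗ₜ[k] θ m) * (i a ⊗ₜ[k] i b)
            rw [Algebra.TensorProduct.tmul_mul_tmul, Algebra.TensorProduct.tmul_mul_tmul, one_mul,
              map_mul i, mul_assoc]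
    refine (e1 (h.inducedComul x)).trans ?_
    congr 1
    rw [h.map_section_comul, ← LinearMap.comp_apply (TensorProduct.map _ _)
      ((coinvProj _ _).rTensor D), LinearMap.map_comp_rTensor]
    have e2 : (cv ((i : K →ₗ[k] D).rTensor D ∘ₗ (coactHom π).toLinearMap) :
        WithConv (D →ₗ[k] D ⊗[k] D)) =
        convPush inL (cvJ i π) * convPush inR (cv LinearMap.id) := by
      refine conv_ext fun d => ?_
      rw [← rTensor_comul_eq]
      show (i : K →ₗ[k] D).rTensor D ((π : D →ₗ[k] K).rTensor D (comul (R := k) d)) = _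
      rw [← LinearMap.rTensor_comp_apply]
      rfl
    show (convPush inL (cv (coinvProj (i : K →ₗ[k] D) (π : D →ₗ[k] K))) *
      cv ((i : K →ₗ[k] D).rTensor D ∘ₗ (coactHom π).toLinearMap) :
        WithConv (D →ₗ[k] D ⊗[k] D)) (θ x) = _
    rw [e2, ← mul_assoc, ← map_mul, cv_coinvProj, mul_assoc _ (cvQ i π), cvQ_mul_cvJ, mul_one,
      ← convPush_comul_id]
    rfl

theorem isBiproductIso : IsBiproductIso h.inducedBraidedHopfAlgebra
    (TensorProduct.lift ((LinearMap.mul k D).compl₁₂ θ (i : K →ₗ[k] D))) where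
  bijective := ⟨Function.LeftInverse.injective (g := fun d => TensorProduct.map p (π : D →ₗ[k] K)
      (comul (R := k) d)) h.map_comul_biproductMap,
    fun d => ⟨_, h.biproductMap_map_comul d⟩⟩
  mul := h.biproductMap_mul
  one := by
    refine (biproductMap_tmul (i := i) (θ := θ) (p 1) 1).trans ?_
    rw [h.section_one, map_one, one_mul]
  comul := h.map_biproductMap_comul
  counit x κ := by
    refine (congrArg (counit (R := k)) (biproductMap_tmul (i := i) (θ := θ) x κ)).trans ?_
    rw [Bialgebra.counit_mul, CoalgHomClass.counit_comp_apply i]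
    rfl

end CoinvSplitting

/-! ### Invariance of a skew pairing under the antipodes -/

section SkewPairingAntipode

variable {k B V : Type*} [Field k] [Ring B] [HopfAlgebra k B] [Ring V] [HopfAlgebra k V]
variable {p : B →ₗ[k] V →ₗ[k] k}

/-- A bilinear form on `B × V`, as a map from `B` to the convolution algebra of `V`. -/
def toDualConv (p : B →ₗ[k] V →ₗ[k] k) : B →ₗ[k] WithConv (V →ₗ[k] k) :=
  (WithConv.linearEquiv k (V →ₗ[k] k)).symm.toLinearMap ∘ₗ p

/-- Viewed as a map from `B` to the convolution algebra `V^*`, the form `p(S(b), v)` has the left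
inverse `p(S(b), S(v))` and the right inverse `p(b, v)`, which therefore agree. No bijectivity of an
antipode is needed, so the result can serve to prove it. -/
theorem IsSkewPairing.apply_antipode_antipode (hp : IsSkewPairing p) (b : B) (v : V) :
    p (antipode k b) (antipode k v) = p b v := by
  let τ : B →ₗ[k] V →ₗ[k] k := p.compl₁₂ (antipode k) (antipode k)
  -- For `c = S(b)` one has `c₁ ⊗ c₂ = S(b₂) ⊗ S(b₁)`, so the flip in `mul_right` collects the
  -- product into `p(S(b), S(v₁) v₂)`.
  have h1 : cv (toDualConv τ) * cv (toDualConv p ∘ₗ antipode k) = 1 := by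
    refine conv_ext fun b => conv_ext fun v => ?_
    have e1 : ∀ (s : B ⊗[k] B) (v : V), (LinearMap.mul' k (WithConv (V →ₗ[k] k)) (TensorProduct.map
        (toDualConv τ) (toDualConv p ∘ₗ antipode k) s)) v =
        LinearMap.mul' k k (TensorProduct.map (TensorProduct.lift p) (TensorProduct.lift p)
          (TensorProduct.tensorTensorTensorComm k B B V V
            (TensorProduct.map (antipode k) (antipode k) s ⊗ₜ
              (antipode k).rTensor V (comul (R := k) v)))) := by
      intro s v
      induction s using TensorProduct.induction_on with
      | zero => simp
      | add a b ha hb =>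
        simp only [map_add, TensorProduct.add_tmul, ← ha, ← hb]; rfl
      | tmul a b =>
        rw [TensorProduct.map_tmul, LinearMap.mul'_apply, conv_mul_apply]
        induction comul (R := k) v using TensorProduct.induction_on with
        | zero => simp
        | add a b ha hb => simp only [map_add, TensorProduct.tmul_add, ha, hb]
        | tmul c d => rfl
    have e2 : ∀ (s : B ⊗[k] B) (t : V ⊗[k] V) , LinearMap.mul' k k (TensorProduct.map
          (TensorProduct.lift p) (TensorProduct.lift p)
          (TensorProduct.tensorTensorTensorComm k B B V V
            (TensorProduct.comm k B B s ⊗ₜ t))) =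
        LinearMap.mul' k k (TensorProduct.map (TensorProduct.lift p) (TensorProduct.lift p)
          (TensorProduct.tensorTensorTensorComm k B B V V
            (s ⊗ₜ TensorProduct.comm k V V t))) := by
      intro s t
      induction s using TensorProduct.induction_on with
      | zero => simp
      | add a b ha hb => simp only [map_add, TensorProduct.add_tmul, ha, hb]
      | tmul a b =>
        induction t using TensorProduct.induction_on with
        | zero => simp
        | add a b ha hb => simp only [map_add, TensorProduct.tmul_add, ha, hb]
        | tmul c d => simp [mul_comm]
    have e3 : ∀ (t : V ⊗[k] V) (c : B), LinearMap.mul' k k (TensorProduct.map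
          (TensorProduct.lift p) (TensorProduct.lift p)
          (TensorProduct.tensorTensorTensorComm k B B V V
            (comul (R := k) c ⊗ₜ TensorProduct.comm k V V t))) = p c (LinearMap.mul' k V t) := by
      intro t c
      induction t using TensorProduct.induction_on with
      | zero => simp
      | add a b ha hb => simp only [map_add, TensorProduct.tmul_add, ha, hb]
      | tmul x y =>
        rw [LinearMap.mul'_apply, hp.mul_right]
        induction comul (R := k) c using TensorProduct.induction_on with
        | zero => simp
        | add a b ha hb => simp only [map_add, TensorProduct.add_tmul, ha, hb]
        | tmul c d => simp
    have e4 : TensorProduct.map (antipode k) (antipode k) (comul (R := k) b) =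
        TensorProduct.comm k B B (comul (R := k) (antipode k b)) := by
      rw [comul_antipode]
      induction comul (R := k) b using TensorProduct.induction_on with
      | zero => simp
      | add a b ha hb => simp only [map_add, ha, hb]
      | tmul c d => simp
    refine (e1 (comul (R := k) b) v).trans ?_
    rw [e4, e2, e3, HopfAlgebra.mul_antipode_rTensor_comul_apply,
      Algebra.algebraMap_eq_smul_one, map_smul, hp.one_right, HopfAlgebra.counit_antipode,
      conv_one_apply, smul_eq_mul]
    show _ = counit (R := k) b • (1 : WithConv (V →ₗ[k] k)) v
    rw [conv_one_apply, smul_eq_mul, smul_eq_mul, mul_one, mul_comm]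
  -- Multiplicativity in the first variable makes `b ↦ p(b, -)` an algebra map, and algebra maps
  -- have their composite with `S` as convolution inverse.
  have h2 : cv (toDualConv p ∘ₗ antipode k) * cv (toDualConv p) = 1 := by
    let φ : B →ₐ[k] WithConv (V →ₗ[k] k) := AlgHom.ofLinearMap (toDualConv p)
      (conv_ext fun v => hp.one_left v) (fun b b' => conv_ext fun v => hp.mul_left b b' v)
    have e1 : cv (toDualConv p) = convPush φ (cv LinearMap.id) := rfl
    have e2 : cv (toDualConv p ∘ₗ antipode k) = convPush φ (cv (antipode k)) := rfl
    rw [e1, e2, ← map_mul, cv_antipode_mul_id, map_one]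
  have h3 := left_inv_eq_right_inv h1 h2
  exact congrArg (fun F : WithConv (B →ₗ[k] WithConv (V →ₗ[k] k)) => F b v) h3

end SkewPairingAntipode

/-! ### Drinfeld's functional and bijectivity of the antipode -/

section DrinfeldElement

variable {k H : Type*} [Field k] [Ring H] [HopfAlgebra k H] (σ : H →ₗ[k] H →ₗ[k] k)

/-- The functional `u(h) = σ(h₁, S(h₂))`. -/
def drinfeldU : H →ₗ[k] k := TensorProduct.lift σ ∘ₗ (antipode k).lTensor H ∘ₗ comul

/-- The functional `v(h) = σ(S²(h₁), h₂)`. -/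
def drinfeldV : H →ₗ[k] k :=
  TensorProduct.lift σ ∘ₗ (antipode k ∘ₗ antipode k).rTensor H ∘ₗ comul

/-- `σ(h₁, g₁) h₂ g₂ = g₁ h₁ σ(h₂, g₂)`. -/
def BraidedComm : Prop := ∀ h g : H,
    TensorProduct.lid k H (TensorProduct.map (TensorProduct.lift σ) (LinearMap.mul' k H)
      (comul (R := k) (h ⊗ₜ[k] g))) =
    TensorProduct.rid k H (TensorProduct.map
      (LinearMap.mul' k H ∘ₗ (TensorProduct.comm k H H).toLinearMap) (TensorProduct.lift σ)
      (comul (R := k) (h ⊗ₜ[k] g)))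

theorem assoc_map_comul_comul (h : H) : TensorProduct.assoc k H H (H ⊗[k] H)
    (TensorProduct.map comul comul (comul (R := k) h)) = comul4 k H h := by
  have e : (TensorProduct.assoc k H H (H ⊗[k] H)).toLinearMap ∘ₗ
      TensorProduct.map comul comul ∘ₗ comul (R := k) = comul4 k H := by
    simp only [comul4, comul3, coassoc_simps]
  exact LinearMap.congr_fun e h

theorem comul4_eq_middle (h : H) : (((TensorProduct.assoc k H H H).toLinearMap ∘ₗ
    (comul (R := k)).rTensor H).lTensor H) (comul3 k H h) = comul4 k H h := by
  have e : (((TensorProduct.assoc k H H H).toLinearMap ∘ₗ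
    (comul (R := k)).rTensor H).lTensor H) ∘ₗ comul3 k H = comul4 k H := by
    simp only [comul4, comul3, coassoc_simps]
  exact LinearMap.congr_fun e h

/-- The map `a ⊗ (b ⊗ (c ⊗ d)) ↦ σ(a, S(d)) b S(c)`. -/
def outerForm : H ⊗[k] (H ⊗[k] (H ⊗[k] H)) →ₗ[k] H :=
  TensorProduct.lift ((LinearMap.lsmul k H).flip.compr₂ LinearMap.id).flip ∘ₗ
    TensorProduct.map (TensorProduct.lift σ ∘ₗ (antipode k).lTensor H)
      (LinearMap.mul' k H ∘ₗ (antipode k).lTensor H) ∘ₗ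
    (TensorProduct.assoc k H H (H ⊗[k] H)).symm.toLinearMap ∘ₗ
    ((TensorProduct.comm k (H ⊗[k] H) H).toLinearMap ∘ₗ
      (TensorProduct.assoc k H H H).symm.toLinearMap).lTensor H

theorem outerForm_tmul (a b c d : H) : outerForm σ (a ⊗ₜ (b ⊗ₜ (c ⊗ₜ d))) =
    σ a (antipode k d) • (b * antipode k c) := by
  simp [outerForm]

/-- The map `a ⊗ (b ⊗ (c ⊗ d)) ↦ σ(b, S(c)) β(a, d)`. -/
def innerForm {M : Type*} [AddCommGroup M] [Module k M] (β : H →ₗ[k] H →ₗ[k] M) :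
    H ⊗[k] (H ⊗[k] (H ⊗[k] H)) →ₗ[k] M :=
  TensorProduct.lift β ∘ₗ (TensorProduct.lid k H).toLinearMap.lTensor H ∘ₗ
    ((TensorProduct.lift σ ∘ₗ (antipode k).lTensor H).rTensor H ∘ₗ
      (TensorProduct.assoc k H H H).symm.toLinearMap).lTensor H

theorem innerForm_tmul {M : Type*} [AddCommGroup M] [Module k M] (β : H →ₗ[k] H →ₗ[k] M)
    (a b c d : H) : innerForm σ β (a ⊗ₜ (b ⊗ₜ (c ⊗ₜ d))) = σ b (antipode k c) • β a d := by
  simp [innerForm]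

/-- The bilinear map `(a, d) ↦ S(d) a`. -/
def antipodeMul : H →ₗ[k] H →ₗ[k] H :=
  (LinearMap.mul k H).flip.compl₁₂ LinearMap.id (antipode k)

theorem antipodeMul_apply (a d : H) : antipodeMul (k := k) a d = antipode k d * a := rfl

variable {σ}

/-- This is the braiding relation for the pair `h₁`, `S(h₂)`. The coproduct of `S(h₂)` is flipped,
so the relation trades the outer legs for the inner ones: `σ(h₁, S(h₄)) h₂ S(h₃) = S(h₄) h₁ σ(h₂,
S(h₃))`. -/
theorem BraidedComm.outerForm_comul4 (hc : BraidedComm σ) (h : H) :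
    outerForm σ (comul4 k H h) = innerForm σ antipodeMul (comul4 k H h) := by
  rw [← assoc_map_comul_comul]
  induction comul (R := k) h using TensorProduct.induction_on with
  | zero => simp
  | add u v hu hv => simp only [map_add, hu, hv]
  | tmul a b =>
    have h1 := hc a (antipode k b)
    rw [TensorProduct.comul_tmul, comul_antipode] at h1
    rw [TensorProduct.map_tmul]
    refine Eq.trans ?_ (h1.trans ?_)
    · induction comul (R := k) a using TensorProduct.induction_on with
      | zero => simp
      | add u v hu hv => simp only [TensorProduct.add_tmul, map_add, hu, hv]
      | tmul a1 a2 =>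
        induction comul (R := k) b using TensorProduct.induction_on with
        | zero => simp
        | add u v hu hv => simp only [TensorProduct.tmul_add, map_add, hu, hv]
        | tmul b1 b2 => simp [outerForm_tmul]
    · induction comul (R := k) a using TensorProduct.induction_on with
      | zero => simp
      | add u v hu hv => simp only [TensorProduct.add_tmul, map_add, hu, hv]
      | tmul a1 a2 =>
        induction comul (R := k) b using TensorProduct.induction_on with
        | zero => simp
        | add u v hu hv => simp only [TensorProduct.tmul_add, map_add, hu, hv]
        | tmul b1 b2 => simp [innerForm_tmul, antipodeMul_apply]

/-- The middle legs `h₂ S(h₃)` collapse to a counit. -/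
theorem outerForm_comul4_eq (h : H) : outerForm σ (comul4 k H h) = drinfeldU σ h • 1 := by
  rw [← comul4_eq_middle]
  have e : ∀ t : H ⊗[k] (H ⊗[k] H), outerForm σ ((((TensorProduct.assoc k H H H).toLinearMap ∘ₗ
      (comul (R := k)).rTensor H).lTensor H) t) =
      TensorProduct.lift σ ((antipode k).lTensor H ((TensorProduct.lid k H).toLinearMap.lTensor H
        (((counit (R := k)).rTensor H).lTensor H t))) • 1 := by
    intro t
    induction t using TensorProduct.induction_on with
    | zero => simp
    | add u v hu hv => simp only [map_add, add_smul, hu, hv]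
    | tmul a t =>
      induction t using TensorProduct.induction_on with
      | zero => simp
      | add u v hu hv => simp only [TensorProduct.tmul_add, map_add, add_smul, hu, hv]
      | tmul b d =>
        have e1 : ∀ s : H ⊗[k] H, outerForm σ (a ⊗ₜ (TensorProduct.assoc k H H H (s ⊗ₜ d))) =
            σ a (antipode k d) • LinearMap.mul' k H ((antipode k).lTensor H s) := by
          intro s
          induction s using TensorProduct.induction_on with
          | zero => simp
          | add u v hu hv =>
            simp only [TensorProduct.add_tmul, TensorProduct.tmul_add, map_add, smul_add, hu, hv]
          | tmul b c => simp [outerForm_tmul]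
        simp only [LinearMap.lTensor_tmul, LinearMap.comp_apply, LinearMap.rTensor_tmul,
          LinearEquiv.coe_coe]
        rw [e1, HopfAlgebra.mul_antipode_lTensor_comul_apply, TensorProduct.lid_tmul,
          TensorProduct.lift.tmul, map_smul, map_smul, Algebra.algebraMap_eq_smul_one, smul_smul,
          smul_eq_mul, mul_comm]
  rw [e, drinfeldU]
  refine congrArg (fun z => TensorProduct.lift σ z • (1 : H)) ?_
  show (antipode k).lTensor H ((TensorProduct.lid k H).toLinearMap.lTensor H
    (((counit (R := k)).rTensor H).lTensor H ((comul (R := k)).lTensor H (comul (R := k) h)))) = _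
  rw [← LinearMap.lTensor_comp_apply H _ comul, Coalgebra.rTensor_counit_comp_comul,
    ← LinearMap.lTensor_comp_apply]
  have : (TensorProduct.lid k H).toLinearMap ∘ₗ TensorProduct.mk k k H 1 = LinearMap.id := by
    ext; simp
  rw [← LinearMap.lTensor_comp_apply, LinearMap.comp_assoc, this, LinearMap.comp_id]
  rfl

/-- The middle legs form `u`, so the expression is `β(h₁ u(h₂), h₃)`. -/
theorem innerForm_comul4_eq {M : Type*} [AddCommGroup M] [Module k M] (β : H →ₗ[k] H →ₗ[k] M)
    (h : H) : innerForm σ β (comul4 k H h) =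
      TensorProduct.lift β ((hitR (drinfeldU σ)).rTensor H (comul (R := k) h)) := by
  have e : (TensorProduct.assoc k H H H).toLinearMap.lTensor H ∘ₗ
      (TensorProduct.assoc k H (H ⊗[k] H) H).toLinearMap ∘ₗ (comul3 k H).rTensor H ∘ₗ comul =
        comul4 k H := by
    simp only [comul4, comul3, coassoc_simps]
  rw [← e, LinearMap.comp_apply, LinearMap.comp_apply, LinearMap.comp_apply]
  induction comul (R := k) h using TensorProduct.induction_on with
  | zero => simp
  | add u v hu hv => simp only [map_add, hu, hv]
  | tmul x d =>
    rw [LinearMap.rTensor_tmul, LinearMap.rTensor_tmul, comul3, LinearMap.comp_apply, hitR_apply]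
    induction comul (R := k) x using TensorProduct.induction_on with
    | zero => simp
    | add u v hu hv => simp only [TensorProduct.add_tmul, map_add, hu, hv]
    | tmul a y =>
      rw [LinearMap.lTensor_tmul, LinearMap.lTensor_tmul, drinfeldU, LinearMap.comp_apply,
        LinearMap.comp_apply]
      induction comul (R := k) y using TensorProduct.induction_on with
      | zero => simp
      | add u v hu hv => simp only [TensorProduct.add_tmul, TensorProduct.tmul_add, map_add, hu, hv]
      | tmul b c => simp [innerForm_tmul]

/-- `h₁ u(h₂) = u(h₁) S²(h₂)`. -/
theorem BraidedComm.hitR_drinfeldU (hc : BraidedComm σ) :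
    hitR (drinfeldU σ) = antipode k ∘ₗ antipode k ∘ₗ hitL (drinfeldU σ) := by
  -- The relation `S(h₃) h₁ u(h₂) = u(h) 1` has its legs in reversed order. In the opposite algebra
  -- it is a convolution product with `S`, and `S` has the right inverse `S²` there.
  let o : H →ₗ[k] Hᵐᵒᵖ := (MulOpposite.opLinearEquiv k).toLinearMap
  have h1 : cv (o ∘ₗ hitR (drinfeldU σ)) * cv (o ∘ₗ antipode k) =
      cv ((drinfeldU σ).smulRight (1 : Hᵐᵒᵖ)) := by
    refine conv_ext fun h => ?_
    have e := (hc.outerForm_comul4 h).symm.trans (outerForm_comul4_eq h)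
    rw [innerForm_comul4_eq] at e
    show _ = o (drinfeldU σ h • 1)
    rw [← e, conv_mul_apply]
    induction comul (R := k) h using TensorProduct.induction_on with
    | zero => simp
    | add u v hu hv => simp only [map_add, hu, hv]
    | tmul b c => rfl
  have h2 : cv (o ∘ₗ antipode k) * cv (o ∘ₗ antipode k ∘ₗ antipode k) = 1 := by
    refine conv_ext fun h => ?_
    have e : ∀ t : H ⊗[k] H, LinearMap.mul' k Hᵐᵒᵖ (TensorProduct.map (o ∘ₗ antipode k)
        (o ∘ₗ antipode k ∘ₗ antipode k) t) =
        o (antipode k (LinearMap.mul' k H ((antipode k).lTensor H t))) := by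
      intro t
      induction t using TensorProduct.induction_on with
      | zero => simp
      | add u v hu hv => simp only [map_add, hu, hv]
      | tmul b c =>
        rw [LinearMap.lTensor_tmul, LinearMap.mul'_apply, antipode_mul_antidistrib]
        rfl
    refine (e _).trans ?_
    rw [HopfAlgebra.mul_antipode_lTensor_comul_apply, conv_one_apply,
      Algebra.algebraMap_eq_smul_one, map_smul, map_smul, antipode_one]
    rfl
  have h3 : cv (o ∘ₗ hitR (drinfeldU σ)) = cv ((drinfeldU σ).smulRight (1 : Hᵐᵒᵖ)) *
      cv (o ∘ₗ antipode k ∘ₗ antipode k) := by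
    rw [← h1, mul_assoc, h2, mul_one]
  refine LinearMap.ext fun h => (MulOpposite.opLinearEquiv k (M := H)).injective ?_
  refine (congrArg (fun F : WithConv (H →ₗ[k] Hᵐᵒᵖ) => F h) h3).trans ?_
  show (cv ((drinfeldU σ).smulRight (1 : Hᵐᵒᵖ)) * cv (o ∘ₗ antipode k ∘ₗ antipode k) :
    WithConv (H →ₗ[k] Hᵐᵒᵖ)) h = o (antipode k (antipode k (hitL (drinfeldU σ) h)))
  rw [conv_mul_apply, hitL_apply]
  induction comul (R := k) h using TensorProduct.induction_on with
  | zero => simp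
  | add u v hu hv => simp only [map_add, hu, hv]
  | tmul b c => simp [o]

/-- Sliding `u` past `S²` turns `u(h₁) σ(S²(h₂), h₃)` into `σ(h₁, h₄) σ(h₂, S(h₃)) = σ(h₁, S(h₂) h₃)
= ε(h)`. This one-sided inverse suffices for the bijectivity of `S`. -/
theorem conv_drinfeldU_drinfeldV (hσ : IsSkewPairing σ) (hc : BraidedComm σ) :
    conv (drinfeldU σ) (drinfeldV σ) = counit := by
  refine LinearMap.ext fun h => ?_
  have e0 : drinfeldV σ (hitL (drinfeldU σ) h) =
      TensorProduct.lift σ ((hitR (drinfeldU σ)).rTensor H (comul (R := k) h)) := by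
    rw [hc.hitR_drinfeldU, drinfeldV, LinearMap.comp_apply, LinearMap.comp_apply, comul_hitL,
      ← LinearMap.rTensor_comp_apply]
    rfl
  rw [conv_eq_hitL, e0, ← innerForm_comul4_eq, ← assoc_map_comul_comul]
  have e : ∀ t : H ⊗[k] H, innerForm σ σ (TensorProduct.assoc k H H (H ⊗[k] H)
      (TensorProduct.map comul comul t)) = TensorProduct.lift σ
        ((LinearMap.mul' k H ∘ₗ (antipode k).rTensor H ∘ₗ comul).lTensor H t) := by
    intro t
    induction t using TensorProduct.induction_on with
    | zero => simp
    | add u v hu hv => simp only [map_add, hu, hv]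
    | tmul a b =>
      rw [TensorProduct.map_tmul, LinearMap.lTensor_tmul, LinearMap.comp_apply,
        LinearMap.comp_apply, TensorProduct.lift.tmul]
      induction comul (R := k) b using TensorProduct.induction_on with
      | zero => simp
      | add u v hu hv => simp only [TensorProduct.tmul_add, map_add, hu, hv]
      | tmul c d =>
        rw [LinearMap.rTensor_tmul, LinearMap.mul'_apply, hσ.mul_right]
        induction comul (R := k) a using TensorProduct.induction_on with
        | zero => simp
        | add u v hu hv => simp only [TensorProduct.add_tmul, map_add, hu, hv]
        | tmul a1 a2 => simp [innerForm_tmul, mul_comm]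
  have e2 : LinearMap.mul' k H ∘ₗ (antipode k).rTensor H ∘ₗ comul =
      Algebra.linearMap k H ∘ₗ counit := HopfAlgebra.mul_antipode_rTensor_comul
  rw [e, e2, LinearMap.lTensor_comp_apply, Coalgebra.lTensor_counit_comul, LinearMap.lTensor_tmul,
    TensorProduct.lift.tmul, Algebra.linearMap_apply, map_one, hσ.one_right]

theorem comul_antipode_antipode (h : H) : comul (R := k) (antipode k (antipode k h)) =
    TensorProduct.map (antipode k ∘ₗ antipode k) (antipode k ∘ₗ antipode k) (comul (R := k) h) := by
  rw [comul_antipode, comul_antipode]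
  induction comul (R := k) h using TensorProduct.induction_on with
  | zero => simp
  | add u v hu hv => simp only [map_add, hu, hv]
  | tmul a b => simp

theorem drinfeldV_antipode_antipode (hσ : IsSkewPairing σ) (h : H) :
    drinfeldV σ (antipode k (antipode k h)) = drinfeldV σ h := by
  rw [drinfeldV, LinearMap.comp_apply, LinearMap.comp_apply, comul_antipode_antipode,
    LinearMap.comp_apply, LinearMap.comp_apply]
  induction comul (R := k) h using TensorProduct.induction_on with
  | zero => simp
  | add u v hu hv => simp only [map_add, hu, hv]
  | tmul a b =>
    simp only [TensorProduct.map_tmul, LinearMap.rTensor_tmul, TensorProduct.lift.tmul,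
      LinearMap.comp_apply, hσ.apply_antipode_antipode]

theorem drinfeldU_antipode_antipode (hσ : IsSkewPairing σ) (h : H) :
    drinfeldU σ (antipode k (antipode k h)) = drinfeldU σ h := by
  rw [drinfeldU, LinearMap.comp_apply, LinearMap.comp_apply, comul_antipode_antipode,
    LinearMap.comp_apply, LinearMap.comp_apply]
  induction comul (R := k) h using TensorProduct.induction_on with
  | zero => simp
  | add u v hu hv => simp only [map_add, hu, hv]
  | tmul a b =>
    simp only [TensorProduct.map_tmul, LinearMap.lTensor_tmul, TensorProduct.lift.tmul,
      LinearMap.comp_apply, hσ.apply_antipode_antipode]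

/-- The antipode of a Hopf algebra with a braiding is bijective. -/
theorem bijectiveAntipode_of_braidedComm (hσ : IsSkewPairing σ) (hc : BraidedComm σ) :
    BijectiveAntipode k H := by
  -- As `u` and `v` are invariant under `S²`, the operators they define commute with `S²`.
  have hV : ∀ h, hitR (drinfeldV σ) (antipode k (antipode k h)) =
      antipode k (antipode k (hitR (drinfeldV σ) h)) := by
    intro h
    rw [hitR_apply, comul_antipode_antipode, hitR_apply]
    induction comul (R := k) h using TensorProduct.induction_on with
    | zero => simp
    | add u v hu hv => simp only [map_add, hu, hv]
    | tmul a b => simp [drinfeldV_antipode_antipode hσ]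
  have hU : ∀ h, hitL (drinfeldU σ) (antipode k (antipode k h)) =
      antipode k (antipode k (hitL (drinfeldU σ) h)) := by
    intro h
    rw [hitL_apply, comul_antipode_antipode, hitL_apply]
    induction comul (R := k) h using TensorProduct.induction_on with
    | zero => simp
    | add u v hu hv => simp only [map_add, hu, hv]
    | tmul a b => simp [drinfeldU_antipode_antipode hσ]
  -- `S² ∘ hitL u` is `hitR u`, which `hitR v` inverts on the right; so `hitL u ∘ hitR v` is a right
  -- inverse of `S²`.
  have h1 : ∀ h, antipode k (antipode k (hitL (drinfeldU σ) (hitR (drinfeldV σ) h))) = h := by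
    intro h
    have e := LinearMap.congr_fun hc.hitR_drinfeldU (hitR (drinfeldV σ) h)
    refine e.symm.trans ?_
    rw [← LinearMap.comp_apply, ← hitR_conv, conv_drinfeldU_drinfeldV hσ hc, hitR_counit]
    rfl
  -- The right inverse of `S²` commutes with `S²`, hence is also a left inverse. One factor `S` on
  -- either side then gives injectivity and surjectivity of `S`.
  refine ⟨⟨Function.LeftInverse.injective
    (g := fun h => hitL (drinfeldU σ) (hitR (drinfeldV σ) (antipode k h))) fun h => ?_,
    fun h => ⟨_, h1 h⟩⟩⟩
  show hitL (drinfeldU σ) (hitR (drinfeldV σ) (antipode k (antipode k h))) = h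
  rw [hV, hU, h1]

end DrinfeldElement

/-! ### Restriction of the form to sub-Hopf algebras -/

section RestrictForm

variable {k H A X : Type*} [Field k] [Ring H] [HopfAlgebra k H] [Ring A] [HopfAlgebra k A]
  [Ring X] [HopfAlgebra k X] {σ : H →ₗ[k] H →ₗ[k] k}

theorem comul_bialgHom (j : X →ₐc[k] H) (x : X) : comul (R := k) (j x) =
    TensorProduct.map (j : X →ₗ[k] H) (j : X →ₗ[k] H) (comul (R := k) x) :=
  (CoalgHomClass.map_comp_comul_apply j x).symm

theorem counit_bialgHom (j : X →ₐc[k] H) (x : X) :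
    counit (R := k) (j x) = counit (R := k) x :=
  CoalgHomClass.counit_comp_apply j x

/-- The restriction of a bilinear form along two maps of Hopf algebras. -/
abbrev restrictForm (σ : H →ₗ[k] H →ₗ[k] k) (i : A →ₐc[k] H) (j : X →ₐc[k] H) :
    A →ₗ[k] X →ₗ[k] k := σ.compl₁₂ (i : A →ₗ[k] H) (j : X →ₗ[k] H)

theorem IsSkewPairing.restrict (hσ : IsSkewPairing σ) (i : A →ₐc[k] H) (j : X →ₐc[k] H) :
    IsSkewPairing (restrictForm σ i j) where
  mul_left b b' h := by
    show σ (i (b * b')) (j h) = _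
    rw [map_mul, hσ.mul_left, comul_bialgHom]
    induction comul (R := k) h using TensorProduct.induction_on with
    | zero => simp
    | add u v hu hv => simp only [map_add, hu, hv]
    | tmul u v => rfl
  mul_right b h h' := by
    show σ (i b) (j (h * h')) = _
    rw [map_mul, hσ.mul_right, comul_bialgHom]
    induction comul (R := k) b using TensorProduct.induction_on with
    | zero => simp
    | add u v hu hv => simp only [map_add, hu, hv]
    | tmul u v => rfl
  one_left h := by
    show σ (i 1) (j h) = _
    rw [map_one, hσ.one_left, counit_bialgHom]
  one_right b := by
    show σ (i b) (j 1) = _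
    rw [map_one, hσ.one_right, counit_bialgHom]

theorem comul_map_bialgHom (i : A →ₐc[k] H) (j : X →ₐc[k] H) (t : A ⊗[k] X) :
    comul (R := k) (TensorProduct.map (i : A →ₗ[k] H) (j : X →ₗ[k] H) t) =
      TensorProduct.map (TensorProduct.map (i : A →ₗ[k] H) (j : X →ₗ[k] H))
        (TensorProduct.map (i : A →ₗ[k] H) (j : X →ₗ[k] H)) (comul (R := k) t) := by
  induction t using TensorProduct.induction_on with
  | zero => simp
  | add u v hu hv => simp only [map_add, hu, hv]
  | tmul a x =>
    have ei : comul (R := k) ((i : A →ₗ[k] H) a) = _ := comul_bialgHom i a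
    have ej : comul (R := k) ((j : X →ₗ[k] H) x) = _ := comul_bialgHom j x
    rw [TensorProduct.map_tmul, TensorProduct.comul_tmul, TensorProduct.comul_tmul, ei, ej]
    induction comul (R := k) a using TensorProduct.induction_on with
    | zero => simp
    | add u v hu hv => simp only [map_add, TensorProduct.add_tmul, hu, hv]
    | tmul a1 a2 =>
      induction comul (R := k) x using TensorProduct.induction_on with
      | zero => simp
      | add u v hu hv => simp only [map_add, TensorProduct.tmul_add, hu, hv]
      | tmul x1 x2 => rfl

theorem counit_map_bialgHom (i : A →ₐc[k] H) (j : X →ₐc[k] H) (t : A ⊗[k] X) :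
    counit (R := k) (TensorProduct.map (i : A →ₗ[k] H) (j : X →ₗ[k] H) t) =
      counit (R := k) t := by
  induction t using TensorProduct.induction_on with
  | zero => simp
  | add u v hu hv => simp only [map_add, hu, hv]
  | tmul a x =>
    have ei : counit (R := k) ((i : A →ₗ[k] H) a) = _ := counit_bialgHom i a
    have ej : counit (R := k) ((j : X →ₗ[k] H) x) = _ := counit_bialgHom j x
    rw [TensorProduct.map_tmul, TensorProduct.counit_tmul, TensorProduct.counit_tmul, ei, ej]

/-- The two sides are elements of `X`, so the relation in `H` descends only because `j` is
injective. -/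
theorem BraidedComm.restrict (hc : BraidedComm σ) (j : X →ₐc[k] H) (hj : Function.Injective j) :
    BraidedComm (restrictForm σ j j) := by
  intro h g
  have e := hc (j h) (j g)
  have e1 := comul_map_bialgHom j j (h ⊗ₜ g)
  rw [TensorProduct.map_tmul] at e1
  erw [e1] at e
  apply hj
  have e2 : ∀ t : (X ⊗[k] X) ⊗[k] (X ⊗[k] X), j (TensorProduct.lid k X (TensorProduct.map
      (TensorProduct.lift (restrictForm σ j j)) (LinearMap.mul' k X) t)) =
      TensorProduct.lid k H (TensorProduct.map (TensorProduct.lift σ) (LinearMap.mul' k H)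
        (TensorProduct.map (TensorProduct.map (j : X →ₗ[k] H) (j : X →ₗ[k] H))
          (TensorProduct.map (j : X →ₗ[k] H) (j : X →ₗ[k] H)) t)) := by
    intro t
    induction t using TensorProduct.induction_on with
    | zero => simp
    | add u v hu hv => simp only [map_add, hu, hv]
    | tmul u v =>
      induction v using TensorProduct.induction_on with
      | zero => simp
      | add a b ha hb => simp only [map_add, TensorProduct.tmul_add, ha, hb]
      | tmul a b =>
        induction u using TensorProduct.induction_on with
        | zero => simp
        | add a b ha hb => simp only [map_add, TensorProduct.add_tmul, ha, hb]
        | tmul c d => simp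
  have e3 : ∀ t : (X ⊗[k] X) ⊗[k] (X ⊗[k] X), j (TensorProduct.rid k X (TensorProduct.map
      (LinearMap.mul' k X ∘ₗ (TensorProduct.comm k X X).toLinearMap)
      (TensorProduct.lift (restrictForm σ j j)) t)) =
      TensorProduct.rid k H (TensorProduct.map
        (LinearMap.mul' k H ∘ₗ (TensorProduct.comm k H H).toLinearMap) (TensorProduct.lift σ)
        (TensorProduct.map (TensorProduct.map (j : X →ₗ[k] H) (j : X →ₗ[k] H))
          (TensorProduct.map (j : X →ₗ[k] H) (j : X →ₗ[k] H)) t)) := by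
    intro t
    induction t using TensorProduct.induction_on with
    | zero => simp
    | add u v hu hv => simp only [map_add, hu, hv]
    | tmul u v =>
      induction v using TensorProduct.induction_on with
      | zero => simp
      | add a b ha hb => simp only [map_add, TensorProduct.tmul_add, ha, hb]
      | tmul a b =>
        induction u using TensorProduct.induction_on with
        | zero => simp
        | add a b ha hb => simp only [map_add, TensorProduct.add_tmul, ha, hb]
        | tmul c d => simp
  exact (e2 _).trans (e.trans (e3 _).symm)

theorem IsCoquasitriangular.bijectiveAntipode (hσ : IsCoquasitriangular σ) (j : X →ₐc[k] H)
    (hj : Function.Injective j) : BijectiveAntipode k X :=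
  bijectiveAntipode_of_braidedComm (hσ.toIsSkewPairing.restrict j j)
    (BraidedComm.restrict hσ.comm j hj)

end RestrictForm

/-! ### The convolution inverse of the form -/

section InverseForm

variable {k B V H : Type*} [Field k] [Ring B] [HopfAlgebra k B] [Ring V] [HopfAlgebra k V]
  [Ring H] [HopfAlgebra k H]

theorem IsSkewPairing.lift_mul {p : B →ₗ[k] V →ₗ[k] k} (hp : IsSkewPairing p) (s : B ⊗[k] B)
    (v : V) : LinearMap.mul' k k (TensorProduct.map (TensorProduct.lift p) (TensorProduct.lift p)
      (TensorProduct.AlgebraTensorModule.tensorTensorTensorComm k k k k B B V V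
        (s ⊗ₜ comul (R := k) v))) = p (LinearMap.mul' k B s) v := by
  induction s using TensorProduct.induction_on with
  | zero => simp
  | add u v hu hv => simp only [map_add, TensorProduct.add_tmul, LinearMap.add_apply, hu, hv]
  | tmul a b =>
    rw [LinearMap.mul'_apply, hp.mul_left]
    induction comul (R := k) v using TensorProduct.induction_on with
    | zero => simp
    | add u v hu hv => simp only [map_add, TensorProduct.tmul_add, hu, hv]
    | tmul x y => rfl

/-- The convolution inverse `p(S(b), v)` of a skew pairing `p`. -/
def invForm (p : B →ₗ[k] V →ₗ[k] k) : WithConv (B ⊗[k] V →ₗ[k] k) :=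
  cv (TensorProduct.lift (p ∘ₗ antipode k))

/-- Multiplicativity in the first variable gives `p(S(b₁), v₁) p(b₂, v₂) = p(S(b₁) b₂, v)`. -/
theorem IsSkewPairing.invForm_mul {p : B →ₗ[k] V →ₗ[k] k} (hp : IsSkewPairing p) :
    invForm p * cv (TensorProduct.lift p) = 1 := by
  refine WithConv.ext (TensorProduct.ext' fun b v => ?_)
  show LinearMap.mul' k k (TensorProduct.map (TensorProduct.lift (p ∘ₗ antipode k))
    (TensorProduct.lift p) (comul (R := k) (b ⊗ₜ[k] v))) =
      algebraMap k k (counit (R := k) (b ⊗ₜ[k] v))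
  rw [TensorProduct.comul_tmul]
  have e : ∀ s : B ⊗[k] B, ∀ t : V ⊗[k] V, TensorProduct.map (TensorProduct.lift (p ∘ₗ antipode k))
      (TensorProduct.lift p) (TensorProduct.AlgebraTensorModule.tensorTensorTensorComm k k k k B B V V
        (s ⊗ₜ t)) = TensorProduct.map (TensorProduct.lift p) (TensorProduct.lift p)
        (TensorProduct.AlgebraTensorModule.tensorTensorTensorComm k k k k B B V V
          ((antipode k).rTensor B s ⊗ₜ t)) := by
    intro s t
    induction s using TensorProduct.induction_on with
    | zero => simp
    | add u v hu hv => simp only [map_add, TensorProduct.add_tmul, hu, hv]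
    | tmul a b =>
      induction t using TensorProduct.induction_on with
      | zero => simp
      | add u v hu hv => simp only [map_add, TensorProduct.tmul_add, hu, hv]
      | tmul x y => rfl
  rw [e, hp.lift_mul, HopfAlgebra.mul_antipode_rTensor_comul_apply, Algebra.algebraMap_eq_smul_one,
    map_smul, LinearMap.smul_apply, hp.one_left, TensorProduct.counit_tmul]
  simp [mul_comm]

theorem IsSkewPairing.mul_invForm {p : B →ₗ[k] V →ₗ[k] k} (hp : IsSkewPairing p) :
    cv (TensorProduct.lift p) * invForm p = 1 := by
  refine WithConv.ext (TensorProduct.ext' fun b v => ?_)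
  show LinearMap.mul' k k (TensorProduct.map (TensorProduct.lift p)
    (TensorProduct.lift (p ∘ₗ antipode k)) (comul (R := k) (b ⊗ₜ[k] v))) =
      algebraMap k k (counit (R := k) (b ⊗ₜ[k] v))
  rw [TensorProduct.comul_tmul]
  have e : ∀ s : B ⊗[k] B, ∀ t : V ⊗[k] V, TensorProduct.map (TensorProduct.lift p)
      (TensorProduct.lift (p ∘ₗ antipode k))
      (TensorProduct.AlgebraTensorModule.tensorTensorTensorComm k k k k B B V V
        (s ⊗ₜ t)) = TensorProduct.map (TensorProduct.lift p) (TensorProduct.lift p)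
        (TensorProduct.AlgebraTensorModule.tensorTensorTensorComm k k k k B B V V
          ((antipode k).lTensor B s ⊗ₜ t)) := by
    intro s t
    induction s using TensorProduct.induction_on with
    | zero => simp
    | add u v hu hv => simp only [map_add, TensorProduct.add_tmul, hu, hv]
    | tmul a b =>
      induction t using TensorProduct.induction_on with
      | zero => simp
      | add u v hu hv => simp only [map_add, TensorProduct.tmul_add, hu, hv]
      | tmul x y => rfl
  rw [e, hp.lift_mul, HopfAlgebra.mul_antipode_lTensor_comul_apply, Algebra.algebraMap_eq_smul_one,
    map_smul, LinearMap.smul_apply, hp.one_left, TensorProduct.counit_tmul]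
  simp [mul_comm]

variable {σ : H →ₗ[k] H →ₗ[k] k}

theorem mul'_map_linearMap_right {C C' : Type*} [AddCommGroup C] [Module k C] [AddCommGroup C']
    [Module k C'] (f : H →ₗ[k] k) (F : C →ₗ[k] H) (s : C' →ₗ[k] k) (t : C ⊗[k] C') :
    f (LinearMap.mul' k H (TensorProduct.map F (Algebra.linearMap k H ∘ₗ s) t)) =
      LinearMap.mul' k k (TensorProduct.map (f ∘ₗ F) s t) := by
  induction t using TensorProduct.induction_on with
  | zero => simp
  | add u v hu hv => simp only [map_add, hu, hv]
  | tmul u v => simp [Algebra.algebraMap_eq_smul_one, mul_comm]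

theorem mul'_map_linearMap_left {C C' : Type*} [AddCommGroup C] [Module k C] [AddCommGroup C']
    [Module k C'] (f : H →ₗ[k] k) (F : C →ₗ[k] H) (s : C' →ₗ[k] k) (t : C' ⊗[k] C) :
    f (LinearMap.mul' k H (TensorProduct.map (Algebra.linearMap k H ∘ₗ s) F t)) =
      LinearMap.mul' k k (TensorProduct.map s (f ∘ₗ F) t) := by
  induction t using TensorProduct.induction_on with
  | zero => simp
  | add u v hu hv => simp only [map_add, hu, hv]
  | tmul u v => simp [Algebra.algebraMap_eq_smul_one, mul_comm]

/-- `f(h₁ g₁) σ⁻¹(h₂, g₂) = σ⁻¹(h₁, g₁) f(g₂ h₂)`. -/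
theorem BraidedComm.mul_invForm (hc : BraidedComm σ) (hσ : IsSkewPairing σ) (f : H →ₗ[k] k) :
    cv (f ∘ₗ LinearMap.mul' k H) * invForm σ =
      invForm σ * cv (f ∘ₗ LinearMap.mul' k H ∘ₗ (TensorProduct.comm k H H).toLinearMap) := by
  -- With `m` the product of `H`, the braiding relation reads `σ * m = mᵒᵖ * σ` in the convolution
  -- algebra of maps `H ⊗ H → H`.
  have h1 : convPush (Algebra.ofId k H) (cv (TensorProduct.lift σ)) * cv (LinearMap.mul' k H) =
      cv (LinearMap.mul' k H ∘ₗ (TensorProduct.comm k H H).toLinearMap) *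
        convPush (Algebra.ofId k H) (cv (TensorProduct.lift σ)) := by
    refine WithConv.ext (TensorProduct.ext' fun h g => ?_)
    have e := hc h g
    have e1 : ∀ t : (H ⊗[k] H) ⊗[k] (H ⊗[k] H), LinearMap.mul' k H (TensorProduct.map
        (Algebra.linearMap k H ∘ₗ TensorProduct.lift σ) (LinearMap.mul' k H) t) =
        TensorProduct.lid k H (TensorProduct.map (TensorProduct.lift σ) (LinearMap.mul' k H) t) := by
      intro t
      induction t using TensorProduct.induction_on with
      | zero => simp
      | add u v hu hv => simp only [map_add, hu, hv]
      | tmul u v => simp [Algebra.algebraMap_eq_smul_one]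
    have e2 : ∀ t : (H ⊗[k] H) ⊗[k] (H ⊗[k] H), LinearMap.mul' k H (TensorProduct.map
        (LinearMap.mul' k H ∘ₗ (TensorProduct.comm k H H).toLinearMap)
        (Algebra.linearMap k H ∘ₗ TensorProduct.lift σ) t) =
        TensorProduct.rid k H (TensorProduct.map
          (LinearMap.mul' k H ∘ₗ (TensorProduct.comm k H H).toLinearMap)
          (TensorProduct.lift σ) t) := by
      intro t
      induction t using TensorProduct.induction_on with
      | zero => simp
      | add u v hu hv => simp only [map_add, hu, hv]
      | tmul u v => simp [Algebra.algebraMap_eq_smul_one]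
    exact (e1 _).trans (e.trans (e2 _).symm)
  have hl : convPush (Algebra.ofId k H) (invForm σ) *
      convPush (Algebra.ofId k H) (cv (TensorProduct.lift σ)) = 1 := by
    rw [← map_mul, hσ.invForm_mul, map_one]
  have hr : convPush (Algebra.ofId k H) (cv (TensorProduct.lift σ)) *
      convPush (Algebra.ofId k H) (invForm σ) = 1 := by
    rw [← map_mul, hσ.mul_invForm, map_one]
  -- Conjugation by `σ⁻¹` gives `m * σ⁻¹ = σ⁻¹ * mᵒᵖ`, to which `f` is then applied.
  have h2 : cv (LinearMap.mul' k H) * convPush (Algebra.ofId k H) (invForm σ) =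
      convPush (Algebra.ofId k H) (invForm σ) *
        cv (LinearMap.mul' k H ∘ₗ (TensorProduct.comm k H H).toLinearMap) := by
    calc _ = (convPush (Algebra.ofId k H) (invForm σ) *
          convPush (Algebra.ofId k H) (cv (TensorProduct.lift σ))) * cv (LinearMap.mul' k H) *
            convPush (Algebra.ofId k H) (invForm σ) := by rw [hl, one_mul]
      _ = convPush (Algebra.ofId k H) (invForm σ) *
          (convPush (Algebra.ofId k H) (cv (TensorProduct.lift σ)) * cv (LinearMap.mul' k H)) *
            convPush (Algebra.ofId k H) (invForm σ) := by simp only [mul_assoc]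
      _ = _ := by rw [h1]; simp only [mul_assoc]; rw [hr, mul_one]
  refine conv_ext fun c => ?_
  have h3 := congrArg (fun F : WithConv (H ⊗[k] H →ₗ[k] H) => f (F c)) h2
  exact (mul'_map_linearMap_right f (LinearMap.mul' k H) (invForm σ).ofConv _).symm.trans
    (h3.trans (mul'_map_linearMap_left f _ (invForm σ).ofConv _))

end InverseForm

/-! ### A criterion for membership in the finite dual -/

section FiniteDualCriterion

variable {k H : Type*} [Field k] [Ring H] [HopfAlgebra k H]

/-- A matrix coefficient factors through the endomorphism algebra of `W`, which is finite
dimensional. -/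
theorem IsFiniteDual.of_representation {W : Type*} [AddCommGroup W] [Module k W]
    [Module.Finite k W] (ρ : H →ₗ[k] W →ₗ[k] W) (h1 : ∀ w, ρ 1 w = w)
    (hmul : ∀ a b w, ρ (a * b) w = ρ a (ρ b w)) (w : W) (φ : W →ₗ[k] k) :
    IsFiniteDual (cv (φ ∘ₗ ρ.flip w)) := by
  let r : H →ₐ[k] Module.End k W := AlgHom.ofLinearMap ρ (LinearMap.ext h1)
    (fun a b => LinearMap.ext (hmul a b))
  exact IsFiniteDual.of_factor r (φ ∘ₗ LinearMap.applyₗ w)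

/-- The translates `f(- h)` form a representation of `H` by `(h · w)(g) = w(g h)`, and `f(h) = (h ·
f)(1)` is one of its matrix coefficients. -/
theorem IsFiniteDual.of_finite_translates (f : H →ₗ[k] k) (V : Submodule k (H →ₗ[k] k))
    [Module.Finite k V] (hf : ∀ h, f ∘ₗ LinearMap.mulRight k h ∈ V) :
    IsFiniteDual (cv f) := by
  -- `V` need not be stable under translation; the space `W` of all translates of `f` is, and it is
  -- finite dimensional as a subspace of `V`.
  let W : Submodule k (H →ₗ[k] k) := LinearMap.range
    ((LinearMap.llcomp k H H k f) ∘ₗ (LinearMap.mul k H).flip)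
  have hW : ∀ h, f ∘ₗ LinearMap.mulRight k h ∈ W := fun h => ⟨h, rfl⟩
  have hWV : W ≤ V := by
    rintro _ ⟨h, rfl⟩
    exact hf h
  have : Module.Finite k W := Submodule.finiteDimensional_of_le hWV
  have hmem : ∀ h : H, ∀ w ∈ W, w ∘ₗ LinearMap.mulRight k h ∈ W := by
    rintro h _ ⟨h', rfl⟩
    refine ⟨h * h', LinearMap.ext fun g => ?_⟩
    exact congrArg f (mul_assoc g h h').symm
  let ρ : H →ₗ[k] W →ₗ[k] W :=
    { toFun := fun h => (LinearMap.lcomp k k (LinearMap.mulRight k h)).restrict (hmem h)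
      map_add' := fun a b => LinearMap.ext fun w => Subtype.ext <| LinearMap.ext fun g => by
        show w.1 (g * (a + b)) = w.1 (g * a) + w.1 (g * b)
        rw [mul_add, map_add]
      map_smul' := fun r a => LinearMap.ext fun w => Subtype.ext <| LinearMap.ext fun g => by
        show w.1 (g * (r • a)) = r • w.1 (g * a)
        rw [mul_smul_comm, map_smul] }
  have hfW : f ∈ W := by
    have := hW 1
    rwa [LinearMap.mulRight_one, LinearMap.comp_id] at this
  have e : cv f = cv ((LinearMap.applyₗ (1 : H) ∘ₗ W.subtype) ∘ₗ ρ.flip (⟨f, hfW⟩ : W)) :=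
    conv_ext fun h => congrArg f (one_mul h).symm
  rw [e]
  have h1 : ∀ w, ρ 1 w = w := fun w =>
    Subtype.ext <| LinearMap.ext fun g => congrArg w.1 (mul_one g)
  have hmul : ∀ a b w, ρ (a * b) w = ρ a (ρ b w) := fun a b w =>
    Subtype.ext <| LinearMap.ext fun g => congrArg w.1 (mul_assoc g a b).symm
  exact IsFiniteDual.of_representation (k := k) (H := H) (W := W) ρ h1 hmul ⟨f, hfW⟩
    (LinearMap.applyₗ (1 : H) ∘ₗ W.subtype)

/-- If `f(g h)` is a finite sum of products `a(g) b(h)`, every translate `f(- h)` lies in the span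
of the finitely many `a`. -/
theorem IsFiniteDual.of_comp_mul (f : H →ₗ[k] k) (t : (H →ₗ[k] k) ⊗[k] (H →ₗ[k] k))
    (ht : ∀ g h, f (g * h) = TensorProduct.dualDistrib k H H t (g ⊗ₜ h)) :
    IsFiniteDual (cv f) := by
  classical
  obtain ⟨s, hs⟩ := TensorProduct.exists_finset t
  refine IsFiniteDual.of_finite_translates f
    (Submodule.span k ((s.image Prod.fst : Finset (H →ₗ[k] k)) : Set (H →ₗ[k] k))) fun h => ?_
  have e : f ∘ₗ LinearMap.mulRight k h = ∑ i ∈ s, i.2 h • i.1 := by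
    refine LinearMap.ext fun g => (ht g h).trans ?_
    rw [hs, map_sum, LinearMap.sum_apply, LinearMap.sum_apply]
    exact Finset.sum_congr rfl fun i _ => mul_comm _ _
  rw [e]
  exact Submodule.sum_mem _ fun i hi => Submodule.smul_mem _ _
    (Submodule.subset_span (Finset.mem_coe.2 (Finset.mem_image_of_mem _ hi)))

end FiniteDualCriterion

/-! ### The functionals l_x and r_a in the finite dual -/

section Functionals

variable {k H : Type*} [Field k] [Ring H] [HopfAlgebra k H] {σ : H →ₗ[k] H →ₗ[k] k}

/-- The map `x ↦ l_x = σ(-, x)` from `H` to its finite dual. -/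
def leftFun (hσ : IsSkewPairing σ) : H →ₗ[k] FiniteDual k H :=
  LinearMap.codRestrict (Subalgebra.toSubmodule (finiteDualSubalgebra k H))
    ((WithConv.linearEquiv k (H →ₗ[k] k)).symm.toLinearMap ∘ₗ σ.flip) fun x => by
      refine IsFiniteDual.of_comp_mul (σ.flip x) (TensorProduct.map σ.flip σ.flip (comul (R := k) x))
        fun g h => (hσ.mul_left g h x).trans ?_
      induction comul (R := k) x using TensorProduct.induction_on with
      | zero => simp
      | add u v hu hv => simp only [map_add, LinearMap.add_apply, hu, hv]
      | tmul u v => rfl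

/-- The map `a ↦ r_a = σ(a, -)` from `H` to its finite dual. -/
def rightFun (hσ : IsSkewPairing σ) : H →ₗ[k] FiniteDual k H :=
  LinearMap.codRestrict (Subalgebra.toSubmodule (finiteDualSubalgebra k H))
    ((WithConv.linearEquiv k (H →ₗ[k] k)).symm.toLinearMap ∘ₗ σ) fun a => by
      refine IsFiniteDual.of_comp_mul (σ a)
        (TensorProduct.map σ σ (TensorProduct.comm k H H (comul (R := k) a)))
        fun g h => (hσ.mul_right a g h).trans ?_
      induction comul (R := k) a using TensorProduct.induction_on with
      | zero => simp
      | add u v hu hv => simp only [map_add, LinearMap.add_apply, hu, hv]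
      | tmul u v => exact mul_comm _ _

variable (hσ : IsSkewPairing σ)

theorem finiteDual_ext {f g : FiniteDual k H}
    (h : ∀ x, FiniteDual.ev k H f x = FiniteDual.ev k H g x) : f = g :=
  FiniteDual.ev_injective k H (LinearMap.ext h)

/-- The flip in `mul_right` makes `x ↦ l_x` reverse products, while it preserves coproducts; `a ↦
r_a` behaves the other way round. Thus `x ↦ l_{S⁻¹(x)}` is multiplicative and reverses coproducts,
which is why the co-opposite Hopf algebra appears. -/
theorem leftFun_mul (x y : H) : leftFun hσ (x * y) = leftFun hσ y * leftFun hσ x :=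
  finiteDual_ext fun h => hσ.mul_right h x y

theorem rightFun_mul (a b : H) : rightFun hσ (a * b) = rightFun hσ a * rightFun hσ b :=
  finiteDual_ext fun h => hσ.mul_left a b h

theorem leftFun_one : leftFun hσ 1 = 1 := finiteDual_ext fun h => hσ.one_right h

theorem rightFun_one : rightFun hσ 1 = 1 := finiteDual_ext fun h => hσ.one_left h

theorem counit_leftFun (x : H) : counit (R := k) (leftFun hσ x) = counit (R := k) x :=
  hσ.one_left x

theorem comul_leftFun (x : H) : comul (R := k) (leftFun hσ x) =
    TensorProduct.map (leftFun hσ) (leftFun hσ) (comul (R := k) x) := by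
  refine FiniteDual.ev2_injective k H (TensorProduct.ext' fun g h => ?_)
  rw [FiniteDual.ev2_comul]
  refine (hσ.mul_left g h x).trans ?_
  induction comul (R := k) x using TensorProduct.induction_on with
  | zero => simp
  | add u v hu hv => simp only [map_add, LinearMap.add_apply, hu, hv]
  | tmul u v => rfl

theorem comul_rightFun (a : H) : comul (R := k) (rightFun hσ a) =
    TensorProduct.map (rightFun hσ) (rightFun hσ) (TensorProduct.comm k H H (comul (R := k) a)) := by
  refine FiniteDual.ev2_injective k H (TensorProduct.ext' fun g h => ?_)
  rw [FiniteDual.ev2_comul]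
  refine (hσ.mul_right a g h).trans ?_
  induction comul (R := k) a using TensorProduct.induction_on with
  | zero => simp
  | add u v hu hv => simp only [map_add, LinearMap.add_apply, hu, hv]
  | tmul u v => exact mul_comm _ _

/-- Invariance of `σ` under `S ⊗ S`; hence the antipode of the finite dual sends `l_x` to
`l_{S⁻¹(x)}` when `S` is bijective. -/
theorem antipode_leftFun_antipode (x : H) :
    antipode k (leftFun hσ (antipode k x)) = leftFun hσ x :=
  finiteDual_ext fun h => hσ.apply_antipode_antipode h x

theorem antipode_rightFun_antipode (a : H) :
    antipode k (rightFun hσ (antipode k a)) = rightFun hσ a :=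
  finiteDual_ext fun h => hσ.apply_antipode_antipode a h

end Functionals

/-! ### Translates of functionals and the exchange relation -/

section Translates

variable {k H X : Type*} [Field k] [Ring H] [HopfAlgebra k H] [Ring X] [HopfAlgebra k X]

/-- A map `F` to the finite dual, as the bilinear form `h ⊗ x ↦ F(x)(h)`. -/
def evForm (F : WithConv (X →ₗ[k] FiniteDual k H)) : WithConv (H ⊗[k] X →ₗ[k] k) :=
  cv (TensorProduct.lift (FiniteDual.ev k H ∘ₗ F.ofConv).flip)

theorem evForm_tmul (F : WithConv (X →ₗ[k] FiniteDual k H)) (h : H) (x : X) :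
    evForm F (h ⊗ₜ x) = FiniteDual.ev k H (F x) h := rfl

theorem evForm_injective : Function.Injective (evForm (k := k) (H := H) (X := X)) := by
  intro F G h
  refine conv_ext fun x => finiteDual_ext fun y => ?_
  rw [← evForm_tmul, h, evForm_tmul]

/-- The product of the finite dual is dual to the coproduct of `H`; together with the coproduct of
`X` it gives the coproduct of `H ⊗ X`. Identities between maps into the finite dual can therefore be
checked on bilinear forms. -/
theorem evForm_mul (F G : WithConv (X →ₗ[k] FiniteDual k H)) :
    evForm (F * G) = evForm F * evForm G := by
  refine WithConv.ext (TensorProduct.ext' fun h x => ?_)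
  show FiniteDual.ev k H (LinearMap.mul' k _ (TensorProduct.map F.ofConv G.ofConv
    (comul (R := k) x))) h = LinearMap.mul' k k (TensorProduct.map (evForm F).ofConv
      (evForm G).ofConv (comul (R := k) (h ⊗ₜ[k] x)))
  rw [TensorProduct.comul_tmul]
  induction comul (R := k) x using TensorProduct.induction_on with
  | zero => simp
  | add u v hu hv => simp only [map_add, TensorProduct.tmul_add, LinearMap.add_apply, hu, hv]
  | tmul u v =>
    rw [TensorProduct.map_tmul, LinearMap.mul'_apply, FiniteDual.ev_mul]
    induction comul (R := k) h using TensorProduct.induction_on with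
    | zero => simp
    | add u v hu hv => simp only [map_add, TensorProduct.add_tmul, hu, hv]
    | tmul g h => rfl

/-- The map `x ↦ f(- x) = f₁ f₂(x)`. -/
def rightTranslate (j : X →ₐc[k] H) (f : FiniteDual k H) : X →ₗ[k] FiniteDual k H :=
  ((LinearMap.llcomp k _ _ _ (TensorProduct.rid k (FiniteDual k H)).toLinearMap) ∘ₗ
    LinearMap.lTensorHom (FiniteDual k H) ∘ₗ (FiniteDual.ev k H).flip ∘ₗ
      (j : X →ₗ[k] H)).flip (comul (R := k) f)

/-- The map `x ↦ f(x -) = f₁(x) f₂`. -/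
def leftTranslate (j : X →ₐc[k] H) (f : FiniteDual k H) : X →ₗ[k] FiniteDual k H :=
  ((LinearMap.llcomp k _ _ _ (TensorProduct.lid k (FiniteDual k H)).toLinearMap) ∘ₗ
    LinearMap.rTensorHom (FiniteDual k H) ∘ₗ (FiniteDual.ev k H).flip ∘ₗ
      (j : X →ₗ[k] H)).flip (comul (R := k) f)

theorem rightTranslate_apply (j : X →ₐc[k] H) (f : FiniteDual k H) (x : X) :
    rightTranslate j f x = TensorProduct.rid k (FiniteDual k H)
      (((FiniteDual.ev k H).flip (j x)).lTensor (FiniteDual k H) (comul (R := k) f)) := rfl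

theorem leftTranslate_apply (j : X →ₐc[k] H) (f : FiniteDual k H) (x : X) :
    leftTranslate j f x = TensorProduct.lid k (FiniteDual k H)
      (((FiniteDual.ev k H).flip (j x)).rTensor (FiniteDual k H) (comul (R := k) f)) := rfl

theorem ev_rightTranslate (j : X →ₐc[k] H) (f : FiniteDual k H) (x : X) (h : H) :
    FiniteDual.ev k H (rightTranslate j f x) h = FiniteDual.ev k H f (h * j x) := by
  rw [rightTranslate_apply, ← FiniteDual.ev2_comul]
  induction comul (R := k) f using TensorProduct.induction_on with
  | zero => simp
  | add u v hu hv => simp only [map_add, LinearMap.add_apply, hu, hv]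
  | tmul u v => simp [FiniteDual.ev2_tmul, mul_comm]

theorem ev_leftTranslate (j : X →ₐc[k] H) (f : FiniteDual k H) (x : X) (h : H) :
    FiniteDual.ev k H (leftTranslate j f x) h = FiniteDual.ev k H f (j x * h) := by
  rw [leftTranslate_apply, ← FiniteDual.ev2_comul]
  induction comul (R := k) f using TensorProduct.induction_on with
  | zero => simp
  | add u v hu hv => simp only [map_add, LinearMap.add_apply, hu, hv]
  | tmul u v => simp [FiniteDual.ev2_tmul]

variable [BijectiveAntipode k X] {σ : H →ₗ[k] H →ₗ[k] k}

/-- The map `x ↦ l_{S⁻¹(x)}`. -/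
def leftFunInv (hσ : IsSkewPairing σ) (j : X →ₐc[k] H) : X →ₗ[k] FiniteDual k H :=
  leftFun hσ ∘ₗ (j : X →ₗ[k] H) ∘ₗ antipodeInv k X

/-- By invariance of `σ` under the antipodes, `σ(h, S⁻¹(x)) = σ(S(h), x)`. So `l_{S⁻¹(x)}` is the
convolution inverse of `σ` in its first variable. -/
theorem ev_leftFunInv (hσ : IsSkewPairing σ) (j : X →ₐc[k] H) (x : X) (h : H) :
    FiniteDual.ev k H (leftFunInv hσ j x) h = σ (antipode k h) (j x) := by
  show σ h (j (antipodeInv k X x)) = _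
  rw [← hσ.apply_antipode_antipode h, antipode_comp_bialgHom, antipode_antipodeInv]

/-- `f(- x₁) l_{S⁻¹(x₂)} = l_{S⁻¹(x₁)} f(x₂ -)`. -/
theorem rightTranslate_mul_leftFunInv (hσ : IsSkewPairing σ) (hc : BraidedComm σ)
    (j : X →ₐc[k] H) (f : FiniteDual k H) :
    cv (rightTranslate j f) * cv (leftFunInv hσ j) =
      cv (leftFunInv hσ j) * cv (leftTranslate j f) := by
  apply evForm_injective
  rw [evForm_mul, evForm_mul]
  -- All maps involved are restrictions along `id ⊗ j` of forms on `H ⊗ H`, and restriction is a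
  -- ring morphism; the claim becomes `BraidedComm.mul_invForm`.
  let P : WithConv (H ⊗[k] H →ₗ[k] k) →+* WithConv (H ⊗[k] X →ₗ[k] k) :=
    convPull (TensorProduct.map ((BialgHom.id k H : H →ₐc[k] H) : H →ₗ[k] H) (j : X →ₗ[k] H))
      (comul_map_bialgHom _ j) (counit_map_bialgHom _ j)
  have e1 : evForm (cv (rightTranslate j f)) =
      P (cv (FiniteDual.ev k H f ∘ₗ LinearMap.mul' k H)) :=
    WithConv.ext (TensorProduct.ext' fun h x => ev_rightTranslate j f x h)
  have e2 : evForm (cv (leftFunInv hσ j)) = P (invForm σ) :=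
    WithConv.ext (TensorProduct.ext' fun h x => ev_leftFunInv hσ j x h)
  have e3 : evForm (cv (leftTranslate j f)) = P (cv (FiniteDual.ev k H f ∘ₗ LinearMap.mul' k H ∘ₗ
      (TensorProduct.comm k H H).toLinearMap)) :=
    WithConv.ext (TensorProduct.ext' fun h x => ev_leftTranslate j f x h)
  rw [e1, e2, e3, ← map_mul, ← map_mul, hc.mul_invForm hσ]

end Translates

/-! ### The spaces of l_x and of r_a commute -/

section FunctionalsCommute

variable {k C E : Type*} [Field k] [AddCommGroup C] [Module k C] [Coalgebra k C]
  [Ring E] [Algebra k E]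

/-- A scalar-valued factor only forms linear combinations of the values of `G`. This allows `σ` and
its inverse to be stripped off the exchange relation. -/
theorem scalar_conv_mem (s : WithConv (C →ₗ[k] k)) (G : WithConv (C →ₗ[k] E))
    (M : Submodule k E) (hG : ∀ c, G c ∈ M) (c : C) :
    (convPush (Algebra.ofId k E) s * G : WithConv (C →ₗ[k] E)) c ∈ M := by
  rw [conv_mul_apply]
  induction comul (R := k) c using TensorProduct.induction_on with
  | zero => simp
  | add u v hu hv => rw [map_add, map_add]; exact M.add_mem hu hv
  | tmul u v =>
    have : LinearMap.mul' k E (TensorProduct.map (convPush (Algebra.ofId k E) s).ofConv G.ofConv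
        (u ⊗ₜ v)) = s u • G v := (Algebra.smul_def _ _).symm
    rw [this]
    exact M.smul_mem _ (hG v)

theorem conv_scalar_mem (s : WithConv (C →ₗ[k] k)) (G : WithConv (C →ₗ[k] E))
    (M : Submodule k E) (hG : ∀ c, G c ∈ M) (c : C) :
    (G * convPush (Algebra.ofId k E) s : WithConv (C →ₗ[k] E)) c ∈ M := by
  rw [conv_mul_apply]
  induction comul (R := k) c using TensorProduct.induction_on with
  | zero => simp
  | add u v hu hv => rw [map_add, map_add]; exact M.add_mem hu hv
  | tmul u v =>
    have : LinearMap.mul' k E (TensorProduct.map G.ofConv (convPush (Algebra.ofId k E) s).ofConv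
        (u ⊗ₜ v)) = s v • G u := (Algebra.commutes _ _).symm.trans (Algebra.smul_def _ _).symm
    rw [this]
    exact M.smul_mem _ (hG u)

variable {H A X : Type*} [Ring H] [HopfAlgebra k H] [Ring A] [HopfAlgebra k A]
  [Ring X] [HopfAlgebra k X] [BijectiveAntipode k X] {σ : H →ₗ[k] H →ₗ[k] k}

/-- The map `a ⊗ x ↦ r_a l_{S⁻¹(x)}`. -/
def rightLeft (hσ : IsSkewPairing σ) (i : A →ₐc[k] H) (j : X →ₐc[k] H) :
    WithConv (A ⊗[k] X →ₗ[k] FiniteDual k H) :=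
  cv (TensorProduct.lift ((LinearMap.mul k (FiniteDual k H)).compl₁₂
    (rightFun hσ ∘ₗ (i : A →ₗ[k] H)) (leftFunInv hσ j)))

/-- The map `a ⊗ x ↦ l_{S⁻¹(x)} r_a`. -/
def leftRight (hσ : IsSkewPairing σ) (i : A →ₐc[k] H) (j : X →ₐc[k] H) :
    WithConv (A ⊗[k] X →ₗ[k] FiniteDual k H) :=
  cv (TensorProduct.lift ((LinearMap.mul k (FiniteDual k H)).flip.compl₁₂
    (rightFun hσ ∘ₗ (i : A →ₗ[k] H)) (leftFunInv hσ j)))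

/-- `σ(a₁, x₁) r_{a₂} l_{S⁻¹(x₂)} = l_{S⁻¹(x₁)} r_{a₁} σ(a₂, x₂)`. -/
theorem form_mul_rightLeft (hσ : IsSkewPairing σ) (hc : BraidedComm σ) (i : A →ₐc[k] H)
    (j : X →ₐc[k] H) :
    convPush (Algebra.ofId k _) (cv (TensorProduct.lift (restrictForm σ i j))) * rightLeft hσ i j =
      leftRight hσ i j *
        convPush (Algebra.ofId k _) (cv (TensorProduct.lift (restrictForm σ i j))) := by
  refine WithConv.ext (TensorProduct.ext' fun a x => ?_)
  have h := congrArg (fun F : WithConv (X →ₗ[k] FiniteDual k H) => F x)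
    (rightTranslate_mul_leftFunInv hσ hc j (rightFun hσ (i a)))
  -- The translates of `r_a` are `r_a(- y) = σ(a₁, y) r_{a₂}` and `r_a(y -) = r_{a₁} σ(a₂, y)`, so
  -- the exchange relation for `f = r_a` is the claim.
  have hr : ∀ y, rightTranslate j (rightFun hσ (i a)) y = TensorProduct.lid k (FiniteDual k H)
      (TensorProduct.map ((restrictForm σ i j).flip y) (rightFun hσ ∘ₗ (i : A →ₗ[k] H))
        (comul (R := k) a)) := by
    intro y
    rw [rightTranslate_apply, comul_rightFun, comul_bialgHom]
    induction comul (R := k) a using TensorProduct.induction_on with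
    | zero => simp
    | add u v hu hv => simp only [map_add, hu, hv]
    | tmul u v => rfl
  have hl : ∀ y, leftTranslate j (rightFun hσ (i a)) y = TensorProduct.rid k (FiniteDual k H)
      (TensorProduct.map (rightFun hσ ∘ₗ (i : A →ₗ[k] H)) ((restrictForm σ i j).flip y)
        (comul (R := k) a)) := by
    intro y
    rw [leftTranslate_apply, comul_rightFun, comul_bialgHom]
    induction comul (R := k) a using TensorProduct.induction_on with
    | zero => simp
    | add u v hu hv => simp only [map_add, hu, hv]
    | tmul u v => rfl
  refine Eq.trans ?_ (h.trans ?_)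
  · show LinearMap.mul' k _ (TensorProduct.map _ _ (comul (R := k) (a ⊗ₜ[k] x))) =
      LinearMap.mul' k _ (TensorProduct.map (rightTranslate j (rightFun hσ (i a))) _
        (comul (R := k) x))
    rw [TensorProduct.comul_tmul]
    induction comul (R := k) x using TensorProduct.induction_on with
    | zero => simp
    | add u v hu hv => simp only [map_add, TensorProduct.tmul_add, hu, hv]
    | tmul x y =>
      rw [TensorProduct.map_tmul, LinearMap.mul'_apply, hr]
      induction comul (R := k) a using TensorProduct.induction_on with
      | zero => simp
      | add u v hu hv => simp only [map_add, TensorProduct.add_tmul, hu, hv, add_mul]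
      | tmul a b =>
        exact (Algebra.smul_def (restrictForm σ i j a x) _).symm.trans
          (smul_mul_assoc _ _ _).symm
  · show LinearMap.mul' k _ (TensorProduct.map _ (leftTranslate j (rightFun hσ (i a)))
        (comul (R := k) x)) =
      LinearMap.mul' k _ (TensorProduct.map _ _ (comul (R := k) (a ⊗ₜ[k] x)))
    rw [TensorProduct.comul_tmul]
    induction comul (R := k) x using TensorProduct.induction_on with
    | zero => simp
    | add u v hu hv => simp only [map_add, TensorProduct.tmul_add, hu, hv]
    | tmul x y =>
      rw [TensorProduct.map_tmul, LinearMap.mul'_apply, hl]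
      induction comul (R := k) a using TensorProduct.induction_on with
      | zero => simp
      | add u v hu hv => simp only [map_add, TensorProduct.add_tmul, hu, hv, mul_add]
      | tmul a b =>
        show leftFunInv hσ j x * (restrictForm σ i j b y • rightFun hσ (i a)) =
          leftFunInv hσ j x * rightFun hσ (i a) *
            algebraMap k (FiniteDual k H) (restrictForm σ i j b y)
        rw [mul_smul_comm, ← Algebra.commutes, ← Algebra.smul_def]

variable (σ)

/-- The space of the functionals `l_x`. -/
def leftSpan (hσ : IsSkewPairing σ) (j : X →ₐc[k] H) : Submodule k (FiniteDual k H) :=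
  LinearMap.range (leftFun hσ ∘ₗ (j : X →ₗ[k] H))

/-- The space of the functionals `r_a`. -/
def rightSpan (hσ : IsSkewPairing σ) (i : A →ₐc[k] H) : Submodule k (FiniteDual k H) :=
  LinearMap.range (rightFun hσ ∘ₗ (i : A →ₗ[k] H))

variable {σ}

/-- Since `σ` is convolution invertible, the exchange relation can be solved for either order of the
factors, expressing products `l r` through products `r l` and conversely. Replacing `x` by `S(x)`
removes the `S⁻¹`. -/
theorem leftSpan_mul_rightSpan (hσ : IsSkewPairing σ) (hc : BraidedComm σ) (i : A →ₐc[k] H)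
    (j : X →ₐc[k] H) : leftSpan σ hσ j * rightSpan σ hσ i = rightSpan σ hσ i * leftSpan σ hσ j := by
  have h := form_mul_rightLeft hσ hc i j
  have hS : ∀ x : X, leftFunInv hσ j (antipode k x) = leftFun hσ (j x) := fun x => by
    have : antipodeInv k X (antipode k x) = x :=
      (BijectiveAntipode.bijective (k := k) (H := X)).1 (antipode_antipodeInv k X _)
    show leftFun hσ (j (antipodeInv k X (antipode k x))) = _
    rw [this]
  have hp := hσ.restrict i j
  have e1 : convPush (Algebra.ofId k (FiniteDual k H)) (invForm (restrictForm σ i j)) *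
      convPush (Algebra.ofId k _) (cv (TensorProduct.lift (restrictForm σ i j))) = 1 := by
    rw [← map_mul, hp.invForm_mul, map_one]
  have e2 : convPush (Algebra.ofId k (FiniteDual k H))
      (cv (TensorProduct.lift (restrictForm σ i j))) *
      convPush (Algebra.ofId k _) (invForm (restrictForm σ i j)) = 1 := by
    rw [← map_mul, hp.mul_invForm, map_one]
  apply le_antisymm
  · rw [Submodule.mul_le]
    rintro _ ⟨x, rfl⟩ _ ⟨a, rfl⟩
    have e : leftRight hσ i j = convPush (Algebra.ofId k _)
        (cv (TensorProduct.lift (restrictForm σ i j))) * (rightLeft hσ i j *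
          convPush (Algebra.ofId k _) (invForm (restrictForm σ i j))) := by
      rw [← mul_assoc, h, mul_assoc, e2, mul_one]
    have e3 : leftRight hσ i j (a ⊗ₜ antipode k x) = leftFun hσ (j x) * rightFun hσ (i a) :=
      congrArg (· * rightFun hσ (i a)) (hS x)
    show leftFun hσ (j x) * rightFun hσ (i a) ∈ _
    rw [← e3, e]
    refine scalar_conv_mem _ _ _ (fun c => conv_scalar_mem _ _ _ (fun c => ?_) c) _
    induction c using TensorProduct.induction_on with
    | zero => exact (congrArg (· ∈ rightSpan σ hσ i * leftSpan σ hσ j)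
        (LinearMap.map_zero (rightLeft hσ i j).ofConv)).mpr (zero_mem _)
    | add u v hu hv => exact (congrArg (· ∈ rightSpan σ hσ i * leftSpan σ hσ j)
        (LinearMap.map_add (rightLeft hσ i j).ofConv u v)).mpr (add_mem hu hv)
    | tmul b y => exact Submodule.mul_mem_mul ⟨b, rfl⟩ ⟨antipodeInv k X y, rfl⟩
  · rw [Submodule.mul_le]
    rintro _ ⟨a, rfl⟩ _ ⟨x, rfl⟩
    have e : rightLeft hσ i j = convPush (Algebra.ofId k _)
        (invForm (restrictForm σ i j)) * (leftRight hσ i j *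
          convPush (Algebra.ofId k _) (cv (TensorProduct.lift (restrictForm σ i j)))) := by
      rw [← h, ← mul_assoc, e1, one_mul]
    have e3 : rightLeft hσ i j (a ⊗ₜ antipode k x) = rightFun hσ (i a) * leftFun hσ (j x) :=
      congrArg (rightFun hσ (i a) * ·) (hS x)
    show rightFun hσ (i a) * leftFun hσ (j x) ∈ _
    rw [← e3, e]
    refine scalar_conv_mem _ _ _ (fun c => conv_scalar_mem _ _ _ (fun c => ?_) c) _
    induction c using TensorProduct.induction_on with
    | zero => exact (congrArg (· ∈ leftSpan σ hσ j * rightSpan σ hσ i)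
        (LinearMap.map_zero (leftRight hσ i j).ofConv)).mpr (zero_mem _)
    | add u v hu hv => exact (congrArg (· ∈ leftSpan σ hσ j * rightSpan σ hσ i)
        (LinearMap.map_add (leftRight hσ i j).ofConv u v)).mpr (add_mem hu hv)
    | tmul b y => exact Submodule.mul_mem_mul ⟨antipodeInv k X y, rfl⟩ ⟨b, rfl⟩

end FunctionalsCommute

/-! ### The sub-Hopf algebra H_{X,A} -/

section FunctionalsHopf

variable {k H A X : Type*} [Field k] [Ring H] [HopfAlgebra k H] [Ring A] [HopfAlgebra k A]
  [Ring X] [HopfAlgebra k X] [BijectiveAntipode k X] [BijectiveAntipode k A]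
  {σ : H →ₗ[k] H →ₗ[k] k} (hσ : IsSkewPairing σ) (hc : BraidedComm σ) (i : A →ₐc[k] H)
  (j : X →ₐc[k] H)

theorem one_mem_leftSpan : 1 ∈ leftSpan σ hσ j := ⟨1, by
  show leftFun hσ (j 1) = 1
  rw [map_one, leftFun_one]⟩

theorem one_mem_rightSpan : 1 ∈ rightSpan σ hσ i := ⟨1, by
  show rightFun hσ (i 1) = 1
  rw [map_one, rightFun_one]⟩

theorem leftSpan_mul_self_le : leftSpan σ hσ j * leftSpan σ hσ j ≤ leftSpan σ hσ j := by
  rw [Submodule.mul_le]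
  rintro _ ⟨x, rfl⟩ _ ⟨y, rfl⟩
  refine ⟨y * x, ?_⟩
  show leftFun hσ (j (y * x)) = leftFun hσ (j x) * leftFun hσ (j y)
  rw [map_mul, leftFun_mul]

theorem rightSpan_mul_self_le : rightSpan σ hσ i * rightSpan σ hσ i ≤ rightSpan σ hσ i := by
  rw [Submodule.mul_le]
  rintro _ ⟨x, rfl⟩ _ ⟨y, rfl⟩
  refine ⟨x * y, ?_⟩
  show rightFun hσ (i (x * y)) = rightFun hσ (i x) * rightFun hσ (i y)
  rw [map_mul, rightFun_mul]

theorem leftSpan_le : leftSpan σ hσ j ≤ leftSpan σ hσ j * rightSpan σ hσ i := fun f hf => by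
  have := Submodule.mul_mem_mul hf (one_mem_rightSpan hσ i)
  rwa [mul_one] at this

theorem rightSpan_le : rightSpan σ hσ i ≤ leftSpan σ hσ j * rightSpan σ hσ i := fun f hf => by
  have := Submodule.mul_mem_mul (one_mem_leftSpan hσ j) hf
  rwa [one_mul] at this

/-- The subalgebra `H_{X,A} = H_{l_X} H_{r_A}` of the finite dual. -/
def functionalsSubalgebra : Subalgebra k (FiniteDual k H) :=
  (leftSpan σ hσ j * rightSpan σ hσ i).toSubalgebra
    (leftSpan_le hσ i j (one_mem_leftSpan hσ j)) (by
      intro f g hf hg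
      have h1 := Submodule.mul_mem_mul hf hg
      -- With `L` and `R` the two spaces, `LRLR = LLRR` by commuting the middle factors, and `LLRR`
      -- lies in `LR`.
      have e : leftSpan σ hσ j * rightSpan σ hσ i * (leftSpan σ hσ j * rightSpan σ hσ i) =
          leftSpan σ hσ j * leftSpan σ hσ j * (rightSpan σ hσ i * rightSpan σ hσ i) := by
        rw [mul_assoc, ← mul_assoc (rightSpan σ hσ i), ← leftSpan_mul_rightSpan hσ hc i j]
        simp only [mul_assoc]
      rw [e] at h1
      exact mul_le_mul' (leftSpan_mul_self_le hσ j) (rightSpan_mul_self_le hσ i) h1)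

theorem antipode_mem_leftSpan {f : FiniteDual k H} (hf : f ∈ leftSpan σ hσ j) :
    antipode k f ∈ leftSpan σ hσ j := by
  obtain ⟨x, rfl⟩ := hf
  refine ⟨antipodeInv k X x, ?_⟩
  show leftFun hσ (j (antipodeInv k X x)) = antipode k (leftFun hσ (j x))
  rw [← antipode_leftFun_antipode, antipode_comp_bialgHom, antipode_antipodeInv]

theorem antipode_mem_rightSpan {f : FiniteDual k H} (hf : f ∈ rightSpan σ hσ i) :
    antipode k f ∈ rightSpan σ hσ i := by
  obtain ⟨x, rfl⟩ := hf
  refine ⟨antipodeInv k A x, ?_⟩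
  show rightFun hσ (i (antipodeInv k A x)) = antipode k (rightFun hσ (i x))
  rw [← antipode_rightFun_antipode, antipode_comp_bialgHom, antipode_antipodeInv]

/-- The sub-Hopf algebra `H_{X,A} = H_{l_X} H_{r_A}` of the finite dual. -/
def functionalsHopf : SubHopfAlgebra k (FiniteDual k H) where
  toSubalgebra := functionalsSubalgebra hσ hc i j
  comul_mem' f hf := by
    let K := functionalsSubalgebra hσ hc i j
    replace hf : f ∈ leftSpan σ hσ j * rightSpan σ hσ i := hf
    show comul (R := k) f ∈ LinearMap.range (Algebra.TensorProduct.map K.val K.val).toLinearMap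
    induction hf using Submodule.mul_induction_on' with
    | mem_mul_mem l hl r hr =>
      obtain ⟨x, rfl⟩ := hl
      obtain ⟨a, rfl⟩ := hr
      have h1 : comul (R := k) (leftFun hσ (j x)) ∈
          (Algebra.TensorProduct.map K.val K.val).range := by
        rw [comul_leftFun, comul_bialgHom]
        induction comul (R := k) x using TensorProduct.induction_on with
        | zero => simp
        | add u v hu hv => simp only [map_add]; exact add_mem hu hv
        | tmul u v =>
          exact ⟨(⟨leftFun hσ (j u), leftSpan_le hσ i j ⟨u, rfl⟩⟩ : K) ⊗ₜ
            (⟨leftFun hσ (j v), leftSpan_le hσ i j ⟨v, rfl⟩⟩ : K), rfl⟩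
      have h2 : comul (R := k) (rightFun hσ (i a)) ∈
          (Algebra.TensorProduct.map K.val K.val).range := by
        rw [comul_rightFun, comul_bialgHom]
        induction comul (R := k) a using TensorProduct.induction_on with
        | zero => simp
        | add u v hu hv => simp only [map_add]; exact add_mem hu hv
        | tmul u v =>
          exact ⟨(⟨rightFun hσ (i v), rightSpan_le hσ i j ⟨v, rfl⟩⟩ : K) ⊗ₜ
            (⟨rightFun hσ (i u), rightSpan_le hσ i j ⟨u, rfl⟩⟩ : K), rfl⟩
      have h3 := mul_mem h1 h2
      rw [← Bialgebra.comul_mul] at h3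
      exact h3
    | add f hf g hg h1 h2 => rw [map_add]; exact add_mem h1 h2
  antipode_mem' f hf := by
    replace hf : f ∈ leftSpan σ hσ j * rightSpan σ hσ i := hf
    show antipode k f ∈ leftSpan σ hσ j * rightSpan σ hσ i
    induction hf using Submodule.mul_induction_on' with
    | mem_mul_mem l hl r hr =>
      rw [antipode_mul_antidistrib, leftSpan_mul_rightSpan hσ hc i j]
      exact Submodule.mul_mem_mul (antipode_mem_rightSpan hσ i hr) (antipode_mem_leftSpan hσ j hl)
    | add f hf g hg h1 h2 => rw [map_add]; exact add_mem h1 h2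

/-- The antipode is precomposition with the surjective antipode of `H`, hence injective. It is
surjective because `l_x r_a = S(r_{S(a)} l_{S(x)})` and the two spaces commute. -/
theorem bijectiveAntipode_functionalsHopf [BijectiveAntipode k H] :
    BijectiveAntipode k (functionalsHopf hσ hc i j) where
  bijective := by
    constructor
    · intro f g h
      apply Subtype.ext
      have h' : antipode k (f : FiniteDual k H) = antipode k (g : FiniteDual k H) :=
        congrArg Subtype.val h
      refine finiteDual_ext fun x => ?_
      rw [← antipode_antipodeInv k H x]
      exact congrArg (fun f => FiniteDual.ev k H f (antipodeInv k H x)) h'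
    · intro f
      obtain ⟨f, hf⟩ := f
      have hf' : f ∈ leftSpan σ hσ j * rightSpan σ hσ i := hf
      suffices h : ∃ g ∈ leftSpan σ hσ j * rightSpan σ hσ i, antipode k g = f by
        obtain ⟨g, hg, e⟩ := h
        exact ⟨⟨g, hg⟩, Subtype.ext e⟩
      clear hf
      induction hf' using Submodule.mul_induction_on' with
      | mem_mul_mem l hl r hr =>
        obtain ⟨x, rfl⟩ := hl
        obtain ⟨a, rfl⟩ := hr
        refine ⟨rightFun hσ (i (antipode k a)) * leftFun hσ (j (antipode k x)), ?_, ?_⟩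
        · rw [leftSpan_mul_rightSpan hσ hc i j]
          exact Submodule.mul_mem_mul ⟨_, rfl⟩ ⟨_, rfl⟩
        · rw [antipode_mul_antidistrib, ← antipode_comp_bialgHom, ← antipode_comp_bialgHom,
            antipode_leftFun_antipode, antipode_rightFun_antipode]
          rfl
      | add f hf g hg h1 h2 =>
        obtain ⟨f', hf', rfl⟩ := h1
        obtain ⟨g', hg', rfl⟩ := h2
        exact ⟨f' + g', add_mem hf' hg', map_add _ _ _⟩

end FunctionalsHopf

/-! ### The inverse antipode -/

section AntipodeInv

variable {k V : Type*} [Field k] [Ring V] [HopfAlgebra k V] [BijectiveAntipode k V]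

theorem antipodeInv_antipode (x : V) : antipodeInv k V (antipode k x) = x :=
  (BijectiveAntipode.bijective (k := k) (H := V)).1 (antipode_antipodeInv k V _)

theorem antipodeInv_mul (x y : V) :
    antipodeInv k V (x * y) = antipodeInv k V y * antipodeInv k V x :=
  (BijectiveAntipode.bijective (k := k) (H := V)).1 <| by
    rw [antipode_mul_antidistrib]
    simp only [antipode_antipodeInv]

/-- `S⁻¹` is the antipode of the co-opposite Hopf algebra, whence `S⁻¹(y₂) y₁ = ε(y)`. -/
theorem mul_antipodeInv_comm_comul (y : V) : LinearMap.mul' k V ((antipodeInv k V).rTensor V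
    (TensorProduct.comm k V V (comul (R := k) y))) = counit (R := k) y • 1 :=
  (HopfAlgebra.mul_antipode_rTensor_comul_apply (R := k) (A := Cop k V) y).trans
    (Algebra.algebraMap_eq_smul_one _)

theorem IsSkewPairing.antipode_left {B : Type*} [Ring B] [HopfAlgebra k B]
    {p : B →ₗ[k] V →ₗ[k] k} (hp : IsSkewPairing p) (b : B) (v : V) :
    p (antipode k b) v = p b (antipodeInv k V v) := by
  rw [← hp.apply_antipode_antipode b, antipode_antipodeInv]

end AntipodeInv

/-! ### The projection of the generalized double -/

section DoubleProjection

variable {k B V : Type*} [Field k] [Ring B] [HopfAlgebra k B] [Ring V] [HopfAlgebra k V]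
  [BijectiveAntipode k V] {p : B →ₗ[k] V →ₗ[k] k}

/-- `p(κ₁, y₁) κ₂ γ(y₂) = γ(y₁) κ₁ p(κ₂, y₂)`. -/
def Intertwines (p : B →ₗ[k] V →ₗ[k] k) (γ : V →ₐc[k] B) : Prop := ∀ κ : B,
  cv ((actL p).flip κ) * cv (γ : V →ₗ[k] B) = cv (γ : V →ₗ[k] B) * cv ((hitR ∘ₗ p.flip).flip κ)

theorem IsSkewPairing.actR_eq (hp : IsSkewPairing p) (z : V) :
    actR p z = hitR (p.flip (antipodeInv k V z)) :=
  congrArg hitR (LinearMap.ext fun b => hp.antipode_left b z)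

theorem IsSkewPairing.hitR_flip_mul (hp : IsSkewPairing p) (x y : V) :
    hitR (p.flip (x * y)) = hitR (p.flip y) ∘ₗ hitR (p.flip x) := by
  rw [hp.flip_mul, hitR_conv]

/-- The two right operators compose to `κ₁ p(κ₂, S⁻¹(y₂) y₁)`. -/
theorem IsSkewPairing.hitR_actR_comul (hp : IsSkewPairing p) (κ : B) (y : V) :
    TensorProduct.lift ((LinearMap.mul k (Module.End k B)).compl₁₂ (hitR ∘ₗ p.flip) (actR p))
      (comul (R := k) y) κ = counit (R := k) y • κ := by
  have e : ∀ t : V ⊗[k] V, TensorProduct.lift ((LinearMap.mul k (Module.End k B)).compl₁₂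
      (hitR ∘ₗ p.flip) (actR p)) t = hitR (p.flip (LinearMap.mul' k V
        ((antipodeInv k V).rTensor V (TensorProduct.comm k V V t)))) := by
    intro t
    induction t using TensorProduct.induction_on with
    | zero => simp
    | add u v hu hv => simp only [map_add, hu, hv]
    | tmul u v =>
      rw [TensorProduct.comm_tmul, LinearMap.rTensor_tmul, LinearMap.mul'_apply, hp.hitR_flip_mul,
        ← hp.actR_eq]
      rfl
  rw [e, mul_antipodeInv_comm_comul, map_smul, map_smul, hp.flip_one, hitR_counit]
  rfl

namespace GenDouble

variable (hp : IsSkewPairing p) (γ : V →ₐc[k] B)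

/-- The map `b ⊗ h ↦ b γ(h)`. -/
def projLin : GenDouble hp →ₗ[k] B :=
  TensorProduct.lift ((LinearMap.mul k B).compl₂ (γ : V →ₗ[k] B))

theorem projLin_tmul (b : B) (h : V) : projLin hp γ (tmul hp b h) = b * γ h := rfl

theorem projLin_inl_mul (b : B) (w : GenDouble hp) :
    projLin hp γ (inl hp b * w) = b * projLin hp γ w := by
  induction w using induction_on hp with
  | zero => rw [mul_zero, map_zero, mul_zero]
  | add s t hs ht => rw [mul_add, map_add, hs, ht, map_add, mul_add]
  | tm c h => rw [inl_mul_tmul, projLin_tmul, projLin_tmul, mul_assoc]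

theorem projLin_mul_inr (w : GenDouble hp) (v : V) :
    projLin hp γ (w * inr hp v) = projLin hp γ w * γ v := by
  induction w using induction_on hp with
  | zero => rw [zero_mul, map_zero, zero_mul]
  | add s t hs ht => rw [add_mul, map_add, hs, ht, map_add, add_mul]
  | tm c h => rw [tmul_mul_inr, projLin_tmul, projLin_tmul, map_mul, mul_assoc]

variable {γ}

/-- The image of `(1 ⊗ h)(c ⊗ 1)` is `p(c₁, h₁) c₂ γ(h₂) p(S(c₃), h₃)`. The intertwining relation
moves `γ` to the left and the pairing with `h₁` to the right, where it cancels the pairing with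
`h₃`. The rest of multiplicativity is linearity over both factors. -/
theorem projLin_inr_mul_inl (hγ : Intertwines p γ) (h : V) (c : B) :
    projLin hp γ (inr hp h * inl hp c) = γ h * c := by
  rw [inr_mul_inl, IsSkewPairing.swap_apply]
  let Φ : V ⊗[k] (V ⊗[k] V) →ₗ[k] B :=
    projLin hp γ ∘ₗ (act3 p).flip (c ⊗ₜ[k] (1 : V))
  let Ψ : V ⊗[k] (V ⊗[k] V) →ₗ[k] B := LinearMap.mul' k B ∘ₗ TensorProduct.map (γ : V →ₗ[k] B)
    ((TensorProduct.lift ((LinearMap.mul k (Module.End k B)).compl₁₂ (hitR ∘ₗ p.flip)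
      (actR p))).flip c)
  -- The intertwining relation for the element `actR p z c`, which already carries the pairing with
  -- the third leg.
  have h1 : ∀ u z : V, Φ (TensorProduct.assoc k V V V (comul (R := k) u ⊗ₜ z)) =
      Ψ (TensorProduct.assoc k V V V (comul (R := k) u ⊗ₜ z)) := by
    intro u z
    have e := congrArg (fun F : WithConv (V →ₗ[k] B) => F u) (hγ (actR p z c))
    refine Eq.trans ?_ (e.trans ?_)
    · show _ = LinearMap.mul' k B (TensorProduct.map ((actL p).flip (actR p z c)) (γ : V →ₗ[k] B)
        (comul (R := k) u))
      induction comul (R := k) u using TensorProduct.induction_on with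
      | zero => simp
      | add s t hs ht => simp only [map_add, TensorProduct.add_tmul, hs, ht]
      | tmul a b =>
        show projLin hp γ (act3 p (a ⊗ₜ (b ⊗ₜ z)) (c ⊗ₜ 1)) = _
        rw [act3_tmul, mul_one]
        rfl
    · show LinearMap.mul' k B (TensorProduct.map (γ : V →ₗ[k] B)
        ((hitR ∘ₗ p.flip).flip (actR p z c)) (comul (R := k) u)) = _
      induction comul (R := k) u using TensorProduct.induction_on with
      | zero => simp
      | add s t hs ht => simp only [map_add, TensorProduct.add_tmul, hs, ht]
      | tmul a b => rfl
  have h2 : ∀ t : V ⊗[k] V, Φ (TensorProduct.assoc k V V V ((comul (R := k)).rTensor V t)) =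
      Ψ (TensorProduct.assoc k V V V ((comul (R := k)).rTensor V t)) := by
    intro t
    induction t using TensorProduct.induction_on with
    | zero => simp
    | add s t hs ht => simp only [map_add, hs, ht]
    | tmul a b => exact h1 a b
  have h3 : Φ (comul3 k V h) = Ψ (comul3 k V h) := by
    have := h2 (comul (R := k) h)
    rwa [Coalgebra.coassoc_apply] at this
  refine h3.trans ?_
  have h4 : ∀ t : V ⊗[k] V, Ψ ((comul (R := k)).lTensor V t) =
      γ (TensorProduct.rid k V ((counit (R := k)).lTensor V t)) * c := by
    intro t
    induction t using TensorProduct.induction_on with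
    | zero => simp
    | add s t hs ht => simp only [map_add, hs, ht, add_mul]
    | tmul a b =>
      show γ a * TensorProduct.lift ((LinearMap.mul k (Module.End k B)).compl₁₂ (hitR ∘ₗ p.flip)
        (actR p)) (comul (R := k) b) c = γ (counit (R := k) b • a) * c
      rw [hp.hitR_actR_comul, mul_smul_comm, map_smul, smul_mul_assoc]
  refine (h4 _).trans ?_
  rw [Coalgebra.lTensor_counit_comul, TensorProduct.rid_tmul, one_smul]

theorem projLin_mul (hγ : Intertwines p γ) (s t : GenDouble hp) :
    projLin hp γ (s * t) = projLin hp γ s * projLin hp γ t := by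
  induction s using induction_on hp with
  | zero => rw [zero_mul, map_zero, zero_mul]
  | add s s' hs hs' => rw [add_mul, map_add, hs, hs', map_add, add_mul]
  | tm b h =>
    induction t using induction_on hp with
    | zero => rw [mul_zero, map_zero, mul_zero]
    | add t t' ht ht' => rw [mul_add, map_add, ht, ht', map_add, mul_add]
    | tm c v =>
      rw [← inl_mul_inr hp c v, ← inl_mul_inr hp b h, mul_assoc, projLin_inl_mul, ← mul_assoc,
        projLin_mul_inr, projLin_inr_mul_inl hp hγ, inl_mul_inr, projLin_tmul, inl_mul_inr,
        projLin_tmul]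
      simp only [mul_assoc]

/-- The projection `b ⊗ h ↦ b γ(h)` of the double onto its first factor. -/
def proj (hγ : Intertwines p γ) : GenDouble hp →ₐc[k] B :=
  BialgHom.ofAlgHom
    (AlgHom.ofLinearMap (projLin hp γ)
      (by rw [one_eq, projLin_tmul, map_one, mul_one]) (projLin_mul hp hγ))
    (AlgHom.ext fun w => by
      show counit (R := k) (projLin hp γ w) = counit (R := k) w
      induction w using induction_on hp with
      | zero => simp
      | add s t hs ht => rw [map_add, map_add, map_add, hs, ht]
      | tm b h =>
        rw [projLin_tmul, Bialgebra.counit_mul, counit_tmul, counit_bialgHom])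
    (AlgHom.ext fun w => by
      show TensorProduct.map (projLin hp γ) (projLin hp γ) (comul (R := k) w) =
        comul (R := k) (projLin hp γ w)
      induction w using induction_on hp with
      | zero => simp
      | add s t hs ht => simp only [map_add, hs, ht]
      | tm b h =>
        rw [projLin_tmul, Bialgebra.comul_mul, comul_tmul, comul_bialgHom]
        induction comul (R := k) b using TensorProduct.induction_on with
        | zero => simp
        | add u v hu hv => simp only [map_add, TensorProduct.add_tmul, add_mul, hu, hv]
        | tmul b1 b2 =>
          induction comul (R := k) h using TensorProduct.induction_on with
          | zero => simp
          | add u v hu hv => simp only [map_add, TensorProduct.tmul_add, mul_add, hu, hv]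
          | tmul h1 h2 =>
            rw [TensorProduct.map_tmul (γ : V →ₗ[k] B), Algebra.TensorProduct.tmul_mul_tmul]
            rfl)

theorem proj_tmul (hγ : Intertwines p γ) (b : B) (h : V) :
    proj hp hγ (tmul hp b h) = b * γ h := rfl

theorem proj_inl (hγ : Intertwines p γ) (b : B) : proj hp hγ (inl hp b) = b :=
  (proj_tmul hp hγ b 1).trans (by rw [map_one, mul_one])

theorem proj_inr (hγ : Intertwines p γ) (h : V) : proj hp hγ (inr hp h) = γ h :=
  (proj_tmul hp hγ 1 h).trans (one_mul _)

/-- The inclusion `b ↦ b ⊗ 1`, as a morphism of bialgebras. -/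
def inlHom : B →ₐc[k] GenDouble hp :=
  BialgHom.ofAlgHom (AlgHom.ofLinearMap (inl hp) rfl (inl_mul hp))
    (AlgHom.ext fun b => by
      show counit (R := k) (inl hp b) = counit (R := k) b
      exact (counit_tmul hp b 1).trans (by rw [Bialgebra.counit_one, mul_one]))
    (AlgHom.ext fun b => (comul_inl hp b).symm)

/-- The inclusion `h ↦ 1 ⊗ h`, as a morphism of bialgebras. -/
def inrHom : V →ₐc[k] GenDouble hp :=
  BialgHom.ofAlgHom (AlgHom.ofLinearMap (inr hp) rfl (inr_mul hp))
    (AlgHom.ext fun b => by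
      show counit (R := k) (inr hp b) = counit (R := k) b
      exact (counit_tmul hp 1 b).trans (by rw [Bialgebra.counit_one, one_mul]))
    (AlgHom.ext fun b => (comul_inr hp b).symm)

end GenDouble

end DoubleProjection

/-! ### Convolution over the co-opposite coalgebra -/

section CopConvolution

variable {k V D : Type*} [Field k] [Ring V] [HopfAlgebra k V] [Ring D] [HopfAlgebra k D]

/-- A linear map on `V`, as an element of the convolution algebra of `V^cop`. -/
abbrev cvCop {A : Type*} [Ring A] [Algebra k A] (f : V →ₗ[k] A) : WithConv (Cop k V →ₗ[k] A) :=
  cv (f ∘ₗ (Cop.of k V).symm.toLinearMap)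

theorem cop_conv_mul_apply {A : Type*} [Ring A] [Algebra k A] (F G : WithConv (Cop k V →ₗ[k] A))
    (v : V) : (F * G) (Cop.of k V v) = LinearMap.mul' k A (TensorProduct.map
      (F.ofConv ∘ₗ (Cop.of k V).toLinearMap) (G.ofConv ∘ₗ (Cop.of k V).toLinearMap)
      (TensorProduct.comm k V V (comul (R := k) v))) := rfl

theorem convPush_comul_cvCop (φ : V →ₐc[k] D) :
    convPush (Bialgebra.comulAlgHom k D) (cvCop (φ : V →ₗ[k] D)) =
      convPush inR (cvCop (φ : V →ₗ[k] D)) * convPush inL (cvCop (φ : V →ₗ[k] D)) :=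
  conv_ext fun v => by
    refine Eq.trans ?_ (cop_conv_mul_apply _ _ ((Cop.of k V).symm v)).symm
    show comul (R := k) (φ ((Cop.of k V).symm v)) = _
    rw [comul_bialgHom]
    induction comul (R := k) ((Cop.of k V).symm v) using TensorProduct.induction_on with
    | zero => simp
    | add u v hu hv => simp only [map_add, hu, hv]
    | tmul u v =>
      show φ u ⊗ₜ[k] φ v = ((1 : D) ⊗ₜ[k] φ v) * (φ u ⊗ₜ[k] (1 : D))
      rw [Algebra.TensorProduct.tmul_mul_tmul, mul_one, one_mul]

variable [BijectiveAntipode k V]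

/-- Over the co-opposite coalgebra, `S⁻¹` is the antipode and so gives convolution inverses of
algebra maps. The map `x ↦ γ(S⁻¹(x₂)) ⊗ x₁` takes its legs in reversed order, which makes it a
convolution product in this setting. -/
theorem cvCop_mul_antipodeInv {A : Type*} [Ring A] [Algebra k A] (φ : V →ₐ[k] A) :
    cvCop φ.toLinearMap * cvCop (φ.toLinearMap ∘ₗ antipodeInv k V) = 1 := by
  let Γ : Cop k V →ₐ[k] A := φ.comp (Cop.of k V).symm.toAlgHom
  have e1 : cvCop φ.toLinearMap = convPush Γ (cv LinearMap.id) := rfl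
  have e2 : cvCop (φ.toLinearMap ∘ₗ antipodeInv k V) = convPush Γ (cv (antipode k)) := rfl
  rw [e1, e2, ← map_mul, cv_id_mul_antipode, map_one]

theorem cvCop_antipodeInv_mul {A : Type*} [Ring A] [Algebra k A] (φ : V →ₐ[k] A) :
    cvCop (φ.toLinearMap ∘ₗ antipodeInv k V) * cvCop φ.toLinearMap = 1 := by
  let Γ : Cop k V →ₐ[k] A := φ.comp (Cop.of k V).symm.toAlgHom
  have e1 : cvCop φ.toLinearMap = convPush Γ (cv LinearMap.id) := rfl
  have e2 : cvCop (φ.toLinearMap ∘ₗ antipodeInv k V) = convPush Γ (cv (antipode k)) := rfl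
  rw [e1, e2, ← map_mul, cv_antipode_mul_id, map_one]

/-- Both sides are convolution inverse to the coproduct composed with `φ`. -/
theorem convPush_comul_cvCop_antipodeInv (φ : V →ₐc[k] D) :
    convPush (Bialgebra.comulAlgHom k D) (cvCop ((φ : V →ₗ[k] D) ∘ₗ antipodeInv k V)) =
      convPush inL (cvCop ((φ : V →ₗ[k] D) ∘ₗ antipodeInv k V)) *
        convPush inR (cvCop ((φ : V →ₗ[k] D) ∘ₗ antipodeInv k V)) := by
  have hr : cvCop (φ : V →ₗ[k] D) * cvCop ((φ : V →ₗ[k] D) ∘ₗ antipodeInv k V) = 1 :=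
    cvCop_mul_antipodeInv (φ : V →ₐ[k] D)
  have hl : cvCop ((φ : V →ₗ[k] D) ∘ₗ antipodeInv k V) * cvCop (φ : V →ₗ[k] D) = 1 :=
    cvCop_antipodeInv_mul (φ : V →ₐ[k] D)
  refine left_inv_eq_right_inv (a := convPush (Bialgebra.comulAlgHom k D)
    (cvCop (φ : V →ₗ[k] D))) ?_ ?_
  · rw [← map_mul, hl, map_one]
  · rw [convPush_comul_cvCop, mul_assoc, ← mul_assoc (convPush inL _), ← map_mul, hr, map_one,
      one_mul, ← map_mul, hr, map_one]

theorem counit_antipodeInv (x : V) :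
    counit (R := k) (antipodeInv k V x) = counit (R := k) x := by
  have h := HopfAlgebra.counit_antipode (R := k) (antipodeInv k V x)
  rw [antipode_antipodeInv] at h
  exact h.symm

end CopConvolution

/-! ### The coinvariants of the double -/

namespace GenDouble

variable {k B V : Type*} [Field k] [Ring B] [HopfAlgebra k B] [Ring V] [HopfAlgebra k V]
  [BijectiveAntipode k V] {p : B →ₗ[k] V →ₗ[k] k} (hp : IsSkewPairing p) (γ : V →ₐc[k] B)

/-- The map `x ↦ γ(S⁻¹(x)) ⊗ 1` on `V^cop`. -/
def twistInv : WithConv (Cop k V →ₗ[k] GenDouble hp) :=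
  cvCop (((inlHom hp).comp γ : V →ₐc[k] GenDouble hp) ∘ₗ antipodeInv k V)

/-- The map `x ↦ γ(x) ⊗ 1` on `V^cop`. -/
def twist : WithConv (Cop k V →ₗ[k] GenDouble hp) :=
  cvCop ((inlHom hp).comp γ : V →ₐc[k] GenDouble hp)

/-- The map `x ↦ 1 ⊗ x` on `V^cop`. -/
def inrCop : WithConv (Cop k V →ₗ[k] GenDouble hp) :=
  cvCop (inrHom hp : V →ₗ[k] GenDouble hp)

theorem twist_mul_twistInv : twist hp γ * twistInv hp γ = 1 :=
  cvCop_mul_antipodeInv ((inlHom hp).comp γ : V →ₐ[k] GenDouble hp)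

/-- The map `x ↦ γ(S⁻¹(x₂)) ⊗ x₁`. -/
def sec : V →ₗ[k] GenDouble hp :=
  (twistInv hp γ * inrCop hp).ofConv ∘ₗ (Cop.of k V).toLinearMap

theorem cvCop_sec : cvCop (sec hp γ) = twistInv hp γ * inrCop hp := rfl

/-- In Sweedler form, `1 ⊗ x = γ(x₂) sec(x₁)`: the double is generated by its first factor and the
section. -/
theorem twist_mul_sec : twist hp γ * cvCop (sec hp γ) = inrCop hp := by
  rw [cvCop_sec, ← mul_assoc, twist_mul_twistInv, one_mul]

theorem sec_apply (x : V) : sec hp γ x = TensorProduct.lift (tmul hp) (TensorProduct.map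
    ((γ : V →ₗ[k] B) ∘ₗ antipodeInv k V) LinearMap.id
      (TensorProduct.comm k V V (comul (R := k) x))) := by
  refine (cop_conv_mul_apply _ _ x).trans ?_
  induction comul (R := k) x using TensorProduct.induction_on with
  | zero => simp
  | add u v hu hv => simp only [map_add, hu, hv]
  | tmul u v => exact inl_mul_inr hp _ _

/-- The second leg receives `γ(S⁻¹(-))` and `1 ⊗ (-)` on adjacent middle legs of `x`, which regroup
into `sec(x₂)`. -/
theorem convPush_comul_sec : convPush (Bialgebra.comulAlgHom k (GenDouble hp))
    (cvCop (sec hp γ)) = convPush inL (twistInv hp γ) * convPush inR (cvCop (sec hp γ)) *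
      convPush inL (inrCop hp) := by
  rw [cvCop_sec, map_mul, map_mul, twistInv, inrCop, convPush_comul_cvCop_antipodeInv,
    convPush_comul_cvCop]
  simp only [mul_assoc]

variable {γ} (hγ : Intertwines p γ)

theorem convPush_proj_sec :
    convPush (proj hp hγ : GenDouble hp →ₐ[k] B) (cvCop (sec hp γ)) = 1 := by
  have e1 : convPush (proj hp hγ : GenDouble hp →ₐ[k] B) (twistInv hp γ) =
      cvCop ((γ : V →ₐ[k] B).toLinearMap ∘ₗ antipodeInv k V) :=
    conv_ext fun v => proj_inl hp hγ _
  have e2 : convPush (proj hp hγ : GenDouble hp →ₐ[k] B) (inrCop hp) =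
      cvCop (γ : V →ₐ[k] B).toLinearMap :=
    conv_ext fun v => proj_inr hp hγ _
  rw [cvCop_sec, map_mul, e1, e2, cvCop_antipodeInv_mul]

/-- Applying `π` to the second leg makes the middle factor `sec(x₂)` trivial, and the outer factors
form `sec(x) ⊗ 1`. -/
theorem sec_mem (x : V) : sec hp γ x ∈ coinvariants (proj hp hγ : GenDouble hp →ₗ[k] B) := by
  rw [CoinvSplitting.mem_coinvariants_iff]
  show convPush ((Algebra.TensorProduct.map (AlgHom.id k (GenDouble hp))
    (proj hp hγ : GenDouble hp →ₐ[k] B)).comp (Bialgebra.comulAlgHom k (GenDouble hp)))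
      (cvCop (sec hp γ)) (Cop.of k V x) = convPush inL (cvCop (sec hp γ)) (Cop.of k V x)
  rw [← convPush_convPush, convPush_comul_sec, map_mul, map_mul]
  simp only [convPush_convPush, map_comp_inL, map_comp_inR]
  rw [← convPush_convPush inR, convPush_proj_sec, map_one, mul_one, ← map_mul, cvCop_sec]
  rfl

/-- The map `b ⊗ h ↦ ε(b) h`. -/
def counitProj : GenDouble hp →ₗ[k] V :=
  TensorProduct.lift (LinearMap.lsmul k V ∘ₗ counit)

theorem counitProj_tmul (b : B) (h : V) : counitProj hp (tmul hp b h) = counit (R := k) b • h :=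
  rfl

theorem counitProj_inr (h : V) : counitProj hp (inr hp h) = h := by
  refine (counitProj_tmul hp 1 h).trans ?_
  rw [Bialgebra.counit_one, one_smul]

theorem counitProj_inl_mul (b : B) (w : GenDouble hp) :
    counitProj hp (inl hp b * w) = counit (R := k) b • counitProj hp w := by
  induction w using induction_on hp with
  | zero => rw [mul_zero, map_zero, smul_zero]
  | add s t hs ht => rw [mul_add, map_add, hs, ht, map_add, smul_add]
  | tm c h =>
    rw [inl_mul_tmul, counitProj_tmul, counitProj_tmul, Bialgebra.counit_mul, smul_smul]

theorem counitProj_mul_inr (w : GenDouble hp) (v : V) :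
    counitProj hp (w * inr hp v) = counitProj hp w * v := by
  induction w using induction_on hp with
  | zero => rw [zero_mul, map_zero, zero_mul]
  | add s t hs ht => rw [add_mul, map_add, hs, ht, map_add, add_mul]
  | tm c h => rw [tmul_mul_inr, counitProj_tmul, counitProj_tmul, smul_mul_assoc]

/-- `ε ⊗ id` turns left multiplication by `γ(S⁻¹(x₂)) ⊗ 1` into `ε(x₂)`, so under it `sec(x)` may be
replaced by `1 ⊗ x`. -/
theorem counitProj_sec_mul (x : V) (w : GenDouble hp) :
    counitProj hp (sec hp γ x * w) = counitProj hp (inr hp x * w) := by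
  refine conv_absorb_left (counitProj hp ∘ₗ LinearMap.mulRight k w) (inrCop hp) (twistInv hp γ)
    (fun a c => ?_) (Cop.of k V x)
  show counitProj hp (inl hp (γ (antipodeInv k V c)) * a * w) =
    counit (R := k) (A := V) c • counitProj hp (a * w)
  rw [mul_assoc, counitProj_inl_mul, counit_bialgHom]
  exact congrArg (fun r : k => r • counitProj hp (a * w)) (counit_antipodeInv (k := k) (V := V) c)

theorem counitProj_sec (x : V) : counitProj hp (sec hp γ x) = x := by
  rw [← mul_one (sec hp γ x), counitProj_sec_mul, mul_one, counitProj_inr]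

/-- For `d = b ⊗ h` the left side is `b γ(h₂) sec(h₁) = b ⊗ h`. On a coinvariant `d` the factor
`π(d₂)` becomes `1` and `d` is seen to lie in the image of `sec`. -/
theorem inl_proj_mul_sec (d : GenDouble hp) :
    TensorProduct.lift (((LinearMap.mul k (GenDouble hp)).compl₁₂ (inl hp)
      (sec hp γ ∘ₗ counitProj hp)).flip) ((proj hp hγ : GenDouble hp →ₗ[k] B).lTensor
        (GenDouble hp) (comul (R := k) d)) = d := by
  induction d using induction_on hp with
  | zero => simp
  | add s t hs ht => simp only [map_add, hs, ht]
  | tm b h =>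
    have e : ∀ (s : B ⊗[k] B) (t : V ⊗[k] V),
        TensorProduct.lift (((LinearMap.mul k (GenDouble hp)).compl₁₂ (inl hp)
          (sec hp γ ∘ₗ counitProj hp)).flip) ((proj hp hγ : GenDouble hp →ₗ[k] B).lTensor
            (GenDouble hp) (TensorProduct.map (TensorProduct.lift (tmul hp))
              (TensorProduct.lift (tmul hp))
                (TensorProduct.tensorTensorTensorComm k B B V V (s ⊗ₜ t)))) =
        inl hp (TensorProduct.lid k B ((counit (R := k)).rTensor B s)) *
          LinearMap.mul' k (GenDouble hp) (TensorProduct.map (inl hp ∘ₗ (γ : V →ₗ[k] B))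
            (sec hp γ) (TensorProduct.comm k V V t)) := by
      intro s t
      induction s using TensorProduct.induction_on with
      | zero => simp
      | add u v hu hv => simp only [TensorProduct.add_tmul, map_add, hu, hv, add_mul]
      | tmul b1 b2 =>
        induction t using TensorProduct.induction_on with
        | zero => simp
        | add u v hu hv => simp only [TensorProduct.tmul_add, map_add, hu, hv, mul_add]
        | tmul h1 h2 =>
          show inl hp (b2 * γ h2) * sec hp γ (counit (R := k) b1 • h1) =
            inl hp (counit (R := k) b1 • b2) * (inl hp (γ h2) * sec hp γ h1)
          rw [inl_mul, map_smul, map_smul, mul_smul_comm, smul_mul_assoc, mul_assoc]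
    rw [comul_tmul, e, Coalgebra.rTensor_counit_comul, TensorProduct.lid_tmul, one_smul]
    have e2 := congrArg (fun F : WithConv (Cop k V →ₗ[k] GenDouble hp) => F (Cop.of k V h))
      (twist_mul_sec hp γ)
    refine (congrArg (inl hp b * ·) e2).trans ?_
    exact inl_mul_inr hp b h

theorem sec_counitProj {d : GenDouble hp}
    (hd : d ∈ coinvariants (proj hp hγ : GenDouble hp →ₗ[k] B)) :
    sec hp γ (counitProj hp d) = d := by
  have h := inl_proj_mul_sec hp hγ d
  have hd' : (proj hp hγ : GenDouble hp →ₗ[k] B).lTensor (GenDouble hp) (comul (R := k) d) =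
    d ⊗ₜ[k] (1 : B) := hd
  rw [hd'] at h
  exact (one_mul _).symm.trans h

/-- The projection of the double onto `V` along the coinvariants. -/
def coinvCoord : GenDouble hp →ₗ[k] V :=
  counitProj hp ∘ₗ coinvProj (inlHom hp : B →ₗ[k] GenDouble hp)
    (proj hp hγ : GenDouble hp →ₗ[k] B)

/-- This is the input for the general theory of projections; `coinvCoord` plays the role of `p`. -/
theorem coinvSplitting :
    CoinvSplitting (inlHom hp) (proj hp hγ) (sec hp γ) (coinvCoord hp hγ) where
  retract := proj_inl hp hγ
  section_proj d := sec_counitProj hp hγ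
    (CoinvSplitting.coinvProj_mem_of_retract (proj_inl hp hγ) d)
  proj_section x := by
    show counitProj hp (coinvProj _ _ (sec hp γ x)) = x
    rw [coinvProj_of_coinvariant (inlHom hp) (proj hp hγ) (sec_mem hp hγ x), counitProj_sec]

end GenDouble

/-! ### Iterated coproducts -/

section PairOuter

variable {k V : Type*} [Field k] [Ring V] [HopfAlgebra k V]

/-- `pairOuter φ (a ⊗ (b ⊗ c)) = φ(a ⊗ c) b`. -/
def pairOuter : (V ⊗[k] V →ₗ[k] k) →ₗ[k] (V ⊗[k] (V ⊗[k] V) →ₗ[k] V) :=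
  LinearMap.lcomp k V ((TensorProduct.assoc k V V V).symm.toLinearMap ∘ₗ
      (TensorProduct.comm k V V).toLinearMap.lTensor V) ∘ₗ
    LinearMap.llcomp k _ _ _ (TensorProduct.lid k V).toLinearMap ∘ₗ LinearMap.rTensorHom V

theorem pairOuter_tmul (φ : V ⊗[k] V →ₗ[k] k) (a b c : V) :
    pairOuter φ (a ⊗ₜ (b ⊗ₜ c)) = φ (a ⊗ₜ c) • b := rfl

theorem comul3_eq (x : V) : comul3 k V x =
    TensorProduct.assoc k V V V ((comul (R := k)).rTensor V (comul (R := k) x)) :=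
  (Coalgebra.coassoc_apply x).symm

theorem comul4_eq_rTensor (x : V) : comul4 k V x =
    (TensorProduct.assoc k V V V).toLinearMap.lTensor V (TensorProduct.assoc k V (V ⊗[k] V) V
      ((comul3 k V).rTensor V (comul (R := k) x))) := by
  have e : (TensorProduct.assoc k V V V).toLinearMap.lTensor V ∘ₗ
      (TensorProduct.assoc k V (V ⊗[k] V) V).toLinearMap ∘ₗ (comul3 k V).rTensor V ∘ₗ comul =
        comul4 k V := by
    simp only [comul4, comul3, coassoc_simps]
  rw [← e]
  rfl

theorem cop_conv3_apply {A : Type*} [Ring A] [Algebra k A]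
    (F G K : WithConv (Cop k V →ₗ[k] A)) (v : V) :
    (F * G * K : WithConv (Cop k V →ₗ[k] A)) (Cop.of k V v) =
      LinearMap.mul' k A (TensorProduct.map (F.ofConv ∘ₗ (Cop.of k V).toLinearMap)
        (LinearMap.mul' k A ∘ₗ TensorProduct.map (G.ofConv ∘ₗ (Cop.of k V).toLinearMap)
          (K.ofConv ∘ₗ (Cop.of k V).toLinearMap) ∘ₗ (TensorProduct.comm k V V).toLinearMap)
        (TensorProduct.comm k (V ⊗[k] V) V ((TensorProduct.assoc k V V V).symm
          (comul3 k V v)))) := by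
  rw [comul3_eq, LinearEquiv.symm_apply_apply, mul_assoc, cop_conv_mul_apply]
  induction comul (R := k) v using TensorProduct.induction_on with
  | zero => simp
  | add u v hu hv => simp only [map_add, hu, hv]
  | tmul u v => rfl

end PairOuter

/-! ### Explicit formulas for the induced structure -/

namespace GenDouble

variable {k B V : Type*} [Field k] [Ring B] [HopfAlgebra k B] [Ring V] [HopfAlgebra k V]
  [BijectiveAntipode k V] {p : B →ₗ[k] V →ₗ[k] k} (hp : IsSkewPairing p) {γ : V →ₐc[k] B}
  (hγ : Intertwines p γ)

/-- The counit merges the two pairings of the exchange: `p(κ₁, y₁) p(S(κ₂), y₃) = p(κ, S⁻¹(y₃) y₁)`.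
The action, the product and the antipode are evaluated through this formula. -/
theorem counitProj_inr_mul_inl (y : V) (κ : B) : counitProj hp (inr hp y * inl hp κ) =
    pairOuter (p κ ∘ₗ LinearMap.mul' k V ∘ₗ (antipodeInv k V).rTensor V ∘ₗ
      (TensorProduct.comm k V V).toLinearMap) (comul3 k V y) := by
  rw [inr_mul_inl, IsSkewPairing.swap_apply]
  let Ψ : V ⊗[k] (V ⊗[k] V) →ₗ[k] V := counitProj hp ∘ₗ (act3 p).flip (κ ⊗ₜ[k] (1 : V))
  have e : ∀ t : V ⊗[k] (V ⊗[k] V), Ψ t =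
      pairOuter (p κ ∘ₗ LinearMap.mul' k V ∘ₗ (antipodeInv k V).rTensor V ∘ₗ
        (TensorProduct.comm k V V).toLinearMap) t := by
    intro t
    induction t using TensorProduct.induction_on with
    | zero => rw [map_zero, map_zero]
    | add u v hu hv => rw [map_add, map_add, hu, hv]
    | tmul a t =>
      induction t using TensorProduct.induction_on with
      | zero => rw [TensorProduct.tmul_zero, map_zero, map_zero]
      | add u v hu hv => rw [TensorProduct.tmul_add, map_add, map_add, hu, hv]
      | tmul b c =>
        show counitProj hp (act3 p (a ⊗ₜ (b ⊗ₜ c)) (κ ⊗ₜ[k] (1 : V))) = _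
        rw [act3_tmul, pairOuter_tmul, mul_one]
        show counit (R := k) (hitL (p.flip a) (actR p c κ)) • b =
          p κ (antipodeInv k V c * a) • b
        rw [counit_hitL, hp.actR_eq, ← conv_eq_hitR, ← hp.flip_mul]
        rfl
  exact e _

/-- `actForm κ (a ⊗ (b ⊗ c)) = p(κ, S⁻¹(a) S⁻²(c)) b`. -/
def actForm (p : B →ₗ[k] V →ₗ[k] k) : B →ₗ[k] V ⊗[k] (V ⊗[k] V) →ₗ[k] V :=
  pairOuter ∘ₗ LinearMap.lcomp k k (LinearMap.mul' k V ∘ₗ TensorProduct.map (antipodeInv k V)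
    (antipodeInv k V ∘ₗ antipodeInv k V)) ∘ₗ p

theorem actForm_tmul (κ : B) (a b c : V) : actForm p κ (a ⊗ₜ (b ⊗ₜ c)) =
    p κ (antipodeInv k V a * antipodeInv k V (antipodeInv k V c)) • b := rfl

/-- The structure of a braided Hopf algebra on `V` induced from the projection of the double. -/
abbrev braided : BraidedHopfAlgebra k B V := (coinvSplitting hp hγ).inducedBraidedHopfAlgebra

/-- Under `ε ⊗ id` the element `i(κ₁) sec(x) i(S(κ₂))` loses both left factors and becomes the
exchange of `1 ⊗ x` with `S(κ) ⊗ 1`. Moving `S` across the pairing turns `S⁻¹(x₃) x₁` into `S⁻¹(x₁)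
S⁻²(x₃)`. -/
theorem braided_act (κ : B) (x : V) : (braided hp hγ).act κ x = actForm p κ (comul3 k V x) := by
  have h := (coinvSplitting hp hγ).section_act κ x
  have h1 : (braided hp hγ).act κ x = counitProj hp (cvAdj (inlHom hp) (sec hp γ x) κ) := by
    rw [← h, counitProj_sec]
    rfl
  have h2 : counitProj hp (cvAdj (inlHom hp) (sec hp γ x) κ) =
      counitProj hp (sec hp γ x * inl hp (antipode k κ)) := by
    rw [cvAdj, mul_assoc]
    refine (conv_absorb_left (counitProj hp) _ _ (fun a c => counitProj_inl_mul hp c a) κ).trans ?_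
    rw [cst_mul_apply]
    rfl
  rw [h1, h2, counitProj_sec_mul, counitProj_inr_mul_inl]
  induction comul3 k V x using TensorProduct.induction_on with
  | zero => simp
  | add u v hu hv => simp only [map_add, hu, hv]
  | tmul a t =>
    induction t using TensorProduct.induction_on with
    | zero => simp
    | add u v hu hv => simp only [TensorProduct.tmul_add, map_add, hu, hv]
    | tmul b c =>
      rw [actForm_tmul, pairOuter_tmul]
      show p (antipode k κ) (antipodeInv k V c * a) • b = _
      rw [hp.antipode_left, antipodeInv_mul]

/-- `a ⊗ (b ⊗ c) ↦ (γ(S⁻¹(c)) ⊗ a) ⊗ b`. -/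
def comulSecForm (γ : V →ₐc[k] B) : V ⊗[k] (V ⊗[k] V) →ₗ[k] GenDouble hp ⊗[k] V :=
  (TensorProduct.lift (tmul hp)).rTensor V ∘ₗ (TensorProduct.assoc k B V V).symm.toLinearMap ∘ₗ
    TensorProduct.map ((γ : V →ₗ[k] B) ∘ₗ antipodeInv k V) LinearMap.id ∘ₗ
      (TensorProduct.comm k (V ⊗[k] V) V).toLinearMap ∘ₗ
        (TensorProduct.assoc k V V V).symm.toLinearMap

theorem comulSecForm_tmul (a b c : V) : comulSecForm hp γ (a ⊗ₜ (b ⊗ₜ c)) =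
    tmul hp (γ (antipodeInv k V c)) a ⊗ₜ b := rfl

theorem comul_sec (x : V) : comul (R := k) (sec hp γ x) =
    (sec hp γ).lTensor (GenDouble hp) (comulSecForm hp γ (comul3 k V x)) := by
  have h := congrArg (fun F : WithConv (Cop k V →ₗ[k] _) => F (Cop.of k V x))
    (convPush_comul_sec hp γ)
  refine h.trans ((cop_conv3_apply _ _ _ x).trans ?_)
  induction comul3 k V x using TensorProduct.induction_on with
  | zero => simp
  | add u v hu hv => simp only [map_add, hu, hv]
  | tmul a t =>
    induction t using TensorProduct.induction_on with
    | zero => simp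
    | add u v hu hv => simp only [TensorProduct.tmul_add, map_add, hu, hv]
    | tmul b c =>
      rw [comulSecForm_tmul, LinearMap.lTensor_tmul]
      show (inl hp (γ (antipodeInv k V c)) ⊗ₜ[k] (1 : GenDouble hp)) *
        (((1 : GenDouble hp) ⊗ₜ[k] sec hp γ b) * (inr hp a ⊗ₜ[k] (1 : GenDouble hp))) = _
      rw [Algebra.TensorProduct.tmul_mul_tmul, Algebra.TensorProduct.tmul_mul_tmul, one_mul,
        mul_one, one_mul, inl_mul_inr]

/-- The second leg of the coproduct of `sec(x)` is `sec(x₂)`, with coordinate `x₂`. Taking `f = π`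
yields the coaction, and `f = coinvCoord` the coproduct. -/
theorem map_comul_sec {M : Type*} [AddCommGroup M] [Module k M] (f : GenDouble hp →ₗ[k] M) (x : V) :
    TensorProduct.map f (coinvCoord hp hγ) (comul (R := k) (sec hp γ x)) =
      f.rTensor V (comulSecForm hp γ (comul3 k V x)) := by
  rw [comul_sec]
  induction comulSecForm hp γ (comul3 k V x) using TensorProduct.induction_on with
  | zero => simp
  | add u v hu hv => simp only [map_add, hu, hv]
  | tmul a b =>
    rw [LinearMap.lTensor_tmul, TensorProduct.map_tmul, LinearMap.rTensor_tmul,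
      (coinvSplitting hp hγ).proj_section]

theorem braided_coact (x : V) : (braided hp hγ).coact x =
    (proj hp hγ : GenDouble hp →ₗ[k] B).rTensor V (comulSecForm hp γ (comul3 k V x)) :=
  map_comul_sec hp hγ _ x

/-- Under `ε ⊗ id`, `sec(x)` becomes `1 ⊗ x`, and the factor `1 ⊗ y₁` of `sec(y)` comes out on the
right. -/
theorem braided_mul (x y : V) : (braided hp hγ).mul x y =
    LinearMap.mul' k V (TensorProduct.map (counitProj hp ∘ₗ LinearMap.mulLeft k (inr hp x) ∘ₗ
      inl hp ∘ₗ (γ : V →ₗ[k] B) ∘ₗ antipodeInv k V) LinearMap.id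
        (TensorProduct.comm k V V (comul (R := k) y))) := by
  have h : (braided hp hγ).mul x y = counitProj hp (sec hp γ x * sec hp γ y) := by
    rw [← (coinvSplitting hp hγ).section_mul, counitProj_sec]
    rfl
  rw [h, counitProj_sec_mul, sec_apply]
  induction comul (R := k) y using TensorProduct.induction_on with
  | zero => simp
  | add u v hu hv => simp only [map_add, mul_add, hu, hv]
  | tmul u v =>
    show counitProj hp (inr hp x * tmul hp (γ (antipodeInv k V v)) u) =
      counitProj hp (inr hp x * inl hp (γ (antipodeInv k V v))) * u
    rw [← inl_mul_inr, ← mul_assoc, counitProj_mul_inr]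

theorem braided_one : (braided hp hγ).one = 1 := by
  show counitProj hp (coinvProj _ _ 1) = 1
  rw [coinvProj_of_coinvariant (inlHom hp) (proj hp hγ) CoinvSplitting.one_mem_coinvariants]
  exact counitProj_inr hp 1

theorem braided_counit : (braided hp hγ).counit = counit := by
  refine LinearMap.ext fun x => ?_
  show counit (R := k) (sec hp γ x) = counit (R := k) x
  have e : ∀ t : V ⊗[k] V, counit (R := k) (TensorProduct.lift (tmul hp) (TensorProduct.map
    ((γ : V →ₗ[k] B) ∘ₗ antipodeInv k V) LinearMap.id (TensorProduct.comm k V V t))) =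
      counit (R := k) (TensorProduct.rid k V ((counit (R := k)).lTensor V t)) := by
    intro t
    induction t using TensorProduct.induction_on with
    | zero => simp
    | add u v hu hv => simp only [map_add, hu, hv]
    | tmul u v =>
      show counit (R := k) (tmul hp (γ (antipodeInv k V v)) u) =
        counit (R := k) (counit (R := k) v • u)
      rw [counit_tmul, counit_bialgHom, counit_antipodeInv, map_smul, smul_eq_mul]
  rw [sec_apply, e, Coalgebra.lTensor_counit_comul, TensorProduct.rid_tmul, one_smul]

/-- `(a ⊗ (b ⊗ c)) ⊗ d ↦ p(κ γ(d), S⁻¹(a) S⁻²(c)) b`. -/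
def coordForm (p : B →ₗ[k] V →ₗ[k] k) (γ : V →ₐc[k] B) :
    B →ₗ[k] (V ⊗[k] (V ⊗[k] V)) ⊗[k] V →ₗ[k] V :=
  (TensorProduct.lift.equiv (RingHom.id k) _ _ _).toLinearMap ∘ₗ LinearMap.lflip.toLinearMap ∘ₗ
    (LinearMap.llcomp k V B _ (actForm p)) ∘ₗ
      (LinearMap.llcomp k V B B).flip (γ : V →ₗ[k] B) ∘ₗ LinearMap.mul k B

theorem coordForm_tmul (κ : B) (t : V ⊗[k] (V ⊗[k] V)) (d : V) :
    coordForm p γ κ (t ⊗ₜ d) = actForm p (κ * γ d) t := rfl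

/-- Writing `1 ⊗ y = γ(y₂) sec(y₁)` shows that the coordinate of `κ ⊗ y` is the action of `κ γ(y₂)`
on `y₁`. -/
theorem coinvCoord_inl_mul_inr (κ : B) (y : V) : coinvCoord hp hγ (inl hp κ * inr hp y) =
    coordForm p γ κ ((comul3 k V).rTensor V (comul (R := k) y)) := by
  have h : inr hp y = LinearMap.mul' k (GenDouble hp) (TensorProduct.map
      (inl hp ∘ₗ (γ : V →ₗ[k] B)) (sec hp γ) (TensorProduct.comm k V V (comul (R := k) y))) :=
    congrArg (fun F : WithConv (Cop k V →ₗ[k] GenDouble hp) => F (Cop.of k V y))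
      (twist_mul_sec hp γ).symm
  rw [h]
  induction comul (R := k) y using TensorProduct.induction_on with
  | zero => simp
  | add u v hu hv => simp only [map_add, mul_add, hu, hv]
  | tmul u v =>
    rw [LinearMap.rTensor_tmul, coordForm_tmul, ← braided_act hp hγ]
    show coinvCoord hp hγ (inl hp κ * (inl hp (γ v) * sec hp γ u)) =
      coinvCoord hp hγ (inl hp (κ * γ v) * sec hp γ u)
    rw [inl_mul, mul_assoc]

/-- `((a ⊗ (b ⊗ c)) ⊗ d) ⊗ (e ⊗ f) ↦ p(γ(S⁻¹(f)) γ(d), S⁻¹(a) S⁻²(c)) b ⊗ e`. -/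
def comulForm (p : B →ₗ[k] V →ₗ[k] k) (γ : V →ₐc[k] B) :
    ((V ⊗[k] (V ⊗[k] V)) ⊗[k] V) ⊗[k] (V ⊗[k] V) →ₗ[k] V ⊗[k] V :=
  (TensorProduct.lift (coordForm p γ ∘ₗ (γ : V →ₗ[k] B) ∘ₗ antipodeInv k V).flip).rTensor V ∘ₗ
    (TensorProduct.assoc k _ V V).symm.toLinearMap ∘ₗ
      (TensorProduct.comm k V V).toLinearMap.lTensor _

theorem comulForm_tmul (s : (V ⊗[k] (V ⊗[k] V)) ⊗[k] V) (e f : V) :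
    comulForm p γ (s ⊗ₜ (e ⊗ₜ f)) = coordForm p γ (γ (antipodeInv k V f)) s ⊗ₜ e := rfl

/-- The first leg `γ(S⁻¹(x₃)) ⊗ x₁` of the coproduct of `sec(x)` need not be coinvariant. Expressing
its coordinate through the action splits `x₁` into four legs, which accounts for the sixfold
coproduct. -/
theorem braided_comul (x : V) : (braided hp hγ).comul x = comulForm p γ
    (((comul3 k V).rTensor V ∘ₗ comul).rTensor (V ⊗[k] V) (comul3 k V x)) := by
  refine (map_comul_sec hp hγ (coinvCoord hp hγ) x).trans ?_
  induction comul3 k V x using TensorProduct.induction_on with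
  | zero => simp
  | add u v hu hv => simp only [map_add, hu, hv]
  | tmul a t =>
    induction t using TensorProduct.induction_on with
    | zero => simp
    | add u v hu hv => simp only [TensorProduct.tmul_add, map_add, hu, hv]
    | tmul b c =>
      rw [comulSecForm_tmul, LinearMap.rTensor_tmul, LinearMap.rTensor_tmul, comulForm_tmul,
        ← inl_mul_inr, coinvCoord_inl_mul_inr]
      rfl

/-- `(a ⊗ (b ⊗ c)) ⊗ d ↦ p(γ(d), a S(c)) S(b)`. -/
def antipodeForm (p : B →ₗ[k] V →ₗ[k] k) (γ : V →ₐc[k] B) :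
    (V ⊗[k] (V ⊗[k] V)) ⊗[k] V →ₗ[k] V :=
  TensorProduct.lift (LinearMap.llcomp k _ _ _ (antipode k) ∘ₗ pairOuter ∘ₗ
    LinearMap.lcomp k k (LinearMap.mul' k V ∘ₗ (antipode k).lTensor V) ∘ₗ p ∘ₗ
      (γ : V →ₗ[k] B)).flip

theorem antipodeForm_tmul (a b c d : V) : antipodeForm p γ ((a ⊗ₜ (b ⊗ₜ c)) ⊗ₜ d) =
    p (γ d) (a * antipode k c) • antipode k b :=
  map_smul (antipode k) (p (γ d) (a * antipode k c)) b

/-- `a ⊗ (b ⊗ c) ↦ S(c) ⊗ (S(b) ⊗ S(a))`. -/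
def antipodeReverse (k V : Type*) [Field k] [Ring V] [HopfAlgebra k V] :
    V ⊗[k] (V ⊗[k] V) →ₗ[k] V ⊗[k] (V ⊗[k] V) :=
  TensorProduct.map (antipode k) (TensorProduct.map (antipode k) (antipode k) ∘ₗ
    (TensorProduct.comm k V V).toLinearMap) ∘ₗ (TensorProduct.comm k (V ⊗[k] V) V).toLinearMap ∘ₗ
      (TensorProduct.assoc k V V V).symm.toLinearMap

theorem comul3_antipode (x : V) :
    comul3 k V (antipode k x) = antipodeReverse k V (comul3 k V x) := by
  rw [comul3_eq x, comul3, LinearMap.comp_apply, comul_antipode]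
  induction comul (R := k) x using TensorProduct.induction_on with
  | zero => simp
  | add u v hu hv => simp only [map_add, hu, hv]
  | tmul u v =>
    rw [TensorProduct.comm_tmul, TensorProduct.map_tmul, LinearMap.lTensor_tmul, comul_antipode,
      LinearMap.rTensor_tmul, antipodeReverse, LinearMap.comp_apply, LinearMap.comp_apply,
      LinearEquiv.coe_coe, LinearEquiv.coe_coe, LinearEquiv.symm_apply_apply,
      TensorProduct.comm_tmul, TensorProduct.map_tmul]
    rfl

/-- `ε ⊗ id` removes the left factor `i(π(-))`, and the antipode of the double sends `γ(S⁻¹(x₂)) ⊗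
x₁` to the exchange of `S(x₁)` with `γ(x₂)`. -/
theorem braided_antipode (x : V) : (braided hp hγ).antipode x =
    antipodeForm p γ ((comul3 k V).rTensor V (comul (R := k) x)) := by
  have h1 : (braided hp hγ).antipode x = counitProj hp (coinvAntipode
      (inlHom hp : B →ₗ[k] GenDouble hp) (proj hp hγ : GenDouble hp →ₗ[k] B) (sec hp γ x)) := by
    rw [← (coinvSplitting hp hγ).section_antipode, counitProj_sec]
    rfl
  have h2 : counitProj hp (coinvAntipode (inlHom hp : B →ₗ[k] GenDouble hp)
      (proj hp hγ : GenDouble hp →ₗ[k] B) (sec hp γ x)) =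
        counitProj hp (antipode k (sec hp γ x)) := by
    refine conv_absorb_left (counitProj hp) (cv (antipode k))
      (cvJ (inlHom hp) (proj hp hγ)) (fun a c => ?_) (sec hp γ x)
    refine (counitProj_inl_mul hp (proj hp hγ c) a).trans ?_
    rw [counit_bialgHom]
  rw [h1, h2, sec_apply]
  induction comul (R := k) x using TensorProduct.induction_on with
  | zero => simp
  | add u v hu hv => simp only [map_add, hu, hv]
  | tmul u v =>
    show counitProj hp (inr hp (antipode k u) * inl hp (antipode k (γ (antipodeInv k V v)))) = _
    rw [antipode_comp_bialgHom, antipode_antipodeInv, counitProj_inr_mul_inl, comul3_antipode,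
      LinearMap.rTensor_tmul]
    induction comul3 k V u using TensorProduct.induction_on with
    | zero => simp
    | add s t hs ht => simp only [map_add, TensorProduct.add_tmul, hs, ht]
    | tmul a t =>
      induction t using TensorProduct.induction_on with
      | zero => simp
      | add s t hs ht => simp only [map_add, TensorProduct.tmul_add, TensorProduct.add_tmul, hs, ht]
      | tmul b c =>
        rw [antipodeForm_tmul]
        show p (γ v) (antipodeInv k V (antipode k a) * antipode k c) • antipode k b = _
        rw [antipodeInv_antipode]

end GenDouble

/-! ### The formulas in terms of Sweedler components -/

namespace GenDouble

variable {k B V : Type*} [Field k] [Ring B] [HopfAlgebra k B] [Ring V] [HopfAlgebra k V]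
  [BijectiveAntipode k V] {p : B →ₗ[k] V →ₗ[k] k} (hp : IsSkewPairing p) {γ : V →ₐc[k] B}
  (hγ : Intertwines p γ)

/-- Here and below the coproduct may be given by any finite sum of pure tensors; the formula is the
value of a linear map on that sum, hence independent of the choice. -/
theorem sec_eq_sum {x : V} {n : ℕ} {x₁ x₂ : Fin n → V}
    (hx : comul (R := k) x = ∑ i, x₁ i ⊗ₜ x₂ i) :
    sec hp γ x = ∑ i, tmul hp (γ (antipodeInv k V (x₂ i))) (x₁ i) := by
  rw [sec_apply, hx, map_sum, map_sum, map_sum]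
  rfl

theorem braided_act_eq_sum (κ : B) {y : V} {n : ℕ} {y₁ y₂ y₃ : Fin n → V}
    (hy : comul3 k V y = ∑ i, y₁ i ⊗ₜ (y₂ i ⊗ₜ y₃ i)) : (braided hp hγ).act κ y =
      ∑ i, p κ (antipodeInv k V (y₁ i) * antipodeInv k V (antipodeInv k V (y₃ i))) • y₂ i := by
  rw [braided_act, hy, map_sum]
  rfl

theorem braided_coact_eq_sum {y : V} {n : ℕ} {y₁ y₂ y₃ : Fin n → V}
    (hy : comul3 k V y = ∑ i, y₁ i ⊗ₜ (y₂ i ⊗ₜ y₃ i)) : (braided hp hγ).coact y =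
      ∑ i, γ (antipodeInv k V (y₃ i) * y₁ i) ⊗ₜ y₂ i := by
  rw [braided_coact, hy, map_sum, map_sum]
  refine Finset.sum_congr rfl fun i _ => ?_
  rw [map_mul]
  rfl

theorem braided_mul_eq_sum {x y : V} {n m : ℕ} {x₁ x₂ x₃ : Fin n → V} {y₁ y₂ : Fin m → V}
    (hx : comul3 k V x = ∑ i, x₁ i ⊗ₜ (x₂ i ⊗ₜ x₃ i))
    (hy : comul (R := k) y = ∑ j, y₁ j ⊗ₜ y₂ j) : (braided hp hγ).mul x y =
      ∑ i, ∑ j, p (γ (antipodeInv k V (y₂ j))) (antipodeInv k V (x₃ i) * x₁ i) •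
        (x₂ i * y₁ j) := by
  rw [braided_mul, hy, map_sum, map_sum, map_sum, Finset.sum_comm]
  refine Finset.sum_congr rfl fun j _ => ?_
  show counitProj hp (inr hp x * inl hp (γ (antipodeInv k V (y₂ j)))) * y₁ j = _
  rw [counitProj_inr_mul_inl, hx, map_sum, Finset.sum_mul]
  refine Finset.sum_congr rfl fun i _ => ?_
  rw [pairOuter_tmul, smul_mul_assoc]
  rfl

/-- The reassociation `V^{⊗ 6} → (V^{⊗ 3} ⊗ V) ⊗ V^{⊗ 2}`. -/
def reassocSix (k V : Type*) [Field k] [Ring V] [HopfAlgebra k V] :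
    V ⊗[k] (V ⊗[k] (V ⊗[k] (V ⊗[k] (V ⊗[k] V)))) →ₗ[k]
      ((V ⊗[k] (V ⊗[k] V)) ⊗[k] V) ⊗[k] (V ⊗[k] V) :=
  (TensorProduct.assoc k (V ⊗[k] (V ⊗[k] V)) V (V ⊗[k] V)).symm.toLinearMap ∘ₗ
    (TensorProduct.assoc k V (V ⊗[k] V) (V ⊗[k] (V ⊗[k] V))).symm.toLinearMap ∘ₗ
      (TensorProduct.assoc k V V (V ⊗[k] (V ⊗[k] V))).symm.toLinearMap.lTensor V

theorem reassocSix_comul6 (x : V) : reassocSix k V (comul6 k V x) =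
    ((comul3 k V).rTensor V ∘ₗ comul).rTensor (V ⊗[k] V) (comul3 k V x) := by
  have e : reassocSix k V ∘ₗ comul6 k V =
      ((comul3 k V).rTensor V ∘ₗ comul).rTensor (V ⊗[k] V) ∘ₗ comul3 k V := by
    simp only [reassocSix, comul6, comul4, comul3, coassoc_simps]
  exact LinearMap.congr_fun e x

theorem braided_comul_eq_sum {x : V} {n : ℕ} {x₁ x₂ x₃ x₄ x₅ x₆ : Fin n → V}
    (hx : comul6 k V x = ∑ i, x₁ i ⊗ₜ (x₂ i ⊗ₜ (x₃ i ⊗ₜ (x₄ i ⊗ₜ (x₅ i ⊗ₜ x₆ i))))) :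
    (braided hp hγ).comul x = ∑ i, p (γ (antipodeInv k V (x₆ i) * x₄ i))
      (antipodeInv k V (x₁ i) * antipodeInv k V (antipodeInv k V (x₃ i))) • x₂ i ⊗ₜ[k] x₅ i := by
  rw [braided_comul, ← reassocSix_comul6, hx, map_sum, map_sum]
  refine Finset.sum_congr rfl fun i _ => ?_
  rw [map_mul γ]
  rfl

theorem braided_antipode_eq_sum {x : V} {n : ℕ} {x₁ x₂ x₃ x₄ : Fin n → V}
    (hx : comul4 k V x = ∑ i, x₁ i ⊗ₜ (x₂ i ⊗ₜ (x₃ i ⊗ₜ x₄ i))) :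
    (braided hp hγ).antipode x =
      ∑ i, p (γ (x₄ i)) (x₁ i * antipode k (x₃ i)) • antipode k (x₂ i) := by
  have e : (TensorProduct.assoc k V (V ⊗[k] V) V).symm
      ((TensorProduct.assoc k V V V).symm.toLinearMap.lTensor V (comul4 k V x)) =
      (comul3 k V).rTensor V (comul (R := k) x) := by
    rw [comul4_eq_rTensor, ← LinearMap.lTensor_comp_apply, LinearEquiv.symm_comp,
      LinearMap.lTensor_id, LinearMap.id_apply, LinearEquiv.symm_apply_apply]
  rw [braided_antipode, ← e, hx, map_sum, map_sum, map_sum]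
  exact Finset.sum_congr rfl fun i _ => antipodeForm_tmul _ _ _ _

variable {τ : V →ₗ[k] V →ₗ[k] k}

/-- The inverse antipode on `y₂` is moved to an antipode in the first argument of `τ`, where it
removes the remaining inverse: `S²(S⁻¹(x₃) x₁) = S(x₃) S²(x₁)`. -/
theorem braided_mul_eq_form {x y : V} {n m : ℕ} {x₁ x₂ x₃ : Fin n → V} {y₁ y₂ : Fin m → V}
    (hτ : IsSkewPairing τ) (hpτ : ∀ y z, p (γ y) z = τ (antipode k z) y)
    (hx : comul3 k V x = ∑ i, x₁ i ⊗ₜ (x₂ i ⊗ₜ x₃ i))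
    (hy : comul (R := k) y = ∑ j, y₁ j ⊗ₜ y₂ j) : (braided hp hγ).mul x y =
      ∑ i, ∑ j, τ (antipode k (x₃ i) * antipode k (antipode k (x₁ i))) (y₂ j) •
        (x₂ i * y₁ j) := by
  rw [braided_mul_eq_sum hp hγ hx hy]
  refine Finset.sum_congr rfl fun i _ => Finset.sum_congr rfl fun j _ => ?_
  rw [hpτ, ← hτ.antipode_left, antipode_mul_antidistrib, antipode_antipodeInv,
    antipode_mul_antidistrib]

/-- Applying `S` to both arguments of `τ`, which does not change the value, clears all inverse
antipodes. -/
theorem braided_comul_eq_form {x : V} {n : ℕ} {x₁ x₂ x₃ x₄ x₅ x₆ : Fin n → V}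
    (hτ : IsSkewPairing τ) (hpτ : ∀ y z, p (γ y) z = τ (antipode k z) y)
    (hx : comul6 k V x = ∑ i, x₁ i ⊗ₜ (x₂ i ⊗ₜ (x₃ i ⊗ₜ (x₄ i ⊗ₜ (x₅ i ⊗ₜ x₆ i))))) :
    (braided hp hγ).comul x = ∑ i, τ (antipode k (x₁ i) * x₃ i) (antipode k (x₄ i) * x₆ i) •
      x₂ i ⊗ₜ[k] x₅ i := by
  rw [braided_comul_eq_sum hp hγ hx]
  refine Finset.sum_congr rfl fun i _ => ?_
  rw [hpτ, ← hτ.apply_antipode_antipode]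
  simp only [antipode_mul_antidistrib, antipode_antipodeInv]

theorem braided_antipode_eq_form {x : V} {n : ℕ} {x₁ x₂ x₃ x₄ : Fin n → V}
    (hpτ : ∀ y z, p (γ y) z = τ (antipode k z) y)
    (hx : comul4 k V x = ∑ i, x₁ i ⊗ₜ (x₂ i ⊗ₜ (x₃ i ⊗ₜ x₄ i))) :
    (braided hp hγ).antipode x =
      ∑ i, τ (antipode k (antipode k (x₃ i)) * antipode k (x₁ i)) (x₄ i) •
        antipode k (x₂ i) := by
  rw [braided_antipode_eq_sum hp hγ hx]
  refine Finset.sum_congr rfl fun i _ => ?_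
  rw [hpτ, antipode_mul_antidistrib]

end GenDouble

/-! ### The evaluation pairing and the map x ↦ l_{S⁻¹(x)} -/

section Evaluation

variable {k H : Type*} [Field k] [Ring H] [HopfAlgebra k H]

/-- The inclusion of a sub-Hopf algebra, as a morphism of bialgebras. -/
def SubHopfAlgebra.inclHom (X : SubHopfAlgebra k H) : X →ₐc[k] H :=
  BialgHom.ofAlgHom X.toSubalgebra.val (AlgHom.ext fun _ => rfl)
    (AlgHom.ext fun x => X.map_incl_comul x)

theorem comul_antipodeInv {V : Type*} [Ring V] [HopfAlgebra k V] [BijectiveAntipode k V] (x : V) :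
    comul (R := k) (antipodeInv k V x) = TensorProduct.map (antipodeInv k V) (antipodeInv k V)
      (TensorProduct.comm k V V (comul (R := k) x)) := by
  have h := comul_antipode (k := k) (antipodeInv k V x)
  rw [antipode_antipodeInv] at h
  rw [h]
  induction comul (R := k) (antipodeInv k V x) using TensorProduct.induction_on with
  | zero => simp
  | add u v hu hv => simp only [map_add, ← hu, ← hv]
  | tmul u v =>
    simp only [TensorProduct.comm_tmul, TensorProduct.map_tmul, antipodeInv_antipode]

variable {σ : H →ₗ[k] H →ₗ[k] k} (hσ : IsSkewPairing σ) (X : SubHopfAlgebra k H)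
  (K : SubHopfAlgebra k (FiniteDual k H)) (hK : ∀ x : X, leftFun hσ (X.incl x) ∈ K.toSubalgebra)

/-- The map `x ↦ l_x` from `X` to a sub-Hopf algebra of the finite dual which contains all
`l_x`. -/
def leftHom : X →ₗ[k] K :=
  LinearMap.codRestrict (Subalgebra.toSubmodule K.toSubalgebra) (leftFun hσ ∘ₗ X.incl) hK

theorem leftHom_mul (x y : X) :
    leftHom hσ X K hK (x * y) = leftHom hσ X K hK y * leftHom hσ X K hK x :=
  K.incl_injective (leftFun_mul hσ (X.incl x) (X.incl y))

theorem leftHom_one : leftHom hσ X K hK 1 = 1 := K.incl_injective (leftFun_one hσ)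

theorem comul_leftHom (x : X) : comul (R := k) (leftHom hσ X K hK x) =
    TensorProduct.map (leftHom hσ X K hK) (leftHom hσ X K hK) (comul (R := k) x) := by
  apply K.map_incl_injective
  refine (K.map_incl_comul _).trans ?_
  refine (comul_leftFun hσ (X.incl x)).trans ?_
  refine (congrArg _ (X.map_incl_comul x).symm).trans ?_
  induction comul (R := k) x using TensorProduct.induction_on with
  | zero => simp
  | add u v hu hv => simp only [map_add, hu, hv]
  | tmul u v => rfl

variable [BijectiveAntipode k X]

/-- The map `x ↦ l_{S⁻¹(x)}` from `X` to `K^cop`. -/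
def twistHom : X →ₐc[k] Cop k K :=
  BialgHom.ofAlgHom (AlgHom.ofLinearMap
    ((Cop.of k K).toLinearMap ∘ₗ leftHom hσ X K hK ∘ₗ antipodeInv k X)
    (by
      show Cop.of k K (leftHom hσ X K hK (antipodeInv k X 1)) = 1
      have h : antipodeInv k X 1 = 1 := by
        have h1 := antipodeInv_antipode (k := k) (1 : X)
        rwa [antipode_one] at h1
      rw [h, leftHom_one, map_one])
    (fun x y => by
      show Cop.of k K (leftHom hσ X K hK (antipodeInv k X (x * y))) = _
      rw [antipodeInv_mul, leftHom_mul, map_mul]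
      rfl))
    (AlgHom.ext fun x => by
      show counit (R := k) (leftFun hσ (X.incl (antipodeInv k X x))) = counit (R := k) x
      rw [counit_leftFun]
      exact counit_antipodeInv x)
    (AlgHom.ext fun x => by
      show TensorProduct.map ((Cop.of k K).toLinearMap ∘ₗ leftHom hσ X K hK ∘ₗ antipodeInv k X)
        ((Cop.of k K).toLinearMap ∘ₗ leftHom hσ X K hK ∘ₗ antipodeInv k X) (comul (R := k) x) =
          comul (R := k) (Cop.of k K (leftHom hσ X K hK (antipodeInv k X x)))
      rw [Cop.comul_of, comul_leftHom, comul_antipodeInv]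
      induction comul (R := k) x using TensorProduct.induction_on with
      | zero => simp
      | add u v hu hv => simp only [map_add, hu, hv]
      | tmul u v => rfl)

theorem twistHom_apply (x : X) : twistHom hσ X K hK x =
    Cop.of k K (leftHom hσ X K hK (antipodeInv k X x)) := rfl

theorem evalPairing_twistHom (y z : X) : evalPairing K X (twistHom hσ X K hK y) z =
    restrictForm σ X.inclHom X.inclHom (antipode k z) y :=
  ev_leftFunInv hσ X.inclHom y (X.incl z)

variable [BijectiveAntipode k K]

/-- In the co-opposite Hopf algebra the coproduct is flipped, so `p(κ₁, y) κ₂` is the translate `κ(-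
y)` and `κ₁ p(κ₂, y)` is `κ(y -)`. Inside the finite dual the relation is
`rightTranslate_mul_leftFunInv`. -/
theorem intertwines_twistHom (hc : BraidedComm σ) :
    Intertwines (evalPairing K X) (twistHom hσ X K hK) := by
  intro κ
  let ι : Cop k K →ₐ[k] FiniteDual k H := K.toSubalgebra.val.comp (Cop.of k K).symm.toAlgHom
  have hι : Function.Injective ι := K.incl_injective
  have hpush : Function.Injective (convPush (C := X) ι) := fun F G h =>
    conv_ext fun c => hι (congrArg (fun F : WithConv (X →ₗ[k] FiniteDual k H) => F c) h)
  apply hpush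
  have e1 : convPush ι (cv ((actL (evalPairing K X)).flip κ)) =
      cv (rightTranslate X.inclHom (ι κ)) := by
    refine conv_ext fun y => ?_
    have e : ∀ t : K ⊗[k] K, ι (TensorProduct.lid k (Cop k K)
        (((evalPairing K X).flip y).rTensor (Cop k K) (TensorProduct.map (Cop.of k K).toLinearMap
          (Cop.of k K).toLinearMap (TensorProduct.comm k K K t)))) =
        TensorProduct.rid k (FiniteDual k H) (((FiniteDual.ev k H).flip (X.incl y)).lTensor
          (FiniteDual k H) (TensorProduct.map K.incl K.incl t)) := by
      intro t
      induction t using TensorProduct.induction_on with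
      | zero => simp
      | add u v hu hv => simp only [map_add, hu, hv]
      | tmul u v => rfl
    refine ((congrArg (fun t => ι (TensorProduct.lid k (Cop k K)
      (((evalPairing K X).flip y).rTensor (Cop k K) t))) (Cop.comul_of k K κ)).trans (e _)).trans ?_
    exact congrArg (fun t => TensorProduct.rid k (FiniteDual k H)
      (((FiniteDual.ev k H).flip (X.incl y)).lTensor (FiniteDual k H) t)) (K.map_incl_comul κ)
  have e2 : convPush ι (cv ((hitR ∘ₗ (evalPairing K X).flip).flip κ)) =
      cv (leftTranslate X.inclHom (ι κ)) := by
    refine conv_ext fun y => ?_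
    have e : ∀ t : K ⊗[k] K, ι (TensorProduct.rid k (Cop k K)
        (((evalPairing K X).flip y).lTensor (Cop k K) (TensorProduct.map (Cop.of k K).toLinearMap
          (Cop.of k K).toLinearMap (TensorProduct.comm k K K t)))) =
        TensorProduct.lid k (FiniteDual k H) (((FiniteDual.ev k H).flip (X.incl y)).rTensor
          (FiniteDual k H) (TensorProduct.map K.incl K.incl t)) := by
      intro t
      induction t using TensorProduct.induction_on with
      | zero => simp
      | add u v hu hv => simp only [map_add, hu, hv]
      | tmul u v => rfl
    refine ((congrArg (fun t => ι (TensorProduct.rid k (Cop k K)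
      (((evalPairing K X).flip y).lTensor (Cop k K) t))) (Cop.comul_of k K κ)).trans (e _)).trans ?_
    exact congrArg (fun t => TensorProduct.lid k (FiniteDual k H)
      (((FiniteDual.ev k H).flip (X.incl y)).rTensor (FiniteDual k H) t)) (K.map_incl_comul κ)
  have e3 : convPush ι (cv (twistHom hσ X K hK : X →ₗ[k] Cop k K)) =
      cv (leftFunInv hσ X.inclHom) := rfl
  rw [map_mul, map_mul, e1, e2, e3]
  exact rightTranslate_mul_leftFunInv hσ hc X.inclHom (ι κ)

end Evaluation

/-! ### H_{X,A} inside the convolution algebra of functionals -/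

section FunctionalsProduct

variable {k H : Type*} [Field k] [Ring H] [HopfAlgebra k H] {σ : H →ₗ[k] H →ₗ[k] k}
  (hσ : IsSkewPairing σ) (hc : BraidedComm σ) (A X : SubHopfAlgebra k H)

theorem map_val_leftSpan : (leftSpan σ hσ X.inclHom).map
    (finiteDualSubalgebra k H).val.toLinearMap = leftFunctionals σ X :=
  (LinearMap.range_comp _ _).symm

theorem map_val_rightSpan : (rightSpan σ hσ A.inclHom).map
    (finiteDualSubalgebra k H).val.toLinearMap = rightFunctionals σ A :=
  (LinearMap.range_comp _ _).symm

variable [BijectiveAntipode k X] [BijectiveAntipode k A]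

theorem functionals_functionalsHopf : (functionalsHopf hσ hc A.inclHom X.inclHom).functionals =
    leftFunctionals σ X * rightFunctionals σ A := by
  have h : (functionalsHopf hσ hc A.inclHom X.inclHom).functionals =
      (leftSpan σ hσ X.inclHom * rightSpan σ hσ A.inclHom).map
        (finiteDualSubalgebra k H).val.toLinearMap := by
    refine (LinearMap.range_comp _ _).trans ?_
    exact congrArg (Submodule.map _) (Submodule.range_subtype _)
  rw [h, ← map_val_leftSpan hσ, ← map_val_rightSpan hσ]
  exact Submodule.map_mul (leftSpan σ hσ X.inclHom) (rightSpan σ hσ A.inclHom)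
    (finiteDualSubalgebra k H).val

theorem functionals_functionalsHopf_comm :
    (functionalsHopf hσ hc A.inclHom X.inclHom).functionals =
      rightFunctionals σ A * leftFunctionals σ X := by
  rw [functionals_functionalsHopf, ← map_val_leftSpan hσ, ← map_val_rightSpan hσ]
  have h := congrArg (Submodule.map (finiteDualSubalgebra k H).val.toLinearMap)
    (leftSpan_mul_rightSpan hσ hc A.inclHom X.inclHom)
  exact (Submodule.map_mul _ _ (finiteDualSubalgebra k H).val).symm.trans
    (h.trans (Submodule.map_mul _ _ (finiteDualSubalgebra k H).val))

end FunctionalsProduct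

/-! ### The braided structure in terms of σ -/

section BraidedEvaluation

variable {k H : Type*} [Field k] [Ring H] [HopfAlgebra k H] {σ : H →ₗ[k] H →ₗ[k] k}
  (hσ : IsSkewPairing σ) (hc : BraidedComm σ) (X : SubHopfAlgebra k H)
  (K : SubHopfAlgebra k (FiniteDual k H)) (hK : ∀ x : X, leftFun hσ (X.incl x) ∈ K.toSubalgebra)
  [BijectiveAntipode k X] [BijectiveAntipode k K]

/-- The braided Hopf algebra structure on `X` induced from the double of `K^cop` and `X`. -/
abbrev braidedEval : BraidedHopfAlgebra k (Cop k K) X :=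
  GenDouble.braided (isSkewPairing_evalPairing K X) (intertwines_twistHom hσ X K hK hc)

theorem restrictForm_inclHom (x y : X) : restrictForm σ X.inclHom X.inclHom x y = σ x y := rfl

theorem braidedEval_mul {x y : X} {n m : ℕ} {x₁ x₂ x₃ : Fin n → X} {y₁ y₂ : Fin m → X}
    (hx : comul3 k X x = ∑ i, x₁ i ⊗ₜ (x₂ i ⊗ₜ x₃ i))
    (hy : comul (R := k) y = ∑ j, y₁ j ⊗ₜ y₂ j) : (braidedEval hσ hc X K hK).mul x y =
      ∑ i, ∑ j, σ (antipode k (x₃ i) * antipode k (antipode k (x₁ i)) : X) (y₂ j) •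
        (x₂ i * y₁ j) := by
  rw [GenDouble.braided_mul_eq_form _ _ (hσ.restrict X.inclHom X.inclHom)
    (evalPairing_twistHom hσ X K hK) hx hy]
  simp only [restrictForm_inclHom]

theorem braidedEval_comul {x : X} {n : ℕ} {x₁ x₂ x₃ x₄ x₅ x₆ : Fin n → X}
    (hx : comul6 k X x = ∑ i, x₁ i ⊗ₜ (x₂ i ⊗ₜ (x₃ i ⊗ₜ (x₄ i ⊗ₜ (x₅ i ⊗ₜ x₆ i))))) :
    (braidedEval hσ hc X K hK).comul x =
      ∑ i, σ (antipode k (x₁ i) * x₃ i : X) (antipode k (x₄ i) * x₆ i : X) • x₂ i ⊗ₜ x₅ i := by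
  rw [GenDouble.braided_comul_eq_form _ _ (hσ.restrict X.inclHom X.inclHom)
    (evalPairing_twistHom hσ X K hK) hx]
  simp only [restrictForm_inclHom]

theorem braidedEval_antipode {x : X} {n : ℕ} {x₁ x₂ x₃ x₄ : Fin n → X}
    (hx : comul4 k X x = ∑ i, x₁ i ⊗ₜ (x₂ i ⊗ₜ (x₃ i ⊗ₜ x₄ i))) :
    (braidedEval hσ hc X K hK).antipode x =
      ∑ i, σ (antipode k (antipode k (x₃ i)) * antipode k (x₁ i) : X) (x₄ i) •
        antipode k (x₂ i) := by
  rw [GenDouble.braided_antipode_eq_form _ _ (evalPairing_twistHom hσ X K hK) hx]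
  simp only [restrictForm_inclHom]

end BraidedEvaluation

end BraidedCQT

end

/-! ### The main theorem -/

theorem mainTheorem3 {k H : Type*} [Field k] [Ring H] [HopfAlgebra k H]
    (σ : H →ₗ[k] H →ₗ[k] k) (hσ : IsCoquasitriangular σ) (X A : SubHopfAlgebra k H) :
    ∃ (_ : BijectiveAntipode k X) (K : SubHopfAlgebra k (FiniteDual k H))
      (_ : BijectiveAntipode k K) (l : X →ₗ[k] K) (r : A →ₗ[k] K),
      -- `K` is `H_{X,A} = H_{l_X} H_{r_A} = H_{r_A} H_{l_X}`, and `l x = l_x`, `r a = r_a`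
      K.functionals = leftFunctionals σ X * rightFunctionals σ A ∧
      K.functionals = rightFunctionals σ A * leftFunctionals σ X ∧
      (∀ x h, FiniteDual.ev k H (l x) h = σ h x) ∧
      (∀ a h, FiniteDual.ev k H (r a) h = σ a h) ∧
      -- the Hopf algebra projection `π : D(K^cop, X) → K^cop`
      ∃ π : GenDouble (isSkewPairing_evalPairing K X) →ₐc[k] Cop k K,
        (∀ x a y, π (GenDouble.tmul _ (Cop.of k K (l x * r a)) y) =
          Cop.of k K (l x * r a * l (antipodeInv k X y))) ∧
        (∀ κ, π (GenDouble.inl _ κ) = κ) ∧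
        -- the braided Hopf algebra structure `P` on `X`
        ∃ P : BraidedHopfAlgebra k (Cop k K) X,
          (∀ (f : K) (y : X) (n : ℕ) (y₁ y₂ y₃ : Fin n → X),
            comul3 k X y = ∑ i, y₁ i ⊗ₜ (y₂ i ⊗ₜ y₃ i) →
            P.act (Cop.of k K f) y = ∑ i, FiniteDual.ev k H f
              (antipodeInv k X (y₁ i) * antipodeInv k X (antipodeInv k X (y₃ i)) : X) • y₂ i) ∧
          (∀ (y : X) (n : ℕ) (y₁ y₂ y₃ : Fin n → X),
            comul3 k X y = ∑ i, y₁ i ⊗ₜ (y₂ i ⊗ₜ y₃ i) →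
            P.coact y = ∑ i, Cop.of k K
              (l (antipodeInv k X (y₁ i) * antipodeInv k X (antipodeInv k X (y₃ i)))) ⊗ₜ y₂ i) ∧
          (∀ (x y : X) (n m : ℕ) (x₁ x₂ x₃ : Fin n → X) (y₁ y₂ : Fin m → X),
            comul3 k X x = ∑ i, x₁ i ⊗ₜ (x₂ i ⊗ₜ x₃ i) →
            comul (R := k) y = ∑ j, y₁ j ⊗ₜ y₂ j →
            P.mul x y = ∑ i, ∑ j, σ (antipode k (x₃ i) * antipode k (antipode k (x₁ i)) : X) (y₂ j) •
              (x₂ i * y₁ j)) ∧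
          P.one = 1 ∧
          (∀ (x : X) (n : ℕ) (x₁ x₂ x₃ x₄ x₅ x₆ : Fin n → X),
            comul6 k X x = ∑ i, x₁ i ⊗ₜ (x₂ i ⊗ₜ (x₃ i ⊗ₜ (x₄ i ⊗ₜ (x₅ i ⊗ₜ x₆ i)))) →
            P.comul x = ∑ i, σ (antipode k (x₁ i) * x₃ i : X) (antipode k (x₄ i) * x₆ i : X) •
              x₂ i ⊗ₜ x₅ i) ∧
          P.counit = counit ∧
          (∀ (x : X) (n : ℕ) (x₁ x₂ x₃ x₄ : Fin n → X),
            comul4 k X x = ∑ i, x₁ i ⊗ₜ (x₂ i ⊗ₜ (x₃ i ⊗ₜ x₄ i)) →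
            P.antipode x = ∑ i, σ (antipode k (antipode k (x₃ i)) * antipode k (x₁ i) : X) (x₄ i) •
              antipode k (x₂ i)) ∧
          -- `P` is the structure induced from the coinvariants of `π` along
          -- `θ(x) = l_{S⁻²(x₂)} ⊗ x₁`, and `X × K^cop` is isomorphic to `D(K^cop, X)`
          ∃ θ : X →ₗ[k] GenDouble (isSkewPairing_evalPairing K X),
            (∀ (x : X) (n : ℕ) (x₁ x₂ : Fin n → X), comul (R := k) x = ∑ i, x₁ i ⊗ₜ x₂ i →
              θ x = ∑ i, GenDouble.tmul _ (Cop.of k K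
                (l (antipodeInv k X (antipodeInv k X (x₂ i))))) (x₁ i)) ∧
            IsCoinvariantsIso (GenDouble.inl _) (π : _ →ₗ[k] _) P θ ∧
            IsBiproductIso P (TensorProduct.lift ((LinearMap.mul k _).compl₁₂ θ (GenDouble.inl _))) := by
  have hs := hσ.toIsSkewPairing
  have hc : BraidedComm σ := hσ.comm
  -- The antipode of `H` itself, obtained from the identity embedding, is needed for injectivity of
  -- the antipode of `K`.
  have bH : BijectiveAntipode k H :=
    hσ.bijectiveAntipode (BialgHom.id k H) Function.injective_id
  have bX : BijectiveAntipode k X := hσ.bijectiveAntipode X.inclHom X.incl_injective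
  have bA : BijectiveAntipode k A := hσ.bijectiveAntipode A.inclHom A.incl_injective
  let K := functionalsHopf hs hc A.inclHom X.inclHom
  have bK : BijectiveAntipode k K :=
    bijectiveAntipode_functionalsHopf hs hc A.inclHom X.inclHom
  have hl : ∀ x : X, leftFun hs (X.incl x) ∈ K.toSubalgebra := fun x =>
    leftSpan_le hs A.inclHom X.inclHom ⟨x, rfl⟩
  have hr : ∀ a : A, rightFun hs (A.incl a) ∈ K.toSubalgebra := fun a =>
    rightSpan_le hs A.inclHom X.inclHom ⟨a, rfl⟩
  let l : X →ₗ[k] K := leftHom hs X K hl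
  let r : A →ₗ[k] K :=
    LinearMap.codRestrict (Subalgebra.toSubmodule K.toSubalgebra) (rightFun hs ∘ₗ A.incl) hr
  have hp := isSkewPairing_evalPairing K X
  have hγ : Intertwines (evalPairing K X) (twistHom hs X K hl) := intertwines_twistHom hs X K hl hc
  have hKL : K.functionals = leftFunctionals σ X * rightFunctionals σ A :=
    functionals_functionalsHopf hs hc A X
  have hKR : K.functionals = rightFunctionals σ A * leftFunctionals σ X :=
    functionals_functionalsHopf_comm hs hc A X
  refine ⟨bX, K, bK, l, r, hKL, hKR, fun _ _ => rfl, fun _ _ => rfl, GenDouble.proj hp hγ,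
    fun x a y => ?_, GenDouble.proj_inl hp hγ, GenDouble.braided hp hγ, ?_, ?_, ?_,
    GenDouble.braided_one hp hγ, ?_, GenDouble.braided_counit hp hγ, ?_,
    GenDouble.sec hp (twistHom hs X K hl), ?_,
    (GenDouble.coinvSplitting hp hγ).isCoinvariantsIso,
    (GenDouble.coinvSplitting hp hγ).isBiproductIso⟩
  · rw [GenDouble.proj_tmul, twistHom_apply, ← map_mul]
  · intro f y n y₁ y₂ y₃ hy
    exact GenDouble.braided_act_eq_sum hp hγ (Cop.of k K f) hy
  · intro y n y₁ y₂ y₃ hy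
    rw [GenDouble.braided_coact_eq_sum hp hγ hy]
    refine Finset.sum_congr rfl fun i _ => ?_
    -- The coaction is first found as `γ(S⁻¹(y₃) y₁)`, and `S⁻¹` reverses this product into `S⁻¹(y₁)
    -- S⁻²(y₃)`.
    rw [twistHom_apply, antipodeInv_mul]
  · intro x y n m x₁ x₂ x₃ y₁ y₂ hx hy
    exact braidedEval_mul hs hc X K hl hx hy
  · intro x n x₁ x₂ x₃ x₄ x₅ x₆ hx
    exact braidedEval_comul hs hc X K hl hx
  · intro x n x₁ x₂ x₃ x₄ hx
    exact braidedEval_antipode hs hc X K hl hx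
  · intro x n x₁ x₂ hx
    exact GenDouble.sec_eq_sum hp hx
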